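/- Let $S$ be a Riemann surface, $x,y$ meromorphic functions on $S$ with $dx$, $dy$ not identically zero on any nonempty open set, and let $\omega^{(g)}_{m,0}$ ($g\ge 0$, $m\ge 1$) be symmetric meromorphic $m$-differentials on $S^m$ such that $\omega^{(0)}_{1,0}=-y\,dx$ and such that $\omega^{(g)}_{m,0}-\delta_{(g,m),(0,2)}\frac{dx_1dx_2}{(x_1-x_2)^2}$ has no poles on the diagonals (a generic point of each diagonal, of any codimension, is not a pole). Write $x_i=x(z_i)$, $y_i=y(z_i)$, $\mathcal S(z)=(e^{z/2}-e^{-z/2})/z$, and let $[t^k]$ denote extraction of a coefficient from everything to its right. Fix $g\ge 0$, $n\ge 1$. Sums over $\Gamma$ run over the isomorphism classes of connected graphs with $n$ vertices labelled $1,\dots,n$ and a finite set $E(\Gamma)$ of multiedges, each multiedge $e$ having $|e|\ge 2$ legs, which are attached to vertices by an arbitrary map $e:\{1,\dots,|e|\}\to\{1,\dots,n\}$; automorphisms fix the labels of the vertices, and $b(\Gamma)$ is the first Betti number. For a multiedge $e$ put $\tilde\omega^{(0)}_{2,0}=\omega^{(0)}_{2,0}-\frac{d\tilde x_1d\tilde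 x_2}{(\tilde x_1-\tilde x_2)^2}$ if $|e|=2$ and $e(1)=e(2)$, and $\tilde\omega^{(h)}_{|e|,0}=\omega^{(h)}_{|e|,0}$ in all other cases. In the products over multiedges, the variables with a tilde belong to the legs; after the operators have been applied, one substitutes $\tilde z_j=z_{e(j)}$ and $\tilde u_j=u_{e(j)}$ (respectively $\tilde w_j=w_{e(j)}$). Let $\theta(z)=-\frac{x}{dx}\omega^{(0)}_{1,0}(z)$ and $$L(v,\theta)=\exp\Big(v\tfrac{\mathcal S(\hbar v\partial_\theta)}{\mathcal S(\hbar\partial_\theta)}\log\theta-v\log\theta\Big).$$ Define the functions $A^{(g)}_n$ and $B^{(g)}_n$ on $S^n$ by $$\begin{aligned}A^{(g)}_n={}&[\hbar^{2g}]\sum_\Gamma\frac{\hbar^{2b(\Gamma)}}{|\mathrm{Aut}\,\Gamma|}\prod_{i=1}^n\sum_{k_i\ge0}(-y_i\partial_{y_i})^{k_i}[v_i^{k_i}]\Big(-\frac{y_i}{dy_i}\frac{dx_i}{x_i}\Big)\sum_{r_i\ge0}\Big(\partial_{\theta_i}+\frac{v_i}{\theta_i}\Big)^{r_i}L(v_i,\theta_i)\Big|_{\theta_i=\theta(z_i)}[u_i^{r_i}]\\&\frac{1}{u_i\mathcal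 S(\hbar u_i)}\exp\Big(u_i\mathcal S(\hbar u_ix_i\partial_{x_i})\sum_{h\ge0}\hbar^{2h}\big(-\tfrac{x_i}{dx_i}\omega^{(h)}_{1,0}(z_i)\big)-u_i\,\theta(z_i)\Big)\\&\prod_{e\in E(\Gamma)}\Big(\prod_{j=1}^{|e|}\tilde u_j\mathcal S(\hbar\tilde u_j\tilde x_j\partial_{\tilde x_j})\Big(-\frac{\tilde x_j}{d\tilde x_j}\Big)\Big)\sum_{h\ge0}\hbar^{2h}\tilde\omega^{(h)}_{|e|,0}(\tilde z_1,\dots,\tilde z_{|e|})\\&+\delta_{n,1}[\hbar^{2g}]\sum_{k\ge0}(-y_1\partial_{y_1})^k[v^{k+1}]\Big(L(v,\theta(z_1))\,(-y_1\partial_{y_1})\theta(z_1)\Big)+\delta_{(g,n),(0,1)}\theta(z_1)\end{aligned}$$ and $$\begin{aligned}B^{(g)}_n={}&(-1)^n[\hbar^{2g}]\sum_\Gamma\frac{\hbar^{2b(\Gamma)}}{|\mathrm{Aut}\,\Gamma|}\prod_{i=1}^n\sum_{k_i\ge0}\partial_{y_i}^{k_i}[w_i^{k_i}]\frac{dx_i}{dy_i}\frac1{w_i}\exp\Big(w_i\mathcal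 S(\hbar w_i\partial_{x_i})\sum_{h\ge0}\hbar^{2h}\frac{\omega^{(h)}_{1,0}(z_i)}{dx_i}-w_i\frac{\omega^{(0)}_{1,0}(z_i)}{dx_i}\Big)\\&\prod_{e\in E(\Gamma)}\Big(\prod_{j=1}^{|e|}\tilde w_j\mathcal S(\hbar\tilde w_j\partial_{\tilde x_j})\Big)\sum_{h\ge0}\hbar^{2h}\frac{\tilde\omega^{(h)}_{|e|,0}(\tilde z_1,\dots,\tilde z_{|e|})}{d\tilde x_1\cdots d\tilde x_{|e|}}+\delta_{(g,n),(0,1)}(-x_1).\end{aligned}$$ Then $A^{(g)}_n=B^{(g)}_n\prod_{i=1}^n(-y_i)$ as meromorphic functions on $S^n$ (that is, on a dense open subset). Consequently, for every $n$-differential $\omega^{(g)}_{0,n}$ on $S^n$, the formula $$\omega^{(g)}_{0,n}(z_1,\dots,z_n)\prod_{i=1}^n\Big(-\frac{y_i}{dy_i}\Big)=A^{(g)}_n$$ holds if and only if the formula $$\omega^{(g)}_{0,n}(z_1,\dots,z_n)\prod_{i=1}^n\frac1{dy_i}=B^{(g)}_n$$ holds. -/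

import Mathlib

open scoped Manifold ContDiff Topology

noncomputable section

namespace XYSwap

/-! ### Functions and differentials on a Riemann surface and on its powers -/

section Geometry

variable {S : Type*} [TopologicalSpace S] [ChartedSpace ℂ S]

/-- The differential `df` at `p`, applied to a tangent vector `v`. -/
def dApp (f : S → ℂ) (p : S) (v : TangentSpace 𝓘(ℂ) p) : ℂ :=
  mfderiv 𝓘(ℂ) 𝓘(ℂ) f p v

/-- The value at `p` of the differential `df` on the coordinate vector of the preferred chart at `p`.
The quotient `dAt f p / dAt h p` is the value of `df / dh` at `p`; it depends on no chart. -/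
def dAt (f : S → ℂ) (p : S) : ℂ :=
  dApp f p (1 : ℂ)

/-- `f` is holomorphic at `p`. -/
def HolAt (f : S → ℂ) (p : S) : Prop :=
  AnalyticAt ℂ (f ∘ (chartAt ℂ p).symm) (chartAt ℂ p p)

/-- `f` is a meromorphic function on `S` (with arbitrary values at its poles) whose differential
does not vanish identically on any nonempty open set. -/
structure IsNonconstMeromorphic (f : S → ℂ) : Prop where
  meromorphic : ∀ p : S, MeromorphicAt (f ∘ (chartAt ℂ p).symm) (chartAt ℂ p p)
  nonconst : Dense {p : S | HolAt f p ∧ dAt f p ≠ 0}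

/-- Coordinates on `S ^ n` near `c`, in the product of the preferred charts at the `c i`. -/
def toCoord {n : ℕ} (c z : Fin n → S) : Fin n → ℂ := fun i => chartAt ℂ (c i) (z i)

/-- The inverse of `toCoord c` near `c`. -/
def ofCoord {n : ℕ} (c : Fin n → S) (t : Fin n → ℂ) : Fin n → S :=
  fun i => (chartAt ℂ (c i)).symm (t i)

/-- `F` is holomorphic at the point `c` of `S ^ n`. -/
def HolAtPow {n : ℕ} (F : (Fin n → S) → ℂ) (c : Fin n → S) : Prop :=
  AnalyticAt ℂ (fun t => F (ofCoord c t)) (toCoord c c)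

/-- `G` is a holomorphic extension near `c` of the meromorphic function represented by `F`:
it is holomorphic at `c` and generically (on a dense open set) equal to `F` near `c`. -/
def IsHolExtension {n : ℕ} (F G : (Fin n → S) → ℂ) (c : Fin n → S) : Prop :=
  HolAtPow G c ∧ ∃ U : Set (Fin n → S), IsOpen U ∧ Dense U ∧ ∀ᶠ z in 𝓝 c, z ∈ U → F z = G z

/-- The meromorphic function represented by `F` has no pole at `c` (is regular at `c`). -/
def RegularAt {n : ℕ} (F : (Fin n → S) → ℂ) (c : Fin n → S) : Prop :=
  ∃ G : (Fin n → S) → ℂ, IsHolExtension F G c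

open Classical in
/-- The meromorphic function represented by `F`, with its removable singularities removed; the
value is `0` at the points that are not regular. -/
def regExt {n : ℕ} (F : (Fin n → S) → ℂ) : (Fin n → S) → ℂ :=
  fun c => if h : RegularAt F c then h.choose c else 0

/-- Equality of two meromorphic functions on `S ^ n`: equality on a dense open set. -/
def MeroEq {n : ℕ} (F G : (Fin n → S) → ℂ) : Prop :=
  ∃ U : Set (Fin n → S), IsOpen U ∧ Dense U ∧ ∀ z ∈ U, F z = G z

variable (S) in
/-- An `m`-differential on `S ^ m`: at every point `z`, an element of
`T*_{z 0} S ⊗ ⋯ ⊗ T*_{z (m-1)} S`, with arbitrary values where it has poles. -/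
abbrev MultiDifferential (m : ℕ) : Type _ :=
  ∀ z : Fin m → S, MultilinearMap ℂ (fun i => TangentSpace 𝓘(ℂ) (z i)) ℂ

/-- A meromorphic `m`-differential: near every `c ∈ S ^ m` it is
`(a / b) dφ_1 ⋯ dφ_m` with `a`, `b` holomorphic, `b` not identically zero near `c`, and `φ_i`
a local coordinate at `c i`. -/
def IsMeromorphicDifferential {m : ℕ} (η : MultiDifferential S m) : Prop :=
  ∀ c : Fin m → S, ∃ a b : (Fin m → ℂ) → ℂ,
    AnalyticAt ℂ a (toCoord c c) ∧ AnalyticAt ℂ b (toCoord c c) ∧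
    (¬ ∀ᶠ t in 𝓝 (toCoord c c), b t = 0) ∧
    ∀ᶠ z in 𝓝 c, b (toCoord c z) ≠ 0 → ∀ v : ∀ i, TangentSpace 𝓘(ℂ) (z i),
      η z v = a (toCoord c z) / b (toCoord c z) *
        ∏ i, dApp (chartAt ℂ (c i)) (z i) (v i)

/-- `η` is invariant under the permutations of its arguments. -/
def IsSymmetricDifferential {m : ℕ} (η : MultiDifferential S m) : Prop :=
  ∀ (σ : Equiv.Perm (Fin m)) (z : Fin m → S) (v : ∀ i, TangentSpace 𝓘(ℂ) (z i)),
    η (fun i => z (σ i)) (fun i => v (σ i)) = η z v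

/-- The value of `η` on the coordinate vectors of the preferred charts. -/
def coordValue {m : ℕ} (η : MultiDifferential S m) (z : Fin m → S) : ℂ :=
  η z (fun _ => (1 : ℂ))

/-- The function `η / (dx_1 ⋯ dx_m)` on `S ^ m`, where `x_i = x (z_i)`. -/
def divDx (x : S → ℂ) {m : ℕ} (η : MultiDifferential S m) : (Fin m → S) → ℂ :=
  fun z => coordValue η z / ∏ i, dAt x (z i)

/-- The function `1 / (x_1 - x_2) ^ 2` on `S ^ 2`, extended by zero to the indices `m ≠ 2`. -/
def doublePole (x : S → ℂ) (m : ℕ) : (Fin m → S) → ℂ :=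
  fun z => if h : m = 2 then
    1 / (x (z ⟨0, by omega⟩) - x (z ⟨1, by omega⟩)) ^ 2 else 0

/-- A system of symmetric meromorphic differentials `om g m` on `S ^ m`, `g ≥ 0`, `m ≥ 1`, with
`om 0 1 = - y dx` and such that `om g m - δ_{(g,m),(0,2)} dx_1 dx_2 / (x_1 - x_2) ^ 2`
has no poles on the diagonals. The diagonals of `S ^ m` are the images of the maps
`S ^ k → S ^ m` that repeat coordinates, `z ↦ z ∘ e` with `e : Fin m → Fin k`; having no pole
there means that a generic point of the diagonal is not a pole, so that the
restriction to the diagonal is defined as a meromorphic function. -/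
structure IsInitialSystem (x y : S → ℂ) (om : ℕ → ∀ m : ℕ, MultiDifferential S m) : Prop where
  meromorphic : ∀ g m : ℕ, 1 ≤ m → IsMeromorphicDifferential (om g m)
  symmetric : ∀ g m : ℕ, 1 ≤ m → IsSymmetricDifferential (om g m)
  omega_zero_one : ∀ p : S, HolAt x p → HolAt y p →
    ∀ v : ∀ _ : Fin 1, TangentSpace 𝓘(ℂ) p,
      om 0 1 (fun _ => p) v = - y p * dApp x p (v 0)
  diagonals : ∀ g m k : ℕ, 1 ≤ m → ∀ e : Fin m → Fin k,
    Dense {z : Fin k → S | RegularAt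
      (fun t => divDx x (om g m) t - if g = 0 ∧ m = 2 then doublePole x m t else 0) (z ∘ e)}

end Geometry

/-! ### Graphs with multiedges -/

/-- A connected graph with `n` labelled vertices and multiedges of index at least `2`. Flags at
vertices and flags at multiedges are identified by the given bijection between them; the resulting
flags are called legs. -/
structure MultiGraph (n : ℕ) where
  numEdges : ℕ
  numLegs : ℕ
  edgeOf : Fin numLegs → Fin numEdges
  vertexOf : Fin numLegs → Fin n
  two_le_index : ∀ e : Fin numEdges, 2 ≤ Fintype.card {j : Fin numLegs // edgeOf j = e}
  connected : (SimpleGraph.fromRel fun a b : Fin n ⊕ Fin numEdges =>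
    ∃ j : Fin numLegs, a = Sum.inl (vertexOf j) ∧ b = Sum.inr (edgeOf j)).Connected

namespace MultiGraph

variable {n : ℕ}

/-- Isomorphisms of graphs with labelled vertices: bijections of the legs and of the multiedges
that are compatible with the attaching maps and preserve the labels of the vertices. -/
structure Iso (Γ Δ : MultiGraph n) where
  legs : Fin Γ.numLegs ≃ Fin Δ.numLegs
  edges : Fin Γ.numEdges ≃ Fin Δ.numEdges
  edge_comp : ∀ j, Δ.edgeOf (legs j) = edges (Γ.edgeOf j)
  vertex_comp : ∀ j, Δ.vertexOf (legs j) = Γ.vertexOf j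

/-- The relation of being isomorphic. -/
instance isoSetoid (n : ℕ) : Setoid (MultiGraph n) where
  r Γ Δ := Nonempty (Iso Γ Δ)
  iseqv :=
    { refl := fun Γ => ⟨⟨Equiv.refl _, Equiv.refl _, fun _ => rfl, fun _ => rfl⟩⟩
      symm := fun {Γ Δ} ⟨f⟩ => ⟨⟨f.legs.symm, f.edges.symm,
        fun j => by
          have h := f.edge_comp (f.legs.symm j)
          rw [Equiv.apply_symm_apply] at h
          rw [h, Equiv.symm_apply_apply],
        fun j => by
          have h := f.vertex_comp (f.legs.symm j)
          rw [Equiv.apply_symm_apply] at h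
          exact h.symm⟩⟩
      trans := fun {Γ Δ Λ} ⟨f⟩ ⟨h⟩ => ⟨⟨f.legs.trans h.legs, f.edges.trans h.edges,
        fun j => by simp [f.edge_comp, h.edge_comp],
        fun j => by simp [f.vertex_comp, h.vertex_comp]⟩⟩ }

/-- The order of the automorphism group. -/
def numAut (Γ : MultiGraph n) : ℕ := Nat.card (Iso Γ Γ)

/-- The first Betti number of the connected one-dimensional complex whose points are the vertices
and the multiedges and whose segments are the legs. -/
def betti (Γ : MultiGraph n) : ℕ := Γ.numLegs + 1 - (n + Γ.numEdges)

/-- The index of a multiedge. -/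
def index (Γ : MultiGraph n) (e : Fin Γ.numEdges) : ℕ :=
  Fintype.card {j : Fin Γ.numLegs // Γ.edgeOf j = e}

/-- The legs of a multiedge `e`, labelled in an arbitrary way by `Fin (Γ.index e)`, are attached to
the vertices by this map. -/
def attach (Γ : MultiGraph n) (e : Fin Γ.numEdges) : Fin (Γ.index e) → Fin n :=
  fun j => Γ.vertexOf
    ((Fintype.equivFin {j : Fin Γ.numLegs // Γ.edgeOf j = e}).symm j).val

end MultiGraph

/-- The weighted sum over isomorphism classes of graphs `∑_Γ (1 / |Aut Γ|) F Γ`. -/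
def graphSum {n : ℕ} {A : Type*} [AddCommGroup A] [Module ℂ A] (F : MultiGraph n → A) : A :=
  ∑ᶠ c : Quotient (MultiGraph.isoSetoid n), ((c.out.numAut : ℂ)⁻¹) • F c.out

/-! ### Formal series

The outer power series variable, called `PowerSeries.X`, is always `ħ`. -/

/-- The series `𝒮(z) = (exp (z / 2) - exp (- z / 2)) / z`. -/
def calS : PowerSeries ℂ :=
  PowerSeries.mk fun j => PowerSeries.coeff (j + 1)
    (PowerSeries.rescale (1 / 2 : ℂ) (PowerSeries.exp ℂ) -
      PowerSeries.rescale (-1 / 2 : ℂ) (PowerSeries.exp ℂ))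

/-- The exponential of a series `A` in `ħ` without constant term, `∑_j A ^ j / j!`: only the terms
with `j ≤ N` contribute to the coefficient of `ħ ^ N`. -/
def expHbar {R : Type*} [CommRing R] [Algebra ℂ R] (A : PowerSeries R) : PowerSeries R :=
  PowerSeries.mk fun N => ∑ j ∈ Finset.range (N + 1),
    ((Nat.factorial j : ℂ)⁻¹) • PowerSeries.coeff N (A ^ j)

/-- The series `∑_g ħ ^ (2 g) F g`. -/
def genusSeries {R : Type*} [Zero R] (F : ℕ → R) : PowerSeries R :=
  PowerSeries.mk fun N => if Even N then F (N / 2) else 0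

/-- Polynomials in `v` whose coefficients are functions of `θ`. -/
abbrev ThetaPoly : Type := Polynomial (ℂ → ℂ)

/-- `∂_θ ^ j log θ`, for `j ≥ 1`, as a function of `θ`. -/
def derivLog (j : ℕ) : ℂ → ℂ := iteratedDeriv (j - 1) (fun θ => θ⁻¹)

/-- The exponent `v (𝒮(ħ v ∂_θ) / 𝒮(ħ ∂_θ)) log θ - v log θ`. Its term of degree zero in `ħ`
is `v log θ - v log θ = 0`. -/
def expL : PowerSeries ThetaPoly :=
  PowerSeries.mk fun N => if N = 0 then 0 else
    Polynomial.X * ∑ p ∈ Finset.HasAntidiagonal.antidiagonal N,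
      Polynomial.monomial p.1
        ((PowerSeries.coeff p.1 calS * PowerSeries.coeff p.2 calS⁻¹) • derivLog N)

/-- The operator `∂_θ + v / θ` on series in `ħ`, with `∂_θ` acting on all coefficients. -/
def thetaStep (L : PowerSeries ThetaPoly) : PowerSeries ThetaPoly :=
  PowerSeries.mk fun N =>
    (PowerSeries.coeff N L).sum (fun j f => Polynomial.monomial j (deriv f)) +
      Polynomial.X * Polynomial.C (fun θ : ℂ => θ⁻¹) * PowerSeries.coeff N L

/-- `(∂_θ + v / θ) ^ r exp (v (𝒮(ħ v ∂_θ) / 𝒮(ħ ∂_θ)) log θ - v log θ)`. -/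
def serL (r : ℕ) : PowerSeries ThetaPoly := thetaStep^[r] (expHbar expL)

section Formulas

variable {S : Type*} [TopologicalSpace S] [ChartedSpace ℂ S]

/-- Series in `ħ` whose coefficients are polynomials in `n` variables (`u_i`, `v_i` or `w_i`)
with functions on `S ^ n` as coefficients. -/
abbrev Ser (S : Type*) (n : ℕ) : Type _ :=
  PowerSeries (MvPolynomial (Fin n) ((Fin n → S) → ℂ))

/-- A function on `S ^ n`, or a number, as a constant series. -/
def cst {n : ℕ} (F : (Fin n → S) → ℂ) : Ser S n := PowerSeries.C (MvPolynomial.C F)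

/-- The `i`-th polynomial variable. -/
def var (S : Type*) {n : ℕ} (i : Fin n) : Ser S n := PowerSeries.C (MvPolynomial.X i)

/-- `∂_{f_i} = d_i / df_i`, the derivative in the `i`-th argument with respect to `f (z_i)`. -/
def partialD (f : S → ℂ) {n : ℕ} (i : Fin n) (F : (Fin n → S) → ℂ) : (Fin n → S) → ℂ :=
  fun z => dAt (fun s => F (Function.update z i s)) (z i) / dAt f (z i)

/-- `f_i ∂_{f_i}`. -/
def eulerD (f : S → ℂ) {n : ℕ} (i : Fin n) (F : (Fin n → S) → ℂ) : (Fin n → S) → ℂ :=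
  fun z => f (z i) * partialD f i F z

/-- `∏_i (D i) ^ (a i)`. -/
def iterD {n : ℕ} (D : Fin n → ((Fin n → S) → ℂ) → ((Fin n → S) → ℂ)) (a : Fin n → ℕ)
    (F : (Fin n → S) → ℂ) : (Fin n → S) → ℂ :=
  (List.finRange n).foldr (fun i G => (D i)^[a i] G) F

/-- `𝒮(ħ u_i D) Φ` for a series `Φ` in `ħ` whose coefficients are functions on `S ^ n`. -/
def applyS {n : ℕ} (i : Fin n) (D : ((Fin n → S) → ℂ) → ((Fin n → S) → ℂ))
    (Φ : PowerSeries ((Fin n → S) → ℂ)) : Ser S n :=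
  PowerSeries.mk fun N => ∑ p ∈ Finset.HasAntidiagonal.antidiagonal N,
    MvPolynomial.monomial (Finsupp.single i p.1)
      (PowerSeries.coeff p.1 calS • D^[p.1] (PowerSeries.coeff p.2 Φ))

/-- `exp (u_i 𝒮(ħ u_i D) ∑_g ħ ^ (2 g) F g(z_i) - u_i F 0(z_i))`. -/
def vertexExp {n : ℕ} (i : Fin n) (D : ((Fin n → S) → ℂ) → ((Fin n → S) → ℂ))
    (F : ℕ → S → ℂ) : Ser S n :=
  expHbar (var S i * applyS i D (genusSeries fun g z => F g (z i)) -
    var S i * cst fun z => F 0 (z i))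

/-- The factor of a multiedge with `k` legs attached to the vertices by `e`: the result of applying
`∏_j ũ_j 𝒮(ħ ũ_j D j)` to `∑_g ħ ^ (2 g) H g`, where the `H g` are functions on `S ^ k`, and
then substituting `ũ_j = u_{e j}` and `z̃_j = z_{e j}`. -/
def edgeFactor {n k : ℕ} (e : Fin k → Fin n)
    (D : Fin k → ((Fin k → S) → ℂ) → ((Fin k → S) → ℂ))
    (H : ℕ → (Fin k → S) → ℂ) : Ser S n :=
  PowerSeries.mk fun N => ∑ p ∈ Finset.HasAntidiagonal.antidiagonal N,
    ∑ a ∈ Finset.piAntidiag (Finset.univ : Finset (Fin k)) p.1,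
      (∏ j, MvPolynomial.X (e j) ^ (a j + 1)) *
        MvPolynomial.C (fun z : Fin n → S =>
          (∏ j, PowerSeries.coeff (a j) calS) *
            iterD D a (PowerSeries.coeff p.2 (genusSeries H)) (z ∘ e))

/-- `∑_{k ∈ ℕ ^ n} ∏_i (D i) ^ (k i) [∏_i v_i ^ (k i)] P`. -/
def transferSum {n : ℕ} (D : Fin n → ((Fin n → S) → ℂ) → ((Fin n → S) → ℂ))
    (P : (Fin n →₀ ℕ) → ((Fin n → S) → ℂ)) : (Fin n → S) → ℂ :=
  ∑ᶠ k : Fin n →₀ ℕ, iterD D k (P k)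

/-- `[∏_i v_i ^ (k i)] (P / ∏_i v_i)`, that is, the coefficient of `∏_i v_i ^ (k i + 1)` in `P`. -/
def coeffDiv {n : ℕ} {R : Type*} [CommSemiring R] (P : MvPolynomial (Fin n) R)
    (k : Fin n →₀ ℕ) : R :=
  MvPolynomial.coeff (k + Finsupp.equivFunOnFinite.symm fun _ => 1) P

/-- The function `ω^{(g)}_{1,0} / dx` on `S`. -/
def omegaOne (x : S → ℂ) (om : ℕ → ∀ m : ℕ, MultiDifferential S m) (g : ℕ) : S → ℂ :=
  fun p => regExt (divDx x (om g 1)) (fun _ => p)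

/-- The function `ω̃^{(g)}_{k,0} / (dx̃_1 ⋯ dx̃_k)` on `S ^ k` at a multiedge attached to
the vertices by `e`. The double pole is subtracted if `g = 0`, `k = 2` and `e 1 = e 2`. -/
def omegaTilde (x : S → ℂ) (om : ℕ → ∀ m : ℕ, MultiDifferential S m) {n k : ℕ}
    (e : Fin k → Fin n) (g : ℕ) : (Fin k → S) → ℂ :=
  regExt fun t => divDx x (om g k) t -
    if g = 0 ∧ k = 2 ∧ ∀ i j, e i = e j then doublePole x k t else 0

/-! ### The simple formula -/

/-- The contribution of a graph to the coefficient of `ħ ^ (2 g)` in the simple formula: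
`∏_i ∑_{k_i} ∂_{y_i} ^ k_i [w_i ^ k_i] (dx_i / dy_i) (1 / w_i) exp (⋯)` applied to the product of
the factors of the multiedges. -/
def simpleTerm (x y : S → ℂ) (om : ℕ → ∀ m : ℕ, MultiDifferential S m) (g : ℕ) {n : ℕ}
    (Γ : MultiGraph n) : (Fin n → S) → ℂ :=
  transferSum (fun i => partialD y i) <| coeffDiv <| PowerSeries.coeff (2 * g) <|
    PowerSeries.X ^ (2 * Γ.betti) *
    (∏ i, cst (fun z => dAt x (z i) / dAt y (z i)) *
      vertexExp i (partialD x i) (omegaOne x om)) *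
    ∏ e, edgeFactor (Γ.attach e) (fun j => partialD x j) (omegaTilde x om (Γ.attach e))

/-- The right hand side of the simple formula. -/
def simpleRHS (x y : S → ℂ) (om : ℕ → ∀ m : ℕ, MultiDifferential S m) (g n : ℕ) :
    (Fin n → S) → ℂ :=
  (-1) ^ n * graphSum (simpleTerm x y om g) +
    if h : g = 0 ∧ n = 1 then (fun z : Fin n → S => - x (z ⟨0, by omega⟩))
    else (0 : (Fin n → S) → ℂ)

/-- The simple formula for `η = ω^{(g)}_{0,n}`:
`η ∏_i (1 / dy_i)` equals the simple right hand side. -/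
def SimpleFormula (x y : S → ℂ) (om : ℕ → ∀ m : ℕ, MultiDifferential S m) (g n : ℕ)
    (η : MultiDifferential S n) : Prop :=
  MeroEq (fun z => coordValue η z * ∏ i, (1 / dAt y (z i))) (simpleRHS x y om g n)

/-! ### The universal formula -/

/-- `θ = - (x / dx) ω^{(0)}_{1,0}` -/
def theta (x : S → ℂ) (om : ℕ → ∀ m : ℕ, MultiDifferential S m) : S → ℂ :=
  fun p => - x p * omegaOne x om 0 p

/-- Substitution of `v = v_i` and `θ = T` in a polynomial in `v` with functions of `θ` as
coefficients, where `T` is a function on `S ^ n`. -/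
def substTheta {n : ℕ} (i : Fin n) (T : (Fin n → S) → ℂ) :
    ThetaPoly →+* MvPolynomial (Fin n) ((Fin n → S) → ℂ) :=
  Polynomial.eval₂RingHom
    (MvPolynomial.C.comp (RingHom.pi fun z => Pi.evalRingHom (fun _ : ℂ => ℂ) (T z)))
    (MvPolynomial.X i)

/-- `(∂_{θ_i} + v_i / θ_i) ^ r exp (⋯)` at `θ_i = - (x_i / dx_i) ω^{(0)}_{1,0}(z_i)`. -/
def serLAt (x : S → ℂ) (om : ℕ → ∀ m : ℕ, MultiDifferential S m) {n : ℕ} (i : Fin n) (r : ℕ) :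
    Ser S n :=
  PowerSeries.map (substTheta i fun z => theta x om (z i)) (serL r)

/-- The part of the graph contribution that depends on the `u_i`, multiplied by `∏_i u_i`:
`∏_i (1 / 𝒮(ħ u_i)) exp (⋯)` times the product of the factors of the multiedges. -/
def universalInner (x : S → ℂ) (om : ℕ → ∀ m : ℕ, MultiDifferential S m) {n : ℕ}
    (Γ : MultiGraph n) : Ser S n :=
  PowerSeries.X ^ (2 * Γ.betti) *
    (∏ i, (PowerSeries.mk fun N =>
        MvPolynomial.monomial (Finsupp.single i N) (fun _ => PowerSeries.coeff N calS⁻¹)) *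
      vertexExp i (eulerD x i) (fun g p => - x p * omegaOne x om g p)) *
    ∏ e, edgeFactor (Γ.attach e) (fun j => eulerD x j)
      (fun g t => (∏ j, - x (t j)) * omegaTilde x om (Γ.attach e) g t)

/-- `∏_i (- (y_i / dy_i) (dx_i / x_i)) ∑_{r_i} (∂_{θ_i} + v_i / θ_i) ^ r_i exp (⋯) [u_i ^ r_i]`
applied to the inner part divided by `∏_i u_i`. -/
def universalOuter (x y : S → ℂ) (om : ℕ → ∀ m : ℕ, MultiDifferential S m) {n : ℕ}
    (Γ : MultiGraph n) : Ser S n :=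
  (∏ i, cst fun z => - (y (z i) / dAt y (z i)) * (dAt x (z i) / x (z i))) *
  PowerSeries.mk fun N => ∑ p ∈ Finset.HasAntidiagonal.antidiagonal N, ∑ᶠ r : Fin n →₀ ℕ,
    PowerSeries.coeff p.1 (∏ i, serLAt x om i (r i)) *
      MvPolynomial.C (coeffDiv (PowerSeries.coeff p.2 (universalInner x om Γ)) r)

/-- The contribution of a graph to the coefficient of `ħ ^ (2 g)` in the universal formula. -/
def universalTerm (x y : S → ℂ) (om : ℕ → ∀ m : ℕ, MultiDifferential S m) (g : ℕ) {n : ℕ}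
    (Γ : MultiGraph n) : (Fin n → S) → ℂ :=
  transferSum (fun i F => - eulerD y i F) fun k =>
    MvPolynomial.coeff k (PowerSeries.coeff (2 * g) (universalOuter x y om Γ))

/-- `[ħ ^ (2 g)] ∑_k (- y_i ∂_{y_i}) ^ k [v ^ (k + 1)] exp (⋯) (- y_i ∂_{y_i}) θ_i`; here
the exponential is the one of `serL 0`. -/
def regularization (x y : S → ℂ) (om : ℕ → ∀ m : ℕ, MultiDifferential S m) (g : ℕ) {n : ℕ}
    (i : Fin n) : (Fin n → S) → ℂ :=
  ∑ᶠ k : ℕ, (fun F => - eulerD y i F)^[k]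
    (MvPolynomial.coeff (Finsupp.single i (k + 1)) (PowerSeries.coeff (2 * g) (serLAt x om i 0)) *
      - eulerD y i (fun z => theta x om (z i)))

/-- The right hand side of the universal formula. -/
def universalRHS (x y : S → ℂ) (om : ℕ → ∀ m : ℕ, MultiDifferential S m) (g n : ℕ) :
    (Fin n → S) → ℂ :=
  graphSum (universalTerm x y om g) +
    (if h : n = 1 then regularization x y om g (⟨0, by omega⟩ : Fin n) else 0) +
    if h : g = 0 ∧ n = 1 then (fun z : Fin n → S => theta x om (z ⟨0, by omega⟩))
    else (0 : (Fin n → S) → ℂ)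

/-- The universal formula for `η = ω^{(g)}_{0,n}`:
`η ∏_i (- y_i / dy_i)` equals the universal right hand side. -/
def UniversalFormula (x y : S → ℂ) (om : ℕ → ∀ m : ℕ, MultiDifferential S m) (g n : ℕ)
    (η : MultiDifferential S n) : Prop :=
  MeroEq (fun z => coordValue η z * ∏ i, (- (y (z i) / dAt y (z i)))) (universalRHS x y om g n)

end Formulas

end XYSwap

end

/-!
The identity holds already for the contributions of each graph, and it is local: both sides are
computed near a point of `S ^ n` in general position (`IsGeneric`). There `x` and `y` are holomorphic
and nonzero with nonzero differentials, `x` separates the coordinates, and the differentials that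
occur are regular on the diagonals. Such points form a dense open set (`isGeneric_open_dense`),
because only finitely many graphs have first Betti number at most `g` (`MultiGraph.numLegs_le`) and
the others do not contribute. Germs of analytic functions at such a point form an algebra with
commuting derivations `∂_{x_i}` and with invertible elements `x_i`, `y_i`, `dy_i / dx_i` (`Frame`),
and the rest is algebra. Note that `θ = x y`.

*The integrands.* Let `Psi` be the ring homomorphism that fixes `ħ`, sends `w_i` to
`- x_i u_i 𝒮(ħ u_i)` and shifts the argument `x_i` of functions to `x_i cosh (ħ u_i / 2)`. Since
`u 𝒮(ħ u x ∂_x) x` integrates a function over the segment from `x exp (- ħ u / 2)` to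
`x exp (ħ u / 2)`, up to a factor, and `𝒮(ħ w ∂_x)` averages it over a segment of length `ħ w`,
`Psi` transforms the factors of the multiedges in the simple formula into those of the universal one
(`kap_eq`, `Psi_edgeSer`). The same holds for the exponents at the vertices, except that the term
`ω^{(0)}_{1,0}` is subtracted before the shift in one formula and after it in the other. With the
factor `1 / 𝒮(ħ u)` of the universal formula this leaves the correction
`𝒮(ħ u)⁻¹ exp (u (Y - θ))`, where `Y = x 𝒮(τ) y(x cosh (τ / 2))` and `τ = ħ u`
(`jet_expHbar_vertexU`). Taylor expansion of the shifts turns the universal formula into a product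
over the vertices of operators `coreT`, applied to the coefficients of `∏_i w_i ^ (m i)` of the
simple integrand (`Frame.univ_eq`).

*One vertex.* What remains is the evaluation of `coreT`. For `m ≥ 1` it is
`g ↦ y ∂_y ^ (m - 1) (g / dy)` in degree zero in `ħ`, which is the operator of the simple formula,
and it vanishes in positive degrees (`coreT_of_pos`). The transform `∑_k (- y ∂_y) ^ k [v ^ k]` kills
total derivatives, so the derivatives of `g` may be integrated by parts; the resulting coefficient
is polynomial in `v`, up to the factor `y ^ v`, and is determined by its values at large integers
`v = N` (`sum_opT_deriv_pow`). There `L(v, θ)` becomes a product: the coefficient of `ħ ^ K` in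
`L(N, θ)` is `θ ^ (- K)` times the `K`-th elementary symmetric function of the numbers
`s_j = j - (N - 1) / 2` (`eval_ell`), and the claim reduces to the fact that the operator
`∏_j (∂_τ + s_j)` annihilates `sinh (τ / 2) ^ k cosh (τ / 2) ^ l` for `k + l = N - 1`, as this
function is a combination of the `exp (s_j τ)` (`sum_ell_mul_coeff`).

For `m = 0` the same computation lacks one term of the scalar identity, and `coreT` applied to `1`
is minus the regularization term of the universal formula (`coreT_zero`). In a connected graph every
vertex has a leg, and then `m ≥ 1`, except for the graph that consists of a single vertex without
legs (`MultiGraph.exists_leg_or`); this is the graph that the regularization compensates for.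

The equivalence of the two formulas for `ω^{(g)}_{0,n}` follows because `∏_i (- y_i)` does not
vanish at points in general position.
-/

open scoped Manifold ContDiff Topology

noncomputable section

namespace XYSwap

/-! ### Exponentials of nilpotent elements and of series in `ħ` -/

section NilpotentExp

variable {A B : Type*} [CommRing A] [Algebra ℂ A] [CommRing B] [Algebra ℂ B]

/-- The exponential of a nilpotent element of a commutative `ℂ`-algebra. -/
def nexp (a : A) : A :=
  letI : Algebra ℚ A := Algebra.compHom A (algebraMap ℚ ℂ)
  IsNilpotent.exp a

theorem nexp_eq_sum {a : A} {k : ℕ} (h : a ^ k = 0) :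
    nexp a = ∑ j ∈ Finset.range k, ((Nat.factorial j : ℂ)⁻¹) • a ^ j := by
  let _ : Algebra ℚ A := Algebra.compHom A (algebraMap ℚ ℂ)
  have h1 : nexp a = IsNilpotent.exp a := rfl
  rw [h1, IsNilpotent.exp_eq_sum h]
  refine Finset.sum_congr rfl fun j _ => ?_
  have : ∀ (c : ℚ) (b : A), c • b = (c : ℂ) • b := fun c b => rfl
  rw [this]
  push_cast
  rfl

theorem nexp_add {a b : A} (ha : IsNilpotent a) (hb : IsNilpotent b) :
    nexp (a + b) = nexp a * nexp b := by
  let _ : Algebra ℚ A := Algebra.compHom A (algebraMap ℚ ℂ)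
  exact IsNilpotent.exp_add_of_commute (Commute.all a b) ha hb

theorem nexp_zero : nexp (0 : A) = 1 := by
  let _ : Algebra ℚ A := Algebra.compHom A (algebraMap ℚ ℂ)
  exact IsNilpotent.exp_zero

theorem nexp_sum {ι : Type*} (s : Finset ι) {a : ι → A} (ha : ∀ i ∈ s, IsNilpotent (a i)) :
    nexp (∑ i ∈ s, a i) = ∏ i ∈ s, nexp (a i) := by
  classical
  induction s using Finset.induction_on with
  | empty => simp [nexp_zero]
  | insert i s hi ih =>
    have hs : ∀ j ∈ s, IsNilpotent (a j) := fun j hj => ha j (Finset.mem_insert_of_mem hj)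
    rw [Finset.sum_insert hi, Finset.prod_insert hi,
      nexp_add (ha i (Finset.mem_insert_self _ _)) (isNilpotent_sum hs), ih hs]

theorem map_nexp (f : A →+* B) {a : A} (ha : IsNilpotent a) : f (nexp a) = nexp (f a) := by
  let _ : Algebra ℚ A := Algebra.compHom A (algebraMap ℚ ℂ)
  let _ : Algebra ℚ B := Algebra.compHom B (algebraMap ℚ ℂ)
  exact IsNilpotent.map_exp ha f

end NilpotentExp

section Jets

variable {A B : Type*} [CommRing A] [CommRing B]

/-- Series in `ħ` modulo `ħ ^ (M + 1)`. -/
def Jet (M : ℕ) (A : Type*) [CommRing A] : Type _ :=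
  PowerSeries A ⧸ Ideal.span {(PowerSeries.X : PowerSeries A) ^ (M + 1)}

instance (M : ℕ) : CommRing (Jet M A) :=
  inferInstanceAs (CommRing (PowerSeries A ⧸ Ideal.span {(PowerSeries.X : PowerSeries A) ^ (M + 1)}))

/-- Reduction modulo `ħ ^ (M + 1)`. -/
def jet (M : ℕ) {A : Type*} [CommRing A] : PowerSeries A →+* Jet M A :=
  Ideal.Quotient.mk _

/-- The class of `ħ`. -/
abbrev hbar (M : ℕ) (A : Type*) [CommRing A] : Jet M A := jet M PowerSeries.X

theorem jet_eq_iff {M : ℕ} {f g : PowerSeries A} :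
    jet M f = jet M g ↔ ∀ K ≤ M, PowerSeries.coeff K f = PowerSeries.coeff K g := by
  change Ideal.Quotient.mk _ f = Ideal.Quotient.mk _ g ↔ _
  rw [Ideal.Quotient.eq, Ideal.mem_span_singleton, PowerSeries.X_pow_dvd_iff]
  refine forall_congr' fun K => ?_
  rw [Nat.lt_succ_iff, map_sub, sub_eq_zero]

theorem hbar_pow (M : ℕ) : hbar M A ^ (M + 1) = 0 := by
  rw [hbar, ← map_pow]
  exact Ideal.Quotient.eq_zero_iff_mem.2 (Ideal.mem_span_singleton_self _)

theorem hbar_pow_of_lt {M k : ℕ} (h : M < k) : hbar M A ^ k = 0 :=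
  pow_eq_zero_of_le h (hbar_pow M)

/-- A series is the sum of its terms of degree at most `M` modulo `ħ ^ (M + 1)`. -/
theorem jet_eq_sum (M : ℕ) (f : PowerSeries A) :
    jet M f = ∑ K ∈ Finset.range (M + 1),
      hbar M A ^ K * jet M (PowerSeries.C (PowerSeries.coeff K f)) := by
  simp only [hbar, ← map_pow, ← map_mul, ← map_sum]
  rw [jet_eq_iff]
  intro K hK
  simp only [map_sum]
  rw [Finset.sum_eq_single K]
  · simp
  · intro b _ hb
    rw [PowerSeries.coeff_X_pow_mul', PowerSeries.coeff_C]
    split_ifs <;> first | rfl | omega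
  · simp; omega

theorem isNilpotent_jet {M : ℕ} {f : PowerSeries A} (h : PowerSeries.constantCoeff f = 0) :
    jet M f ^ (M + 1) = 0 := by
  obtain ⟨g, rfl⟩ := PowerSeries.X_dvd_iff.2 h
  rw [map_mul, mul_pow, hbar_pow, zero_mul]

theorem coeff_pow_eq_zero {f : PowerSeries A} (h : PowerSeries.constantCoeff f = 0) {N j : ℕ}
    (hj : N < j) : PowerSeries.coeff N (f ^ j) = 0 := by
  obtain ⟨g, rfl⟩ := PowerSeries.X_dvd_iff.2 h
  rw [mul_pow, PowerSeries.coeff_X_pow_mul', if_neg (by omega)]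

theorem ext_jet {f g : PowerSeries A} (h : ∀ M, jet M f = jet M g) : f = g := by
  ext N
  exact jet_eq_iff.1 (h N) N le_rfl

variable [Algebra ℂ A]

instance (M : ℕ) : Algebra ℂ (Jet M A) :=
  ((jet M).comp ((PowerSeries.C (R := A)).comp (algebraMap ℂ A))).toAlgebra

theorem algebraMap_jet (M : ℕ) (c : ℂ) :
    algebraMap ℂ (Jet M A) c = jet M (PowerSeries.C (algebraMap ℂ A c)) := rfl

theorem jet_smul (M : ℕ) (c : ℂ) (f : PowerSeries A) : jet M (c • f) = c • jet M f := by
  rw [Algebra.smul_def c (jet M f), algebraMap_jet, ← map_mul]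
  congr 1
  ext N
  rw [PowerSeries.coeff_smul, PowerSeries.coeff_C_mul, Algebra.smul_def]

theorem coeff_expHbar {f : PowerSeries A} (h : PowerSeries.constantCoeff f = 0) {N M : ℕ}
    (hM : N ≤ M) : PowerSeries.coeff N (expHbar f) =
      ∑ j ∈ Finset.range (M + 1), ((Nat.factorial j : ℂ)⁻¹) • PowerSeries.coeff N (f ^ j) := by
  rw [expHbar, PowerSeries.coeff_mk]
  refine Finset.sum_subset (by simpa using hM) fun j _ hj => ?_
  rw [coeff_pow_eq_zero h (by simpa using hj), smul_zero]

theorem jet_expHbar (M : ℕ) {f : PowerSeries A} (h : PowerSeries.constantCoeff f = 0) :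
    jet M (expHbar f) = nexp (jet M f) := by
  have h1 : jet M (expHbar f) = jet M (∑ j ∈ Finset.range (M + 1),
      ((Nat.factorial j : ℂ)⁻¹) • f ^ j) := by
    rw [jet_eq_iff]
    intro K hK
    rw [coeff_expHbar h hK, map_sum]
    rfl
  rw [h1, nexp_eq_sum (isNilpotent_jet h), map_sum]
  refine Finset.sum_congr rfl fun j _ => ?_
  rw [← map_pow, jet_smul]

theorem expHbar_add {f g : PowerSeries A} (hf : PowerSeries.constantCoeff f = 0)
    (hg : PowerSeries.constantCoeff g = 0) : expHbar (f + g) = expHbar f * expHbar g := by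
  refine ext_jet fun M => ?_
  rw [map_mul, jet_expHbar M hf, jet_expHbar M hg, jet_expHbar M (by simp [hf, hg]), map_add,
    nexp_add ⟨_, isNilpotent_jet hf⟩ ⟨_, isNilpotent_jet hg⟩]

theorem expHbar_zero : expHbar (0 : PowerSeries A) = 1 := by
  refine ext_jet fun M => ?_
  rw [jet_expHbar M (by simp), map_zero, nexp_zero, map_one]

theorem expHbar_sum {ι : Type*} (s : Finset ι) {f : ι → PowerSeries A}
    (hf : ∀ i ∈ s, PowerSeries.constantCoeff (f i) = 0) :
    expHbar (∑ i ∈ s, f i) = ∏ i ∈ s, expHbar (f i) := by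
  classical
  induction s using Finset.induction_on with
  | empty => simp [expHbar_zero]
  | insert i s hi ih =>
    have hs : ∀ j ∈ s, PowerSeries.constantCoeff (f j) = 0 :=
      fun j hj => hf j (Finset.mem_insert_of_mem hj)
    rw [Finset.sum_insert hi, Finset.prod_insert hi,
      expHbar_add (hf i (Finset.mem_insert_self _ _)) (by rw [map_sum]; exact Finset.sum_eq_zero hs),
      ih hs]

theorem constantCoeff_expHbar (f : PowerSeries A) : PowerSeries.constantCoeff (expHbar f) = 1 := by
  rw [← PowerSeries.coeff_zero_eq_constantCoeff_apply]
  simp [expHbar]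

theorem map_expHbar [Algebra ℂ B] (φ : A →ₐ[ℂ] B) (f : PowerSeries A) :
    PowerSeries.map φ.toRingHom (expHbar f) = expHbar (PowerSeries.map φ.toRingHom f) := by
  ext N
  simp only [expHbar, PowerSeries.coeff_map, PowerSeries.coeff_mk, map_sum]
  refine Finset.sum_congr rfl fun j _ => ?_
  rw [← map_pow, PowerSeries.coeff_map]
  exact map_smul φ _ _

/-- The exponential solves the differential equation `F' = f' F`. -/
theorem derivative_expHbar {f : PowerSeries A} (h : PowerSeries.constantCoeff f = 0) :
    PowerSeries.derivative A (expHbar f) = PowerSeries.derivative A f * expHbar f := by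
  ext N
  have h1 : ∀ j : ℕ, (((j + 1).factorial : ℂ)⁻¹) • PowerSeries.derivative A (f ^ (j + 1)) =
      PowerSeries.derivative A f * (((Nat.factorial j : ℂ)⁻¹) • f ^ j) := by
    intro j
    rw [Derivation.leibniz_pow, Nat.factorial_succ]
    simp only [Nat.add_sub_cancel, smul_eq_mul, nsmul_eq_mul]
    rw [mul_smul_comm, ← mul_comm (f ^ j), ← nsmul_eq_mul, ← Nat.cast_smul_eq_nsmul ℂ, smul_smul]
    congr 1
    push_cast
    field_simp
  have h2 : PowerSeries.coeff N (PowerSeries.derivative A (expHbar f)) =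
      PowerSeries.coeff N (PowerSeries.derivative A (∑ j ∈ Finset.range (N + 2),
        ((Nat.factorial j : ℂ)⁻¹) • f ^ j)) := by
    rw [PowerSeries.coeff_derivative, PowerSeries.coeff_derivative, coeff_expHbar h le_rfl, map_sum]
    rfl
  have h3 : PowerSeries.derivative A (∑ j ∈ Finset.range (N + 2),
        ((Nat.factorial j : ℂ)⁻¹) • f ^ j) =
      PowerSeries.derivative A f * ∑ j ∈ Finset.range (N + 1), ((Nat.factorial j : ℂ)⁻¹) • f ^ j := by
    rw [Finset.sum_range_succ', map_add, map_sum, Finset.mul_sum]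
    have : ∀ j, PowerSeries.derivative A (((Nat.factorial j : ℂ)⁻¹) • f ^ j) =
        ((Nat.factorial j : ℂ)⁻¹) • PowerSeries.derivative A (f ^ j) := by
      intro j
      rw [← algebraMap_smul A, Derivation.map_smul, algebraMap_smul]
    simp only [this, h1]
    simp
  have h4 : jet N (∑ j ∈ Finset.range (N + 1), ((Nat.factorial j : ℂ)⁻¹) • f ^ j) =
      jet N (expHbar f) := by
    rw [jet_eq_iff]
    intro K hK
    rw [coeff_expHbar h hK, map_sum]
    rfl
  rw [h2, h3]
  refine jet_eq_iff.1 ?_ N le_rfl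
  rw [map_mul, map_mul, h4]

theorem eq_expHbar [IsAddTorsionFree A] {f G : PowerSeries A}
    (h : PowerSeries.constantCoeff f = 0) (hG : PowerSeries.constantCoeff G = 1)
    (hd : PowerSeries.derivative A G = PowerSeries.derivative A f * G) : G = expHbar f := by
  have hneg : PowerSeries.constantCoeff (-f) = 0 := by simp [h]
  have h1 : expHbar f * expHbar (-f) = 1 := by
    rw [← expHbar_add h hneg, add_neg_cancel, expHbar_zero]
  have h2 : G * expHbar (-f) = 1 := by
    refine PowerSeries.derivative.ext ?_ ?_
    · rw [Derivation.leibniz, derivative_expHbar hneg, hd]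
      simp only [map_neg, smul_eq_mul, Derivation.map_one_eq_zero]
      ring
    · simp [hG, constantCoeff_expHbar]
  calc G = G * (expHbar f * expHbar (-f)) := by rw [h1, mul_one]
    _ = expHbar f * (G * expHbar (-f)) := by ring
    _ = expHbar f := by rw [h2, mul_one]

end Jets

/-! ### Numerical identities -/

section Scalar

open PowerSeries

/-- The series `exp (c τ)`. -/
def expS (c : ℂ) : PowerSeries ℂ := rescale c (exp ℂ)

theorem coeff_expS (c : ℂ) (n : ℕ) : coeff n (expS c) = c ^ n / n.factorial := by
  simp [expS, coeff_rescale, coeff_exp, div_eq_mul_inv]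

theorem expS_add (a b : ℂ) : expS a * expS b = expS (a + b) := exp_mul_exp_eq_exp_add a b

theorem expS_zero : expS 0 = 1 := by
  simp [expS]

theorem X_mul_calS : X * calS = expS (1 / 2) - expS (-1 / 2) := by
  ext n
  cases n with
  | zero =>
    rw [map_sub, coeff_expS, coeff_expS]
    simp
  | succ n =>
    rw [coeff_succ_X_mul, calS, coeff_mk]
    rfl

theorem coeff_calS (n : ℕ) :
    coeff n calS = ((1 / 2 : ℂ) ^ (n + 1) - (-1 / 2) ^ (n + 1)) / (n + 1).factorial := by
  rw [← coeff_succ_X_mul, X_mul_calS, map_sub, coeff_expS, coeff_expS, sub_div]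

theorem constantCoeff_calS : constantCoeff calS = 1 := by
  rw [← coeff_zero_eq_constantCoeff_apply, coeff_calS]
  norm_num

theorem calS_mul_inv : calS * calS⁻¹ = 1 :=
  PowerSeries.mul_inv_cancel _ (by rw [constantCoeff_calS]; exact one_ne_zero)

/-- The series `cosh (τ / 2)`. -/
def calC : PowerSeries ℂ := (1 / 2 : ℂ) • (expS (1 / 2) + expS (-1 / 2))

theorem constantCoeff_calC_sub_one : constantCoeff (calC - 1) = 0 := by
  rw [← coeff_zero_eq_constantCoeff_apply]
  rw [calC, map_sub, coeff_smul, map_add, coeff_expS, coeff_expS, coeff_one]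
  norm_num

/-! ### The polynomials `ℓ_K` -/

/-- The exponent of `expL` with `θ = 1`. -/
def expEll : PowerSeries (Polynomial ℂ) :=
  PowerSeries.mk fun N => if N = 0 then 0 else
    Polynomial.X * ∑ p ∈ Finset.HasAntidiagonal.antidiagonal N,
      Polynomial.monomial p.1
        ((coeff p.1 calS * coeff p.2 calS⁻¹) * ((-1) ^ (N - 1) * (N - 1).factorial))

/-- The coefficient of `ħ ^ K θ ^ (- K)` in `exp (v (𝒮(ħ v ∂_θ) / 𝒮(ħ ∂_θ)) log θ - v log θ)`,
a polynomial in `v`. -/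
def ell (K : ℕ) : Polynomial ℂ := coeff K (expHbar expEll)

theorem ell_zero : ell 0 = 1 := by
  rw [ell, coeff_zero_eq_constantCoeff_apply, constantCoeff_expHbar]

/-- The series `log (1 + s τ)`. -/
def logS (s : ℂ) : PowerSeries ℂ :=
  PowerSeries.mk fun K => if K = 0 then 0 else (-1) ^ (K - 1) * s ^ K / K

theorem constantCoeff_logS (s : ℂ) : constantCoeff (logS s) = 0 := by
  rw [← coeff_zero_eq_constantCoeff_apply]
  simp [logS]

theorem expHbar_logS (s : ℂ) : expHbar (logS s) = 1 + C s * X := by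
  symm
  refine eq_expHbar (constantCoeff_logS s) (by simp) ?_
  have h1 : ∀ n, coeff n (derivative ℂ (logS s)) = (-1) ^ n * s ^ (n + 1) := by
    intro n
    rw [coeff_derivative, logS, coeff_mk, if_neg (Nat.succ_ne_zero n)]
    push_cast
    have : (n : ℂ) + 1 ≠ 0 := Nat.cast_add_one_ne_zero n
    field_simp
  have h2 : derivative ℂ (1 + C s * X) = C s := by
    ext n
    rw [coeff_derivative, map_add, coeff_C_mul, coeff_X, coeff_one, coeff_C]
    cases n <;> simp
  rw [h2]
  ext n
  rw [mul_add, mul_one, map_add, h1, ← mul_assoc, coeff_C]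
  cases n with
  | zero => simp
  | succ n =>
    rw [coeff_succ_mul_X, coeff_mul_C, h1, if_neg (Nat.succ_ne_zero n)]
    ring

/-- The centered sequence `j - (N - 1) / 2`. -/
def node (N j : ℕ) : ℂ := j - ((N : ℂ) - 1) / 2

/-- The telescoping sum `N 𝒮(N τ) = 𝒮(τ) ∑_j exp (s_j τ)`. -/
theorem nat_mul_rescale_calS (N : ℕ) :
    C (N : ℂ) * rescale (N : ℂ) calS = calS * ∑ j ∈ Finset.range N, expS (node N j) := by
  have h1 : X * (C (N : ℂ) * rescale (N : ℂ) calS) = expS (N / 2) - expS (-N / 2) := by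
    have : rescale (N : ℂ) (X * calS) = X * (C (N : ℂ) * rescale (N : ℂ) calS) := by
      rw [map_mul, rescale_X]
      ring
    rw [← this, X_mul_calS, map_sub]
    simp only [expS, rescale_rescale]
    congr 3 <;> ring_nf
  have h2 : X * (calS * ∑ j ∈ Finset.range N, expS (node N j)) = expS (N / 2) - expS (-N / 2) := by
    rw [← mul_assoc, X_mul_calS, Finset.mul_sum]
    have h3 : ∀ j ∈ Finset.range N, (expS (1 / 2) - expS (-1 / 2)) * expS (node N j) =
        expS (((j + 1 : ℕ) : ℂ) - N / 2) - expS ((j : ℂ) - N / 2) := by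
      intro j _
      rw [sub_mul, expS_add, expS_add, node]
      congr 2 <;> push_cast <;> ring
    rw [Finset.sum_congr rfl h3, Finset.sum_range_sub fun j : ℕ => expS ((j : ℂ) - N / 2)]
    congr 2 <;> push_cast <;> ring
  exact PowerSeries.X_mul_cancel (h1.trans h2.symm)

theorem map_eval_expEll (N : ℕ) : map (Polynomial.evalRingHom (N : ℂ)) expEll =
    ∑ j ∈ Finset.range N, logS (node N j) := by
  ext K
  rw [coeff_map, expEll, coeff_mk, map_sum]
  simp only [logS, coeff_mk]
  by_cases hK : K = 0
  · simp [hK]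
  simp only [if_neg hK]
  have h1 : ∑ j ∈ Finset.range N, node N j ^ K =
      K.factorial * (N * ∑ p ∈ Finset.HasAntidiagonal.antidiagonal K,
        (N : ℂ) ^ p.1 * coeff p.1 calS * coeff p.2 calS⁻¹) := by
    have h2 : C (N : ℂ) * rescale (N : ℂ) calS * calS⁻¹ =
        ∑ j ∈ Finset.range N, expS (node N j) := by
      rw [nat_mul_rescale_calS, mul_right_comm, calS_mul_inv, one_mul]
    have h3 := congrArg (coeff K) h2
    rw [mul_assoc, coeff_C_mul, coeff_mul, map_sum] at h3
    simp only [coeff_rescale, coeff_expS] at h3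
    rw [h3, Finset.mul_sum]
    refine Finset.sum_congr rfl fun j _ => ?_
    have : (K.factorial : ℂ) ≠ 0 := Nat.cast_ne_zero.2 K.factorial_ne_zero
    field_simp
  rw [← Finset.sum_div, ← Finset.mul_sum, h1]
  simp only [Polynomial.coe_evalRingHom, Polynomial.eval_mul, Polynomial.eval_X,
    Polynomial.eval_finsetSum, Polynomial.eval_monomial]
  obtain ⟨k, rfl⟩ := Nat.exists_eq_succ_of_ne_zero hK
  simp only [Nat.succ_eq_add_one, Nat.add_sub_cancel, Nat.factorial_succ]
  have : ((k + 1 : ℕ) : ℂ) ≠ 0 := Nat.cast_ne_zero.2 (Nat.succ_ne_zero k)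
  push_cast at this ⊢
  rw [eq_div_iff this]
  simp only [Finset.mul_sum, Finset.sum_mul]
  refine Finset.sum_congr rfl fun p _ => ?_
  ring

/-- At `v = N` the polynomials `ℓ_K` are the elementary symmetric functions of the numbers
`j - (N - 1) / 2`, `j < N`. -/
theorem eval_ell (N K : ℕ) : (ell K).eval (N : ℂ) =
    coeff K (∏ j ∈ Finset.range N, (1 + C (node N j) * X)) := by
  have h := map_expHbar (Polynomial.aeval (R := ℂ) (N : ℂ)) expEll
  have h0 : (Polynomial.aeval (R := ℂ) (N : ℂ)).toRingHom = Polynomial.evalRingHom (N : ℂ) := by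
    ext <;> simp
  rw [h0, map_eval_expEll, expHbar_sum _ fun i _ => constantCoeff_logS _] at h
  simp only [expHbar_logS] at h
  rw [← h, coeff_map]
  rfl

theorem coeff_prod_eq_zero (s : ℕ → ℂ) (N : ℕ) {K : ℕ} (hK : N < K) :
    coeff K (∏ j ∈ Finset.range N, (1 + C (s j) * X)) = 0 := by
  induction N generalizing K with
  | zero => simp [coeff_one]; omega
  | succ N ih =>
    obtain ⟨k, rfl⟩ := Nat.exists_eq_add_of_lt (Nat.zero_lt_of_lt hK)
    rw [Finset.prod_range_succ, mul_add, mul_one, map_add, ih (by omega), ← mul_assoc, zero_add,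
      zero_add, coeff_succ_mul_X, coeff_mul_C, ih (by omega), zero_mul]

theorem sum_coeff_prod (s : ℕ → ℂ) (c : ℂ) (N : ℕ) :
    ∑ k ∈ Finset.range (N + 1), coeff k (∏ j ∈ Finset.range N, (1 + C (s j) * X)) * c ^ (N - k) =
      ∏ j ∈ Finset.range N, (c + s j) := by
  induction N with
  | zero => simp
  | succ N ih =>
    rw [Finset.prod_range_succ (fun j => c + s j), ← ih, Finset.prod_range_succ]
    set P := ∏ j ∈ Finset.range N, (1 + C (s j) * X) with hP
    have hP0 : coeff (N + 1) P = 0 := coeff_prod_eq_zero s N (Nat.lt_succ_self N)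
    rw [mul_add, mul_one]
    simp only [map_add, add_mul, Finset.sum_add_distrib]
    rw [mul_add, Finset.sum_range_succ _ (N + 1), hP0, zero_mul, add_zero, Finset.sum_mul,
      Finset.sum_mul]
    congr 1
    · refine Finset.sum_congr rfl fun k hk => ?_
      rw [Finset.mem_range] at hk
      rw [mul_assoc, ← pow_succ]
      congr 2
      omega
    · rw [Finset.sum_range_succ']
      simp only [← mul_assoc, coeff_succ_mul_X, coeff_mul_C, coeff_zero_mul_X, zero_mul, add_zero]
      refine Finset.sum_congr rfl fun k _ => ?_
      rw [Nat.add_sub_add_right]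
      ring

theorem eval_ell_eq_zero {N K : ℕ} (h : N < K) : (ell K).eval (N : ℂ) = 0 := by
  rw [eval_ell, coeff_prod_eq_zero _ _ h]

/-- The functional `f ↦ ∑_k ℓ_k(N) (N - k)! [τ ^ (N - k)] f`, that is, the differential operator
`∏_j (∂_τ + s_j)` followed by the evaluation at `τ = 0`. -/
def nodeFunctional (N : ℕ) : PowerSeries ℂ →ₗ[ℂ] ℂ :=
  ∑ k ∈ Finset.range (N + 1), ((ell k).eval (N : ℂ) * (N - k).factorial) • coeff (N - k)

theorem nodeFunctional_expS (N : ℕ) {i : ℕ} (hi : i < N) :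
    nodeFunctional N (expS (node N i)) = 0 := by
  have h : nodeFunctional N (expS (node N i)) =
      ∏ j ∈ Finset.range N, (node N i + node N j) := by
    rw [← sum_coeff_prod, nodeFunctional, LinearMap.sum_apply]
    refine Finset.sum_congr rfl fun k _ => ?_
    rw [LinearMap.smul_apply, coeff_expS, ← eval_ell, smul_eq_mul]
    have : ((N - k).factorial : ℂ) ≠ 0 := Nat.cast_ne_zero.2 (N - k).factorial_ne_zero
    field_simp
  rw [h]
  refine Finset.prod_eq_zero (i := N - 1 - i) (Finset.mem_range.2 (by omega)) ?_
  rw [node, node, Nat.cast_sub (by omega), Nat.cast_sub (by omega)]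
  push_cast
  ring

/-- Every factor `sinh (τ / 2)` or `cosh (τ / 2)` shifts exponents by `± 1 / 2`, so a product of `N`
of them is a combination of the exponentials `exp (s_i τ)` for the centered sequence `s` of length
`N + 1`. -/
theorem mul_pow_mem_span (N k l : ℕ) (h : k + l = N) :
    (expS (1 / 2) - expS (-1 / 2)) ^ k * calC ^ l ∈
      Submodule.span ℂ (Set.range fun i : Fin (N + 1) => expS (node (N + 1) i)) := by
  have key : ∀ (n : ℕ) (f : PowerSeries ℂ),
      f ∈ Submodule.span ℂ (Set.range fun i : Fin (n + 1) => expS (node (n + 1) i)) →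
      ∀ c d : ℂ, (c • expS (1 / 2) + d • expS (-1 / 2)) * f ∈
        Submodule.span ℂ (Set.range fun i : Fin (n + 2) => expS (node (n + 2) i)) := by
    intro n f hf c d
    induction hf using Submodule.span_induction with
    | mem f hf =>
      obtain ⟨i, rfl⟩ := hf
      rw [add_mul, smul_mul_assoc, smul_mul_assoc, expS_add, expS_add]
      refine Submodule.add_mem _ (Submodule.smul_mem _ _ (Submodule.subset_span ⟨i.succ, ?_⟩))
        (Submodule.smul_mem _ _ (Submodule.subset_span ⟨i.castSucc, ?_⟩))
      · simp only [node, Fin.val_succ]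
        congr 1
        push_cast
        ring
      · simp only [node, Fin.val_castSucc]
        congr 1
        push_cast
        ring
    | zero => simp
    | add f g _ _ hf hg => rw [mul_add]; exact Submodule.add_mem _ hf hg
    | smul r f _ hf => rw [mul_smul_comm]; exact Submodule.smul_mem _ _ hf
  induction N generalizing k l with
  | zero =>
    obtain ⟨rfl, rfl⟩ : k = 0 ∧ l = 0 := by omega
    refine Submodule.subset_span ⟨0, ?_⟩
    simp [node, expS_zero]
  | succ N ih =>
    rcases Nat.eq_zero_or_pos k with hk | hk
    · obtain ⟨m, rfl⟩ : ∃ m, l = m + 1 := ⟨l - 1, by omega⟩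
      have := key N _ (ih k m (by omega)) (1 / 2) (1 / 2)
      rwa [← smul_add, ← calC, mul_left_comm, ← pow_succ'] at this
    · obtain ⟨m, rfl⟩ : ∃ m, k = m + 1 := ⟨k - 1, by omega⟩
      have := key N _ (ih m l (by omega)) 1 (-1)
      rwa [one_smul, neg_smul, one_smul, ← sub_eq_add_neg, ← mul_assoc, ← pow_succ'] at this

/-- The differential operator `∏_j (∂_τ + s_j)` annihilates `sinh ^ k * cosh ^ l` for
`k + l = N - 1`, in terms of the coefficients of `𝒮`. -/
theorem sum_ell_mul_coeff {N K : ℕ} (hK : 1 ≤ K) (hN : K ≤ N) :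
    ∑ p ∈ Finset.HasAntidiagonal.antidiagonal K, (ell p.1).eval (N : ℂ) * (N - p.1).factorial *
      coeff p.2 (calS ^ (N - K) * calC ^ (K - 1)) = 0 := by
  set F : PowerSeries ℂ := (expS (1 / 2) - expS (-1 / 2)) ^ (N - K) * calC ^ (K - 1) with hF
  have h1 : F = X ^ (N - K) * (calS ^ (N - K) * calC ^ (K - 1)) := by
    rw [hF, ← X_mul_calS, mul_pow, mul_assoc]
  have h2 : nodeFunctional N F = 0 := by
    obtain ⟨n, rfl⟩ : ∃ n, N = n + 1 := ⟨N - 1, by omega⟩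
    have hmem := mul_pow_mem_span n (n + 1 - K) (K - 1) (by omega)
    rw [← hF] at hmem
    have hle : Submodule.span ℂ (Set.range fun i : Fin (n + 1) => expS (node (n + 1) i)) ≤
        LinearMap.ker (nodeFunctional (n + 1)) := by
      rw [Submodule.span_le]
      rintro _ ⟨i, rfl⟩
      exact nodeFunctional_expS _ i.2
    exact hle hmem
  rw [nodeFunctional, LinearMap.sum_apply] at h2
  rw [Finset.Nat.sum_antidiagonal_eq_sum_range_succ_mk, ← h2]
  refine Finset.sum_subset_zero_on_sdiff (Finset.range_mono (by omega)) ?_ ?_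
  · intro k hk
    simp only [Finset.mem_sdiff, Finset.mem_range] at hk
    rw [LinearMap.smul_apply, h1, coeff_X_pow_mul', if_neg (by omega), smul_zero]
  · intro k hk
    rw [Finset.mem_range] at hk
    rw [LinearMap.smul_apply, h1, coeff_X_pow_mul', if_pos (by omega), smul_eq_mul]
    congr 3
    omega

end Scalar

/-! ### Normal ordering of `𝒮(τ x D)` -/

section Scalar

open PowerSeries

/-- The numbers `σ(n, p)` with `(x D) ^ n x = ∑_p σ(n, p) x ^ (p + 1) D ^ p` (Stirling numbers of
the second kind with shifted indices), given by their generating function. -/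
def sig (n p : ℕ) : ℂ :=
  ((n + 1).factorial : ℂ) / (p + 1).factorial * coeff (n + 1) ((exp ℂ - 1) ^ (p + 1))

theorem derivative_exp_sub_one_pow (p : ℕ) :
    derivative ℂ ((exp ℂ - 1) ^ (p + 1)) =
      C ((p : ℂ) + 1) * ((exp ℂ - 1) ^ (p + 1) + (exp ℂ - 1) ^ p) := by
  rw [Derivation.leibniz_pow, map_sub, derivative_exp, Derivation.map_one_eq_zero, sub_zero]
  simp only [Nat.add_sub_cancel, smul_eq_mul, nsmul_eq_mul, map_add, map_one, map_natCast]
  push_cast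
  ring

theorem coeff_exp_sub_one_pow (n p : ℕ) :
    coeff (n + 1) ((exp ℂ - 1) ^ (p + 1)) * ((n : ℂ) + 1) =
      (p + 1) * (coeff n ((exp ℂ - 1) ^ (p + 1)) + coeff n ((exp ℂ - 1) ^ p)) := by
  rw [← coeff_derivative, derivative_exp_sub_one_pow, coeff_C_mul, map_add]

theorem sig_zero (p : ℕ) : sig 0 p = if p = 0 then 1 else 0 := by
  have h := coeff_exp_sub_one_pow 0 p
  cases p with
  | zero =>
    simp [sig, coeff_one, coeff_exp]
  | succ p =>
    rw [if_neg (Nat.succ_ne_zero p), sig]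
    have h0 : constantCoeff (exp ℂ - 1) = 0 := by simp
    have h1 : coeff 0 ((exp ℂ - 1) ^ (p + 1 + 1)) = 0 := by
      rw [coeff_zero_eq_constantCoeff_apply, map_pow, h0, zero_pow (Nat.succ_ne_zero _)]
    have h2 : coeff 0 ((exp ℂ - 1) ^ (p + 1)) = 0 := by
      rw [coeff_zero_eq_constantCoeff_apply, map_pow, h0, zero_pow (Nat.succ_ne_zero _)]
    rw [h1, h2] at h
    simp only [Nat.cast_zero, zero_add, mul_one, add_zero, mul_zero] at h
    rw [zero_add, h, mul_zero]

theorem sig_succ_zero (n : ℕ) : sig (n + 1) 0 = sig n 0 := by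
  have h := coeff_exp_sub_one_pow (n + 1) 0
  rw [pow_zero, coeff_one, if_neg (Nat.succ_ne_zero n), zero_add, add_zero, Nat.cast_zero, zero_add,
    one_mul] at h
  rw [sig, sig, zero_add, ← h, Nat.factorial_succ (n + 1)]
  push_cast
  ring

theorem sig_succ_succ (n p : ℕ) :
    sig (n + 1) (p + 1) = (p + 2) * sig n (p + 1) + sig n p := by
  have h := coeff_exp_sub_one_pow (n + 1) (p + 1)
  have e : coeff (n + 2) ((exp ℂ - 1) ^ (p + 2)) = ((p : ℂ) + 2) / ((n : ℂ) + 2) *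
      (coeff (n + 1) ((exp ℂ - 1) ^ (p + 2)) + coeff (n + 1) ((exp ℂ - 1) ^ (p + 1))) := by
    have hn : (n : ℂ) + 2 ≠ 0 := by exact_mod_cast (Nat.succ_ne_zero (n + 1))
    rw [div_mul_eq_mul_div, eq_div_iff hn]
    have e1 : ((n + 1 : ℕ) : ℂ) + 1 = n + 2 := by push_cast; ring
    have e2 : ((p + 1 : ℕ) : ℂ) + 1 = p + 2 := by push_cast; ring
    rw [e1, e2] at h
    exact h
  simp only [sig]
  rw [show n + 1 + 1 = n + 2 from rfl, show p + 1 + 1 = p + 2 from rfl, e,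
    Nat.factorial_succ (n + 1), Nat.factorial_succ (p + 1)]
  have hn : (n : ℂ) + 2 ≠ 0 := by exact_mod_cast (Nat.succ_ne_zero (n + 1))
  have hp : (p : ℂ) + 2 ≠ 0 := by exact_mod_cast (Nat.succ_ne_zero (p + 1))
  have hf : ((p + 1).factorial : ℂ) ≠ 0 := Nat.cast_ne_zero.2 (p + 1).factorial_ne_zero
  push_cast
  have e1 : (n : ℂ) + 1 + 1 = n + 2 := by ring
  have e2 : (p : ℂ) + 1 + 1 = p + 2 := by ring
  rw [e1, e2]
  field_simp

theorem sig_eq_zero {n p : ℕ} (h : n < p) : sig n p = 0 := by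
  induction n generalizing p with
  | zero => rw [sig_zero, if_neg (by omega)]
  | succ n ih =>
    obtain ⟨q, rfl⟩ : ∃ q, p = q + 1 := ⟨p - 1, by omega⟩
    rw [sig_succ_succ, ih (by omega), ih (by omega), mul_zero, add_zero]

/-- The coefficient `κ_p(τ)` of `x ^ (p + 1) D ^ p` in the operator `𝒮(τ x D) x`. -/
def kap (p : ℕ) : PowerSeries ℂ := PowerSeries.mk fun n => coeff n calS * sig n p

theorem X_mul_kap (p : ℕ) : X * kap p = C (((p + 1).factorial : ℂ)⁻¹) *
    ((expS (1 / 2) - 1) ^ (p + 1) - (expS (-1 / 2) - 1) ^ (p + 1)) := by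
  have h : ∀ c : ℂ, (expS c - 1) ^ (p + 1) = rescale c ((exp ℂ - 1) ^ (p + 1)) := by
    intro c
    rw [map_pow, map_sub, map_one, expS]
  rw [h, h]
  ext n
  rw [coeff_C_mul, map_sub, coeff_rescale, coeff_rescale]
  cases n with
  | zero => simp
  | succ n =>
    rw [coeff_succ_X_mul, kap, coeff_mk, coeff_calS, sig]
    have hn : ((n + 1).factorial : ℂ) ≠ 0 := Nat.cast_ne_zero.2 (n + 1).factorial_ne_zero
    field_simp

theorem sum_antidiagonal_pow (z b : PowerSeries ℂ) (p : ℕ) :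
    ∑ q ∈ Finset.HasAntidiagonal.antidiagonal p,
      C ((((q.1 + 1).factorial : ℂ)⁻¹) * ((q.2.factorial : ℂ)⁻¹)) * (z ^ (q.1 + 1) * b ^ q.2) =
    C (((p + 1).factorial : ℂ)⁻¹) * ((b + z) ^ (p + 1) - b ^ (p + 1)) := by
  rw [add_comm b z, (Commute.all z b).add_pow', Finset.Nat.sum_antidiagonal_succ]
  simp only [pow_zero, one_mul, Nat.choose_zero_right, one_smul]
  rw [add_sub_cancel_left, Finset.mul_sum]
  refine Finset.sum_congr rfl fun q hq => ?_
  rw [Finset.HasAntidiagonal.mem_antidiagonal] at hq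
  rw [← hq, nsmul_eq_mul, ← map_natCast (C : ℂ →+* PowerSeries ℂ),
    ← mul_assoc (C (((q.1 + q.2 + 1).factorial : ℂ)⁻¹)), ← map_mul]
  congr 2
  rw [show q.1 + q.2 + 1 = (q.1 + 1) + q.2 by ring, Nat.choose_symm_add, Nat.add_choose,
    Nat.cast_div (Nat.factorial_mul_factorial_dvd_factorial_add _ _)
      (by exact_mod_cast (mul_ne_zero (Nat.factorial_ne_zero _) (Nat.factorial_ne_zero _)))]
  have h1 : ((q.1 + 1 + q.2).factorial : ℂ) ≠ 0 := Nat.cast_ne_zero.2 (Nat.factorial_ne_zero _)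
  have h2 : ((q.1 + 1).factorial : ℂ) ≠ 0 := Nat.cast_ne_zero.2 (Nat.factorial_ne_zero _)
  have h3 : (q.2.factorial : ℂ) ≠ 0 := Nat.cast_ne_zero.2 (Nat.factorial_ne_zero _)
  push_cast
  field_simp

/-- The integral of a function over the segment with endpoints `x exp (± τ / 2)`, computed in the
coordinate `log x` and in the coordinate `x`: there the segment has the midpoint `x cosh (τ / 2)`
and the length `x τ 𝒮(τ)`. -/
theorem kap_eq (p : ℕ) : kap p = ∑ q ∈ Finset.HasAntidiagonal.antidiagonal p,
    C (coeff q.1 calS * ((q.2.factorial : ℂ)⁻¹)) *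
      (calS * (-(X * calS)) ^ q.1 * (calC - 1) ^ q.2) := by
  refine PowerSeries.X_mul_cancel ?_
  rw [X_mul_kap, Finset.mul_sum]
  obtain ⟨Z, hZ⟩ : ∃ Z : PowerSeries ℂ, Z = C (1 / 2 : ℂ) * (X * calS) := ⟨_, rfl⟩
  have e : X * calS = C (2 : ℂ) * Z := by
    rw [hZ, ← mul_assoc, ← map_mul]
    norm_num
  have hp : expS (1 / 2) - 1 = (calC - 1) + Z := by
    rw [hZ, X_mul_calS, calC, smul_eq_C_mul]
    have : C (1 / 2 : ℂ) * 2 = 1 := by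
      rw [← map_ofNat (C : ℂ →+* PowerSeries ℂ), ← map_mul]
      norm_num
    linear_combination (-expS (1 / 2)) * this
  have hm : expS (-1 / 2) - 1 = (calC - 1) + (-Z) := by
    rw [hZ, X_mul_calS, calC, smul_eq_C_mul]
    have : C (1 / 2 : ℂ) * 2 = 1 := by
      rw [← map_ofNat (C : ℂ →+* PowerSeries ℂ), ← map_mul]
      norm_num
    linear_combination (-expS (-1 / 2)) * this
  have h3 : C (((p + 1).factorial : ℂ)⁻¹) *
      ((expS (1 / 2) - 1) ^ (p + 1) - (expS (-1 / 2) - 1) ^ (p + 1)) =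
      C (((p + 1).factorial : ℂ)⁻¹) * (((calC - 1) + Z) ^ (p + 1) - (calC - 1) ^ (p + 1)) -
      C (((p + 1).factorial : ℂ)⁻¹) * (((calC - 1) + (-Z)) ^ (p + 1) - (calC - 1) ^ (p + 1)) := by
    rw [hp, hm]
    ring
  rw [h3, ← sum_antidiagonal_pow, ← sum_antidiagonal_pow, ← Finset.sum_sub_distrib]
  refine Finset.sum_congr rfl fun q _ => ?_
  rw [coeff_calS, div_eq_mul_inv _ ((q.1 + 1).factorial : ℂ)]
  have h4 : X * (C (((1 / 2 : ℂ) ^ (q.1 + 1) - (-1 / 2) ^ (q.1 + 1)) * ((q.1 + 1).factorial : ℂ)⁻¹ *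
        (q.2.factorial : ℂ)⁻¹) * (calS * (-(X * calS)) ^ q.1 * (calC - 1) ^ q.2)) =
      C (((1 / 2 : ℂ) ^ (q.1 + 1) - (-1 / 2) ^ (q.1 + 1)) * ((q.1 + 1).factorial : ℂ)⁻¹ *
        (q.2.factorial : ℂ)⁻¹) * (-1) ^ q.1 * ((X * calS) ^ (q.1 + 1) * (calC - 1) ^ q.2) := by
    rw [neg_pow]
    ring
  rw [h4, e, mul_pow, neg_pow Z]
  set f := ((q.1 + 1).factorial : ℂ)⁻¹
  set f2 := (q.2.factorial : ℂ)⁻¹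
  have h6 : C (((1 / 2 : ℂ) ^ (q.1 + 1) - (-1 / 2) ^ (q.1 + 1)) * f * f2) * C ((-1 : ℂ) ^ q.1) *
      C ((2 : ℂ) ^ (q.1 + 1)) = C (f * f2) - C (f * f2) * C ((-1 : ℂ) ^ (q.1 + 1)) := by
    simp only [← map_mul, ← map_sub]
    congr 1
    have i1 : (1 / 2 : ℂ) ^ (q.1 + 1) * 2 ^ (q.1 + 1) = 1 := by
      rw [← mul_pow]; norm_num
    have i2 : (-1 / 2 : ℂ) ^ (q.1 + 1) * 2 ^ (q.1 + 1) = (-1) ^ (q.1 + 1) := by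
      rw [← mul_pow]; norm_num
    have i3 : (-1 : ℂ) ^ q.1 * (-1) ^ q.1 = 1 := by
      rw [← mul_pow]; norm_num
    rw [pow_succ (-1 : ℂ) q.1] at i2 ⊢
    linear_combination (f * f2 * (-1) ^ q.1) * i1 - (f * f2 * (-1) ^ q.1) * i2 + f * f2 * i3
  simp only [map_pow, map_neg, map_one] at h6
  clear_value f f2
  linear_combination (-(Z ^ (q.1 + 1) * (calC - 1) ^ q.2)) * h6

end Scalar

/-! ### The operators `(∂_θ + v / θ) ^ r` applied to `L(v, θ)` -/

section ThetaSeries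

open PowerSeries

theorem expHbar_rescale {A : Type*} [CommRing A] [Algebra ℂ A] (a : A) (f : PowerSeries A) :
    expHbar (rescale a f) = rescale a (expHbar f) := by
  ext N
  rw [coeff_rescale]
  simp only [expHbar, coeff_mk, Finset.mul_sum]
  refine Finset.sum_congr rfl fun j _ => ?_
  rw [← map_pow, coeff_rescale, mul_smul_comm]

/-- The function `θ ↦ θ⁻¹`. -/
def invF : ℂ → ℂ := fun θ => θ⁻¹

theorem derivLog_eq {N : ℕ} (hN : N ≠ 0) :
    derivLog N = ((-1) ^ (N - 1) * ((N - 1).factorial : ℂ)) • invF ^ N := by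
  obtain ⟨k, rfl⟩ := Nat.exists_eq_succ_of_ne_zero hN
  rw [derivLog, iteratedDeriv_eq_iterate, Nat.succ_sub_one]
  change deriv^[k] Inv.inv = _
  rw [iter_deriv_inv']
  funext x
  simp only [Pi.smul_apply, Pi.pow_apply, invF, smul_eq_mul]
  rw [show (-1 - (k : ℤ)) = -((k + 1 : ℕ) : ℤ) by push_cast; ring, zpow_neg, zpow_natCast, inv_pow]

theorem expL_eq : expL = rescale (Polynomial.C invF)
    (map (Polynomial.mapRingHom (algebraMap ℂ (ℂ → ℂ))) expEll) := by
  ext1 N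
  rw [coeff_rescale, coeff_map, expL, expEll, coeff_mk, coeff_mk]
  by_cases hN : N = 0
  · simp [hN]
  rw [if_neg hN, if_neg hN, map_mul, Polynomial.coe_mapRingHom, Polynomial.map_X, Polynomial.map_sum,
    ← map_pow, mul_left_comm, Finset.mul_sum (Finset.HasAntidiagonal.antidiagonal N) _
      (Polynomial.C (invF ^ N))]
  congr 1
  refine Finset.sum_congr rfl fun p _ => ?_
  rw [Polynomial.map_monomial, Polynomial.C_mul_monomial,
    derivLog_eq hN, smul_smul]
  congr 1
  rw [Algebra.smul_def, mul_comm]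

theorem expHbar_expL : expHbar expL = PowerSeries.mk fun K =>
    Polynomial.C (invF ^ K) * (ell K).map (algebraMap ℂ (ℂ → ℂ)) := by
  have h0 : Polynomial.mapRingHom (algebraMap ℂ (ℂ → ℂ)) =
      (Polynomial.mapAlgHom (Algebra.ofId ℂ (ℂ → ℂ))).toRingHom := rfl
  rw [expL_eq, expHbar_rescale, h0, ← map_expHbar]
  ext1 N
  rw [coeff_rescale, coeff_map, coeff_mk, ell, map_pow]
  rfl

theorem deriv_smul_invF_pow (c : ℂ) (m : ℕ) :
    deriv (algebraMap ℂ (ℂ → ℂ) c * invF ^ m) =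
      algebraMap ℂ (ℂ → ℂ) (-(m : ℂ) * c) * invF ^ (m + 1) := by
  have h1 : (algebraMap ℂ (ℂ → ℂ) c * invF ^ m) = fun θ => c * θ ^ (-(m : ℤ)) := by
    funext θ
    simp [invF, zpow_neg]
  rw [h1]
  funext θ
  rw [deriv_const_mul_field, deriv_zpow]
  simp only [Pi.mul_apply, Pi.pow_apply, invF, Pi.algebraMap_apply, Algebra.algebraMap_self,
    RingHom.id_apply]
  rw [show -(m : ℤ) - 1 = -((m + 1 : ℕ) : ℤ) by push_cast; ring, zpow_neg, zpow_natCast, inv_pow]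
  push_cast
  ring

/-- The product `(v - K) (v - K - 1) ⋯ (v - K - r + 1)`. -/
def fallFrom (K r : ℕ) : Polynomial ℂ :=
  (descPochhammer ℂ r).comp (Polynomial.X - Polynomial.C (K : ℂ))

theorem fallFrom_succ (K r : ℕ) :
    fallFrom K (r + 1) = fallFrom K r * (Polynomial.X - Polynomial.C ((K + r : ℕ) : ℂ)) := by
  rw [fallFrom, descPochhammer_succ_right, Polynomial.mul_comp, ← fallFrom]
  congr 1
  simp
  ring

theorem eval_fallFrom {N K : ℕ} (h : K ≤ N) (r : ℕ) :
    (fallFrom K r).eval (N : ℂ) = (N - K).descFactorial r := by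
  rw [fallFrom, Polynomial.eval_comp]
  simp only [Polynomial.eval_sub, Polynomial.eval_X, Polynomial.eval_C]
  rw [← Nat.cast_sub h, descPochhammer_eval_eq_descFactorial]

/-- `(∂_θ + v / θ) ^ r` is diagonal on the powers of `θ`. -/
theorem serL_eq (r : ℕ) : serL r = PowerSeries.mk fun K =>
    Polynomial.C (invF ^ (K + r)) * (ell K * fallFrom K r).map (algebraMap ℂ (ℂ → ℂ)) := by
  induction r with
  | zero =>
    rw [serL, Function.iterate_zero, id, expHbar_expL]
    simp [fallFrom]
  | succ r ih =>
    rw [serL, Function.iterate_succ_apply', ← serL, ih]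
    ext1 K
    rw [thetaStep, coeff_mk, coeff_mk, coeff_mk, fallFrom_succ, ← mul_assoc (ell K)]
    set P := ell K * fallFrom K r
    have h1 : ∀ Q : Polynomial ℂ, (Polynomial.C (invF ^ (K + r)) *
        Q.map (algebraMap ℂ (ℂ → ℂ))).sum (fun j f => Polynomial.monomial j (deriv f)) =
        Polynomial.C (invF ^ (K + r + 1)) *
          (Q * Polynomial.C (-((K + r : ℕ) : ℂ))).map (algebraMap ℂ (ℂ → ℂ)) := by
      intro Q
      ext1 j
      rw [Polynomial.sum_def, Polynomial.finsetSum_coeff]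
      simp only [Polynomial.coeff_monomial, Polynomial.coeff_C_mul, Polynomial.coeff_map,
        Polynomial.coeff_mul_C]
      rw [Finset.sum_ite_eq' _ j]
      have h2 : deriv (invF ^ (K + r) * algebraMap ℂ (ℂ → ℂ) (Q.coeff j)) =
          invF ^ (K + r + 1) * algebraMap ℂ (ℂ → ℂ) (Q.coeff j * -((K + r : ℕ) : ℂ)) := by
        rw [mul_comm, deriv_smul_invF_pow, mul_comm, mul_comm (Q.coeff j)]
      split_ifs with h
      · exact h2
      · rw [← h2]
        rw [Polynomial.notMem_support_iff, Polynomial.coeff_C_mul, Polynomial.coeff_map] at h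
        rw [h]
        exact (deriv_const' (0 : ℂ)).symm
    rw [h1, mul_sub, sub_eq_add_neg, ← mul_neg, ← Polynomial.C_neg, Polynomial.map_add, mul_add,
      add_comm]
    congr 1
    · rw [Polynomial.map_mul (p := P), Polynomial.map_X, show K + (r + 1) = K + r + 1 from rfl, pow_succ invF,
        Polynomial.C_mul]
      change Polynomial.X * Polynomial.C invF * (_ * P.map _) = _
      ring

end ThetaSeries

/-! ### Integration by parts -/

section Transfer

open Polynomial

variable {R : Type*} [CommRing R] [Algebra ℂ R]

/-- The operator `f ↦ ∑_k (-E) ^ k ([v ^ k] P * f)` attached to a polynomial `P` in `v`. -/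
def opT (E : Module.End ℂ R) : R[X] →ₗ[ℂ] Module.End ℂ R :=
  lsum fun k => (LinearMap.mulLeft ℂ ((-E) ^ k)).comp (LinearMap.mul ℂ R)

theorem opT_monomial (E : Module.End ℂ R) (k : ℕ) (a f : R) :
    opT E (monomial k a) f = ((-E) ^ k) (a * f) := by
  rw [opT, lsum_apply, sum_monomial_index _ _ (by simp)]
  rfl

theorem opT_apply_eq (E : Module.End ℂ R) (P : R[X]) (f : R) :
    opT E P f = opT E (P * C f) 1 := by
  induction P using Polynomial.induction_on' with
  | add P Q hP hQ => rw [map_add, LinearMap.add_apply, hP, hQ, add_mul, map_add, LinearMap.add_apply]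
  | monomial k a => rw [monomial_mul_C, opT_monomial, opT_monomial, mul_one]

/-- On polynomials with numerical coefficients, `opT` is the functional calculus of `-E`. -/
theorem opT_map (E : Module.End ℂ R) (P : ℂ[X]) (f : R) :
    opT E (P.map (algebraMap ℂ R)) f = aeval (-E) P f := by
  induction P using Polynomial.induction_on' with
  | add P Q hP hQ => rw [Polynomial.map_add, map_add, map_add, LinearMap.add_apply, hP, hQ,
      LinearMap.add_apply]
  | monomial k a =>
    rw [map_monomial, opT_monomial, ← Algebra.smul_def, map_smul, aeval_monomial,
      ← Algebra.smul_def, LinearMap.smul_apply]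

variable (D : Derivation ℂ R R)

/-- The coefficientwise action of a derivation on polynomials. -/
def coefD : R[X] →ₗ[ℂ] R[X] :=
  lsum fun k => ((monomial k).restrictScalars ℂ).comp (D : R →ₗ[ℂ] R)

theorem coefD_monomial (k : ℕ) (a : R) : coefD D (monomial k a) = monomial k (D a) := by
  rw [coefD, lsum_apply, sum_monomial_index _ _ (by simp)]
  rfl

/-- The operator `D + v q`: for `q = y⁻¹ D y` it is the operator `y ^ (- v) ∘ D ∘ y ^ v`. -/
def nabla (q : R) : R[X] →ₗ[ℂ] R[X] :=
  coefD D + (LinearMap.mulLeft ℂ (X * C q))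

theorem nabla_monomial (q : R) (k : ℕ) (a : R) :
    nabla D q (monomial k a) = monomial k (D a) + monomial (k + 1) (q * a) := by
  rw [nabla, LinearMap.add_apply, coefD_monomial, LinearMap.mulLeft_apply, mul_assoc, C_mul_monomial,
    X_mul_monomial]

theorem nabla_mul_C (q : R) (c : R[X]) (g : R) :
    nabla D q (c * C g) = nabla D q c * C g + c * C (D g) := by
  induction c using Polynomial.induction_on' with
  | add P Q hP hQ => rw [add_mul, map_add, hP, hQ, map_add]; ring
  | monomial k a =>
    simp only [monomial_mul_C, nabla_monomial, add_mul, Derivation.leibniz, smul_eq_mul, map_add]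
    rw [mul_comm g, mul_assoc]
    ring

variable (y dy : Rˣ)

/-- The derivation `y ∂_y = (y / dy) D`. -/
def eulerE : Module.End ℂ R := LinearMap.mulLeft ℂ (y * ↑dy⁻¹ : R) * (D : R →ₗ[ℂ] R)

theorem eulerE_apply (f : R) : eulerE D y dy f = y * ↑dy⁻¹ * D f := rfl

/-- The transform of a total derivative vanishes: `y ∂_y` applied to `[v ^ k]` cancels the shift
of the exponent of `v` by one. -/
theorem opT_nabla (c : R[X]) :
    opT (eulerE D y dy) (C (y * ↑dy⁻¹ : R) * nabla D (↑y⁻¹ * dy) c) 1 = 0 := by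
  induction c using Polynomial.induction_on' with
  | add P Q hP hQ => rw [map_add, mul_add, map_add, LinearMap.add_apply, hP, hQ, add_zero]
  | monomial k a =>
    have h : (y * ↑dy⁻¹ : R) * (↑y⁻¹ * dy * a) = a := by
      have h1 := y.mul_inv
      have h2 := dy.inv_mul
      linear_combination a * (↑dy⁻¹ * (dy : R)) * h1 + a * h2
    rw [nabla_monomial, mul_add, C_mul_monomial, C_mul_monomial, h, map_add, LinearMap.add_apply,
      opT_monomial, opT_monomial, mul_one, mul_one, pow_succ, Module.End.mul_apply,
      LinearMap.neg_apply, eulerE_apply, map_neg, add_neg_cancel]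

theorem opT_deriv (c : R[X]) (g : R) :
    opT (eulerE D y dy) (C (y * ↑dy⁻¹ : R) * c) (D g) =
      opT (eulerE D y dy) (C (y * ↑dy⁻¹ : R) * -nabla D (↑y⁻¹ * dy) c) g := by
  have h := opT_nabla D y dy (c * C g)
  rw [nabla_mul_C, mul_add, map_add, LinearMap.add_apply, ← mul_assoc, ← opT_apply_eq, ← mul_assoc,
    ← opT_apply_eq] at h
  rw [mul_neg, map_neg, LinearMap.neg_apply]
  exact eq_neg_of_add_eq_zero_right h

/-- Integration by parts: the transform does not change when derivatives of the argument are moved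
to the coefficients, where `D` becomes `- nabla`. -/
theorem opT_deriv_pow (p : ℕ) (c : R[X]) (g : R) :
    opT (eulerE D y dy) (C (y * ↑dy⁻¹ : R) * c) (((D : R →ₗ[ℂ] R) ^ p) g) =
      opT (eulerE D y dy) (C (y * ↑dy⁻¹ : R) * ((-nabla D (↑y⁻¹ * dy)) ^ p) c) g := by
  induction p generalizing c with
  | zero => rfl
  | succ p ih =>
    rw [pow_succ', Module.End.mul_apply]
    change opT _ _ (D _) = _
    rw [opT_deriv, ih, pow_succ, Module.End.mul_apply]
    rfl

variable {D y dy}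

/-- At `v = N` the operator `nabla` is `D` conjugated by `y ^ N`. -/
theorem eval_nabla (hy : D y = dy) (N : ℕ) (c : R[X]) :
    (y : R) ^ N * (nabla D (↑y⁻¹ * dy) c).eval (N : R) = D ((y : R) ^ N * c.eval (N : R)) := by
  induction c using Polynomial.induction_on' with
  | add P Q hP hQ => rw [map_add, eval_add, mul_add, hP, hQ, eval_add, mul_add, map_add]
  | monomial k a =>
    rw [nabla_monomial, eval_add, eval_monomial, eval_monomial, eval_monomial, Derivation.leibniz,
      Derivation.leibniz_pow, Derivation.leibniz, Derivation.leibniz_pow, hy]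
    simp only [smul_eq_mul, nsmul_eq_mul, Derivation.map_natCast, mul_zero, zero_add]
    have h1 := y.mul_inv
    cases N with
    | zero => simp; ring
    | succ N =>
      rw [Nat.add_sub_cancel]
      linear_combination ((y : R) ^ N * dy * a * ((N + 1 : ℕ) : R) ^ (k + 1)) * h1

theorem eval_nabla_pow (hy : D y = dy) (N p : ℕ) (c : R[X]) :
    (y : R) ^ N * (((-nabla D (↑y⁻¹ * dy)) ^ p) c).eval (N : R) =
      (-1) ^ p * ((D : R →ₗ[ℂ] R) ^ p) ((y : R) ^ N * c.eval (N : R)) := by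
  induction p with
  | zero => simp
  | succ p ih =>
    rw [pow_succ', Module.End.mul_apply, LinearMap.neg_apply, eval_neg, mul_neg, eval_nabla hy, ih,
      pow_succ' (D : R →ₗ[ℂ] R), Module.End.mul_apply]
    have : ∀ f : R, D ((-1) ^ p * f) = (-1) ^ p * D f := by
      intro f
      rw [Derivation.leibniz, Derivation.leibniz_pow]
      simp
    rw [this, pow_succ]
    simp

/-- A polynomial over a `ℂ`-algebra that vanishes at all large natural numbers is zero. -/
theorem eq_zero_of_eval_nat {P : R[X]} {N₀ : ℕ} (h : ∀ N : ℕ, N₀ ≤ N → P.eval (N : R) = 0) :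
    P = 0 := by
  ext k
  rw [coeff_zero, ← Module.forall_dual_apply_eq_zero_iff ℂ]
  intro φ
  set Q : ℂ[X] := ∑ i ∈ Finset.range (P.natDegree + 1), monomial i (φ (P.coeff i)) with hQ
  have hc : ∀ i, Q.coeff i = φ (P.coeff i) := by
    intro i
    rw [hQ, finsetSum_coeff]
    simp only [coeff_monomial]
    rw [Finset.sum_ite_eq']
    split_ifs with hi
    · rfl
    · rw [coeff_eq_zero_of_natDegree_lt (by simpa using hi), map_zero]
  have hz : Q = 0 := by
    refine eq_zero_of_infinite_isRoot Q (Set.Infinite.mono ?_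
      (Set.infinite_range_of_injective (f := fun n : ℕ => ((n + N₀ : ℕ) : ℂ))
        fun a b hab => by simpa using hab))
    rintro _ ⟨n, rfl⟩
    have h1 := congrArg φ (h (n + N₀) (by omega))
    rw [map_zero, eval_eq_sum_range, map_sum] at h1
    rw [Set.mem_ofPred_eq, IsRoot, hQ, eval_finsetSum, ← h1]
    refine Finset.sum_congr rfl fun i _ => ?_
    rw [eval_monomial, mul_comm (P.coeff i), ← map_natCast (algebraMap ℂ R), ← map_pow,
      ← Algebra.smul_def, map_smul, smul_eq_mul, mul_comm]
  rw [← hc, hz, coeff_zero]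

/-- Two differential operators in `g` with values in polynomials in `v` are equivalent under
integration by parts if their formal adjoints agree at all large integral values of `v`. -/
theorem sum_opT_deriv_pow (hy : D y = dy) (s : Finset ℕ) (c : ℕ → R[X]) (Q : R[X]) {N₀ : ℕ}
    (h : ∀ N : ℕ, N₀ ≤ N → ∑ p ∈ s, (-1) ^ p * ((D : R →ₗ[ℂ] R) ^ p) ((y : R) ^ N *
      (c p).eval (N : R)) = (y : R) ^ N * Q.eval (N : R)) (g : R) :
    ∑ p ∈ s, opT (eulerE D y dy) (C (y * ↑dy⁻¹ : R) * c p) (((D : R →ₗ[ℂ] R) ^ p) g) =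
      opT (eulerE D y dy) (C (y * ↑dy⁻¹ : R) * Q) g := by
  have hQ : ∑ p ∈ s, ((-nabla D (↑y⁻¹ * dy)) ^ p) (c p) = Q := by
    rw [← sub_eq_zero]
    refine eq_zero_of_eval_nat (N₀ := N₀) fun N hN => ?_
    have h1 := h N hN
    simp only [← eval_nabla_pow hy] at h1
    rw [← Finset.mul_sum] at h1
    rw [← Units.val_pow_eq_pow_val] at h1
    have h2 := (y ^ N).isUnit.mul_left_cancel h1
    rw [eval_sub, eval_finsetSum, h2, sub_self]
  simp only [opT_deriv_pow]
  rw [← hQ, Finset.mul_sum, map_sum, LinearMap.sum_apply]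

/-- The sum `∑_p binom(s, p) (-D) ^ p ∘ F ∘ D ^ (s - p)` is the multiplication by
`(-D) ^ s F`, as `(-ad D) ^ s` applied to the multiplication by `F`. -/
theorem sum_choose_deriv (D : Derivation ℂ R R) (s : ℕ) (F f : R) :
    ∑ p ∈ Finset.HasAntidiagonal.antidiagonal s, (s.choose p.1 : R) * ((-1) ^ p.1 *
      ((D : R →ₗ[ℂ] R) ^ p.1) (F * ((D : R →ₗ[ℂ] R) ^ p.2) f)) =
      (-1) ^ s * ((D : R →ₗ[ℂ] R) ^ s) F * f := by
  set Dl : Module.End ℂ R := (D : R →ₗ[ℂ] R) with hDl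
  have h1 : ∀ n (G : R), ((LinearMap.mulLeft ℂ (-Dl) + LinearMap.mulRight ℂ Dl) ^ n)
      (LinearMap.mulLeft ℂ G) = LinearMap.mulLeft ℂ (((-Dl) ^ n) G) := by
    intro n
    induction n with
    | zero => intro G; rfl
    | succ n ih =>
      intro G
      rw [pow_succ, Module.End.mul_apply, pow_succ, Module.End.mul_apply, ← ih]
      congr 1
      ext f
      change -(D (G * f)) + G * D f = -(D G) * f
      rw [Derivation.leibniz, smul_eq_mul, smul_eq_mul]
      ring
  have h2 := h1 s F
  rw [(LinearMap.commute_mulLeft_right (R := ℂ) (-Dl) Dl).add_pow'] at h2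
  have hn : ∀ n (G : R), ((-Dl) ^ n) G = (-1) ^ n * (Dl ^ n) G := by
    intro n G
    rw [neg_pow Dl n, Module.End.mul_apply]
    rcases Nat.even_or_odd n with h | h
    · rw [h.neg_one_pow, h.neg_one_pow, one_mul]; rfl
    · rw [h.neg_one_pow, h.neg_one_pow, neg_one_mul]; rfl
  have h3 := LinearMap.congr_fun h2 f
  rw [LinearMap.mulLeft_apply, hn] at h3
  rw [← h3, LinearMap.sum_apply, LinearMap.sum_apply]
  refine Finset.sum_congr rfl fun p _ => ?_
  rw [LinearMap.smul_apply, LinearMap.smul_apply, Module.End.mul_apply, LinearMap.pow_mulLeft,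
    LinearMap.pow_mulRight, nsmul_eq_mul]
  congr 1
  rw [← hn]
  rfl

end Transfer

/-! ### Taylor shifts -/

section TaylorShift

open PowerSeries

variable {R : Type*} [CommRing R] [Algebra ℂ R] (D : Derivation ℂ R R) (x : R)

/-- The shift of the argument of `f` from `x` to `x cosh (τ / 2)`, as a Taylor series in `τ`. -/
def tay (f : R) : PowerSeries R := PowerSeries.mk fun K => ∑ q ∈ Finset.range (K + 1),
  (coeff K ((calC - 1) ^ q) * (q.factorial : ℂ)⁻¹) • (x ^ q * ((D : R →ₗ[ℂ] R) ^ q) f)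

/-- The series `∑_q D ^ q f X ^ q / q!`. -/
def divPow (f : R) : PowerSeries R :=
  PowerSeries.mk fun q => (q.factorial : ℂ)⁻¹ • ((D : R →ₗ[ℂ] R) ^ q) f

theorem cast_succ_smul_cancel {M : Type*} [AddCommGroup M] [Module ℂ M] {a b : M} {n : ℕ}
    (h : ((n : ℂ) + 1) • a = ((n : ℂ) + 1) • b) : a = b :=
  (IsUnit.mk0 _ (Nat.cast_add_one_ne_zero n)).smul_left_cancel.1 h

theorem coeff_divPow_succ (n : ℕ) (f : R) :
    ((n : ℂ) + 1) • coeff (n + 1) (divPow D f) = coeff n (divPow D (D f)) := by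
  rw [divPow, divPow, coeff_mk, coeff_mk, smul_smul, pow_succ, Module.End.mul_apply,
    Nat.factorial_succ]
  congr 1
  have : (n : ℂ) + 1 ≠ 0 := Nat.cast_add_one_ne_zero n
  push_cast
  field_simp

theorem derivative_divPow (f : R) : derivative R (divPow D f) = divPow D (D f) := by
  ext n
  rw [coeff_derivative, ← coeff_divPow_succ, Algebra.smul_def, mul_comm]
  simp

/-- The exponential of a derivation is multiplicative; coefficient by coefficient, since both sides
have the same derivative in the formal variable. -/
theorem divPow_mul (f g : R) : divPow D (f * g) = divPow D f * divPow D g := by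
  ext n
  induction n generalizing f g with
  | zero => simp [divPow]
  | succ n ih =>
    refine cast_succ_smul_cancel (n := n) ?_
    have h : ((n : ℂ) + 1) • coeff (n + 1) (divPow D f * divPow D g) =
        coeff n (derivative R (divPow D f * divPow D g)) := by
      rw [coeff_derivative, Algebra.smul_def, mul_comm]
      simp
    rw [coeff_divPow_succ, h, Derivation.leibniz, Derivation.leibniz, derivative_divPow,
      derivative_divPow, smul_eq_mul, smul_eq_mul, smul_eq_mul, smul_eq_mul, map_add, ← ih, ← ih,
      ← map_add]
    simp [divPow]

theorem constantCoeff_shift :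
    constantCoeff (C x * map (algebraMap ℂ R) (calC - 1)) = 0 := by
  rw [map_mul, ← coeff_zero_eq_constantCoeff_apply (map _ _), coeff_map,
    coeff_zero_eq_constantCoeff_apply, constantCoeff_calC_sub_one, map_zero, mul_zero]

theorem tay_eq_subst (f : R) :
    tay D x f = (divPow D f).subst (C x * map (algebraMap ℂ R) (calC - 1)) := by
  ext K
  rw [coeff_subst' (HasSubst.of_constantCoeff_zero' (constantCoeff_shift x)),
    finsum_eq_sum_of_support_subset (s := Finset.range (K + 1))]
  · rw [tay, coeff_mk]
    refine Finset.sum_congr rfl fun q _ => ?_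
    rw [divPow, coeff_mk, mul_pow, ← map_pow, coeff_C_mul, ← map_pow, coeff_map]
    simp only [smul_eq_mul, Algebra.smul_def, map_mul]
    ring
  · intro q hq
    rw [Finset.coe_range, Set.mem_Iio]
    by_contra h
    refine hq ?_
    change _ • _ = _
    rw [coeff_pow_eq_zero (constantCoeff_shift x) (by omega), smul_zero]

/-- The Taylor shift is multiplicative, being a substitution into the exponential of `D`. -/
theorem tay_mul (f g : R) : tay D x (f * g) = tay D x f * tay D x g := by
  rw [tay_eq_subst, tay_eq_subst, tay_eq_subst, divPow_mul,
    subst_mul (HasSubst.of_constantCoeff_zero' (constantCoeff_shift x))]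

theorem tay_one : tay D x 1 = 1 := by
  have h : divPow D (1 : R) = 1 := by
    ext n
    rw [divPow, coeff_mk, coeff_one]
    cases n with
    | zero => simp
    | succ n =>
      rw [pow_succ, Module.End.mul_apply, if_neg (Nat.succ_ne_zero n)]
      change _ • (_ : R →ₗ[ℂ] R) (D 1) = 0
      rw [Derivation.map_one_eq_zero, map_zero, smul_zero]
  rw [tay_eq_subst, h, ← coe_substAlgHom (HasSubst.of_constantCoeff_zero' (constantCoeff_shift x)),
    map_one]

theorem tay_pow (f : R) (n : ℕ) : tay D x (f ^ n) = tay D x f ^ n := by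
  induction n with
  | zero => rw [pow_zero, pow_zero, tay_one]
  | succ n ih => rw [pow_succ, pow_succ, tay_mul, ih]

theorem coeff_tay {K M : ℕ} (h : K ≤ M) (f : R) :
    coeff K (tay D x f) = ∑ q ∈ Finset.range (M + 1),
      (coeff K ((calC - 1) ^ q) * (q.factorial : ℂ)⁻¹) • (x ^ q * ((D : R →ₗ[ℂ] R) ^ q) f) := by
  rw [tay, coeff_mk]
  refine Finset.sum_subset (Finset.range_mono (by omega)) fun q _ hq => ?_
  rw [coeff_pow_eq_zero constantCoeff_calC_sub_one (by simpa using hq), zero_mul, zero_smul]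

theorem coeff_map_mul_tay (φ : PowerSeries ℂ) (K : ℕ) (f : R) :
    coeff K (map (algebraMap ℂ R) φ * tay D x f) = ∑ q ∈ Finset.range (K + 1),
      (coeff K (φ * (calC - 1) ^ q) * (q.factorial : ℂ)⁻¹) •
        (x ^ q * ((D : R →ₗ[ℂ] R) ^ q) f) := by
  rw [coeff_mul]
  have h : ∀ p ∈ Finset.HasAntidiagonal.antidiagonal K,
      coeff p.1 (map (algebraMap ℂ R) φ) * coeff p.2 (tay D x f) =
      ∑ q ∈ Finset.range (K + 1), (coeff p.1 φ * coeff p.2 ((calC - 1) ^ q) *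
        (q.factorial : ℂ)⁻¹) • (x ^ q * ((D : R →ₗ[ℂ] R) ^ q) f) := by
    intro p hp
    rw [Finset.HasAntidiagonal.mem_antidiagonal] at hp
    rw [coeff_tay D x (by omega : p.2 ≤ K), Finset.mul_sum]
    refine Finset.sum_congr rfl fun q _ => ?_
    rw [coeff_map, ← Algebra.smul_def, smul_smul, mul_assoc]
  rw [Finset.sum_congr rfl h, Finset.sum_comm]
  refine Finset.sum_congr rfl fun q _ => ?_
  rw [← Finset.sum_smul, ← Finset.sum_mul, coeff_mul]

end TaylorShift

/-! ### The transform at one vertex -/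

section Core

open PowerSeries

theorem sum_range_range {M : Type*} [AddCommMonoid M] (g : ℕ → ℕ → M) {n m k : ℕ} (hn : k < n)
    (hm : k < m) (h : ∀ p q, k < p + q → g p q = 0) :
    ∑ p ∈ Finset.range n, ∑ q ∈ Finset.range m, g p q =
      ∑ s ∈ Finset.range (k + 1), ∑ p ∈ Finset.HasAntidiagonal.antidiagonal s, g p.1 p.2 := by
  rw [← Finset.sum_product', Finset.sum_sigma']
  refine Finset.sum_bij_ne_zero (fun p _ _ => ⟨p.1 + p.2, p⟩) ?_ ?_ ?_ ?_
  · intro p _ hp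
    simp only [Finset.mem_sigma, Finset.mem_range, Finset.HasAntidiagonal.mem_antidiagonal, and_true]
    by_contra hk
    exact hp (h _ _ (by omega))
  · intro p _ _ q _ _ hpq
    simpa using congrArg Sigma.snd hpq
  · rintro ⟨s, p⟩ hp hne
    simp only [Finset.mem_sigma, Finset.mem_range, Finset.HasAntidiagonal.mem_antidiagonal] at hp
    obtain ⟨hs, rfl⟩ := hp
    refine ⟨p, ?_, hne, rfl⟩
    simp only [Finset.mem_product, Finset.mem_range]
    omega
  · intro p _ _
    rfl

variable {R : Type*} [CommRing R] [Algebra ℂ R] (D : Derivation ℂ R R) (x y dy : Rˣ)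

/-- The series `Y = x 𝒮(τ) y(x cosh (τ / 2))`. -/
def calY : PowerSeries R := C (x : R) * map (algebraMap ℂ R) calS * tay D x y

theorem constantCoeff_calY : constantCoeff (calY D x y) = x * y := by
  have h1 : constantCoeff (tay D (x : R) y) = y := by
    rw [← coeff_zero_eq_constantCoeff_apply, tay, coeff_mk]
    simp
  have h2 : constantCoeff (map (algebraMap ℂ R) calS) = 1 := by
    rw [← coeff_zero_eq_constantCoeff_apply, coeff_map, coeff_zero_eq_constantCoeff_apply,
      constantCoeff_calS, map_one]
  rw [calY, map_mul, map_mul, h1, h2, constantCoeff_C, mul_one]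

/-- Since shifts are multiplicative, the powers of `Y` involve only shifts of powers of `y`. -/
theorem calY_pow (J : ℕ) : calY D x y ^ J =
    C ((x : R) ^ J) * (map (algebraMap ℂ R) (calS ^ J) * tay D x ((y : R) ^ J)) := by
  rw [calY, mul_pow, mul_pow, tay_pow, map_pow, map_pow, mul_assoc]

/-- The result of `[u ^ (s - 1)] ↦ (∂_θ + v / θ) ^ (s - 1) L(v, θ)` for the coefficient of `ħ ^ K`
of `L`, with `t = θ⁻¹`. The exponent `s = 0` does not contribute. -/
def lam (t : R) (K s : ℕ) : Polynomial R :=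
  if s = 0 then 0 else Polynomial.C (t ^ (K + (s - 1))) *
    (ell K * fallFrom K (s - 1)).map (algebraMap ℂ R)

theorem eval_lam (t : R) {N K s : ℕ} (hK : K ≤ N) :
    (lam t K (s + 1)).eval (N : R) =
      ((ell K).eval (N : ℂ) * (N - K).descFactorial s) • t ^ (K + s) := by
  rw [lam, if_neg (Nat.succ_ne_zero s), Nat.add_sub_cancel, Polynomial.eval_mul, Polynomial.eval_C,
    ← map_natCast (algebraMap ℂ R) N, Polynomial.eval_map_algebraMap, ← Polynomial.coe_aeval_eq_eval,
    Polynomial.aeval_algebraMap_apply, Polynomial.coe_aeval_eq_eval, Polynomial.eval_mul, eval_fallFrom hK,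
    Algebra.smul_def, mul_comm]

/-- The coefficient of `u ^ (j + m) τ ^ k ξ ^ p` in the vertex factor
`𝒮(τ)⁻¹ exp (u (Y - θ)) (- x u 𝒮(τ)) ^ m exp (x (cosh (τ / 2) - 1) ξ)`. -/
def bet (m p j k : ℕ) : R :=
  ((p.factorial : ℂ)⁻¹ * (j.factorial : ℂ)⁻¹) • ((-x : R) ^ m * (x : R) ^ p *
    coeff k (map (algebraMap ℂ R) (calS ^ m * calS⁻¹ * (calC - 1) ^ p) *
      (calY D x y - C (x * y : R)) ^ j))

/-- The coefficient of `ħ ^ K ξ ^ p` in the transform of the vertex factor. -/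
def lamPoly (m p K : ℕ) : Polynomial R :=
  ∑ q ∈ Finset.HasAntidiagonal.antidiagonal K, ∑ j ∈ Finset.range (q.2 + 1),
    lam (↑x⁻¹ * ↑y⁻¹ : R) q.1 (j + q.2 + m) * Polynomial.C (bet D x y m p j q.2)

/-- The sum over the powers of `Y - θ` is a binomial expansion of a power of `Y`. -/
theorem sum_lam_mul_bet {N K a b m p s J : ℕ} (hK : a + b = K) (hs : s + 1 = b + m)
    (hJ : J + K + m = N + 1) (hb : b ≤ J) :
    (y : R) ^ N * ∑ j ∈ Finset.range (b + 1), (lam (↑x⁻¹ * ↑y⁻¹ : R) a (j + b + m)).eval (N : R) *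
        bet D x y m p j b =
      ((ell a).eval (N : ℂ) * (N - a).descFactorial s * (p.factorial : ℂ)⁻¹) •
        ((↑x⁻¹ : R) ^ N * ((-x : R) ^ m * (x : R) ^ p *
        coeff b (map (algebraMap ℂ R) (calS ^ m * calS⁻¹ * (calC - 1) ^ p) * calY D x y ^ J))) := by
  set φ := map (algebraMap ℂ R) (calS ^ m * calS⁻¹ * (calC - 1) ^ p)
  set L := calY D x y - C (x * y : R) with hL
  have hL0 : constantCoeff L = 0 := by
    rw [hL, map_sub, constantCoeff_calY, constantCoeff_C, sub_self]
  have h1 : coeff b (φ * calY D x y ^ J) = ∑ j ∈ Finset.range (b + 1),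
      (J.choose j : ℂ) • ((x * y : R) ^ (J - j) * coeff b (φ * L ^ j)) := by
    have e : calY D x y = L + C (x * y : R) := by rw [hL, sub_add_cancel]
    rw [e, add_pow, Finset.mul_sum, map_sum]
    symm
    refine Finset.sum_subset_zero_on_sdiff (Finset.range_mono (by omega)) ?_ ?_
    · intro j hj
      simp only [Finset.mem_sdiff, Finset.mem_range] at hj
      obtain ⟨G, hG⟩ := X_dvd_iff.2 hL0
      rw [hG, show φ * ((X * G) ^ j * C (x * y : R) ^ (J - j) * (J.choose j : PowerSeries R)) =
        X ^ j * (φ * G ^ j * C (x * y : R) ^ (J - j) * (J.choose j : PowerSeries R)) by ring,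
        coeff_X_pow_mul', if_neg (by omega)]
    · intro j _
      rw [show φ * (L ^ j * C (x * y : R) ^ (J - j) * (J.choose j : PowerSeries R)) =
        C ((J.choose j : R) * (x * y : R) ^ (J - j)) * (φ * L ^ j) by
          simp only [map_mul, map_natCast, map_pow]; ring, coeff_C_mul, Nat.cast_smul_eq_nsmul,
          nsmul_eq_mul, mul_assoc]
  rw [h1, Finset.mul_sum, Finset.mul_sum, Finset.mul_sum, Finset.smul_sum]
  refine Finset.sum_congr rfl fun j hj => ?_
  rw [Finset.mem_range] at hj
  rw [show j + b + m = (s + j) + 1 by omega, eval_lam _ (by omega), bet]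
  have h2 : (N - a).descFactorial (s + j) = (N - a).descFactorial s * (j.factorial * J.choose j) := by
    rw [← Nat.descFactorial_eq_factorial_mul_choose,
      ← Nat.descFactorial_mul_descFactorial (Nat.le_add_right s j), Nat.add_sub_cancel_left,
      show N - a - s = J by omega, mul_comm]
  have h3 : (y : R) ^ N * (↑x⁻¹ * ↑y⁻¹ : R) ^ (a + (s + j)) =
      (↑x⁻¹ : R) ^ N * (x * y : R) ^ (J - j) := by
    obtain ⟨d, hd⟩ : ∃ d, N = (a + (s + j)) + d := ⟨N - (a + (s + j)), by omega⟩
    rw [show J - j = d by omega, hd, pow_add, pow_add, mul_pow, mul_pow]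
    have i1 : (y : R) ^ (a + (s + j)) * (↑y⁻¹ : R) ^ (a + (s + j)) = 1 := by
      rw [← mul_pow, Units.mul_inv, one_pow]
    have i2 : (↑x⁻¹ : R) ^ d * (x : R) ^ d = 1 := by
      rw [← mul_pow, Units.inv_mul, one_pow]
    linear_combination ((y : R) ^ d * (↑x⁻¹ : R) ^ (a + (s + j))) * i1 -
      ((↑x⁻¹ : R) ^ (a + (s + j)) * (y : R) ^ d) * i2
  have hj0 : (j.factorial : ℂ) ≠ 0 := Nat.cast_ne_zero.2 j.factorial_ne_zero
  simp only [smul_mul_assoc, mul_smul_comm, smul_smul]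
  rw [h2]
  congr 1
  · push_cast
    field_simp
  · linear_combination ((-x : R) ^ m * (x : R) ^ p * coeff b (φ * L ^ j)) * h3

variable {D x y dy}

theorem deriv_inv (hx : D x = 1) : D (↑x⁻¹ : R) = -(↑x⁻¹ : R) ^ 2 := by
  rw [Derivation.leibniz_of_mul_eq_one D (Units.inv_mul x), hx, smul_eq_mul, mul_one]

theorem deriv_pow_mul_inv_pow (hx : D x = 1) (a b : ℕ) :
    D ((x : R) ^ a * (↑x⁻¹ : R) ^ b) =
      ((a : ℂ) - b) • ((x : R) ^ a * (↑x⁻¹ : R) ^ (b + 1)) := by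
  have h := x.mul_inv
  rw [Derivation.leibniz, Derivation.leibniz_pow, Derivation.leibniz_pow, hx, deriv_inv hx,
    sub_smul, Nat.cast_smul_eq_nsmul, Nat.cast_smul_eq_nsmul]
  simp only [smul_eq_mul, nsmul_eq_mul]
  have h1 : (a : R) * (x : R) ^ (a - 1) = a * ((x : R) ^ a * (↑x⁻¹ : R)) := by
    cases a with
    | zero => simp
    | succ a =>
      rw [Nat.add_sub_cancel]
      linear_combination (-((a + 1 : ℕ) : R) * (x : R) ^ a) * h
  have h2 : (b : R) * (↑x⁻¹ : R) ^ (b - 1) * (↑x⁻¹ : R) ^ 2 = b * (↑x⁻¹ : R) ^ (b + 1) := by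
    cases b with
    | zero => simp
    | succ b => rw [Nat.add_sub_cancel]; ring
  linear_combination (↑x⁻¹ : R) ^ b * h1 - (x : R) ^ a * h2

theorem iterate_deriv_pow_mul_inv_pow (hx : D x = 1) (a b s : ℕ) :
    ((D : R →ₗ[ℂ] R) ^ s) ((x : R) ^ a * (↑x⁻¹ : R) ^ b) =
      (∏ i ∈ Finset.range s, ((a : ℂ) - b - i)) • ((x : R) ^ a * (↑x⁻¹ : R) ^ (b + s)) := by
  induction s with
  | zero => simp
  | succ s ih =>
    rw [pow_succ', Module.End.mul_apply, ih, map_smul]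
    change _ • D _ = _
    rw [deriv_pow_mul_inv_pow hx, smul_smul, Finset.prod_range_succ]
    congr 2
    push_cast
    ring

theorem neg_one_pow_iterate_deriv (hx : D x = 1) {K : ℕ} (hK : 1 ≤ K) (s : ℕ) :
    (-1) ^ s * ((D : R →ₗ[ℂ] R) ^ s) ((x : R) ^ s * (↑x⁻¹ : R) ^ K) =
      ((K - 1).descFactorial s : ℂ) • (↑x⁻¹ : R) ^ K := by
  rw [iterate_deriv_pow_mul_inv_pow hx, pow_add, mul_left_comm ((x : R) ^ s), ← mul_pow,
    Units.mul_inv, one_pow, mul_one, ← descPochhammer_eval_eq_descFactorial,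
    descPochhammer_eval_eq_prod_range, ← Finset.prod_range_reflect, mul_smul_comm,
    show ((-1 : R) ^ s) = algebraMap ℂ R ((-1) ^ s) by simp, ← Algebra.smul_def, smul_smul]
  congr 1
  rw [mul_comm, ← Finset.card_range s, ← Finset.prod_const, Finset.card_range,
    ← Finset.prod_mul_distrib]
  refine Finset.prod_congr rfl fun i hi => ?_
  rw [Finset.mem_range] at hi
  rw [Nat.sub_sub, Nat.cast_sub (by omega), Nat.cast_sub hK]
  push_cast
  ring

end Core

section CoreSums

open PowerSeries

variable {R : Type*} [CommRing R] [Algebra ℂ R] {D : Derivation ℂ R R} {x y dy : Rˣ}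

/-- The formal adjoint of the shift operator `∑_p x ^ p (cosh (τ / 2) - 1) ^ p D ^ p / p!`
acts on powers of `x` by a power of `cosh (τ / 2)`. -/
theorem sum_iterate_deriv_shift (hx : D x = 1) {N K a b m J n : ℕ} (hK : a + b = K)
    (hJ : J + K + m = N + 1) (hN : K ≤ N) (hn : K < n) :
    ∑ p ∈ Finset.range n, (-1) ^ p * ((D : R →ₗ[ℂ] R) ^ p) ((p.factorial : ℂ)⁻¹ •
      ((↑x⁻¹ : R) ^ (N + 1) * ((-x : R) ^ m * (x : R) ^ p *
        coeff b (map (algebraMap ℂ R) (calS ^ m * calS⁻¹ * (calC - 1) ^ p) * calY D x y ^ J)))) =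
      ((-1) ^ m * coeff b (calS ^ (N - K) * calC ^ (K - 1))) • ((↑x⁻¹ : R) ^ K * (y : R) ^ J) := by
  set Dl : Module.End ℂ R := (D : R →ₗ[ℂ] R) with hDl
  set c : ℕ → ℂ := fun s => coeff b (calS ^ (N - K) * (calC - 1) ^ s) with hc
  have hc0 : ∀ s, b < s → c s = 0 := by
    intro s hs
    obtain ⟨G, hG⟩ := X_dvd_iff.2 constantCoeff_calC_sub_one
    simp only [hc]
    rw [hG, mul_pow, mul_left_comm, coeff_X_pow_mul', if_neg (by omega)]
  -- The exponents of `𝒮` add up to `m - 1 + J = N - K`.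
  have hS : calS ^ m * calS⁻¹ * calS ^ J = calS ^ (N - K) := by
    rw [mul_right_comm, ← pow_add, show m + J = (N - K) + 1 by omega, pow_succ, mul_assoc,
      calS_mul_inv, mul_one]
  -- Expand `Y ^ J` as a Taylor series in derivatives of `y ^ J`.
  have h1 : ∀ p, (-1) ^ p * (Dl ^ p) ((p.factorial : ℂ)⁻¹ •
      ((↑x⁻¹ : R) ^ (N + 1) * ((-x : R) ^ m * (x : R) ^ p *
        coeff b (map (algebraMap ℂ R) (calS ^ m * calS⁻¹ * (calC - 1) ^ p) * calY D x y ^ J)))) =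
      ∑ q ∈ Finset.range (b + 1), ((-1) ^ m * (p.factorial : ℂ)⁻¹ * (q.factorial : ℂ)⁻¹ * c (p + q)) •
        ((-1) ^ p * (Dl ^ p) ((x : R) ^ (p + q) * (↑x⁻¹ : R) ^ K * (Dl ^ q) ((y : R) ^ J))) := by
    intro p
    have e1 : map (algebraMap ℂ R) (calS ^ m * calS⁻¹ * (calC - 1) ^ p) * calY D x y ^ J =
        C ((x : R) ^ J) * (map (algebraMap ℂ R) (calS ^ (N - K) * (calC - 1) ^ p) *
          tay D x ((y : R) ^ J)) := by
      rw [calY_pow, ← hS, mul_left_comm, ← mul_assoc (map _ _) (map _ _), ← map_mul]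
      congr 3
      ring
    rw [e1, coeff_C_mul, coeff_map_mul_tay, Finset.mul_sum, Finset.mul_sum, Finset.mul_sum,
      Finset.smul_sum, map_sum, Finset.mul_sum]
    refine Finset.sum_congr rfl fun q _ => ?_
    have e2 : (↑x⁻¹ : R) ^ (N + 1) * ((-x : R) ^ m * (x : R) ^ p * ((x : R) ^ J *
        ((x : R) ^ q * (Dl ^ q) ((y : R) ^ J)))) =
        ((-1) ^ m : ℂ) • ((x : R) ^ (p + q) * (↑x⁻¹ : R) ^ K * (Dl ^ q) ((y : R) ^ J)) := by
      have i0 : algebraMap ℂ R ((-1) ^ m) = (-1) ^ m := by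
        rw [RingHom.map_pow, RingHom.map_neg, RingHom.map_one]
      rw [← hJ, neg_pow, Algebra.smul_def, i0,
        show J + K + m = (J + m) + K by ring, pow_add _ (J + m)]
      have i1 : (↑x⁻¹ : R) ^ (J + m) * (x : R) ^ (J + m) = 1 := by
        rw [← mul_pow, Units.inv_mul, one_pow]
      rw [pow_add (x : R) J m] at i1
      linear_combination ((↑x⁻¹ : R) ^ K * (-1) ^ m * (x : R) ^ (p + q) *
        (Dl ^ q) ((y : R) ^ J)) * i1
    rw [mul_smul_comm, mul_smul_comm, mul_smul_comm, e2, smul_smul, smul_smul, map_smul,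
      mul_smul_comm]
    congr 1
    simp only [hc]
    rw [pow_add (calC - 1) p q, ← mul_assoc (calS ^ (N - K))]
    ring
  rw [Finset.sum_congr rfl fun p _ => h1 p, sum_range_range _ (show b < n by omega)
    (Nat.lt_succ_self b) (fun p q hpq => by rw [hc0 _ hpq, mul_zero, zero_smul])]
  -- The terms with `p + q = s` combine, by the Leibniz rule, into one without derivatives of `y`.
  have h2 : ∀ s ∈ Finset.range (b + 1), ∑ p ∈ Finset.HasAntidiagonal.antidiagonal s,
      ((-1) ^ m * (p.1.factorial : ℂ)⁻¹ * (p.2.factorial : ℂ)⁻¹ * c (p.1 + p.2)) •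
        ((-1) ^ p.1 * (Dl ^ p.1) ((x : R) ^ (p.1 + p.2) * (↑x⁻¹ : R) ^ K *
          (Dl ^ p.2) ((y : R) ^ J))) =
      ((-1) ^ m * ((K - 1).choose s * c s)) • ((↑x⁻¹ : R) ^ K * (y : R) ^ J) := by
    intro s hs
    rw [Finset.mem_range] at hs
    have h3 : ∀ p ∈ Finset.HasAntidiagonal.antidiagonal s,
        ((-1) ^ m * (p.1.factorial : ℂ)⁻¹ * (p.2.factorial : ℂ)⁻¹ * c (p.1 + p.2)) •
        ((-1) ^ p.1 * (Dl ^ p.1) ((x : R) ^ (p.1 + p.2) * (↑x⁻¹ : R) ^ K *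
          (Dl ^ p.2) ((y : R) ^ J))) = ((-1) ^ m * (s.factorial : ℂ)⁻¹ * c s) •
        ((s.choose p.1 : R) * ((-1) ^ p.1 * (Dl ^ p.1) ((x : R) ^ s * (↑x⁻¹ : R) ^ K *
          (Dl ^ p.2) ((y : R) ^ J)))) := by
      intro p hp
      rw [Finset.HasAntidiagonal.mem_antidiagonal] at hp
      rw [hp, ← map_natCast (algebraMap ℂ R), ← Algebra.smul_def, smul_smul]
      congr 1
      rw [← hp, Nat.choose_symm_add, Nat.add_choose,
        Nat.cast_div (Nat.factorial_mul_factorial_dvd_factorial_add _ _)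
        (by exact_mod_cast (mul_ne_zero (Nat.factorial_ne_zero _) (Nat.factorial_ne_zero _)))]
      have i1 : ((p.1 + p.2).factorial : ℂ) ≠ 0 := Nat.cast_ne_zero.2 (Nat.factorial_ne_zero _)
      have i2 : (p.1.factorial : ℂ) ≠ 0 := Nat.cast_ne_zero.2 (Nat.factorial_ne_zero _)
      have i3 : (p.2.factorial : ℂ) ≠ 0 := Nat.cast_ne_zero.2 (Nat.factorial_ne_zero _)
      push_cast
      field_simp
    rw [Finset.sum_congr rfl h3, ← Finset.smul_sum, sum_choose_deriv]
    rcases Nat.eq_zero_or_pos K with hK0 | hK0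
    · have hs0 : s = 0 := by omega
      subst hs0
      simp [hK0]
    · rw [neg_one_pow_iterate_deriv hx hK0, smul_mul_assoc, smul_smul]
      congr 1
      rw [Nat.descFactorial_eq_factorial_mul_choose]
      have i1 : (s.factorial : ℂ) ≠ 0 := Nat.cast_ne_zero.2 (Nat.factorial_ne_zero _)
      push_cast
      field_simp
  rw [Finset.sum_congr rfl h2, ← Finset.sum_smul, ← Finset.mul_sum]
  congr 2
  -- The remaining sum over `s` is the binomial expansion of `cosh (τ / 2) ^ (K - 1)`.
  have h4 : calC ^ (K - 1) = ∑ s ∈ Finset.range (K - 1 + 1),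
      C ((K - 1).choose s : ℂ) * (calC - 1) ^ s := by
    conv_lhs => rw [← sub_add_cancel calC 1, add_pow]
    refine Finset.sum_congr rfl fun s _ => ?_
    rw [one_pow, mul_one, mul_comm, map_natCast]
  rw [h4, Finset.mul_sum, map_sum]
  have h5 : ∀ s, coeff b (calS ^ (N - K) * (C ((K - 1).choose s : ℂ) * (calC - 1) ^ s)) =
      (K - 1).choose s * c s := by
    intro s
    rw [mul_left_comm, coeff_C_mul]
  simp only [h5]
  rcases Nat.le_total (b + 1) (K - 1 + 1) with h | h
  · refine Finset.sum_subset (Finset.range_mono h) fun s _ hs => ?_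
    rw [hc0 s (by simpa using hs), mul_zero]
  · refine (Finset.sum_subset (Finset.range_mono h) fun s _ hs => ?_).symm
    rw [Nat.choose_eq_zero_of_lt (by simpa using hs), Nat.cast_zero, zero_mul]

/-- The formal adjoint of the vertex transform at `v = N`. -/
theorem sum_iterate_deriv_lamPoly (hx : D x = 1) {N K m J n : ℕ} (hJ : J + K + m = N + 1)
    (hN : K ≤ J) (hn : K < n) :
    ∑ p ∈ Finset.range n, (-1) ^ p * ((D : R →ₗ[ℂ] R) ^ p) ((y : R) ^ N *
      (Polynomial.C (-↑x⁻¹ : R) * lamPoly D x y m p K).eval (N : R)) =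
    ∑ q ∈ Finset.HasAntidiagonal.antidiagonal K, if q.2 + m = 0 then 0 else
      -((-1) ^ m * ((ell q.1).eval (N : ℂ) * (N - q.1).descFactorial (q.2 + m - 1) *
        coeff q.2 (calS ^ (N - K) * calC ^ (K - 1)))) • ((↑x⁻¹ : R) ^ K * (y : R) ^ J) := by
  set Dl : Module.End ℂ R := (D : R →ₗ[ℂ] R) with hDl
  have h1 : ∀ p, (y : R) ^ N * (Polynomial.C (-↑x⁻¹ : R) * lamPoly D x y m p K).eval (N : R) =
      ∑ q ∈ Finset.HasAntidiagonal.antidiagonal K, -↑x⁻¹ * ((y : R) ^ N *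
        ∑ j ∈ Finset.range (q.2 + 1), (lam (↑x⁻¹ * ↑y⁻¹ : R) q.1 (j + q.2 + m)).eval (N : R) *
        bet D x y m p j q.2) := by
    intro p
    rw [Polynomial.eval_mul, Polynomial.eval_C, lamPoly, Polynomial.eval_finsetSum, Finset.mul_sum,
      Finset.mul_sum]
    refine Finset.sum_congr rfl fun q _ => ?_
    rw [Polynomial.eval_finsetSum]
    simp only [Polynomial.eval_mul, Polynomial.eval_C]
    ring
  simp only [h1, map_sum, Finset.mul_sum (Finset.HasAntidiagonal.antidiagonal K)]
  rw [Finset.sum_comm]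
  refine Finset.sum_congr rfl fun q hq => ?_
  rw [Finset.HasAntidiagonal.mem_antidiagonal] at hq
  split_ifs with h0
  · refine Finset.sum_eq_zero fun p _ => ?_
    have hq2 : q.2 = 0 := by omega
    have hm : m = 0 := by omega
    simp [hq2, hm, lam]
  · obtain ⟨s, hs⟩ : ∃ s, s + 1 = q.2 + m := ⟨q.2 + m - 1, by omega⟩
    have h2 : ∀ p, (-1) ^ p * (Dl ^ p) (-↑x⁻¹ * ((y : R) ^ N *
        ∑ j ∈ Finset.range (q.2 + 1), (lam (↑x⁻¹ * ↑y⁻¹ : R) q.1 (j + q.2 + m)).eval (N : R) *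
        bet D x y m p j q.2)) = (-((ell q.1).eval (N : ℂ) * (N - q.1).descFactorial s)) •
        ((-1) ^ p * (Dl ^ p) ((p.factorial : ℂ)⁻¹ •
      ((↑x⁻¹ : R) ^ (N + 1) * ((-x : R) ^ m * (x : R) ^ p *
        coeff q.2 (map (algebraMap ℂ R) (calS ^ m * calS⁻¹ * (calC - 1) ^ p) *
          calY D x y ^ J))))) := by
      intro p
      rw [sum_lam_mul_bet D x y hq hs hJ (by omega),
        ← mul_smul_comm (-((ell q.1).eval (N : ℂ) * (N - q.1).descFactorial s)), ← map_smul]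
      congr 2
      rw [pow_succ' (↑x⁻¹ : R)]
      simp only [mul_smul_comm, smul_smul, neg_mul, neg_smul, mul_assoc]
      exact smul_neg _ _
    rw [Finset.sum_congr rfl fun p _ => h2 p, ← Finset.smul_sum,
      sum_iterate_deriv_shift hx hq hJ (by omega) hn, smul_smul, show q.2 + m - 1 = s by omega]
    congr 1
    ring

end CoreSums

section VertexTransform

open Polynomial

variable {R : Type*} [CommRing R] [Algebra ℂ R]

theorem opT_mul_C (E : Module.End ℂ R) (P : R[X]) (a f : R) :
    opT E (P * C a) f = opT E P (a * f) := by
  rw [opT_apply_eq, mul_assoc, ← C_mul, ← opT_apply_eq]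

theorem opT_C_mul (E : Module.End ℂ R) (P : R[X]) (a f : R) :
    opT E (C a * P) f = opT E P (a * f) := by
  rw [mul_comm, opT_mul_C]

variable (D : Derivation ℂ R R) (x y dy : Rˣ)

theorem nabla_map_mul_C (q a : R) (P : ℂ[X]) : nabla D q (P.map (algebraMap ℂ R) * C a) =
    P.map (algebraMap ℂ R) * (X * C (q * a) + C (D a)) := by
  have h : coefD D (P.map (algebraMap ℂ R)) = 0 := by
    induction P using Polynomial.induction_on' with
    | add P Q hP hQ => rw [Polynomial.map_add, map_add, hP, hQ, add_zero]
    | monomial k a => rw [map_monomial, coefD_monomial, Derivation.map_algebraMap, monomial_zero_right]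
  rw [nabla_mul_C, nabla, LinearMap.add_apply, h, LinearMap.mulLeft_apply, C_mul]
  ring

/-- The derivation `∂_y = (1 / dy) D`. -/
def derivY (D : Derivation ℂ R R) (dy : Rˣ) : Module.End ℂ R :=
  LinearMap.mulLeft ℂ (↑dy⁻¹ : R) * (D : R →ₗ[ℂ] R)

theorem derivY_apply (f : R) : derivY D dy f = ↑dy⁻¹ * D f := rfl

/-- The transform at one vertex: `g` is the coefficient of `w ^ m` in the integrand of the simple
formula, and `K` is the power of `ħ` that the universal formula extracts at the vertex. -/
def coreT (n m K : ℕ) : R →ₗ[ℂ] R :=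
  ∑ p ∈ Finset.range n, (opT (eulerE D y dy) (C (y * ↑dy⁻¹ : R) *
    (C (-↑x⁻¹ : R) * lamPoly D x y m p K))) * (D : R →ₗ[ℂ] R) ^ p

variable {D x y dy}

/-- The operator identity `E (E + 1) ⋯ (E + k - 1) ∘ y ^ (1 - k) = y ∂_y ^ k` for `E = y ∂_y`. -/
theorem aeval_descPochhammer_eulerE (hy : D y = dy) (k : ℕ) (h : R) :
    (-1) ^ k * aeval (-eulerE D y dy) (descPochhammer ℂ k) (y * (↑y⁻¹ : R) ^ k * h) =
      y * (derivY D dy ^ k) h := by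
  induction k generalizing h with
  | zero => simp
  | succ k ih =>
    have hyi : D (↑y⁻¹ : R) = -(↑y⁻¹ : R) ^ 2 * dy := by
      rw [Derivation.leibniz_of_mul_eq_one D (Units.inv_mul y), hy, smul_eq_mul]
    have h1 : (-eulerE D y dy - (k : Module.End ℂ R)) (y * (↑y⁻¹ : R) ^ (k + 1) * h) =
        -(y * (↑y⁻¹ : R) ^ k * derivY D dy h) := by
      rw [LinearMap.sub_apply, LinearMap.neg_apply, eulerE_apply, Module.End.natCast_apply,
        derivY_apply, Derivation.leibniz, Derivation.leibniz, Derivation.leibniz_pow, hy, hyi]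
      simp only [smul_eq_mul, nsmul_eq_mul, Nat.add_sub_cancel]
      have h2 := dy.inv_mul
      have h3 := y.mul_inv
      push_cast
      generalize (↑y⁻¹ : R) = yi at *
      generalize (↑dy⁻¹ : R) = di at *
      generalize D h = Dh
      have h4 : (y : R) * yi ^ (k + 1) = yi ^ k := by
        rw [pow_succ]; linear_combination yi ^ k * h3
      rw [show (yi : R) ^ (k + 1) = yi ^ k * yi from pow_succ _ _] at *
      linear_combination (-h * yi ^ k * (1 - (k + 1) * y * yi) ) * h2 +
        (-(y : R) * di * Dh * yi ^ k  + h * yi ^ k * (k + 1)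
          - h * dy * di * yi ^ k - k * h * yi ^ k
          + y * di * yi * yi ^ k * h * (k + 1) * dy) * h3
    rw [descPochhammer_succ_right, map_mul (aeval (-eulerE D y dy)), Module.End.mul_apply, map_sub, aeval_X, map_natCast, h1,
      map_neg, pow_succ (-1 : R), pow_succ (derivY D dy), Module.End.mul_apply, ← ih]
    ring

/-- At a vertex with `m ≥ 1` the transform is the operator of the simple formula, and it is
concentrated in degree zero in `ħ`. -/
theorem coreT_of_pos (hx : D x = 1) (hy : D y = dy) {n m K : ℕ} (hm : 1 ≤ m) (hn : K < n) (g : R) :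
    coreT D x y dy n m K g =
      if K = 0 then y * (derivY D dy ^ (m - 1)) (↑dy⁻¹ * g) else 0 := by
  set Q : R[X] := if K = 0 then
    (descPochhammer ℂ (m - 1)).map (algebraMap ℂ R) * C ((-1) ^ (m - 1) * (↑y⁻¹ : R) ^ (m - 1))
    else 0 with hQ
  have key := sum_opT_deriv_pow hy (Finset.range n) (fun p => C (-↑x⁻¹ : R) * lamPoly D x y m p K)
    Q (N₀ := K + K + m) (fun N hN => by
      obtain ⟨J, hJ⟩ : ∃ J, J + K + m = N + 1 := ⟨N + 1 - K - m, by omega⟩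
      rw [sum_iterate_deriv_lamPoly hx hJ (by omega) hn]
      have hfac : ∀ q ∈ Finset.HasAntidiagonal.antidiagonal K,
          ((N - q.1).descFactorial (q.2 + m - 1) : ℂ) = (N - q.1).factorial * (J.factorial : ℂ)⁻¹ := by
        intro q hq
        rw [Finset.HasAntidiagonal.mem_antidiagonal] at hq
        rw [eq_mul_inv_iff_mul_eq₀ (Nat.cast_ne_zero.2 (Nat.factorial_ne_zero _)), mul_comm,
          ← Nat.factorial_mul_descFactorial (show q.2 + m - 1 ≤ N - q.1 by omega),
          show N - q.1 - (q.2 + m - 1) = J by omega]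
        push_cast
        ring
      -- For `K = 0` there is a single term; for `K ≥ 1` the sum is the scalar identity
      -- `sum_ell_mul_coeff`.
      by_cases hK : K = 0
      · subst hK
        rw [hQ, if_pos rfl, Finset.Nat.antidiagonal_zero, Finset.sum_singleton, if_neg (by omega), ell_zero,
          eval_mul, eval_C, ← map_natCast (algebraMap ℂ R) N, eval_map_algebraMap,
          ← coe_aeval_eq_eval, aeval_algebraMap_apply, coe_aeval_eq_eval,
          descPochhammer_eval_eq_descFactorial]
        obtain ⟨k, rfl⟩ : ∃ k, m = k + 1 := ⟨m - 1, by omega⟩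
        obtain rfl : N = J + k := by omega
        have h1 : PowerSeries.coeff 0 (calS ^ (J + k - 0) * calC ^ (0 - 1)) = 1 := by
          simp [constantCoeff_calS]
        have h2 := y.mul_inv
        have h3 : (y : R) ^ k * (↑y⁻¹ : R) ^ k = 1 := by rw [← mul_pow, h2, one_pow]
        rw [h1, Algebra.smul_def, show 0 + (k + 1) - 1 = k by omega, Nat.add_sub_cancel, pow_add (y : R)]
        simp only [eval_one, Nat.sub_zero, map_neg, map_mul, map_pow, map_one, map_natCast, pow_zero,
          pow_succ (-1 : ℂ)]
        linear_combination (-(y : R) ^ J * ((J + k).descFactorial k : R) * (-1) ^ k) * h3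
      · rw [hQ, if_neg hK, eval_zero, mul_zero, ← Finset.sum_congr rfl (fun q hq =>
          (if_neg (show ¬(q.2 + m = 0) by omega)).symm), ← Finset.sum_smul]
        have h1 := sum_ell_mul_coeff (show 1 ≤ K by omega) (show K ≤ N by omega)
        rw [Finset.sum_congr rfl (fun q hq => by rw [hfac q hq]), ← zero_smul ℂ]
        congr 1
        rw [Finset.sum_neg_distrib, ← Finset.mul_sum, neg_eq_zero, mul_eq_zero]
        right
        rw [← mul_zero ((J.factorial : ℂ)⁻¹), ← h1, Finset.mul_sum]
        exact Finset.sum_congr rfl fun q _ => by ring) g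
  rw [coreT, LinearMap.sum_apply]
  refine key.trans ?_
  rw [hQ]
  split_ifs with hK
  · rw [opT_C_mul, opT_mul_C, opT_map, ← aeval_descPochhammer_eulerE hy]
    have h1 : ∀ z : R, (-1) ^ (m - 1) * z = ((-1) ^ (m - 1) : ℂ) • z := by
      intro z
      rw [Algebra.smul_def]
      simp
    rw [h1 (aeval (-eulerE D y dy) (descPochhammer ℂ (m - 1)) _), ← map_smul, ← h1]
    congr 1
    ring
  · rw [mul_zero, map_zero, LinearMap.zero_apply]

/-- At a vertex without legs (`m = 0`) the transform of the constant `1` is, up to sign, the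
regularization term: their sum is the transform of a total derivative. -/
theorem coreT_zero (hx : D x = 1) (hy : D y = dy) {n K : ℕ} (hK1 : K ≠ 1) (hn : K < n) :
    coreT D x y dy n 0 K 1 = -opT (eulerE D y dy) ((ell K).divX.map (algebraMap ℂ R))
      ((↑x⁻¹ * ↑y⁻¹ : R) ^ K * -eulerE D y dy (x * y)) := by
  rcases Nat.eq_zero_or_pos K with rfl | hK
  · rw [ell_zero, divX_one, Polynomial.map_zero, map_zero, LinearMap.zero_apply, neg_zero, coreT,
      LinearMap.sum_apply]
    refine Finset.sum_eq_zero fun p _ => ?_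
    simp [lamPoly, lam]
  -- The polynomial `ell K` vanishes at the integers `0` and `K - 1`, which are smaller than `K` and
  -- distinct because `K ≠ 1`.
  obtain ⟨μ, hμ⟩ : ∃ μ : ℂ[X], ell K = X * ((X - C ((K - 1 : ℕ) : ℂ)) * μ) := by
    have h1 := eval_ell_eq_zero hK
    have h2 := eval_ell_eq_zero (show K - 1 < K by omega)
    obtain ⟨ν, hν⟩ := dvd_iff_isRoot.2 (show (ell K).IsRoot ((K - 1 : ℕ) : ℂ) from h2)
    rw [hν, Nat.cast_zero, eval_mul, mul_eq_zero, eval_sub, eval_X, eval_C, zero_sub, neg_eq_zero,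
      Nat.cast_eq_zero] at h1
    obtain ⟨μ, hμ⟩ := dvd_iff_isRoot.2 (show ν.IsRoot 0 from h1.resolve_left (by omega))
    rw [C_0, sub_zero] at hμ
    exact ⟨μ, by rw [hν, hμ]; ring⟩
  set Q : R[X] := (X * μ).map (algebraMap ℂ R) * C ((↑x⁻¹ : R) ^ K * y * (↑y⁻¹ : R) ^ K) with hQ
  have key := sum_opT_deriv_pow hy (Finset.range n) (fun p => C (-↑x⁻¹ : R) * lamPoly D x y 0 p K)
    Q (N₀ := K + K + 1) (fun N hN => by
      obtain ⟨J, hJ⟩ : ∃ J, J + K + 0 = N + 1 := ⟨N + 1 - K, by omega⟩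
      rw [sum_iterate_deriv_lamPoly hx hJ (by omega) hn]
      have hfac : ∀ q ∈ Finset.HasAntidiagonal.antidiagonal K, q.2 + 0 ≠ 0 →
          ((N - q.1).descFactorial (q.2 + 0 - 1) : ℂ) =
            (N - q.1).factorial * (J.factorial : ℂ)⁻¹ := by
        intro q hq h0
        rw [Finset.HasAntidiagonal.mem_antidiagonal] at hq
        rw [eq_mul_inv_iff_mul_eq₀ (Nat.cast_ne_zero.2 (Nat.factorial_ne_zero _)), mul_comm,
          ← Nat.factorial_mul_descFactorial (show q.2 + 0 - 1 ≤ N - q.1 by omega),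
          show N - q.1 - (q.2 + 0 - 1) = J by omega]
        push_cast
        ring
      have h1 := sum_ell_mul_coeff hK (show K ≤ N by omega)
      set s : ℕ × ℕ → ℂ := fun q => (ell q.1).eval (N : ℂ) * (N - q.1).factorial *
        PowerSeries.coeff q.2 (calS ^ (N - K) * calC ^ (K - 1)) with hs
      -- The scalar identity has one more term than the transform, namely `q = (K, 0)`; this
      -- term is the value of `Q`.
      have h2 : ∀ q ∈ Finset.HasAntidiagonal.antidiagonal K, (if q.2 + 0 = 0 then 0 else
          -((-1) ^ 0 * ((ell q.1).eval (N : ℂ) * (N - q.1).descFactorial (q.2 + 0 - 1) *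
          PowerSeries.coeff q.2 (calS ^ (N - K) * calC ^ (K - 1)))) • ((↑x⁻¹ : R) ^ K * (y : R) ^ J)) =
          (-((J.factorial : ℂ)⁻¹ * s q) + if q = (K, 0) then (J.factorial : ℂ)⁻¹ * s q else 0) •
            ((↑x⁻¹ : R) ^ K * (y : R) ^ J) := by
        intro q hq
        by_cases h0 : q.2 + 0 = 0
        · have : q = (K, 0) := by
            rw [Finset.HasAntidiagonal.mem_antidiagonal] at hq
            ext <;> simp <;> omega
          rw [if_pos h0, if_pos this, neg_add_cancel, zero_smul]
        · rw [if_neg h0, if_neg (by rintro rfl; simp at h0), hfac q hq h0, add_zero]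
          congr 1
          ring
      rw [Finset.sum_congr rfl h2, ← Finset.sum_smul, Finset.sum_add_distrib, Finset.sum_neg_distrib,
        ← Finset.mul_sum, h1, mul_zero, neg_zero, zero_add, Finset.sum_ite_eq',
        if_pos (Finset.HasAntidiagonal.mem_antidiagonal.2 (add_zero K)), hs]
      have h3 : PowerSeries.coeff 0 (calS ^ (N - K) * calC ^ (K - 1)) = 1 := by
        have := constantCoeff_calC_sub_one
        rw [map_sub, map_one, sub_eq_zero] at this
        simp [constantCoeff_calS, this]
      obtain ⟨j, rfl⟩ : ∃ j, J = j + 1 := ⟨J - 1, by omega⟩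
      have hj : ((N - K).factorial : ℂ) * ((j + 1).factorial : ℂ)⁻¹ = (j + 1 : ℂ)⁻¹ := by
        have i1 : (j.factorial : ℂ) ≠ 0 := Nat.cast_ne_zero.2 (Nat.factorial_ne_zero _)
        have i2 : (j + 1 : ℂ) ≠ 0 := by exact_mod_cast Nat.succ_ne_zero j
        rw [show N - K = j by omega, Nat.factorial_succ]
        push_cast
        field_simp
      have hN' : (N : ℂ) - ((K - 1 : ℕ) : ℂ) = j + 1 := by
        rw [sub_eq_iff_eq_add]
        exact_mod_cast (show N = j + 1 + (K - 1) by omega)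
      have i2 : (j + 1 : ℂ) ≠ 0 := by exact_mod_cast Nat.succ_ne_zero j
      have h5 : ((j + 1).factorial : ℂ)⁻¹ * ((ell K).eval (N : ℂ) * (N - K).factorial * 1) =
          (X * μ).eval (N : ℂ) := by
        rw [hμ, mul_one, mul_left_comm, mul_comm (_⁻¹), hj, eval_mul, eval_mul, eval_mul, eval_sub,
          eval_X, eval_C, hN']
        field_simp
      simp only [h3, h5]
      rw [hQ]
      generalize (X * μ : ℂ[X]) = P
      rw [eval_mul, eval_C, ← map_natCast (algebraMap ℂ R) N, eval_map_algebraMap,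
        ← coe_aeval_eq_eval, aeval_algebraMap_apply, coe_aeval_eq_eval, Algebra.smul_def]
      have h6 : (y : R) ^ K * (↑y⁻¹ : R) ^ K = 1 := by rw [← mul_pow, y.mul_inv, one_pow]
      have h7 : (y : R) ^ N * y = y ^ (j + 1) * y ^ K := by
        rw [← pow_succ, ← pow_add]
        congr 1
        omega
      linear_combination (-(algebraMap ℂ R (P.eval (N : ℂ))) * (↑x⁻¹ : R) ^ K *
        (↑y⁻¹ : R) ^ K) * h7 - (algebraMap ℂ R (P.eval (N : ℂ))) * (↑x⁻¹ : R) ^ K *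
        (y : R) ^ (j + 1) * h6) 1
  rw [coreT, LinearMap.sum_apply]
  refine key.trans ?_
  have hX : ∀ P : ℂ[X], divX (X * P) = P := by
    intro P
    ext k
    rw [coeff_divX, coeff_X_mul]
  rw [hμ, hX, eq_neg_iff_add_eq_zero, ← opT_mul_C]
  -- The regularization and the contribution of `Q` add up to the transform of the total derivative
  -- of `- μ(v) x y (x y) ^ (- K)`.
  have h1 := opT_nabla D y dy (μ.map (algebraMap ℂ R) * C (-(x * y * ((↑x⁻¹ : R) * ↑y⁻¹) ^ K)))
  rw [← h1, opT_apply_eq _ (map _ _ * C _), ← LinearMap.add_apply, ← map_add]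
  rw [nabla_map_mul_C]
  congr 2
  have hd : D (-(x * y * ((↑x⁻¹ : R) * ↑y⁻¹) ^ K)) =
      ((K - 1 : ℕ) : R) * ((↑x⁻¹ : R) * ↑y⁻¹) ^ K * (y + x * dy) := by
    have hxi := deriv_inv (x := x) hx
    have hyi : D (↑y⁻¹ : R) = -(↑y⁻¹ : R) ^ 2 * dy := by
      rw [Derivation.leibniz_of_mul_eq_one D (Units.inv_mul y), hy, smul_eq_mul]
    obtain ⟨k, rfl⟩ : ∃ k, K = k + 1 := ⟨K - 1, by omega⟩
    rw [map_neg, Derivation.leibniz, Derivation.leibniz_pow, Derivation.leibniz, Derivation.leibniz,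
      hx, hy, hxi, hyi]
    simp only [smul_eq_mul, nsmul_eq_mul, Nat.add_sub_cancel]
    have h3 := x.mul_inv
    have h4 := y.mul_inv
    push_cast
    rw [pow_succ]
    linear_combination (k + 1) * ((↑x⁻¹ : R) * ↑y⁻¹) ^ k * (↑x⁻¹ * ↑y⁻¹) * (x * dy * h4 + y * h3)
  rw [hd, eulerE_apply, Derivation.leibniz, hx, hy, hQ]
  simp only [Polynomial.map_mul, Polynomial.map_sub, map_X, map_C, smul_eq_mul]
  rw [mul_pow]
  simp only [C_mul, C_add, C_neg, C_pow, C_1, map_natCast]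
  have h4 : C (y : R) * C (↑y⁻¹ : R) = 1 := by rw [← C_mul, y.mul_inv, C_1]
  linear_combination (C (y : R) * C (↑dy⁻¹ : R) * μ.map (algebraMap ℂ R) * C (↑x⁻¹ : R) ^ K *
    C (↑y⁻¹ : R) ^ K * X * C (x : R) * C (dy : R)) * h4

end VertexTransform

/-! ### Symbols of differential operators -/

section ListPow

variable {A : Type*} [Ring A] {k : ℕ}

/-- The ordered product `E 0 ^ a 0 * E 1 ^ a 1 * ⋯`. -/
def listPow (E : Fin k → A) (a : Fin k → ℕ) : A :=
  ((List.finRange k).map fun i => E i ^ a i).prod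

theorem listProd_mul {ι : Type*} {l : List ι} (hl : l.Nodup) {F G : ι → A}
    (h : ∀ i j, i ≠ j → Commute (G i) (F j)) :
    (l.map fun i => F i * G i).prod = (l.map F).prod * (l.map G).prod := by
  induction l with
  | nil => simp
  | cons i l ih =>
    rw [List.nodup_cons] at hl
    have h1 : Commute (G i) (l.map F).prod := by
      refine Commute.list_prod_right _ _ fun y hy => ?_
      obtain ⟨j, hj, rfl⟩ := List.mem_map.1 hy
      exact h i j fun hij => hl.1 (hij ▸ hj)
    simp only [List.map_cons, List.prod_cons]
    rw [ih hl.2, mul_assoc (F i), ← mul_assoc (G i), h1.eq]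
    simp only [mul_assoc]

theorem listPow_zero (E : Fin k → A) : listPow E 0 = 1 := by
  rw [listPow]
  exact List.prod_eq_one fun x hx => by
    obtain ⟨j, _, rfl⟩ := List.mem_map.1 hx
    simp

theorem listPow_add {E : Fin k → A} (h : ∀ i j, Commute (E i) (E j)) (a b : Fin k → ℕ) :
    listPow E (a + b) = listPow E a * listPow E b := by
  rw [listPow, listPow, listPow, ← listProd_mul (List.nodup_finRange k)
    fun i j _ => (h i j).pow_pow _ _]
  simp only [Pi.add_apply, pow_add]

theorem listPow_single (E : Fin k → A) (i : Fin k) (m : ℕ) :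
    listPow E (Pi.single i m) = E i ^ m := by
  have h : ∀ l : List (Fin k), l.Nodup →
      (l.map fun j => E j ^ (Pi.single i m : Fin k → ℕ) j).prod = if i ∈ l then E i ^ m else 1 := by
    intro l
    induction l with
    | nil => simp
    | cons j l ih =>
      intro hl
      rw [List.nodup_cons] at hl
      rw [List.map_cons, List.prod_cons, ih hl.2]
      by_cases hij : i = j
      · subst hij
        simp [hl.1]
      · rw [Pi.single_eq_of_ne (Ne.symm hij)]
        simp [hij]
  rw [listPow, h _ (List.nodup_finRange k), if_pos (List.mem_finRange i)]

end ListPow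

section LinearSymbols

open MvPolynomial

variable {Q : Type*} [CommRing Q] {k : ℕ}

/-- The symbol `∑_i t_i ξ_i`. -/
def linSym (t : Fin k → Q) : MvPolynomial (Fin k) Q := ∑ i, C (t i) * X i

theorem isNilpotent_linSym {t : Fin k → Q} (ht : ∀ i, IsNilpotent (t i)) :
    IsNilpotent (linSym t) :=
  isNilpotent_sum fun i _ => ((Commute.all _ _).isNilpotent_mul_right ((ht i).map C))

end LinearSymbols

section Symbols

open MvPolynomial

variable {B Q : Type*} [AddCommGroup B] [Module ℂ B] [CommRing Q] [Algebra ℂ Q] {k : ℕ}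

/-- The symbol map: the `Q`-linear map `ξ ^ p ↦ φ (D ^ p g)`. -/
def sym (E : Fin k → Module.End ℂ B) (φ : B →ₗ[ℂ] Q) (g : B) : MvPolynomial (Fin k) Q →ₗ[Q] Q :=
  (basisMonomials (Fin k) Q).constr Q fun p => φ (listPow E p g)

variable (E : Fin k → Module.End ℂ B) (φ : B →ₗ[ℂ] Q) (g : B)

theorem sym_monomial (p : Fin k →₀ ℕ) (q : Q) :
    sym E φ g (monomial p q) = q * φ (listPow E p g) := by
  have h : monomial p q = q • (basisMonomials (Fin k) Q) p := by
    rw [coe_basisMonomials, smul_monomial, smul_eq_mul, mul_one]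
  rw [h, map_smul, sym, Module.Basis.constr_basis, smul_eq_mul]

theorem sym_one : sym E φ g 1 = φ g := by
  rw [← C_1, C_apply, sym_monomial, one_mul, Finsupp.coe_zero, listPow_zero]
  rfl

theorem sym_C_mul (q : Q) (c : MvPolynomial (Fin k) Q) : sym E φ g (C q * c) = q * sym E φ g c := by
  rw [← smul_eq_C_mul, map_smul, smul_eq_mul]

theorem sym_add (g h : B) (c : MvPolynomial (Fin k) Q) :
    sym E φ (g + h) c = sym E φ g c + sym E φ h c := by
  induction c using MvPolynomial.induction_on' with
  | add p q hp hq => rw [map_add, map_add, map_add, hp, hq]; ring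
  | monomial p q => simp only [sym_monomial, map_add, mul_add]

theorem sym_monomial_mul (hE : ∀ i j, Commute (E i) (E j)) (a : Fin k →₀ ℕ)
    (c : MvPolynomial (Fin k) Q) :
    sym E φ g (monomial a 1 * c) = sym E φ (listPow E a g) c := by
  induction c using MvPolynomial.induction_on' with
  | add p q hp hq => rw [mul_add, map_add, map_add, hp, hq]
  | monomial p q =>
    rw [monomial_mul, sym_monomial, sym_monomial, one_mul, add_comm, Finsupp.coe_add,
      listPow_add hE, Module.End.mul_apply]

theorem sym_X_mul (hE : ∀ i j, Commute (E i) (E j)) (i : Fin k) (c : MvPolynomial (Fin k) Q) :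
    sym E φ g (X i * c) = sym E φ (E i g) c := by
  rw [X, sym_monomial_mul E φ g hE, Finsupp.single_eq_pi_single, listPow_single, pow_one]

theorem sym_linSym_pow_succ (hE : ∀ i j, Commute (E i) (E j)) (t : Fin k → Q) (m : ℕ) :
    sym E φ g (linSym t ^ (m + 1)) = ∑ i, t i * sym E φ (E i g) (linSym t ^ m) := by
  rw [pow_succ', linSym, Finset.sum_mul, map_sum]
  refine Finset.sum_congr rfl fun i _ => ?_
  rw [mul_assoc, sym_C_mul, sym_X_mul E φ g hE]

/-- The shift `exp (∑_i t_i D_i)`, normally ordered: the numbers `t_i` stay on the left of the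
derivatives. -/
def shift (t : Fin k → Q) : B →ₗ[ℂ] Q where
  toFun g := sym E φ g (nexp (linSym t))
  map_add' g h := sym_add E φ g h _
  map_smul' c g := by
    have : ∀ P : MvPolynomial (Fin k) Q, sym E φ (c • g) P = c • sym E φ g P := by
      intro P
      induction P using MvPolynomial.induction_on' with
      | add p q hp hq => rw [map_add, map_add, hp, hq, smul_add]
      | monomial p q => simp only [sym_monomial, map_smul, mul_smul_comm]
    exact this _

theorem shift_apply (t : Fin k → Q) : shift E φ t g = sym E φ g (nexp (linSym t)) := rfl

theorem shift_eq_sum {t : Fin k → Q} {N : ℕ} (h : linSym t ^ N = 0) :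
    shift E φ t g = ∑ m ∈ Finset.range N, ((m.factorial : ℂ)⁻¹) • sym E φ g (linSym t ^ m) := by
  rw [shift_apply, nexp_eq_sum h, map_sum]
  refine Finset.sum_congr rfl fun m _ => ?_
  rw [← algebraMap_smul Q, map_smul, algebraMap_smul]

/-- The chain rule for shifts. -/
theorem shift_chain {B' : Type*} [AddCommGroup B'] [Module ℂ B'] {n : ℕ} {e : Fin k → Fin n}
    {E' : Fin n → Module.End ℂ B'} {φ' : B' →ₗ[ℂ] Q} {pull : B →ₗ[ℂ] B'} {t : Fin n → Q}
    (hE : ∀ i j, Commute (E i) (E j)) (hE' : ∀ i j, Commute (E' i) (E' j))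
    (ht : ∀ i, IsNilpotent (t i))
    (hp : ∀ i h, E' i (pull h) = ∑ j, if e j = i then pull (E j h) else 0) :
    shift E' φ' t (pull g) = shift E (φ' ∘ₗ pull) (fun j => t (e j)) g := by
  have h1 : ∀ m g, sym E' φ' (pull g) (linSym t ^ m) =
      sym E (φ' ∘ₗ pull) g (linSym (fun j => t (e j)) ^ m) := by
    intro m
    induction m with
    | zero => intro g; rw [pow_zero, pow_zero, sym_one, sym_one]; rfl
    | succ m ih =>
      intro g
      rw [sym_linSym_pow_succ _ _ _ hE', sym_linSym_pow_succ _ _ _ hE]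
      have h2 : ∀ i, sym E' φ' (E' i (pull g)) (linSym t ^ m) =
          ∑ j, if e j = i then sym E (φ' ∘ₗ pull) (E j g) (linSym (fun j => t (e j)) ^ m)
            else 0 := by
        intro i
        have h3 : ∀ s : Finset (Fin k), sym E' φ' (∑ j ∈ s, if e j = i then pull (E j g) else 0)
            (linSym t ^ m) = ∑ j ∈ s, sym E' φ' (if e j = i then pull (E j g) else 0)
              (linSym t ^ m) := by
          intro s
          exact map_sum (AddMonoidHom.mk' (fun f => sym E' φ' f (linSym t ^ m))
            fun f h => sym_add E' φ' f h _) _ _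
        rw [hp, h3]
        refine Finset.sum_congr rfl fun j _ => ?_
        split_ifs
        · exact ih _
        · simpa using sym_add E' φ' 0 0 (linSym t ^ m)
      simp only [h2, Finset.mul_sum]
      rw [Finset.sum_comm]
      refine Finset.sum_congr rfl fun j _ => ?_
      rw [Finset.sum_eq_single (e j)]
      · rw [if_pos rfl]
      · intro i _ hi
        rw [if_neg (Ne.symm hi), mul_zero]
      · simp
  obtain ⟨a, ha⟩ := isNilpotent_linSym ht
  obtain ⟨b, hb⟩ := isNilpotent_linSym (t := fun j => t (e j)) fun j => ht (e j)
  rw [shift_eq_sum _ _ _ (pow_eq_zero_of_le (Nat.le_add_right a b) ha),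
    shift_eq_sum _ _ _ (pow_eq_zero_of_le (Nat.le_add_left b a) hb)]
  simp only [h1]

/-- The explicit form of the shift. -/
theorem shift_eq_sum_piFinset {t : Fin k → Q} {N : ℕ} (h : ∀ i, t i ^ N = 0) :
    shift E φ t g = ∑ p ∈ Fintype.piFinset fun _ : Fin k => Finset.range N,
      (∏ i, ((p i).factorial : ℂ)⁻¹ • t i ^ p i) * φ (listPow E p g) := by
  have h1 : ∀ i, (C (t i) * X i : MvPolynomial (Fin k) Q) ^ N = 0 := by
    intro i
    rw [mul_pow, ← map_pow, h, map_zero, zero_mul]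
  rw [shift_apply, linSym, nexp_sum _ fun i _ => ⟨N, h1 i⟩]
  simp only [nexp_eq_sum (h1 _)]
  rw [Finset.prod_univ_sum, map_sum]
  refine Finset.sum_congr rfl fun p _ => ?_
  have h2 : ∏ i, (((p i).factorial : ℂ)⁻¹) • (C (t i) * X i : MvPolynomial (Fin k) Q) ^ p i =
      monomial (Finsupp.equivFunOnFinite.symm p) (∏ i, ((p i).factorial : ℂ)⁻¹ • t i ^ p i) := by
    rw [monomial_eq, map_prod, Finsupp.prod_fintype _ _ (by simp), ← Finset.prod_mul_distrib]
    refine Finset.prod_congr rfl fun i _ => ?_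
    rw [mul_pow, ← map_pow, ← smul_mul_assoc]
    congr 1
    simp only [smul_eq_C_mul, ← algebraMap_smul Q (_ : ℂ), smul_eq_mul, map_mul]
  rw [h2, sym_monomial]
  rfl

/-- A function killed by all derivatives but one is shifted in one direction only. -/
theorem shift_of_single {t : Fin k → Q} {N : ℕ} (h : ∀ i, t i ^ N = 0)
    (hE : ∀ i j, Commute (E i) (E j)) (i : Fin k) (hg : ∀ j ≠ i, E j g = 0) :
    shift E φ t g = ∑ p ∈ Finset.range N,
      (((p.factorial : ℂ)⁻¹) • t i ^ p) * φ ((E i ^ p) g) := by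
  have h1 : ∀ m g, (∀ j ≠ i, E j g = 0) → sym E φ g (linSym t ^ m) = t i ^ m * φ ((E i ^ m) g) := by
    intro m
    induction m with
    | zero => intro g _; rw [pow_zero, sym_one, pow_zero, pow_zero, one_mul]; rfl
    | succ m ih =>
      intro g hg
      rw [sym_linSym_pow_succ _ _ _ hE, Finset.sum_eq_single i]
      · rw [ih, pow_succ', mul_assoc, pow_succ (E i), Module.End.mul_apply]
        intro j hj
        rw [← Module.End.mul_apply, (hE j i).eq, Module.End.mul_apply, hg j hj, map_zero]
      · intro j _ hj
        have : sym E φ 0 (linSym t ^ m) = 0 := by simpa using sym_add E φ 0 0 (linSym t ^ m)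
        rw [hg j hj, this, mul_zero]
      · simp
  obtain ⟨a, ha⟩ := isNilpotent_linSym fun i => ⟨N, h i⟩
  rw [shift_eq_sum _ _ _ (pow_eq_zero_of_le (Nat.le_add_left a N) ha)]
  simp only [h1 _ g hg]
  have h2 : ∑ p ∈ Finset.range N, (((p.factorial : ℂ)⁻¹) • t i ^ p) * φ ((E i ^ p) g) =
      ∑ p ∈ Finset.range (N + a), (((p.factorial : ℂ)⁻¹) • t i ^ p) * φ ((E i ^ p) g) := by
    refine Finset.sum_subset (Finset.range_mono (Nat.le_add_right N a)) fun p _ hp => ?_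
    rw [pow_eq_zero_of_le (by simpa using hp) (h i), smul_zero, zero_mul]
  rw [h2]
  exact Finset.sum_congr rfl fun p _ => (smul_mul_assoc _ _ _).symm

end Symbols

section ShiftRing

open MvPolynomial

variable {R Q : Type*} [CommRing R] [Algebra ℂ R] [CommRing Q] [Algebra ℂ Q] {k : ℕ}

/-- Shifts are multiplicative. -/
theorem shift_mul (D : Fin k → Derivation ℂ R R)
    (hD : ∀ i j, Commute (D i : Module.End ℂ R) (D j)) (φ : R →ₐ[ℂ] Q)
    {t : Fin k → Q} (ht : ∀ i, IsNilpotent (t i)) (f g : R) :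
    shift (fun i => (D i : Module.End ℂ R)) φ.toLinearMap t (f * g) =
      shift (fun i => (D i : Module.End ℂ R)) φ.toLinearMap t f *
        shift (fun i => (D i : Module.End ℂ R)) φ.toLinearMap t g := by
  set E : Fin k → Module.End ℂ R := fun i => (D i : Module.End ℂ R) with hE
  -- The Leibniz rule for the powers of `∑_i t_i D_i`.
  have h1 : ∀ m f g, sym E φ.toLinearMap (f * g) (linSym t ^ m) =
      ∑ q ∈ Finset.HasAntidiagonal.antidiagonal m, (m.choose q.1 : Q) *
        (sym E φ.toLinearMap f (linSym t ^ q.1) * sym E φ.toLinearMap g (linSym t ^ q.2)) := by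
    intro m
    induction m with
    | zero => intro f g; simp [sym_one]
    | succ m ih =>
      intro f g
      have h2 : ∀ i, E i (f * g) = E i f * g + f * E i g := by
        intro i
        change D i (f * g) = D i f * g + f * D i g
        rw [Derivation.leibniz, smul_eq_mul, smul_eq_mul]
        ring
      have h3 : ∀ f g, ∑ q ∈ Finset.HasAntidiagonal.antidiagonal m, (m.choose q.2 : Q) *
          (sym E φ.toLinearMap f (linSym t ^ (q.1 + 1)) * sym E φ.toLinearMap g (linSym t ^ q.2)) =
          ∑ i, t i * sym E φ.toLinearMap (E i f * g) (linSym t ^ m) := by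
        intro f g
        simp only [ih, sym_linSym_pow_succ E _ _ hD, Finset.mul_sum, Finset.sum_mul]
        rw [Finset.sum_comm]
        refine Finset.sum_congr rfl fun i _ => Finset.sum_congr rfl fun q hq => ?_
        rw [Nat.choose_symm_of_eq_add (Finset.HasAntidiagonal.mem_antidiagonal.1 hq).symm]
        ring
      have h4 : ∀ f g, ∑ q ∈ Finset.HasAntidiagonal.antidiagonal m, (m.choose q.1 : Q) *
          (sym E φ.toLinearMap f (linSym t ^ q.1) * sym E φ.toLinearMap g (linSym t ^ (q.2 + 1))) =
          ∑ i, t i * sym E φ.toLinearMap (f * E i g) (linSym t ^ m) := by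
        intro f g
        simp only [ih, sym_linSym_pow_succ E _ _ hD, Finset.mul_sum]
        rw [Finset.sum_comm]
        exact Finset.sum_congr rfl fun i _ => Finset.sum_congr rfl fun q _ => by ring
      rw [Finset.sum_antidiagonal_choose_succ_mul (fun a b =>
        sym E φ.toLinearMap f (linSym t ^ a) * sym E φ.toLinearMap g (linSym t ^ b)) m, h4, h3, ← Finset.sum_add_distrib,
        sym_linSym_pow_succ E _ _ hD]
      refine Finset.sum_congr rfl fun i _ => ?_
      rw [h2, sym_add, mul_add, add_comm]
  obtain ⟨N, hN⟩ := isNilpotent_linSym ht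
  have h0 : ∀ (f : R) a, N ≤ a → sym E φ.toLinearMap f (linSym t ^ a) = 0 := by
    intro f a ha
    rw [pow_eq_zero_of_le ha hN, map_zero]
  have hN' : ∀ a, N ≤ a → linSym t ^ a = 0 := fun a ha => pow_eq_zero_of_le ha hN
  rw [shift_eq_sum _ _ f (hN' (N + N + 1) (by omega)), shift_eq_sum _ _ g (hN' (N + N + 1) (by omega)),
    shift_eq_sum _ _ _ (hN' (N + N + 1) (by omega)), Finset.sum_mul_sum,
    sum_range_range _ (Nat.lt_succ_self (N + N)) (Nat.lt_succ_self (N + N))]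
  · refine Finset.sum_congr rfl fun m _ => ?_
    rw [h1, Finset.smul_sum]
    refine Finset.sum_congr rfl fun q hq => ?_
    rw [Finset.HasAntidiagonal.mem_antidiagonal] at hq
    rw [smul_mul_smul_comm, ← map_natCast (algebraMap ℂ Q), ← Algebra.smul_def, smul_smul]
    congr 1
    rw [← hq, Nat.choose_symm_add, Nat.add_choose,
      Nat.cast_div (Nat.factorial_mul_factorial_dvd_factorial_add _ _)
      (by exact_mod_cast (mul_ne_zero (Nat.factorial_ne_zero _) (Nat.factorial_ne_zero _)))]
    have i1 : ((q.1 + q.2).factorial : ℂ) ≠ 0 := Nat.cast_ne_zero.2 (Nat.factorial_ne_zero _)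
    have i2 : (q.1.factorial : ℂ) ≠ 0 := Nat.cast_ne_zero.2 (Nat.factorial_ne_zero _)
    have i3 : (q.2.factorial : ℂ) ≠ 0 := Nat.cast_ne_zero.2 (Nat.factorial_ne_zero _)
    push_cast
    field_simp
  · intro a b hab
    rcases le_total N a with h | h
    · rw [h0 f a h, smul_zero, zero_mul]
    · rw [h0 g b (by omega), smul_zero, mul_zero]

theorem shift_one (D : Fin k → Derivation ℂ R R)
    (hD : ∀ i j, Commute (D i : Module.End ℂ R) (D j)) (φ : R →ₐ[ℂ] Q)
    {t : Fin k → Q} (ht : ∀ i, IsNilpotent (t i)) :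
    shift (fun i => (D i : Module.End ℂ R)) φ.toLinearMap t 1 = 1 := by
  obtain ⟨N, hN⟩ := isNilpotent_linSym ht
  rw [shift_eq_sum _ _ _ (pow_eq_zero_of_le (Nat.le_succ N) hN), Finset.sum_range_succ',
    Finset.sum_eq_zero, zero_add, pow_zero, sym_one]
  · simp
  · intro m _
    rw [sym_linSym_pow_succ _ _ _ hD, Finset.sum_eq_zero, smul_zero]
    intro i _
    have : sym (fun i => (D i : Module.End ℂ R)) φ.toLinearMap 0 (linSym t ^ m) = 0 := by
      simpa using sym_add (fun i => (D i : Module.End ℂ R)) φ.toLinearMap 0 0 (linSym t ^ m)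
    change t i * sym _ _ (D i 1) _ = 0
    rw [Derivation.map_one_eq_zero, this, mul_zero]

/-- The shift as a ring homomorphism. -/
def shiftHom (D : Fin k → Derivation ℂ R R)
    (hD : ∀ i j, Commute (D i : Module.End ℂ R) (D j)) (φ : R →ₐ[ℂ] Q)
    (t : Fin k → Q) (ht : ∀ i, IsNilpotent (t i)) : R →ₐ[ℂ] Q :=
  AlgHom.ofLinearMap (shift (fun i => (D i : Module.End ℂ R)) φ.toLinearMap t)
    (shift_one D hD φ ht) (shift_mul D hD φ ht)

end ShiftRing

/-! ### Multiplicative functionals on series in `ħ` -/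

section JetExt

variable {A A' : Type*} [CommRing A] [CommRing A']

/-- The extension of a ring homomorphism on coefficients to series in `ħ`, with `ħ ↦ ħ`. -/
def jetExt {M : ℕ} (φ : A →+* Jet M A') : PowerSeries A →+* Jet M A' where
  toFun f := ∑ K ∈ Finset.range (M + 1), hbar M A' ^ K * φ (PowerSeries.coeff K f)
  map_zero' := by simp
  map_one' := by
    rw [Finset.sum_range_succ', Finset.sum_eq_zero]
    · simp
    · intro K _
      simp [PowerSeries.coeff_one]
  map_add' f g := by simp [mul_add, Finset.sum_add_distrib]
  map_mul' f g := by
    rw [Finset.sum_mul_sum, sum_range_range _ (Nat.lt_succ_self M) (Nat.lt_succ_self M)]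
    · refine Finset.sum_congr rfl fun K _ => ?_
      rw [PowerSeries.coeff_mul, map_sum, Finset.mul_sum]
      refine Finset.sum_congr rfl fun p hp => ?_
      rw [← Finset.HasAntidiagonal.mem_antidiagonal.1 hp, map_mul,
        pow_add (hbar M A')]
      ring
    · intro p q hpq
      have := hbar_pow_of_lt (A := A') hpq
      rw [pow_add (hbar M A')] at this
      linear_combination (φ (PowerSeries.coeff p f) * φ (PowerSeries.coeff q g)) * this

variable {M : ℕ} (φ : A →+* Jet M A')

theorem jetExt_apply (f : PowerSeries A) :
    jetExt φ f = ∑ K ∈ Finset.range (M + 1), hbar M A' ^ K * φ (PowerSeries.coeff K f) := rfl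

theorem jetExt_C (a : A) : jetExt φ (PowerSeries.C a) = φ a := by
  rw [jetExt_apply, Finset.sum_range_succ', Finset.sum_eq_zero]
  · simp
  · intro K _
    simp

theorem jetExt_X_pow (b : ℕ) : jetExt φ (PowerSeries.X ^ b) = hbar M A' ^ b := by
  rw [jetExt_apply]
  by_cases hb : b ≤ M
  · rw [Finset.sum_eq_single b]
    · simp
    · intro K _ hK
      rw [PowerSeries.coeff_X_pow, if_neg hK, map_zero, mul_zero]
    · intro h
      simp at h
      omega
  · rw [hbar_pow_of_lt (by omega)]
    refine Finset.sum_eq_zero fun K hK => ?_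
    rw [PowerSeries.coeff_X_pow, if_neg (by rw [Finset.mem_range] at hK; omega), map_zero, mul_zero]

theorem jetExt_jet : jetExt ((jet M).comp (PowerSeries.C (R := A))) = jet M := by
  ext f
  rw [jetExt_apply, jet_eq_sum]
  rfl

theorem jetExt_expHbar [Algebra ℂ A] [Algebra ℂ A'] {f : PowerSeries A}
    (hf : PowerSeries.constantCoeff f = 0) : jetExt φ (expHbar f) = nexp (jetExt φ f) := by
  -- The extension factors through series modulo `ħ ^ (M + 1)`, where exponentials are finite sums.
  have h : ∀ a ∈ Ideal.span {(PowerSeries.X : PowerSeries A) ^ (M + 1)}, jetExt φ a = 0 := by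
    intro a ha
    obtain ⟨b, rfl⟩ := Ideal.mem_span_singleton.1 ha
    rw [map_mul, jetExt_X_pow, hbar_pow, zero_mul]
  obtain ⟨ψ, h1⟩ : ∃ ψ : Jet M A →+* Jet M A', ∀ a, jetExt φ a = ψ (jet M a) :=
    ⟨Ideal.Quotient.lift _ (jetExt φ) h, fun a => rfl⟩
  rw [h1, h1, jet_expHbar M hf, map_nexp _ ⟨_, isNilpotent_jet hf⟩]

end JetExt

section PerVariable

open PowerSeries

/-- The generating function of the numbers `sig` weighted by the coefficients of `𝒮`, in a form
adapted to a nilpotent argument `h`: conjugating `𝒮(h x ∂_x)` by `x` amounts to a change of the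
variable `h` followed by a shift. -/
theorem sum_calS_sig {Q : Type*} [CommRing Q] [Algebra ℂ Q] {M : ℕ} (ρ : PowerSeries ℂ →+* Q)
    {h : Q} (hρ : ∀ f, ρ f = ∑ a ∈ Finset.range (M + 1), coeff a f • h ^ a) (hX : ρ X = h)
    (hM : h ^ (M + 1) = 0) (ζ : Q) :
    ∑ a ∈ Finset.range (M + 1), (coeff a calS • h ^ a) *
        ∑ p ∈ Finset.range (M + 1), sig a p • ζ ^ p =
      ρ calS * (∑ a ∈ Finset.range (M + 1), coeff a calS • (-(h * ρ calS * ζ)) ^ a) *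
        nexp (ρ (calC - 1) * ζ) := by
  have hC : ∀ c, ρ (C c) = algebraMap ℂ Q c := by
    intro c
    rw [hρ, Finset.sum_range_succ', Finset.sum_eq_zero, zero_add, pow_zero, coeff_zero_C,
      Algebra.algebraMap_eq_smul_one]
    intro a _
    rw [coeff_C, if_neg (Nat.succ_ne_zero a), zero_smul]
  obtain ⟨G, hG⟩ := X_dvd_iff.2 constantCoeff_calC_sub_one
  have hh : ∀ a, M < a → h ^ a = 0 := fun a ha => pow_eq_zero_of_le ha hM
  have hn : (ρ (calC - 1) * ζ) ^ (M + 1) = 0 := by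
    rw [hG, map_mul, hX, mul_pow, mul_pow, hM, zero_mul, zero_mul]
  have h1 : ∀ p, ρ (kap p) = ∑ a ∈ Finset.range (M + 1), (coeff a calS * sig a p) • h ^ a := by
    intro p
    rw [hρ]
    simp only [kap, coeff_mk]
  have h2 : ∑ a ∈ Finset.range (M + 1), (coeff a calS • h ^ a) *
        ∑ p ∈ Finset.range (M + 1), sig a p • ζ ^ p =
      ∑ p ∈ Finset.range (M + 1), ρ (kap p) * ζ ^ p := by
    simp only [h1, Finset.mul_sum, Finset.sum_mul]
    rw [Finset.sum_comm]
    refine Finset.sum_congr rfl fun p _ => Finset.sum_congr rfl fun a _ => ?_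
    rw [smul_mul_smul_comm, smul_mul_assoc]
  rw [h2, nexp_eq_sum hn, mul_assoc, Finset.sum_mul_sum,
    sum_range_range _ (Nat.lt_succ_self M) (Nat.lt_succ_self M), Finset.mul_sum]
  · refine Finset.sum_congr rfl fun p _ => ?_
    rw [kap_eq, map_sum, Finset.sum_mul, Finset.mul_sum]
    refine Finset.sum_congr rfl fun q hq => ?_
    rw [Finset.HasAntidiagonal.mem_antidiagonal] at hq
    rw [map_mul, hC, smul_mul_smul_comm, Algebra.smul_def, ← hq, pow_add ζ]
    simp only [map_mul, map_pow, map_neg, hX]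
    rw [mul_pow _ ζ, show -(h * ρ calS * ζ) = -(h * ρ calS) * ζ by ring, mul_pow _ ζ]
    ring
  · intro a b hab
    have : (-(h * ρ calS * ζ)) ^ a * (ρ (calC - 1) * ζ) ^ b = 0 := by
      have h3 := hh _ hab
      rw [hG, map_mul, hX, neg_eq_neg_one_mul]
      simp only [mul_pow]
      rw [pow_add] at h3
      linear_combination ((-1) ^ a * (ρ calS) ^ a * ζ ^ a * (ρ G) ^ b * ζ ^ b) * h3
    rw [smul_mul_smul_comm, this, smul_zero]

end PerVariable

/-! ### Factors of multiedges -/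

/-- Commuting derivations `D i = ∂_{x i}` on a commutative `ℂ`-algebra, with invertible functions
`x i` and `y i` of the `i`-th variable and invertible derivatives `dy i` of the `y i`. -/
structure Frame (R : Type*) [CommRing R] [Algebra ℂ R] (n : ℕ) where
  D : Fin n → Derivation ℂ R R
  comm : ∀ i j f, D i (D j f) = D j (D i f)
  x : Fin n → Rˣ
  y : Fin n → Rˣ
  dy : Fin n → Rˣ
  D_x : ∀ i j, D i (x j) = if i = j then 1 else 0
  D_y : ∀ i j, D i (y j) = if i = j then (dy j : R) else 0

namespace Frame

variable {R : Type*} [CommRing R] [Algebra ℂ R] {n : ℕ} (F : Frame R n)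

/-- The derivations of a frame as linear maps. -/
def E (i : Fin n) : Module.End ℂ R := (F.D i : R →ₗ[ℂ] R)

theorem E_apply (i : Fin n) (f : R) : F.E i f = F.D i f := rfl

theorem commute_E (i j : Fin n) : Commute (F.E i) (F.E j) :=
  LinearMap.ext fun f => F.comm i j f

/-- The operators `x ∂_x`. -/
def xE (i : Fin n) : Module.End ℂ R := LinearMap.mulLeft ℂ (F.x i : R) * F.E i

theorem xE_apply (i : Fin n) (f : R) : F.xE i f = F.x i * F.D i f := rfl

theorem commute_mulLeft (i : Fin n) {r : R} (hr : F.D i r = 0) :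
    Commute (F.E i) (LinearMap.mulLeft ℂ r) := by
  refine LinearMap.ext fun f => ?_
  change F.D i (r * f) = r * F.D i f
  rw [Derivation.leibniz, hr, smul_zero, add_zero, smul_eq_mul]

theorem commute_E_mulLeft_x {i j : Fin n} (h : i ≠ j) :
    Commute (F.E i) (LinearMap.mulLeft ℂ (F.x j : R)) :=
  F.commute_mulLeft i (by rw [F.D_x, if_neg h])

/-- The operator `x ∂_x` conjugated by `x`. -/
theorem xE_pow (i : Fin n) (a : ℕ) (f : R) : ∀ N, a < N →
    (F.xE i ^ a) (F.x i * f) =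
      ∑ p ∈ Finset.range N, sig a p • ((F.x i : R) ^ (p + 1) * (F.E i ^ p) f) := by
  induction a generalizing f with
  | zero =>
    intro N hN
    rw [Finset.sum_eq_single 0]
    · simp [sig_zero]
    · intro p _ hp
      rw [sig_zero, if_neg hp, zero_smul]
    · intro h
      simp at h
      omega
  | succ a ih =>
    intro N hN
    obtain ⟨N, rfl⟩ : ∃ N', N = N' + 1 := ⟨N - 1, by omega⟩
    have h1 : ∀ p : ℕ, F.xE i ((F.x i : R) ^ (p + 1) * (F.E i ^ p) f) =
        ((p : ℂ) + 1) • ((F.x i : R) ^ (p + 1) * (F.E i ^ p) f) +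
          (F.x i : R) ^ (p + 1 + 1) * (F.E i ^ (p + 1)) f := by
      intro p
      have hs : ∀ z : R, ((p : ℂ) + 1) • z = (p + 1) * z := by
        intro z
        rw [Algebra.smul_def, map_add, map_natCast, map_one]
      rw [hs, xE_apply, Derivation.leibniz, Derivation.leibniz_pow, F.D_x, if_pos rfl,
        pow_succ' (F.E i), Module.End.mul_apply, E_apply]
      simp only [smul_eq_mul, nsmul_eq_mul, Nat.add_sub_cancel]
      push_cast
      ring
    rw [pow_succ', Module.End.mul_apply, ih f (N + 1) (by omega), map_sum]
    simp only [map_smul, h1, smul_add, Finset.sum_add_distrib]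
    rw [Finset.sum_range_succ', Finset.sum_range_succ _ N, Finset.sum_range_succ' _ N,
      sig_eq_zero (show a < N by omega), zero_smul, add_zero, sig_succ_zero, add_right_comm,
      ← Finset.sum_add_distrib]
    congr 1
    · refine Finset.sum_congr rfl fun p _ => ?_
      rw [sig_succ_succ, smul_smul, ← add_smul]
      congr 1
      push_cast
      ring
    · simp

end Frame

section Edges

open MvPolynomial

variable {B Q : Type*} [CommRing B] [Algebra ℂ B] [CommRing Q] [Algebra ℂ Q] {k : ℕ}

/-- The symbol of `∏_j (x_j ∂_{x_j}) ^ (a j)` conjugated by `∏_j x_j`. -/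
theorem sym_xE (G : Frame B k) (φ : B →ₐ[ℂ] Q) (a : Fin k → ℕ) (H : B) {N : ℕ}
    (ha : ∀ j, a j < N) :
    φ (listPow G.xE a ((∏ j, -(G.x j : B)) * H)) =
      sym G.E φ.toLinearMap H (∏ j, C (-φ (G.x j)) *
        ∑ p ∈ Finset.range N, sig (a j) p • (C (φ (G.x j)) * X j) ^ p) := by
  have key : ∀ l : List (Fin k), l.Nodup → ∀ H : B,
      φ ((l.map fun j => G.xE j ^ a j).prod ((l.map fun j => -(G.x j : B)).prod * H)) =
      sym G.E φ.toLinearMap H (l.map fun j => C (-φ (G.x j)) *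
        ∑ p ∈ Finset.range N, sig (a j) p • (C (φ (G.x j)) * X j) ^ p).prod := by
    intro l
    induction l with
    | nil => intro _ H; simp [sym_one]
    | cons j l ih =>
      intro hl H
      rw [List.nodup_cons] at hl
      have hx : ∀ i ∈ l, G.D j (G.x i) = 0 := by
        intro i hi
        rw [G.D_x, if_neg (by rintro rfl; exact hl.1 hi)]
      -- multiplication by functions of `x j` and `D j` commute with the operators of `l`
      have c1 : ∀ p, Commute (G.E j ^ p) (l.map fun j => G.xE j ^ a j).prod := by
        intro p
        refine Commute.list_prod_right _ _ fun y hy => ?_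
        obtain ⟨i, hi, rfl⟩ := List.mem_map.1 hy
        exact (((G.commute_mulLeft j (hx i hi)).mul_right (G.commute_E j i))).pow_pow _ _
      have c2 : Commute (LinearMap.mulLeft ℂ (G.x j : B)) (l.map fun j => G.xE j ^ a j).prod := by
        refine Commute.list_prod_right _ _ fun y hy => ?_
        obtain ⟨i, hi, rfl⟩ := List.mem_map.1 hy
        refine Commute.pow_right (Commute.mul_right ?_ ?_) _
        · refine LinearMap.ext fun f => ?_
          exact mul_left_comm (G.x j : B) (G.x i : B) f
        · exact (G.commute_E_mulLeft_x (by rintro rfl; exact hl.1 hi)).symm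
      have c3 : ∀ p, Commute (G.E j ^ p)
          (LinearMap.mulLeft ℂ (l.map fun j => -(G.x j : B)).prod) := by
        intro p
        refine Commute.pow_left (G.commute_mulLeft j ?_) p
        clear ih c1 c2
        induction l with
        | nil => simp
        | cons i l ih =>
          rw [List.map_cons, List.prod_cons, Derivation.leibniz, map_neg, hx i (by simp),
            ih ⟨fun h => hl.1 (by simp [h]), (List.nodup_cons.1 hl.2).2⟩
              fun i' hi' => hx i' (by simp [hi'])]
          simp
      rw [List.map_cons, List.map_cons, List.map_cons, List.prod_cons, List.prod_cons, List.prod_cons,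
        Module.End.mul_apply]
      set P := (l.map fun j => G.xE j ^ a j).prod
      set z := (l.map fun j => -(G.x j : B)).prod
      have h1 : P (-(G.x j : B) * z * H) = G.x j * -(P (z * H)) := by
        have := LinearMap.congr_fun c2.eq (-(z * H))
        rw [Module.End.mul_apply, Module.End.mul_apply, LinearMap.mulLeft_apply,
          LinearMap.mulLeft_apply, map_neg] at this
        rw [this]
        congr 1
        ring
      have h2 : ∀ p, (G.E j ^ p) (P (z * H)) = P (z * (G.E j ^ p) H) := by
        intro p
        have e1 := LinearMap.congr_fun (c1 p).eq (z * H)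
        have e2 := LinearMap.congr_fun (c3 p).eq H
        simp only [Module.End.mul_apply, LinearMap.mulLeft_apply] at e1 e2
        rw [e1, e2]
      rw [h1, G.xE_pow j (a j) _ N (ha j), map_sum, Finset.mul_sum, Finset.sum_mul, map_sum]
      refine Finset.sum_congr rfl fun p _ => ?_
      rw [map_neg, h2, map_smul, map_mul, map_neg, map_pow, ih hl.2]
      have h3 : ∀ c, C (-φ (G.x j)) * (sig (a j) p • (C (φ (G.x j)) * X j) ^ p) * c =
          C (-(sig (a j) p • φ (G.x j) ^ (p + 1))) * (monomial (Finsupp.single j p) 1 * c) := by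
        intro c
        rw [← X_pow_eq_monomial, mul_pow, ← map_pow]
        simp only [Algebra.smul_def, map_neg, map_mul, pow_succ]
        rw [show algebraMap ℂ (MvPolynomial (Fin k) Q) (sig (a j) p) =
          C (algebraMap ℂ Q (sig (a j) p)) from rfl]
        ring
      rw [h3, sym_C_mul, sym_monomial_mul _ _ _ G.commute_E, Finsupp.single_eq_pi_single,
        listPow_single, mul_neg, neg_mul, smul_neg, smul_mul_assoc]
  have := key _ (List.nodup_finRange k) H
  rw [← List.prod_ofFn (f := fun j => -(G.x j : B))]
  rw [← List.prod_ofFn (f := fun j => C (-φ (G.x j)) *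
        ∑ p ∈ Finset.range N, sig (a j) p • (C (φ (G.x j)) * X j) ^ p), List.ofFn_eq_map,
        List.ofFn_eq_map]
  exact this

end Edges

section Iota

variable {R : Type*} [CommRing R] {n : ℕ}

/-- The substitution `τ = ħ u_i`. -/
def iota (i : Fin n) : PowerSeries R →+* PowerSeries (MvPolynomial (Fin n) R) :=
  (PowerSeries.rescale (MvPolynomial.X i)).comp (PowerSeries.map MvPolynomial.C)

theorem coeff_iota (i : Fin n) (f : PowerSeries R) (N : ℕ) :
    PowerSeries.coeff N (iota i f) =
      MvPolynomial.X i ^ N * MvPolynomial.C (PowerSeries.coeff N f) := by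
  rw [iota, RingHom.comp_apply, PowerSeries.coeff_rescale, PowerSeries.coeff_map]

/-- The class of `u_i`. -/
def uJ (M : ℕ) (R : Type*) [CommRing R] (i : Fin n) : Jet M (MvPolynomial (Fin n) R) :=
  jet M (PowerSeries.C (MvPolynomial.X i))

end Iota

section Psi

variable {R : Type*} [CommRing R] [Algebra ℂ R] {n : ℕ}

/-- A function as a constant jet. -/
def cJet (M n : ℕ) (R : Type*) [CommRing R] [Algebra ℂ R] :
    R →ₐ[ℂ] Jet M (MvPolynomial (Fin n) R) :=
  { (jet M).comp ((PowerSeries.C (R := MvPolynomial (Fin n) R)).comp MvPolynomial.C) with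
    commutes' := fun _ => rfl }

theorem cJet_apply (M n : ℕ) (r : R) :
    cJet M n R r = jet M (PowerSeries.C (MvPolynomial.C r)) := rfl

/-- A numerical series evaluated at `ħ u_i`. -/
def rhoJ (M : ℕ) (R : Type*) [CommRing R] [Algebra ℂ R] (i : Fin n) :
    PowerSeries ℂ →+* Jet M (MvPolynomial (Fin n) R) :=
  (jet M).comp ((iota i).comp (PowerSeries.map (algebraMap ℂ R)))

theorem rhoJ_eq_sum (M : ℕ) (i : Fin n) (f : PowerSeries ℂ) :
    rhoJ M R i f = ∑ a ∈ Finset.range (M + 1),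
      PowerSeries.coeff a f • (hbar M (MvPolynomial (Fin n) R) * uJ M R i) ^ a := by
  rw [rhoJ, RingHom.comp_apply, jet_eq_sum]
  refine Finset.sum_congr rfl fun a _ => ?_
  rw [RingHom.comp_apply, coeff_iota, PowerSeries.coeff_map, Algebra.smul_def, map_mul, map_mul,
    map_pow, map_pow, mul_pow]
  rw [show algebraMap ℂ (Jet M (MvPolynomial (Fin n) R)) (PowerSeries.coeff a f) =
    jet M (PowerSeries.C (MvPolynomial.C (algebraMap ℂ R (PowerSeries.coeff a f)))) from rfl, uJ]
  ring

theorem rhoJ_X (M : ℕ) (i : Fin n) :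
    rhoJ M R i PowerSeries.X = hbar M (MvPolynomial (Fin n) R) * uJ M R i := by
  rw [rhoJ, RingHom.comp_apply, RingHom.comp_apply, PowerSeries.map_X, uJ, ← map_mul]
  congr 1
  ext1 N
  rw [coeff_iota, PowerSeries.coeff_mul_C]
  by_cases h : N = 1
  · subst h
    simp
  · rw [PowerSeries.coeff_X, if_neg h, PowerSeries.coeff_X, if_neg h, map_zero, mul_zero, zero_mul]

theorem rhoJ_pow (M : ℕ) (i : Fin n) {f : PowerSeries ℂ} (hf : PowerSeries.constantCoeff f = 0) :
    rhoJ M R i f ^ (M + 1) = 0 := by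
  obtain ⟨G, rfl⟩ := PowerSeries.X_dvd_iff.2 hf
  rw [map_mul, rhoJ_X, mul_pow, mul_pow, hbar_pow, zero_mul, zero_mul]

namespace Frame

variable (F : Frame R n) (M : ℕ)

/-- The image of `w_i`: the symbol `- x_i u_i 𝒮(ħ u_i)`. -/
def omJ (i : Fin n) : Jet M (MvPolynomial (Fin n) R) :=
  -cJet M n R (F.x i) * uJ M R i * rhoJ M R i calS

/-- The shift `x_i (cosh (ħ u_i / 2) - 1)` of `x_i`. -/
def tJ (i : Fin n) : Jet M (MvPolynomial (Fin n) R) :=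
  cJet M n R (F.x i) * rhoJ M R i (calC - 1)

theorem tJ_pow (i : Fin n) : F.tJ M i ^ (M + 1) = 0 := by
  rw [tJ, mul_pow, rhoJ_pow M i constantCoeff_calC_sub_one, mul_zero]

/-- The image of a function under the shift of all `x_i` by `x_i (cosh (ħ u_i / 2) - 1)`. -/
def tau : R →ₐ[ℂ] Jet M (MvPolynomial (Fin n) R) :=
  shiftHom F.D F.commute_E (cJet M n R) (F.tJ M) fun i => ⟨_, F.tJ_pow M i⟩

theorem tau_apply (f : R) :
    F.tau M f = shift F.E (cJet M n R).toLinearMap (F.tJ M) f := rfl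

/-- The ring homomorphism that turns the integrand of the simple formula into the one of the
universal formula: `w_i ↦ - x_i u_i 𝒮(ħ u_i)`, and functions are shifted. -/
def Psi : PowerSeries (MvPolynomial (Fin n) R) →+* Jet M (MvPolynomial (Fin n) R) :=
  jetExt (MvPolynomial.eval₂Hom (F.tau M : R →+* Jet M (MvPolynomial (Fin n) R)) (F.omJ M))

theorem Psi_X (i : Fin n) : F.Psi M (PowerSeries.C (MvPolynomial.X i)) = F.omJ M i := by
  rw [Psi, jetExt_C, MvPolynomial.coe_eval₂Hom, MvPolynomial.eval₂_X]

theorem Psi_C (f : R) : F.Psi M (PowerSeries.C (MvPolynomial.C f)) = F.tau M f := by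
  rw [Psi, jetExt_C, MvPolynomial.coe_eval₂Hom, MvPolynomial.eval₂_C]
  rfl

end Frame

end Psi

section EdgeSeries

variable {B R : Type*} [CommRing B] [Algebra ℂ B] [CommRing R] [Algebra ℂ R] {k n : ℕ}

/-- The factor of a multiedge: `∏_j ũ_j 𝒮(ħ ũ_j E j) ∑_g ħ ^ (2 g) H g` restricted to a diagonal. -/
def edgeSer (e : Fin k → Fin n) (pull : B →ₗ[ℂ] R) (E : Fin k → Module.End ℂ B) (H : ℕ → B) :
    PowerSeries (MvPolynomial (Fin n) R) :=
  PowerSeries.mk fun N => ∑ p ∈ Finset.HasAntidiagonal.antidiagonal N,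
    ∑ a ∈ Finset.piAntidiag (Finset.univ : Finset (Fin k)) p.1,
      (∏ j, MvPolynomial.X (e j) ^ (a j + 1)) *
        MvPolynomial.C ((∏ j, PowerSeries.coeff (a j) calS) •
          pull (listPow E a (PowerSeries.coeff p.2 (genusSeries H))))

/-- A sum over multi-indices, ordered by their total degree. -/
theorem sum_piFinset_range {A : Type*} [AddCommMonoid A] {M : ℕ} (f : (Fin k → ℕ) → A)
    (hf : ∀ a, M < ∑ j, a j → f a = 0) :
    ∑ a ∈ Fintype.piFinset fun _ : Fin k => Finset.range (M + 1), f a =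
      ∑ b ∈ Finset.range (M + 1), ∑ a ∈ Finset.piAntidiag (Finset.univ : Finset (Fin k)) b, f a := by
  rw [Finset.sum_sigma']
  refine Finset.sum_bij_ne_zero (fun a _ _ => ⟨∑ j, a j, a⟩) ?_ ?_ ?_ ?_
  · intro a _ ha
    simp only [Finset.mem_sigma, Finset.mem_range, Finset.mem_piAntidiag]
    refine ⟨?_, by simp⟩
    by_contra h
    exact ha (hf a (by omega))
  · intro a _ _ b _ _ hab
    simpa using congrArg Sigma.snd hab
  · rintro ⟨s, a⟩ ha hne
    simp only [Finset.mem_sigma, Finset.mem_range, Finset.mem_piAntidiag] at ha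
    obtain ⟨hs, rfl, _⟩ := ha
    refine ⟨a, ?_, hne, rfl⟩
    rw [Fintype.mem_piFinset]
    intro j
    have : a j ≤ Finset.univ.sum a := Finset.single_le_sum (fun i _ => Nat.zero_le _) (Finset.mem_univ j)
    rw [Finset.mem_range]
    omega
  · intro a _ _
    rfl

variable {M : ℕ}

theorem jetExt_edgeSer (φ : MvPolynomial (Fin n) R →+* Jet M (MvPolynomial (Fin n) R))
    (hφ : ∀ c : ℂ, φ (MvPolynomial.C (algebraMap ℂ R c)) = algebraMap ℂ _ c)
    (e : Fin k → Fin n) (pull : B →ₗ[ℂ] R) (E : Fin k → Module.End ℂ B) (H : ℕ → B) :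
    jetExt φ (edgeSer e pull E H) = ∑ N ∈ Finset.range (M + 1), hbar M _ ^ N *
      ∑ a ∈ Fintype.piFinset fun _ : Fin k => Finset.range (M + 1),
        (∏ j, PowerSeries.coeff (a j) calS • (hbar M _ ^ a j * φ (MvPolynomial.X (e j)) ^ (a j + 1))) *
          φ (MvPolynomial.C (pull (listPow E a (PowerSeries.coeff N (genusSeries H))))) := by
  set h := hbar M (MvPolynomial (Fin n) R) with hh
  have h0 : ∀ a, M < a → h ^ a = 0 := fun a ha => hbar_pow_of_lt ha
  have hφs : ∀ (c : ℂ) (r : R), φ (MvPolynomial.C (c • r)) = c • φ (MvPolynomial.C r) := by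
    intro c r
    rw [Algebra.smul_def, map_mul, map_mul, hφ, ← Algebra.smul_def]
  have h1 : ∀ a : Fin k → ℕ, ∏ j, PowerSeries.coeff (a j) calS •
      (h ^ a j * φ (MvPolynomial.X (e j)) ^ (a j + 1)) =
      h ^ (∑ j, a j) * ((∏ j, PowerSeries.coeff (a j) calS) •
        ∏ j, φ (MvPolynomial.X (e j)) ^ (a j + 1)) := by
    intro a
    rw [← Finset.prod_pow_eq_pow_sum, mul_smul_comm, ← Finset.prod_mul_distrib, Finset.prod_smul]
  have h2 : ∀ N, ∑ a ∈ Fintype.piFinset fun _ : Fin k => Finset.range (M + 1),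
        (∏ j, PowerSeries.coeff (a j) calS • (h ^ a j * φ (MvPolynomial.X (e j)) ^ (a j + 1))) *
          φ (MvPolynomial.C (pull (listPow E a (PowerSeries.coeff N (genusSeries H))))) =
      ∑ b ∈ Finset.range (M + 1), h ^ b * ∑ a ∈ Finset.piAntidiag (Finset.univ : Finset (Fin k)) b,
        φ ((∏ j, MvPolynomial.X (e j) ^ (a j + 1)) *
        MvPolynomial.C ((∏ j, PowerSeries.coeff (a j) calS) •
          pull (listPow E a (PowerSeries.coeff N (genusSeries H))))) := by
    intro N
    rw [sum_piFinset_range]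
    · refine Finset.sum_congr rfl fun b _ => ?_
      rw [Finset.mul_sum]
      refine Finset.sum_congr rfl fun a ha => ?_
      rw [Finset.mem_piAntidiag] at ha
      rw [h1, ha.1, map_mul, map_prod, hφs]
      simp only [map_pow, mul_smul_comm, smul_mul_assoc, mul_assoc]
    · intro a ha
      rw [h1, h0 _ ha, zero_mul, zero_mul]
  simp only [h2, Finset.mul_sum _ (fun b => h ^ b * _)]
  rw [Finset.sum_comm, sum_range_range _ (Nat.lt_succ_self M) (Nat.lt_succ_self M), jetExt_apply]
  · refine Finset.sum_congr rfl fun K _ => ?_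
    rw [edgeSer, PowerSeries.coeff_mk, map_sum, Finset.mul_sum]
    refine Finset.sum_congr rfl fun p hp => ?_
    rw [← Finset.HasAntidiagonal.mem_antidiagonal.1 hp, map_sum, pow_add h]
    ring
  · intro b N hbN
    have := h0 _ hbN
    rw [pow_add h] at this
    rw [mul_left_comm, ← mul_assoc, this, zero_mul]

/-- The restriction of functions on a product to a diagonal, compatible with the derivations. -/
structure FrameHom (F : Frame R n) (G : Frame B k) (e : Fin k → Fin n) where
  pull : B →ₐ[ℂ] R
  pull_x : ∀ j, pull (G.x j : B) = (F.x (e j) : R)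
  pull_y : ∀ j, pull (G.y j : B) = (F.y (e j) : R)
  D_pull : ∀ i h, F.D i (pull h) = ∑ j, if e j = i then pull (G.D j h) else 0

/-- The contribution of one leg, as a symbol. -/
theorem sum_calS_leg {Q : Type*} [CommRing Q] [Algebra ℂ Q] (ρ : PowerSeries ℂ →+* Q)
    {h u : Q} (hρ : ∀ f, ρ f = ∑ a ∈ Finset.range (M + 1), PowerSeries.coeff a f • (h * u) ^ a)
    (hX : ρ PowerSeries.X = h * u) (hM : h ^ (M + 1) = 0) (x ξ : Q) :
    ∑ a ∈ Finset.range (M + 1), PowerSeries.coeff a calS •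
        (h ^ a * (-x * u * ρ calS) ^ (a + 1)) * ξ ^ a * nexp (x * ρ (calC - 1) * ξ) =
      ∑ a ∈ Finset.range (M + 1), PowerSeries.coeff a calS • (h ^ a * u ^ (a + 1)) *
        (-x * ∑ p ∈ Finset.range (M + 1), sig a p • (x * ξ) ^ p) := by
  have key := sum_calS_sig ρ hρ hX (by rw [mul_pow, hM, zero_mul]) (x * ξ)
  have l1 : ∀ a : ℕ, PowerSeries.coeff a calS • (h ^ a * (-x * u * ρ calS) ^ (a + 1)) * ξ ^ a =
      -x * u * (ρ calS * (PowerSeries.coeff a calS • (-(h * u * ρ calS * (x * ξ))) ^ a)) := by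
    intro a
    rw [smul_mul_assoc, mul_smul_comm, mul_smul_comm]
    congr 1
    rw [show -(h * u * ρ calS * (x * ξ)) = h * (-x * u * ρ calS) * ξ by ring, mul_pow, mul_pow, pow_succ]
    ring
  have l2 : ∀ (a : ℕ) (z : Q), PowerSeries.coeff a calS • (h ^ a * u ^ (a + 1)) * (-x * z) =
      -x * u * ((PowerSeries.coeff a calS • (h * u) ^ a) * z) := by
    intro a z
    rw [smul_mul_assoc, smul_mul_assoc, mul_smul_comm, mul_pow, pow_succ]
    congr 1
    ring
  simp only [l1, l2]
  rw [← Finset.sum_mul, ← Finset.mul_sum, ← Finset.mul_sum, ← Finset.mul_sum, key,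
    show x * ρ (calC - 1) * ξ = ρ (calC - 1) * (x * ξ) by ring]
  ring

/-- The shift of a derivative of a function, as a symbol. -/
theorem mul_shift_listPow {Q : Type*} [CommRing Q] [Algebra ℂ Q] (G : Frame B k) (φ : B →ₐ[ℂ] Q)
    {t : Fin k → Q} (ht : ∀ j, IsNilpotent (t j)) (q : Fin k → Q) (a : Fin k → ℕ) (g : B) :
    (∏ j, q j) * sym G.E φ.toLinearMap (listPow G.E a g) (nexp (linSym t)) =
      sym G.E φ.toLinearMap g (∏ j, MvPolynomial.C (q j) * MvPolynomial.X j ^ a j *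
        nexp (MvPolynomial.C (t j) * MvPolynomial.X j)) := by
  have h1 : ∀ j, IsNilpotent (MvPolynomial.C (t j) * MvPolynomial.X j : MvPolynomial (Fin k) Q) :=
    fun j => (Commute.all _ _).isNilpotent_mul_right ((ht j).map MvPolynomial.C)
  have h2 : ∏ j, (MvPolynomial.X j : MvPolynomial (Fin k) Q) ^ a j =
      MvPolynomial.monomial (Finsupp.equivFunOnFinite.symm a) 1 := by
    rw [MvPolynomial.monomial_eq, MvPolynomial.C_1, one_mul, Finsupp.prod_fintype _ _ (by simp)]
    rfl
  rw [Finset.prod_mul_distrib, Finset.prod_mul_distrib, ← nexp_sum _ fun j _ => h1 j,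
    ← map_prod, h2, mul_assoc, sym_C_mul, sym_monomial_mul _ _ _ G.commute_E]
  rfl

theorem tau_pull {F : Frame R n} {G : Frame B k} {e : Fin k → Fin n} (f : FrameHom F G e) (g : B) :
    F.tau M (f.pull g) = sym G.E ((cJet M n R).comp f.pull).toLinearMap g
      (nexp (linSym fun j => F.tJ M (e j))) := by
  rw [Frame.tau_apply]
  exact shift_chain G.E g (pull := f.pull.toLinearMap) G.commute_E F.commute_E
    (fun i => ⟨_, F.tJ_pow M i⟩) f.D_pull

/-- A form of `sum_calS_leg` for the jets at a multiedge. -/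
theorem sum_calS_leg_jet (F : Frame R n) (i : Fin n) (j : Fin k) :
    ∑ a ∈ Finset.range (M + 1), (MvPolynomial.C (PowerSeries.coeff a calS •
        (hbar M _ ^ a * F.omJ M i ^ (a + 1))) * MvPolynomial.X j ^ a *
        nexp (MvPolynomial.C (F.tJ M i) * MvPolynomial.X j) :
          MvPolynomial (Fin k) (Jet M (MvPolynomial (Fin n) R))) =
      ∑ a ∈ Finset.range (M + 1), MvPolynomial.C (PowerSeries.coeff a calS •
        (hbar M _ ^ a * uJ M R i ^ (a + 1))) * (MvPolynomial.C (-cJet M n R (F.x i)) *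
        ∑ p ∈ Finset.range (M + 1), sig a p •
          (MvPolynomial.C (cJet M n R (F.x i)) * MvPolynomial.X j) ^ p) := by
  have hs : ∀ (c : ℂ) (q : Jet M (MvPolynomial (Fin n) R)),
      (MvPolynomial.C (c • q) : MvPolynomial (Fin k) _) = c • MvPolynomial.C q := by
    intro c q
    rw [Algebra.smul_def, Algebra.smul_def, map_mul]
    rfl
  have key := sum_calS_leg (M := M) (Q := MvPolynomial (Fin k) (Jet M (MvPolynomial (Fin n) R)))
    (MvPolynomial.C.comp (rhoJ M R i))
    (h := MvPolynomial.C (hbar M _)) (u := MvPolynomial.C (uJ M R i))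
    (fun f => by
      rw [RingHom.comp_apply, rhoJ_eq_sum, map_sum]
      refine Finset.sum_congr rfl fun a _ => ?_
      rw [hs, map_pow, map_mul])
    (by rw [RingHom.comp_apply, rhoJ_X, map_mul])
    (by rw [← map_pow, hbar_pow, map_zero])
    (MvPolynomial.C (cJet M n R (F.x i))) (MvPolynomial.X j)
  simp only [hs, Frame.omJ, Frame.tJ, map_mul, map_pow, map_neg]
  exact key

/-- The homomorphism `Psi` transforms the factors of the multiedges of the simple formula into the
ones of the universal formula. -/
theorem Psi_edgeSer {F : Frame R n} {G : Frame B k} {e : Fin k → Fin n} (f : FrameHom F G e)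
    (H : ℕ → B) : F.Psi M (edgeSer e f.pull.toLinearMap G.E H) =
      jet M (edgeSer e f.pull.toLinearMap G.xE fun g => (∏ j, -(G.x j : B)) * H g) := by
  have hx : ∀ j, ((cJet M n R).comp f.pull) (G.x j) = cJet M n R (F.x (e j)) := fun j => by
    rw [AlgHom.comp_apply, f.pull_x]
  rw [← jetExt_jet, Frame.Psi, jetExt_edgeSer _ (fun c => by
      rw [MvPolynomial.coe_eval₂Hom, MvPolynomial.eval₂_C]; exact (F.tau M).commutes c),
    jetExt_edgeSer _ (fun c => rfl)]
  refine Finset.sum_congr rfl fun N _ => ?_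
  congr 1
  have hH : PowerSeries.coeff N (genusSeries fun g => (∏ j, -(G.x j : B)) * H g) =
      (∏ j, -(G.x j : B)) * PowerSeries.coeff N (genusSeries H) := by
    rw [genusSeries, genusSeries, PowerSeries.coeff_mk, PowerSeries.coeff_mk]
    split_ifs <;> simp
  rw [hH]
  generalize PowerSeries.coeff N (genusSeries H) = H'
  -- both sides are symbols of differential operators applied to `H'`
  have hl : ∀ a : Fin k → ℕ, (∏ j, PowerSeries.coeff (a j) calS •
      (hbar M _ ^ a j * (MvPolynomial.eval₂Hom (F.tau M : R →+* Jet M (MvPolynomial (Fin n) R))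
        (F.omJ M)) (MvPolynomial.X (e j)) ^ (a j + 1))) *
      (MvPolynomial.eval₂Hom (F.tau M : R →+* Jet M (MvPolynomial (Fin n) R)) (F.omJ M))
        (MvPolynomial.C (f.pull.toLinearMap (listPow G.E a H'))) =
      sym G.E ((cJet M n R).comp f.pull).toLinearMap H' (∏ j,
        (MvPolynomial.C (PowerSeries.coeff (a j) calS • (hbar M _ ^ a j * F.omJ M (e j) ^ (a j + 1))) *
          MvPolynomial.X j ^ a j * nexp (MvPolynomial.C (F.tJ M (e j)) * MvPolynomial.X j))) := by
    intro a
    rw [← mul_shift_listPow G _ fun j => ⟨_, F.tJ_pow M (e j)⟩, ← tau_pull,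
      MvPolynomial.coe_eval₂Hom, MvPolynomial.eval₂_C]
    simp only [MvPolynomial.eval₂_X]
    rfl
  have hr : ∀ a ∈ Fintype.piFinset fun _ : Fin k => Finset.range (M + 1),
      (∏ j, PowerSeries.coeff (a j) calS • (hbar M _ ^ a j * uJ M R (e j) ^ (a j + 1))) *
      ((cJet M n R).comp f.pull) (listPow G.xE a ((∏ j, -(G.x j : B)) * H')) =
      sym G.E ((cJet M n R).comp f.pull).toLinearMap H' (∏ j,
        (MvPolynomial.C (PowerSeries.coeff (a j) calS • (hbar M _ ^ a j * uJ M R (e j) ^ (a j + 1))) *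
          (MvPolynomial.C (-cJet M n R (F.x (e j))) * ∑ p ∈ Finset.range (M + 1), sig (a j) p •
            (MvPolynomial.C (cJet M n R (F.x (e j))) * MvPolynomial.X j) ^ p))) := by
    intro a ha
    rw [Fintype.mem_piFinset] at ha
    rw [sym_xE G _ a H' (fun j => Finset.mem_range.1 (ha j)), ← sym_C_mul, map_prod,
      ← Finset.prod_mul_distrib]
    simp only [hx]
  have e1 : ∀ i, ((jet M).comp (PowerSeries.C (R := MvPolynomial (Fin n) R))) (MvPolynomial.X i) =
      uJ M R i := fun i => rfl
  have e2 : ∀ b, ((jet M).comp (PowerSeries.C (R := MvPolynomial (Fin n) R)))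
      (MvPolynomial.C (f.pull.toLinearMap b)) = ((cJet M n R).comp f.pull) b := fun i => rfl
  simp only [e1, e2]
  rw [Finset.sum_congr rfl hr, Finset.sum_congr rfl fun a _ => hl a, ← map_sum, ← map_sum]
  have s1 := Finset.prod_univ_sum (fun _ : Fin k => Finset.range (M + 1)) (fun j a =>
    (MvPolynomial.C (PowerSeries.coeff a calS • (hbar M _ ^ a * F.omJ M (e j) ^ (a + 1))) *
      MvPolynomial.X j ^ a * nexp (MvPolynomial.C (F.tJ M (e j)) * MvPolynomial.X j) :
        MvPolynomial (Fin k) (Jet M (MvPolynomial (Fin n) R))))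
  have s2 := Finset.prod_univ_sum (fun _ : Fin k => Finset.range (M + 1)) (fun j a =>
      (MvPolynomial.C (PowerSeries.coeff a calS • (hbar M _ ^ a * uJ M R (e j) ^ (a + 1))) *
        (MvPolynomial.C (-cJet M n R (F.x (e j))) * ∑ p ∈ Finset.range (M + 1), sig a p •
          (MvPolynomial.C (cJet M n R (F.x (e j))) * MvPolynomial.X j) ^ p) :
        MvPolynomial (Fin k) (Jet M (MvPolynomial (Fin n) R))))
  rw [← s1, ← s2, Finset.prod_congr rfl fun j _ => sum_calS_leg_jet F (e j) j]

end EdgeSeries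

/-! ### Factors of vertices -/

section Vertices

variable {B R : Type*} [CommRing B] [Algebra ℂ B] [CommRing R] [Algebra ℂ R] {n : ℕ}
  (F : Frame R n) (M : ℕ)

theorem jet_iota (i : Fin n) (f : PowerSeries R) :
    jet M (iota i f) = ∑ k ∈ Finset.range (M + 1), hbar M (MvPolynomial (Fin n) R) ^ k *
      (uJ M R i ^ k * cJet M n R (PowerSeries.coeff k f)) := by
  rw [jet_eq_sum]
  refine Finset.sum_congr rfl fun k _ => ?_
  rw [coeff_iota, map_mul, map_mul, map_pow, map_pow]
  rfl

theorem jet_iota_C (i : Fin n) (r : R) : jet M (iota i (PowerSeries.C r)) = cJet M n R r := by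
  rw [cJet_apply]
  congr 1
  ext1 N
  rw [coeff_iota, PowerSeries.coeff_C, PowerSeries.coeff_C]
  split_ifs with h <;> simp [h]

theorem jet_iota_map (i : Fin n) (f : PowerSeries ℂ) :
    jet M (iota i (PowerSeries.map (algebraMap ℂ R) f)) = rhoJ M R i f := rfl

theorem cJet_smul (c : ℂ) (r : R) : cJet M n R (c • r) = c • cJet M n R r := map_smul _ _ _

theorem jet_iota_tay (i : Fin n) {f : R} (hf : ∀ j ≠ i, F.D j f = 0) :
    jet M (iota i (tay (F.D i) (F.x i) f)) = F.tau M f := by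
  rw [Frame.tau_apply, shift_of_single F.E _ f (F.tJ_pow M) F.commute_E i hf, jet_iota]
  have h1 : ∀ q, F.tJ M i ^ q = cJet M n R ((F.x i : R) ^ q) * ∑ k ∈ Finset.range (M + 1),
      PowerSeries.coeff k ((calC - 1) ^ q) • (hbar M (MvPolynomial (Fin n) R) * uJ M R i) ^ k := by
    intro q
    rw [Frame.tJ, mul_pow, ← map_pow, ← map_pow, rhoJ_eq_sum]
  have h2 : ∀ k ∈ Finset.range (M + 1), hbar M (MvPolynomial (Fin n) R) ^ k *
      (uJ M R i ^ k * cJet M n R (PowerSeries.coeff k (tay (F.D i) (F.x i) f))) =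
      ∑ q ∈ Finset.range (M + 1), (((q.factorial : ℂ)⁻¹ * PowerSeries.coeff k ((calC - 1) ^ q)) •
        (hbar M (MvPolynomial (Fin n) R) * uJ M R i) ^ k) *
          (cJet M n R ((F.x i : R) ^ q) * cJet M n R ((F.E i ^ q) f)) := by
    intro k hk
    rw [coeff_tay _ _ (show k ≤ M by rw [Finset.mem_range] at hk; omega), map_sum, Finset.mul_sum,
      Finset.mul_sum]
    refine Finset.sum_congr rfl fun q _ => ?_
    rw [cJet_smul, map_mul, mul_smul_comm, mul_smul_comm, smul_mul_assoc, mul_comm (_⁻¹), mul_pow]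
    congr 1
    rw [Frame.E]
    ring
  rw [Finset.sum_congr rfl h2, Finset.sum_comm]
  refine Finset.sum_congr rfl fun q _ => ?_
  simp only [h1, Finset.mul_sum, Finset.sum_mul, Finset.smul_sum, smul_mul_assoc, mul_smul_comm,
    smul_smul, AlgHom.toLinearMap_apply]
  refine Finset.sum_congr rfl fun k _ => ?_
  congr 1
  ring

/-- The series `Y_i - θ_i`. -/
def Frame.calL (i : Fin n) : PowerSeries R :=
  calY (F.D i) (F.x i) (F.y i) - PowerSeries.C (F.x i * F.y i : R)

theorem constantCoeff_calL (i : Fin n) : PowerSeries.constantCoeff (F.calL i) = 0 := by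
  rw [Frame.calL, map_sub, constantCoeff_calY, PowerSeries.constantCoeff_C, sub_self]

theorem jet_iota_calL (i : Fin n) : jet M (iota i (F.calL i)) =
    cJet M n R (F.x i) * (rhoJ M R i calS * F.tau M (F.y i)) - cJet M n R (F.x i * F.y i) := by
  rw [Frame.calL, map_sub, map_sub, jet_iota_C, calY, map_mul, map_mul, map_mul, map_mul, jet_iota_C,
    jet_iota_tay F M i fun j hj => by rw [F.D_y, if_neg hj], mul_assoc]
  rfl

/-- The exponent at the `i`-th vertex in the simple formula. -/
def vertexS {i : Fin n} {G : Frame B 1} (f : FrameHom F G fun _ => i) (H : ℕ → B) :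
    PowerSeries (MvPolynomial (Fin n) R) :=
  edgeSer (fun _ => i) f.pull.toLinearMap G.E H -
    PowerSeries.C (MvPolynomial.X i * MvPolynomial.C (f.pull (H 0)))

/-- The exponent at the `i`-th vertex in the universal formula. -/
def vertexU {i : Fin n} {G : Frame B 1} (f : FrameHom F G fun _ => i) (H : ℕ → B) :
    PowerSeries (MvPolynomial (Fin n) R) :=
  edgeSer (fun _ => i) f.pull.toLinearMap G.xE (fun g => -(G.x 0 : B) * H g) -
    PowerSeries.C (MvPolynomial.X i * MvPolynomial.C (F.x i * F.y i : R))

theorem constantCoeff_edgeSer_one {i : Fin n} (pull : B →ₗ[ℂ] R) (E : Fin 1 → Module.End ℂ B)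
    (H : ℕ → B) : PowerSeries.constantCoeff (edgeSer (fun _ => i) pull E H) =
      MvPolynomial.X i * MvPolynomial.C (pull (H 0)) := by
  rw [← PowerSeries.coeff_zero_eq_constantCoeff_apply, edgeSer, PowerSeries.coeff_mk]
  have : PowerSeries.constantCoeff calS = 1 := constantCoeff_calS
  simp [this, listPow, genusSeries]

variable {F} {i : Fin n} {G : Frame B 1} (f : FrameHom F G fun _ => i) {H : ℕ → B}

theorem constantCoeff_vertexS : PowerSeries.constantCoeff (vertexS F f H) = 0 := by
  rw [vertexS, map_sub, constantCoeff_edgeSer_one, PowerSeries.constantCoeff_C]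
  exact sub_self _

theorem constantCoeff_vertexU (hH : H 0 = -G.y 0) :
    PowerSeries.constantCoeff (vertexU F f H) = 0 := by
  rw [vertexU, map_sub, constantCoeff_edgeSer_one, PowerSeries.constantCoeff_C, hH, neg_mul_neg]
  simp only [AlgHom.toLinearMap_apply, map_mul, f.pull_x, f.pull_y, sub_self]

/-- The part of the vertex factor of the universal formula that does not come from the simple one. -/
def Frame.vertexCorr (F : Frame R n) (i : Fin n) : PowerSeries (MvPolynomial (Fin n) R) :=
  iota i (PowerSeries.map (algebraMap ℂ R) calS⁻¹) *
    expHbar (PowerSeries.C (MvPolynomial.X i) * iota i (F.calL i))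

theorem constantCoeff_calL_exponent (F : Frame R n) (i : Fin n) :
    PowerSeries.constantCoeff (PowerSeries.C (MvPolynomial.X i) * iota i (F.calL i)) = 0 := by
  rw [map_mul, ← PowerSeries.coeff_zero_eq_constantCoeff_apply (iota i _), coeff_iota,
    PowerSeries.coeff_zero_eq_constantCoeff_apply, constantCoeff_calL, map_zero, mul_zero, mul_zero]

theorem jet_vertexCorr (F : Frame R n) (i : Fin n) : jet M (F.vertexCorr i) =
    rhoJ M R i calS⁻¹ *
      nexp (jet M (PowerSeries.C (MvPolynomial.X i) * iota i (F.calL i))) := by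
  rw [Frame.vertexCorr, map_mul (jet M), jet_expHbar M (constantCoeff_calL_exponent F i)]
  rfl

/-- Up to the factor `vertexCorr`, the homomorphism `Psi` transforms the vertex factors of the simple
formula into those of the universal one: the term of genus zero of the exponent is removed before
the shift in one formula and after it in the other, and the difference is `u (Y - θ)`. -/
theorem jet_expHbar_vertexU (hH : H 0 = -G.y 0) :
    jet M (iota i (PowerSeries.map (algebraMap ℂ R) calS⁻¹) * expHbar (vertexU F f H)) =
      jet M (F.vertexCorr i) * F.Psi M (expHbar (vertexS F f H)) := by
  have h1 : jet M (vertexU F f H) = F.Psi M (vertexS F f H) +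
      jet M (PowerSeries.C (MvPolynomial.X i) * iota i (F.calL i)) := by
    have e1 : (fun g => (∏ j, -(G.x j : B)) * H g) = fun g => -(G.x 0 : B) * H g := by
      simp
    have e2 : jet M (PowerSeries.C (MvPolynomial.X i) * iota i (F.calL i)) =
        uJ M R i * jet M (iota i (F.calL i)) := map_mul _ _ _
    have e3 : ∀ r : R, F.Psi M (PowerSeries.C (MvPolynomial.X i * MvPolynomial.C r)) =
        F.omJ M i * F.tau M r := by
      intro r
      rw [map_mul, map_mul, Frame.Psi_X, Frame.Psi_C]
    have e4 : ∀ r : R, jet M (PowerSeries.C (MvPolynomial.X i * MvPolynomial.C r)) =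
        uJ M R i * cJet M n R r := by
      intro r
      rw [map_mul, map_mul]
      rfl
    rw [vertexU, vertexS, map_sub (jet M), map_sub (F.Psi M), Psi_edgeSer, e1, e2, e3, e4,
      jet_iota_calL, hH, map_neg, map_neg, f.pull_y, Frame.omJ]
    ring
  have h2 : PowerSeries.constantCoeff (vertexS F f H) = 0 := constantCoeff_vertexS f
  have h3 := constantCoeff_calL_exponent F i
  have n1 : IsNilpotent (F.Psi M (vertexS F f H)) := by
    obtain ⟨g, hg⟩ := PowerSeries.X_dvd_iff.2 h2
    refine ⟨M + 1, ?_⟩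
    rw [hg, ← map_pow, mul_pow, map_mul, Frame.Psi, jetExt_X_pow, hbar_pow, zero_mul]
  rw [map_mul, jet_expHbar M (constantCoeff_vertexU f hH), h1, nexp_add n1 ⟨_, isNilpotent_jet h3⟩,
    jet_vertexCorr, Frame.Psi, jetExt_expHbar _ h2, jet_iota_map]
  ring

variable (F)

/-- The product of series in `ħ u_i` whose coefficients are the `bet`. -/
def Frame.betSer (i : Fin n) (m p j : ℕ) : PowerSeries R :=
  PowerSeries.C (((p.factorial : ℂ)⁻¹ * (j.factorial : ℂ)⁻¹) •
    ((-F.x i : R) ^ m * (F.x i : R) ^ p)) * (PowerSeries.map (algebraMap ℂ R)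
      (calS ^ m * calS⁻¹ * (calC - 1) ^ p) * F.calL i ^ j)

theorem coeff_betSer (i : Fin n) (m p j k : ℕ) : PowerSeries.coeff k (F.betSer i m p j) =
    bet (F.D i) (F.x i) (F.y i) m p j k := by
  rw [Frame.betSer, PowerSeries.coeff_C_mul, bet, smul_mul_assoc]
  rfl

theorem bet_eq_zero_of_lt (i : Fin n) (m p : ℕ) {j k : ℕ} (hjk : k < j) :
    bet (F.D i) (F.x i) (F.y i) m p j k = 0 := by
  obtain ⟨g, hg⟩ := PowerSeries.X_dvd_iff.2 (constantCoeff_calL F i)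
  rw [← coeff_betSer, Frame.betSer, hg, PowerSeries.coeff_C_mul, mul_pow, mul_left_comm,
    PowerSeries.coeff_X_pow_mul', if_neg (by omega), mul_zero]

theorem jet_iota_betSer (i : Fin n) (m p j : ℕ) : jet M (iota i (F.betSer i m p j)) =
    ((p.factorial : ℂ)⁻¹ * (j.factorial : ℂ)⁻¹) •
      ((-cJet M n R (F.x i)) ^ m * cJet M n R (F.x i) ^ p * (rhoJ M R i calS ^ m *
        rhoJ M R i calS⁻¹ * rhoJ M R i (calC - 1) ^ p * jet M (iota i (F.calL i)) ^ j)) := by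
  rw [Frame.betSer, map_mul (iota i), map_mul (jet M), jet_iota_C, cJet_smul, smul_mul_assoc,
    map_mul (iota i), map_mul (jet M), map_mul (cJet M n R), map_pow (cJet M n R),
    map_pow (cJet M n R), map_neg (cJet M n R), map_pow (iota i), map_pow (jet M), jet_iota_map,
    map_mul (rhoJ M R i), map_mul (rhoJ M R i), map_pow (rhoJ M R i), map_pow (rhoJ M R i)]

theorem vertex_monomial {Q : Type*} [CommRing Q] [Algebra ℂ Q] (a b : ℂ) (x u S T c L : Q)
    (m p j : ℕ) : T * (a • (u * L) ^ j) * (-x * u * S) ^ m * (b • (x * c) ^ p) =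
      u ^ (j + m) * ((b * a) • ((-x) ^ m * x ^ p * (S ^ m * T * c ^ p * L ^ j))) := by
  simp only [mul_smul_comm, smul_mul_assoc, smul_smul]
  congr 1
  simp only [mul_pow, pow_add]
  ring

/-- The vertex factor of the universal formula attached to a power of `w_i` and to a derivative,
in terms of the coefficients `bet`. -/
theorem vertexCorr_mul (i : Fin n) (m p : ℕ) :
    jet M (F.vertexCorr i) * F.omJ M i ^ m * ((p.factorial : ℂ)⁻¹ • F.tJ M i ^ p) =
      ∑ k ∈ Finset.range (M + 1), ∑ j ∈ Finset.range (k + 1), hbar M _ ^ k *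
        (uJ M R i ^ (j + k + m) * cJet M n R (bet (F.D i) (F.x i) (F.y i) m p j k)) := by
  have e1 : jet M (PowerSeries.C (MvPolynomial.X i) * iota i (F.calL i)) =
      uJ M R i * jet M (iota i (F.calL i)) := map_mul _ _ _
  have h1 : ∀ j, rhoJ M R i calS⁻¹ * (((j.factorial : ℂ)⁻¹) •
      jet M (PowerSeries.C (MvPolynomial.X i) * iota i (F.calL i)) ^ j) * F.omJ M i ^ m *
        ((p.factorial : ℂ)⁻¹ • F.tJ M i ^ p) =
      uJ M R i ^ (j + m) * jet M (iota i (F.betSer i m p j)) := by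
    intro j
    rw [e1, jet_iota_betSer, Frame.omJ, Frame.tJ]
    exact vertex_monomial _ _ _ _ _ _ _ _ _ _ _
  rw [jet_vertexCorr, nexp_eq_sum (isNilpotent_jet (constantCoeff_calL_exponent F i)),
    Finset.mul_sum, Finset.sum_mul, Finset.sum_mul, Finset.sum_congr rfl fun j _ => h1 j]
  simp only [jet_iota, coeff_betSer]
  rw [Finset.sum_congr rfl fun j _ => Finset.mul_sum _ _ _, Finset.sum_comm]
  refine Finset.sum_congr rfl fun k hk => ?_
  rw [Finset.mem_range] at hk
  rw [← Finset.sum_subset (Finset.range_mono (show k + 1 ≤ M + 1 by omega))]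
  · refine Finset.sum_congr rfl fun j _ => ?_
    rw [pow_add, pow_add, pow_add]
    ring
  · intro j _ hj
    rw [bet_eq_zero_of_lt F i m p (by simpa using hj), map_zero, mul_zero, mul_zero, mul_zero]

end Vertices

/-! ### Operators in several variables -/

section OrderedProducts

variable {A : Type*} [Ring A] [Algebra ℂ A] {n : ℕ}

theorem listProd_sum {κ : Type*} (T : Fin n → Finset κ) (g : Fin n → κ → A) :
    ((List.finRange n).map fun i => ∑ k ∈ T i, g i k).prod =
      ∑ r ∈ Fintype.piFinset T, ((List.finRange n).map fun i => g i (r i)).prod := by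
  have h := (MultilinearMap.mkPiAlgebraFin ℂ n A).map_sum_finset (fun i k => g i k) T
  simpa only [MultilinearMap.mkPiAlgebraFin_apply, List.ofFn_eq_map] using h

theorem commute_aeval {a b : A} (h : Commute a b) (P : Polynomial ℂ) :
    Commute a (Polynomial.aeval b P) := by
  induction P using Polynomial.induction_on' with
  | add P Q hP hQ => rw [map_add]; exact hP.add_right hQ
  | monomial k c =>
    rw [Polynomial.aeval_monomial]
    exact Commute.mul_right (Algebra.commutes c a).symm (h.pow_right k)

theorem commute_C_mk {A : Type*} [Ring A] {a : A} {f : ℕ → A} (h : ∀ K, Commute a (f K)) :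
    Commute (PowerSeries.C a) (PowerSeries.mk f) := by
  ext1 K
  rw [PowerSeries.coeff_C_mul, PowerSeries.coeff_mul_C, PowerSeries.coeff_mk, (h K).eq]

end OrderedProducts

section Local

variable {R : Type*} [CommRing R] [Algebra ℂ R] {n : ℕ} (F : Frame R n)

theorem coeff_mul_mem {A : Subalgebra ℂ R} {f g : PowerSeries R}
    (hf : ∀ K, PowerSeries.coeff K f ∈ A) (hg : ∀ K, PowerSeries.coeff K g ∈ A) (K : ℕ) :
    PowerSeries.coeff K (f * g) ∈ A := by
  rw [PowerSeries.coeff_mul]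
  exact sum_mem fun p _ => mul_mem (hf _) (hg _)

theorem coeff_pow_mem {A : Subalgebra ℂ R} {f : PowerSeries R}
    (hf : ∀ K, PowerSeries.coeff K f ∈ A) (j K : ℕ) : PowerSeries.coeff K (f ^ j) ∈ A := by
  induction j generalizing K with
  | zero =>
    rw [pow_zero, PowerSeries.coeff_one]
    split_ifs
    exacts [one_mem _, zero_mem _]
  | succ j ih => rw [pow_succ]; exact coeff_mul_mem ih hf K

theorem coeff_C_mem {A : Subalgebra ℂ R} {r : R} (hr : r ∈ A) (K : ℕ) :
    PowerSeries.coeff K (PowerSeries.C r) ∈ A := by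
  rw [PowerSeries.coeff_C]
  split_ifs
  exacts [hr, zero_mem _]

theorem coeff_map_mem (A : Subalgebra ℂ R) (f : PowerSeries ℂ) (K : ℕ) :
    PowerSeries.coeff K (PowerSeries.map (algebraMap ℂ R) f) ∈ A := by
  rw [PowerSeries.coeff_map]
  exact A.algebraMap_mem _

namespace Frame

/-- The algebra of functions of the `i`-th variable. -/
def loc (i : Fin n) : Subalgebra ℂ R where
  carrier := {r | ∀ j ≠ i, F.D j r = 0}
  mul_mem' := fun ha hb j hj => by
    rw [Derivation.leibniz, ha j hj, hb j hj, smul_zero, smul_zero, add_zero]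
  add_mem' := fun ha hb j hj => by rw [map_add, ha j hj, hb j hj, add_zero]
  algebraMap_mem' := fun c j _ => Derivation.map_algebraMap _ c

theorem x_mem_loc (i : Fin n) : (F.x i : R) ∈ F.loc i := fun j hj => by rw [F.D_x, if_neg hj]

theorem y_mem_loc (i : Fin n) : (F.y i : R) ∈ F.loc i := fun j hj => by rw [F.D_y, if_neg hj]

theorem D_mem_loc {i : Fin n} {r : R} (hr : r ∈ F.loc i) : F.D i r ∈ F.loc i := fun j hj => by
  rw [F.comm, hr j hj, map_zero]

theorem dy_mem_loc (i : Fin n) : (F.dy i : R) ∈ F.loc i := by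
  have h := F.D_mem_loc (F.y_mem_loc i)
  rwa [F.D_y, if_pos rfl] at h

theorem inv_mem_loc {i : Fin n} {u : Rˣ} (hu : (u : R) ∈ F.loc i) : (↑u⁻¹ : R) ∈ F.loc i := by
  intro j hj
  rw [Derivation.leibniz_of_mul_eq_one (F.D j) u.inv_mul, hu j hj, smul_zero]

theorem E_pow_mem_loc {i : Fin n} {r : R} (hr : r ∈ F.loc i) (k : ℕ) :
    (F.E i ^ k) r ∈ F.loc i := by
  induction k with
  | zero => exact hr
  | succ k ih => rw [pow_succ', Module.End.mul_apply]; exact F.D_mem_loc ih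

theorem coeff_calL_mem (i : Fin n) (K : ℕ) : PowerSeries.coeff K (F.calL i) ∈ F.loc i := by
  rw [calL, map_sub, calY]
  refine sub_mem (coeff_mul_mem (coeff_mul_mem (coeff_C_mem (F.x_mem_loc i)) (coeff_map_mem _ _))
    (fun K => ?_) K) (coeff_C_mem (mul_mem (F.x_mem_loc i) (F.y_mem_loc i)) K)
  rw [tay, PowerSeries.coeff_mk]
  exact sum_mem fun q _ => Subalgebra.smul_mem _ (mul_mem (pow_mem (F.x_mem_loc i) _)
    (F.E_pow_mem_loc (F.y_mem_loc i) q)) _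

theorem bet_mem_loc (i : Fin n) (m p j k : ℕ) :
    bet (F.D i) (F.x i) (F.y i) m p j k ∈ F.loc i := by
  rw [← coeff_betSer, betSer]
  refine coeff_mul_mem (coeff_C_mem (Subalgebra.smul_mem _ (mul_mem (pow_mem
    (neg_mem (F.x_mem_loc i)) _) (pow_mem (F.x_mem_loc i) _)) _))
    (coeff_mul_mem (coeff_map_mem _ _) (coeff_pow_mem (F.coeff_calL_mem i) j)) k

/-- The operators `y ∂_y`. -/
def yE (i : Fin n) : Module.End ℂ R := eulerE (F.D i) (F.y i) (F.dy i)

theorem commute_E_mulLeft {i j : Fin n} (h : i ≠ j) {r : R} (hr : r ∈ F.loc j) :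
    Commute (F.E i) (LinearMap.mulLeft ℂ r) := F.commute_mulLeft i (hr i h)

theorem commute_mulLeft_mulLeft (r s : R) :
    Commute (LinearMap.mulLeft ℂ r) (LinearMap.mulLeft ℂ s) :=
  LinearMap.ext fun f => mul_left_comm r s f

theorem commute_E_yE {i j : Fin n} (h : i ≠ j) : Commute (F.E i) (F.yE j) :=
  (F.commute_E_mulLeft h (mul_mem (F.y_mem_loc j) (F.inv_mem_loc (F.dy_mem_loc j)))).mul_right
    (F.commute_E i j)

theorem commute_mulLeft_yE {i j : Fin n} (h : i ≠ j) {r : R} (hr : r ∈ F.loc i) :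
    Commute (LinearMap.mulLeft ℂ r) (F.yE j) :=
  (commute_mulLeft_mulLeft r _).mul_right (F.commute_E_mulLeft h.symm hr).symm

theorem commute_yE (i j : Fin n) : Commute (F.yE i) (F.yE j) := by
  rcases eq_or_ne i j with rfl | h
  · exact Commute.refl _
  · exact (F.commute_mulLeft_yE h (mul_mem (F.y_mem_loc i) (F.inv_mem_loc (F.dy_mem_loc i)))).mul_left
      (F.commute_E_yE h)

/-- The operator by which the universal formula acts on the coefficient of `u_i ^ s`, in degree `K`
in `ħ`. -/
def lamOp (i : Fin n) (K s : ℕ) : Module.End ℂ R :=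
  opT (F.yE i) (Polynomial.C (F.y i * ↑(F.dy i)⁻¹ : R) * (Polynomial.C (-↑(F.x i)⁻¹ : R) *
    lam (↑(F.x i)⁻¹ * ↑(F.y i)⁻¹ : R) K s))

theorem lamOp_eq (i : Fin n) (K s : ℕ) : F.lamOp i K s = if s = 0 then 0 else
    Polynomial.aeval (-F.yE i) (ell K * fallFrom K (s - 1)) *
      LinearMap.mulLeft ℂ ((F.y i * ↑(F.dy i)⁻¹ : R) * (-↑(F.x i)⁻¹ *
        (↑(F.x i)⁻¹ * ↑(F.y i)⁻¹ : R) ^ (K + (s - 1)))) := by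
  rw [lamOp, lam]
  split_ifs with h
  · rw [mul_zero, mul_zero, map_zero]
  · refine LinearMap.ext fun f => ?_
    rw [← mul_assoc (Polynomial.C (-_)), ← mul_assoc (Polynomial.C (_ * _)), ← Polynomial.C_mul,
      ← Polynomial.C_mul, opT_C_mul, opT_map]
    rfl

theorem commute_lamOp {i : Fin n} {A : Module.End ℂ R} (hA : Commute A (F.yE i))
    (hr : ∀ r ∈ F.loc i, Commute A (LinearMap.mulLeft ℂ r)) (K s : ℕ) :
    Commute A (F.lamOp i K s) := by
  rw [lamOp_eq]
  split_ifs with h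
  · exact Commute.zero_right _
  · refine (commute_aeval hA.neg_right _).mul_right (hr _ ?_)
    exact mul_mem (mul_mem (F.y_mem_loc i) (F.inv_mem_loc (F.dy_mem_loc i))) (mul_mem
      (neg_mem (F.inv_mem_loc (F.x_mem_loc i))) (pow_mem (mul_mem (F.inv_mem_loc (F.x_mem_loc i))
        (F.inv_mem_loc (F.y_mem_loc i))) _))

theorem commute_E_lamOp {i j : Fin n} (h : i ≠ j) (K s : ℕ) :
    Commute (F.E i) (F.lamOp j K s) :=
  F.commute_lamOp (F.commute_E_yE h) (fun _ hr => F.commute_E_mulLeft h hr) K s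

theorem commute_mulLeft_lamOp {i j : Fin n} (h : i ≠ j) {r : R} (hr : r ∈ F.loc i) (K s : ℕ) :
    Commute (LinearMap.mulLeft ℂ r) (F.lamOp j K s) :=
  F.commute_lamOp (F.commute_mulLeft_yE h hr) (fun _ _ => commute_mulLeft_mulLeft _ _) K s

/-- The series of the operators `lamOp`. -/
def lamSer (i : Fin n) (s : ℕ) : PowerSeries (Module.End ℂ R) :=
  PowerSeries.mk fun K => F.lamOp i K s

/-- The indices of the terms of the vertex factor. -/
def termIdx (M : ℕ) : Finset (Σ _ : ℕ, ℕ) :=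
  (Finset.range (M + 1)).sigma fun k => Finset.range (k + 1)

/-- The operator by which the universal formula acts on the coefficient of `w_i ^ m` of the simple
one. -/
def coreSer (M : ℕ) (i : Fin n) (m : ℕ) : PowerSeries (Module.End ℂ R) :=
  ∑ p ∈ Finset.range (M + 1), ∑ s ∈ termIdx M, PowerSeries.X ^ s.1 *
    (F.lamSer i (s.2 + s.1 + m) *
      (PowerSeries.C (LinearMap.mulLeft ℂ (bet (F.D i) (F.x i) (F.y i) m p s.2 s.1)) *
        PowerSeries.C (F.E i ^ p)))

theorem coeff_coreSer {M K : ℕ} (hK : K ≤ M) (i : Fin n) (m : ℕ) :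
    PowerSeries.coeff K (F.coreSer M i m) =
      coreT (F.D i) (F.x i) (F.y i) (F.dy i) (M + 1) m K := by
  rw [coreSer, map_sum, coreT]
  refine Finset.sum_congr rfl fun p _ => ?_
  have h1 : ∀ (k s : ℕ) (r : R), PowerSeries.coeff K (PowerSeries.X ^ k * (F.lamSer i s *
      (PowerSeries.C (LinearMap.mulLeft ℂ r) * PowerSeries.C (F.E i ^ p)))) =
      if k ≤ K then F.lamOp i (K - k) s * LinearMap.mulLeft ℂ r * F.E i ^ p else 0 := by
    intro k s r
    rw [PowerSeries.coeff_X_pow_mul', ← mul_assoc (F.lamSer i s), PowerSeries.coeff_mul_C,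
      PowerSeries.coeff_mul_C, lamSer, PowerSeries.coeff_mk]
  have h2 : ∀ (a s : ℕ) (r : R), F.lamOp i a s * LinearMap.mulLeft ℂ r = opT (F.yE i)
      (Polynomial.C (F.y i * ↑(F.dy i)⁻¹ : R) * (Polynomial.C (-↑(F.x i)⁻¹ : R) *
        (lam (↑(F.x i)⁻¹ * ↑(F.y i)⁻¹ : R) a s * Polynomial.C r))) := by
    intro a s r
    refine LinearMap.ext fun f => ?_
    rw [Module.End.mul_apply, LinearMap.mulLeft_apply, lamOp, ← opT_mul_C]
    simp only [mul_assoc]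
  rw [map_sum, Finset.sum_congr rfl fun s _ => h1 _ _ _, termIdx, Finset.sum_sigma, lamPoly,
    ← Finset.Nat.sum_antidiagonal_swap, Finset.Nat.sum_antidiagonal_eq_sum_range_succ_mk]
  simp only [Finset.mul_sum, map_sum, Finset.sum_mul]
  rw [← Finset.sum_subset (Finset.range_mono (show K + 1 ≤ M + 1 by omega))]
  · refine Finset.sum_congr rfl fun k hk => ?_
    rw [Finset.mem_range] at hk
    refine Finset.sum_congr rfl fun j _ => ?_
    rw [if_pos (by omega), h2]
    rfl
  · intro k _ hk
    refine Finset.sum_eq_zero fun j _ => ?_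
    rw [if_neg (by rw [Finset.mem_range] at hk; omega)]

end Frame

end Local

/-! ### The transform of the simple integrand -/

section Universal

variable {R : Type*} [CommRing R] [Algebra ℂ R] {n : ℕ} (F : Frame R n) (M : ℕ)

namespace Frame

/-- The operator by which the universal formula acts on the coefficient of `∏_i u_i ^ (s i)`. -/
def lamProd (s : Fin n → ℕ) : PowerSeries (Module.End ℂ R) :=
  ((List.finRange n).map fun i => F.lamSer i (s i)).prod

/-- The operator by which the universal formula acts on the coefficient of `∏_i w_i ^ (m i)` of the
simple one. -/
def coreProd (m : Fin n → ℕ) : PowerSeries (Module.End ℂ R) :=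
  ((List.finRange n).map fun i => F.coreSer M i (m i)).prod

/-- The coefficient of `ħ ^ M` of the universal formula, as a functional of its inner part. -/
def univ (I : PowerSeries (MvPolynomial (Fin n) R)) : R :=
  ∑ K ∈ Finset.range (M + 1), ∑ᶠ s : Fin n →₀ ℕ,
    PowerSeries.coeff (M - K) (F.lamProd s) (MvPolynomial.coeff s (PowerSeries.coeff K I))

theorem finite_support_apply (A : (Fin n →₀ ℕ) → Module.End ℂ R) (P : MvPolynomial (Fin n) R) :
    (Function.support fun s => A s (MvPolynomial.coeff s P)).Finite := by
  refine P.support.finite_toSet.subset fun s hs => ?_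
  rw [Finset.mem_coe, MvPolynomial.mem_support_iff]
  intro h
  rw [Function.mem_support, h, map_zero] at hs
  exact hs rfl

theorem finsum_apply_eq_sum (A : (Fin n →₀ ℕ) → Module.End ℂ R) (P : MvPolynomial (Fin n) R) :
    ∑ᶠ s, A s (MvPolynomial.coeff s P) = ∑ s ∈ P.support, A s (MvPolynomial.coeff s P) := by
  refine finsum_eq_sum_of_support_subset _ fun s hs => ?_
  rw [Finset.mem_coe, MvPolynomial.mem_support_iff]
  intro h
  rw [Function.mem_support, h, map_zero] at hs
  exact hs rfl

theorem univ_congr {I J : PowerSeries (MvPolynomial (Fin n) R)} (h : jet M I = jet M J) :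
    F.univ M I = F.univ M J := by
  rw [jet_eq_iff] at h
  refine Finset.sum_congr rfl fun K hK => ?_
  rw [h K (Nat.lt_succ_iff.1 (Finset.mem_range.1 hK))]

theorem univ_add (I J : PowerSeries (MvPolynomial (Fin n) R)) :
    F.univ M (I + J) = F.univ M I + F.univ M J := by
  rw [univ, univ, univ, ← Finset.sum_add_distrib]
  refine Finset.sum_congr rfl fun K _ => ?_
  rw [← finsum_add_distrib (finite_support_apply _ _) (finite_support_apply _ _)]
  simp only [map_add, MvPolynomial.coeff_add]

theorem univ_sum {ι : Type*} (s : Finset ι) (I : ι → PowerSeries (MvPolynomial (Fin n) R)) :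
    F.univ M (∑ i ∈ s, I i) = ∑ i ∈ s, F.univ M (I i) :=
  map_sum (AddMonoidHom.mk' (F.univ M) (F.univ_add M)) I s

theorem univ_monomial (a : ℕ) (s : Fin n →₀ ℕ) (f : R) :
    F.univ M (PowerSeries.X ^ a * PowerSeries.C (MvPolynomial.monomial s f)) =
      if a ≤ M then PowerSeries.coeff (M - a) (F.lamProd s) f else 0 := by
  have h1 : ∀ K, ∑ᶠ t : Fin n →₀ ℕ, PowerSeries.coeff (M - K) (F.lamProd t)
      (MvPolynomial.coeff t (PowerSeries.coeff K
        (PowerSeries.X ^ a * PowerSeries.C (MvPolynomial.monomial s f)))) =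
      if K = a then PowerSeries.coeff (M - K) (F.lamProd s) f else 0 := by
    intro K
    rw [PowerSeries.coeff_X_pow_mul', PowerSeries.coeff_C]
    by_cases hK : K = a
    · subst hK
      rw [if_pos le_rfl, if_pos (Nat.sub_self K), if_pos rfl, finsum_eq_single _ s]
      · rw [MvPolynomial.coeff_monomial, if_pos rfl]
      · intro t ht
        rw [MvPolynomial.coeff_monomial, if_neg (Ne.symm ht), map_zero]
    · rw [if_neg hK]
      have : (if a ≤ K then if K - a = 0 then MvPolynomial.monomial s f else 0 else 0) = 0 := by
        split_ifs
        · omega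
        · rfl
        · rfl
      simp [this]
  rw [univ, Finset.sum_congr rfl fun K _ => h1 K, Finset.sum_ite_eq']
  simp only [Finset.mem_range, Nat.lt_succ_iff]

theorem listProd_pow {A ι : Type*} [Monoid A] (a : A) (l : List ι) (k : ι → ℕ) :
    (l.map fun i => a ^ k i).prod = a ^ (l.map k).sum := by
  induction l with
  | nil => simp
  | cons i l ih => rw [List.map_cons, List.prod_cons, ih, List.map_cons, List.sum_cons, pow_add]

theorem listProd_mulLeft (r : Fin n → R) :
    ((List.finRange n).map fun i => LinearMap.mulLeft ℂ (r i)).prod =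
      LinearMap.mulLeft ℂ (∏ i, r i) := by
  rw [Fin.prod_univ_def]
  induction List.finRange n with
  | nil => exact (LinearMap.mulLeft_one ℂ R).symm
  | cons i l ih =>
    rw [List.map_cons, List.prod_cons, ih, List.map_cons, List.prod_cons, LinearMap.mulLeft_mul]
    rfl

theorem coeff_coreProd_apply (m : Fin n → ℕ) (L : ℕ) (g : R) :
    PowerSeries.coeff L (F.coreProd M m) g =
      ∑ p ∈ Fintype.piFinset fun _ : Fin n => Finset.range (M + 1),
        ∑ s ∈ Fintype.piFinset fun _ : Fin n => termIdx M,
          if ∑ i, (s i).1 ≤ L then PowerSeries.coeff (L - ∑ i, (s i).1)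
            (F.lamProd fun i => (s i).2 + (s i).1 + m i)
              ((∏ i, bet (F.D i) (F.x i) (F.y i) (m i) (p i) (s i).2 (s i).1) *
                listPow F.E p g) else 0 := by
  have h1 : ∀ (p : Fin n → ℕ) (s : Fin n → Σ _ : ℕ, ℕ), ((List.finRange n).map fun i =>
      PowerSeries.X ^ (s i).1 * (F.lamSer i ((s i).2 + (s i).1 + m i) *
      (PowerSeries.C (LinearMap.mulLeft ℂ (bet (F.D i) (F.x i) (F.y i) (m i) (p i) (s i).2 (s i).1)) *
        PowerSeries.C (F.E i ^ p i)))).prod = PowerSeries.X ^ (∑ i, (s i).1) *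
      ((F.lamProd fun i => (s i).2 + (s i).1 + m i) *
        (PowerSeries.C (LinearMap.mulLeft ℂ (∏ i, bet (F.D i) (F.x i) (F.y i) (m i) (p i)
          (s i).2 (s i).1)) * PowerSeries.C (listPow F.E p))) := by
    intro p s
    have hE : ∀ i j, i ≠ j → ∀ k r, Commute (PowerSeries.C (F.E i ^ k)) (F.lamSer j r) :=
      fun i j h k r => commute_C_mk fun K => (F.commute_E_lamOp h K r).pow_left k
    have hL : ∀ i j, i ≠ j → ∀ m p t u r, Commute (PowerSeries.C (LinearMap.mulLeft ℂ
        (bet (F.D i) (F.x i) (F.y i) m p t u))) (F.lamSer j r) :=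
      fun i j h m p t u r => commute_C_mk fun K =>
        F.commute_mulLeft_lamOp h (F.bet_mem_loc i _ _ _ _) K r
    have hX : ∀ (A : PowerSeries (Module.End ℂ R)) k, Commute A (PowerSeries.X ^ k) :=
      fun A k => (PowerSeries.commute_X A).pow_right k
    have hEL : ∀ i j, i ≠ j → ∀ k m p t u, Commute (PowerSeries.C (F.E i ^ k))
        (PowerSeries.C (LinearMap.mulLeft ℂ (bet (F.D j) (F.x j) (F.y j) m p t u))) :=
      fun i j h k m p t u =>
        ((F.commute_E_mulLeft h (F.bet_mem_loc j m p t u)).pow_left k).map PowerSeries.C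
    rw [listProd_mul (List.nodup_finRange n) fun i j _ => hX _ _,
      listProd_mul (List.nodup_finRange n) fun i j h => (hL i j h _ _ _ _ _).mul_left (hE i j h _ _),
      listProd_mul (List.nodup_finRange n) fun i j h => hEL i j h _ _ _ _ _,
      listProd_pow, ← Fin.sum_univ_def, ← listProd_mulLeft, map_list_prod, listPow, map_list_prod,
      List.map_map, List.map_map]
    rfl
  rw [coreProd]
  simp only [coreSer]
  rw [listProd_sum]
  simp only [listProd_sum]
  rw [map_sum, LinearMap.sum_apply]
  refine Finset.sum_congr rfl fun p _ => ?_
  rw [map_sum, LinearMap.sum_apply]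
  refine Finset.sum_congr rfl fun s _ => ?_
  rw [h1, PowerSeries.coeff_X_pow_mul', ← mul_assoc (F.lamProd _)]
  split_ifs
  · rw [PowerSeries.coeff_mul_C, PowerSeries.coeff_mul_C]
    rfl
  · rfl

/-- The vertex factors and the Taylor expansion of the shift of `g`, expanded in powers of `ħ` and of
the `u_i`, with the coefficients `bet`. -/
theorem prod_vertexCorr_mul_tau (m : Fin n → ℕ) (g : R) :
    (∏ i, jet M (F.vertexCorr i)) * ((∏ i, F.omJ M i ^ m i) * F.tau M g) =
      ∑ p ∈ Fintype.piFinset fun _ : Fin n => Finset.range (M + 1),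
        ∑ s ∈ Fintype.piFinset fun _ : Fin n => termIdx M,
          jet M (PowerSeries.X ^ (∑ i, (s i).1) * PowerSeries.C (MvPolynomial.monomial
            (Finsupp.equivFunOnFinite.symm fun i => (s i).2 + (s i).1 + m i)
              ((∏ i, bet (F.D i) (F.x i) (F.y i) (m i) (p i) (s i).2 (s i).1) *
                listPow F.E p g))) := by
  have h0 : ∀ i p, jet M (F.vertexCorr i) * F.omJ M i ^ m i *
      ((p.factorial : ℂ)⁻¹ • F.tJ M i ^ p) = ∑ s ∈ termIdx M, hbar M _ ^ s.1 *
        (uJ M R i ^ (s.2 + s.1 + m i) *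
          cJet M n R (bet (F.D i) (F.x i) (F.y i) (m i) p s.2 s.1)) := by
    intro i p
    rw [vertexCorr_mul, termIdx, Finset.sum_sigma]
  have h1 : ∀ p : Fin n → ℕ, (∏ i, jet M (F.vertexCorr i)) * ((∏ i, F.omJ M i ^ m i) *
      ((∏ i, ((p i).factorial : ℂ)⁻¹ • F.tJ M i ^ p i) * cJet M n R (listPow F.E p g))) =
      ∑ s ∈ Fintype.piFinset fun _ : Fin n => termIdx M, (∏ i, hbar M _ ^ (s i).1 *
        (uJ M R i ^ ((s i).2 + (s i).1 + m i) *
          cJet M n R (bet (F.D i) (F.x i) (F.y i) (m i) (p i) (s i).2 (s i).1))) *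
        cJet M n R (listPow F.E p g) := by
    intro p
    rw [← Finset.sum_mul, ← mul_assoc, ← mul_assoc, ← Finset.prod_mul_distrib,
      ← Finset.prod_mul_distrib, Finset.prod_congr rfl fun i _ => h0 i (p i), Finset.prod_univ_sum]
  rw [tau_apply, shift_eq_sum_piFinset _ _ _ (F.tJ_pow M), Finset.mul_sum, Finset.mul_sum]
  refine Finset.sum_congr rfl fun p _ => ?_
  rw [AlgHom.toLinearMap_apply]
  refine (h1 p).trans (Finset.sum_congr rfl fun s _ => ?_)
  rw [MvPolynomial.monomial_eq, Finsupp.prod_fintype _ _ (by simp), map_mul (jet M),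
    map_mul (PowerSeries.C (R := MvPolynomial (Fin n) R)), map_mul (jet M), map_prod, map_prod,
    ← cJet_apply, map_mul (cJet M n R), map_prod (cJet M n R), Finset.prod_mul_distrib,
    Finset.prod_mul_distrib, Finset.prod_pow_eq_pow_sum, map_pow (jet M)]
  have h2 : ∀ (i : Fin n) (k : ℕ), jet M (PowerSeries.C (MvPolynomial.X (R := R) i ^ k)) = uJ M R i ^ k := by
    intro i k
    rw [map_pow, map_pow, uJ]
  simp only [h2, Finsupp.equivFunOnFinite_symm_apply_apply]
  ring

/-- The universal formula in terms of the integrand of the simple one. -/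
theorem univ_eq {Iu Is : PowerSeries (MvPolynomial (Fin n) R)}
    (h : jet M Iu = (∏ i, jet M (F.vertexCorr i)) * F.Psi M Is) :
    F.univ M Iu = ∑ K ∈ Finset.range (M + 1), ∑ m ∈ (PowerSeries.coeff K Is).support,
      PowerSeries.coeff (M - K) (F.coreProd M m)
        (MvPolynomial.coeff m (PowerSeries.coeff K Is)) := by
  have h1 : ∀ P : MvPolynomial (Fin n) R,
      (∏ i, jet M (F.vertexCorr i)) * MvPolynomial.eval₂Hom
        (F.tau M : R →+* Jet M (MvPolynomial (Fin n) R)) (F.omJ M) P =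
      ∑ m ∈ P.support, (∏ i, jet M (F.vertexCorr i)) * ((∏ i, F.omJ M i ^ m i) *
        F.tau M (MvPolynomial.coeff m P)) := by
    intro P
    rw [MvPolynomial.coe_eval₂Hom, MvPolynomial.eval₂_eq', Finset.mul_sum]
    refine Finset.sum_congr rfl fun m _ => ?_
    rw [mul_comm (∏ i, F.omJ M i ^ m i)]
    rfl
  have h2 : jet M Iu = jet M (∑ K ∈ Finset.range (M + 1), ∑ m ∈ (PowerSeries.coeff K Is).support,
      ∑ p ∈ Fintype.piFinset fun _ : Fin n => Finset.range (M + 1),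
        ∑ s ∈ Fintype.piFinset fun _ : Fin n => termIdx M,
          PowerSeries.X ^ (K + ∑ i, (s i).1) * PowerSeries.C (MvPolynomial.monomial
            (Finsupp.equivFunOnFinite.symm fun i => (s i).2 + (s i).1 + m i)
              ((∏ i, bet (F.D i) (F.x i) (F.y i) (m i) (p i) (s i).2 (s i).1) *
                listPow F.E p (MvPolynomial.coeff m (PowerSeries.coeff K Is))))) := by
    rw [h, Psi, jetExt_apply, Finset.mul_sum, map_sum]
    refine Finset.sum_congr rfl fun K _ => ?_
    rw [mul_left_comm, h1, Finset.mul_sum, map_sum]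
    refine Finset.sum_congr rfl fun m _ => ?_
    rw [prod_vertexCorr_mul_tau, Finset.mul_sum, map_sum]
    refine Finset.sum_congr rfl fun p _ => ?_
    rw [Finset.mul_sum, map_sum]
    refine Finset.sum_congr rfl fun s _ => ?_
    rw [pow_add, mul_assoc, map_mul (jet M) (PowerSeries.X ^ K), map_pow]
  rw [F.univ_congr M h2, univ_sum]
  refine Finset.sum_congr rfl fun K hK => ?_
  rw [univ_sum]
  refine Finset.sum_congr rfl fun m _ => ?_
  rw [univ_sum, coeff_coreProd_apply]
  refine Finset.sum_congr rfl fun p _ => ?_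
  rw [univ_sum]
  refine Finset.sum_congr rfl fun s _ => ?_
  rw [univ_monomial]
  have hK' : K ≤ M := Nat.lt_succ_iff.1 (Finset.mem_range.1 hK)
  rw [Nat.sub_sub]
  exact if_congr (by omega) rfl rfl

end Frame

end Universal

section UniversalSimple

variable {R : Type*} [CommRing R] [Algebra ℂ R] {n : ℕ}

/-- A product of series that are constant up to order `M` is constant up to order `M`. -/
theorem coeff_listProd_eq {A ι : Type*} [Ring A] {f : ι → PowerSeries A} {c : ι → A} {M : ℕ}
    (h : ∀ i, ∀ K ≤ M, PowerSeries.coeff K (f i) = if K = 0 then c i else 0) (l : List ι) :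
    ∀ L ≤ M, PowerSeries.coeff L (l.map f).prod = if L = 0 then (l.map c).prod else 0 := by
  induction l with
  | nil =>
    intro L _
    rw [List.map_nil, List.prod_nil, PowerSeries.coeff_one]
    rfl
  | cons i l ih =>
    intro L hL
    rw [List.map_cons, List.prod_cons, PowerSeries.coeff_mul, List.map_cons, List.prod_cons]
    by_cases hL0 : L = 0
    · subst hL0
      rw [Finset.Nat.antidiagonal_zero, Finset.sum_singleton, h i 0 hL, ih 0 hL, if_pos rfl,
        if_pos rfl, if_pos rfl]
    · rw [if_neg hL0]
      refine Finset.sum_eq_zero fun p hp => ?_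
      rw [Finset.HasAntidiagonal.mem_antidiagonal] at hp
      rw [h i _ (by omega), ih _ (by omega)]
      by_cases hp1 : p.1 = 0
      · rw [if_neg (show p.2 ≠ 0 by omega), mul_zero]
      · rw [if_neg hp1, zero_mul]

/-- The index `(1, …, 1)`. -/
def oneIdx (n : ℕ) : Fin n →₀ ℕ := Finsupp.equivFunOnFinite.symm fun _ => 1

theorem oneIdx_apply (i : Fin n) : oneIdx n i = 1 := rfl

/-- A finite sum over multi-indices whose terms vanish at all nonzero indices with a zero entry. -/
theorem finsum_split {B : Type*} [AddCommMonoid B] (hn : 1 ≤ n) {f : (Fin n →₀ ℕ) → B}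
    (hf : (Function.support f).Finite) (h : ∀ m, f m ≠ 0 → m = 0 ∨ ∀ i, 1 ≤ m i) :
    ∑ᶠ m, f m = f 0 + ∑ᶠ k, f (k + oneIdx n) := by
  have h0 : (0 : Fin n →₀ ℕ) ∉ Set.range fun k => k + oneIdx n := by
    rintro ⟨k, hk⟩
    have := DFunLike.congr_fun hk ⟨0, hn⟩
    simp [oneIdx_apply] at this
  rw [← finsum_mem_univ, finsum_mem_inter_support_eq' f Set.univ
    (insert 0 (Set.range fun k => k + oneIdx n)), finsum_mem_insert' _ h0, finsum_mem_range]
  · exact add_left_injective _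
  · exact hf.subset Set.inter_subset_right
  · intro m hm
    simp only [Set.mem_univ, true_iff]
    rcases h m hm with rfl | hm
    · exact Set.mem_insert _ _
    · refine Set.mem_insert_of_mem _ ⟨m - oneIdx n, ?_⟩
      exact tsub_add_cancel_of_le fun i => hm i

namespace Frame

variable (F : Frame R n) (M : ℕ)

/-- The derivations `∂_y`. -/
def dY (i : Fin n) : Module.End ℂ R := derivY (F.D i) (F.dy i)

theorem commute_mulLeft_dY {i j : Fin n} (h : i ≠ j) {r : R} (hr : r ∈ F.loc i) :
    Commute (LinearMap.mulLeft ℂ r) (F.dY j) :=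
  (commute_mulLeft_mulLeft r _).mul_right (F.commute_E_mulLeft h.symm hr).symm

/-- The simple formula, as a functional of its inner part. -/
def simple (I : PowerSeries (MvPolynomial (Fin n) R)) : R :=
  ∑ᶠ k : Fin n →₀ ℕ, listPow F.dY k
    ((∏ i, (↑(F.dy i)⁻¹ : R)) * MvPolynomial.coeff (k + oneIdx n) (PowerSeries.coeff M I))

variable {M}

theorem coeff_coreProd_add_oneIdx (k : Fin n →₀ ℕ) {L : ℕ} (hL : L ≤ M) (g : R) :
    PowerSeries.coeff L (F.coreProd M ⇑(k + oneIdx n)) g =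
      if L = 0 then (∏ i, (F.y i : R)) * listPow F.dY k ((∏ i, (↑(F.dy i)⁻¹ : R)) * g) else 0 := by
  have h1 : ∀ i, ∀ K ≤ M, PowerSeries.coeff K (F.coreSer M i ((k + oneIdx n) i)) =
      if K = 0 then LinearMap.mulLeft ℂ (F.y i : R) * (F.dY i ^ k i *
        LinearMap.mulLeft ℂ (↑(F.dy i)⁻¹ : R)) else 0 := by
    intro i K hK
    rw [coeff_coreSer _ hK]
    refine LinearMap.ext fun g => ?_
    rw [coreT_of_pos (by rw [F.D_x, if_pos rfl]) (by rw [F.D_y, if_pos rfl])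
      (by simp [oneIdx_apply]) (Nat.lt_succ_of_le hK)]
    split_ifs
    · simp [oneIdx_apply, dY]
    · rfl
  have hp : ∀ i j, i ≠ j → ∀ r, Commute (LinearMap.mulLeft ℂ (↑(F.dy i)⁻¹ : R)) (F.dY j ^ r) :=
    fun i j h r => (F.commute_mulLeft_dY h (F.inv_mem_loc (F.dy_mem_loc i))).pow_right r
  rw [coreProd, coeff_listProd_eq h1 _ L hL]
  split_ifs
  · rw [listProd_mul (List.nodup_finRange n), listProd_mul (List.nodup_finRange n),
      listProd_mulLeft, listProd_mulLeft]
    · rfl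
    · exact fun i j h => hp i j h _
    · exact fun i j h => (((F.commute_mulLeft_dY h.symm (F.y_mem_loc j)).symm).pow_left _).mul_left
        (commute_mulLeft_mulLeft _ _)
  · rfl

theorem univ_eq_add (hn : 1 ≤ n) {Iu Is : PowerSeries (MvPolynomial (Fin n) R)}
    (h : jet M Iu = (∏ i, jet M (F.vertexCorr i)) * F.Psi M Is)
    (hs : ∀ K ≤ M, ∀ m, MvPolynomial.coeff m (PowerSeries.coeff K Is) ≠ 0 →
      m = 0 ∨ ∀ i, 1 ≤ m i) :
    F.univ M Iu = (∏ i, (F.y i : R)) * F.simple M Is + ∑ K ∈ Finset.range (M + 1),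
      PowerSeries.coeff (M - K) (F.coreProd M 0)
        (MvPolynomial.coeff 0 (PowerSeries.coeff K Is)) := by
  rw [F.univ_eq M h]
  have h1 : ∀ K ∈ Finset.range (M + 1), ∑ m ∈ (PowerSeries.coeff K Is).support,
      PowerSeries.coeff (M - K) (F.coreProd M m) (MvPolynomial.coeff m (PowerSeries.coeff K Is)) =
      PowerSeries.coeff (M - K) (F.coreProd M 0) (MvPolynomial.coeff 0 (PowerSeries.coeff K Is)) +
        if K = M then (∏ i, (F.y i : R)) * F.simple M Is else 0 := by
    intro K hK
    have hK' : K ≤ M := Nat.lt_succ_iff.1 (Finset.mem_range.1 hK)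
    rw [← finsum_apply_eq_sum (fun m => PowerSeries.coeff (M - K) (F.coreProd M m)),
      finsum_split hn (finite_support_apply _ _)]
    · congr 1
      simp only [F.coeff_coreProd_add_oneIdx _ (Nat.sub_le M K)]
      split_ifs with h1 h2 h2
      · subst h2
        have hfin : (Function.support fun k : Fin n →₀ ℕ => listPow F.dY k
            ((∏ i, (↑(F.dy i)⁻¹ : R)) * MvPolynomial.coeff (k + oneIdx n)
              (PowerSeries.coeff K Is))).Finite := by
          refine (((PowerSeries.coeff K Is).support.finite_toSet).preimage
            (add_left_injective (oneIdx n)).injOn).subset fun k hk => ?_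
          rw [Set.mem_preimage, Finset.mem_coe, MvPolynomial.mem_support_iff]
          intro h0
          rw [Function.mem_support, h0, mul_zero, map_zero] at hk
          exact hk rfl
        rw [simple]
        exact ((AddMonoidHom.mulLeft (∏ i, (F.y i : R))).map_finsum hfin).symm
      · omega
      · omega
      · exact finsum_zero
    · intro m hm
      refine hs K hK' m fun h0 => hm ?_
      rw [h0, map_zero]
  rw [Finset.sum_congr rfl h1, Finset.sum_add_distrib, Finset.sum_ite_eq', if_pos (by simp), add_comm]

/-- If every monomial of the integrand of the simple formula contains all variables, then the two
formulas agree. -/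
theorem univ_eq_of_pos (hn : 1 ≤ n) {Iu Is : PowerSeries (MvPolynomial (Fin n) R)}
    (h : jet M Iu = (∏ i, jet M (F.vertexCorr i)) * F.Psi M Is)
    (hs : ∀ K ≤ M, ∀ m, MvPolynomial.coeff m (PowerSeries.coeff K Is) ≠ 0 → ∀ i, 1 ≤ m i) :
    F.univ M Iu = (∏ i, (F.y i : R)) * F.simple M Is := by
  rw [F.univ_eq_add hn h fun K hK m hm => Or.inr (hs K hK m hm), Finset.sum_eq_zero, add_zero]
  intro K hK
  rw [not_not.1 fun h0 => absurd (hs K (Nat.lt_succ_iff.1 (Finset.mem_range.1 hK)) 0 h0 ⟨0, hn⟩)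
    (by simp), map_zero]

end Frame

/-- The two formulas differ by the regularization if the constant term of the integrand is `1`. -/
theorem Frame.univ_eq_of_one (F : Frame R 1) {M : ℕ} (hM : M ≠ 1)
    {Iu Is : PowerSeries (MvPolynomial (Fin 1) R)}
    (h : jet M Iu = (∏ i, jet M (F.vertexCorr i)) * F.Psi M Is)
    (hs : ∀ K, MvPolynomial.coeff 0 (PowerSeries.coeff K Is) = if K = 0 then 1 else 0) :
    F.univ M Iu + opT (F.yE 0) ((ell M).divX.map (algebraMap ℂ R))
      ((↑(F.x 0)⁻¹ * ↑(F.y 0)⁻¹ : R) ^ M * -F.yE 0 (F.x 0 * F.y 0)) =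
        (∏ i, (F.y i : R)) * F.simple M Is := by
  rw [F.univ_eq_add le_rfl h, Finset.sum_eq_single 0]
  · rw [hs, if_pos rfl, Nat.sub_zero, Frame.coreProd, List.finRange_succ, List.finRange_zero]
    simp only [List.map_cons, List.map_nil, List.prod_cons, List.prod_nil, mul_one, Pi.zero_apply]
    rw [F.coeff_coreSer le_rfl, coreT_zero (by rw [F.D_x, if_pos rfl]) (by rw [F.D_y, if_pos rfl]) hM
      (Nat.lt_succ_self M), add_assoc]
    exact (congrArg _ (neg_add_cancel _)).trans (add_zero _)
  · intro K _ hK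
    rw [hs, if_neg hK, map_zero]
  · simp
  · intro K _ m _
    by_cases h0 : m 0 = 0
    · left
      refine Finsupp.ext fun i => ?_
      rw [Subsingleton.elim i 0, h0, Finsupp.coe_zero, Pi.zero_apply]
    · right
      intro i
      rw [Subsingleton.elim i 0]
      omega

end UniversalSimple

/-! ### The universal formula for coefficients in an algebra -/

section Outer

variable {R : Type*} [CommRing R] [Algebra ℂ R] {n : ℕ}

namespace Frame

variable (F : Frame R n)

/-- The sum `∑_k ∏_i (- y_i ∂_{y_i}) ^ (k i) [∏_i v_i ^ (k i)] P`. -/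
def transfer (P : MvPolynomial (Fin n) R) : R :=
  ∑ᶠ k : Fin n →₀ ℕ, listPow (fun i => -F.yE i) k (MvPolynomial.coeff k P)

theorem transfer_add (P Q : MvPolynomial (Fin n) R) :
    F.transfer (P + Q) = F.transfer P + F.transfer Q := by
  rw [transfer, transfer, transfer,
    ← finsum_add_distrib (finite_support_apply _ P) (finite_support_apply _ Q)]
  simp only [map_add, MvPolynomial.coeff_add]

/-- The additive form of `transfer`. -/
def transferHom : MvPolynomial (Fin n) R →+ R := AddMonoidHom.mk' F.transfer F.transfer_add

theorem transferHom_apply (P : MvPolynomial (Fin n) R) : F.transferHom P = F.transfer P := rfl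

theorem transfer_monomial (k : Fin n →₀ ℕ) (r : R) :
    F.transfer (MvPolynomial.monomial k r) = listPow (fun i => -F.yE i) k r := by
  rw [transfer, finsum_eq_single _ k]
  · rw [MvPolynomial.coeff_monomial, if_pos rfl]
  · intro t ht
    rw [MvPolynomial.coeff_monomial, if_neg (Ne.symm ht), map_zero]

theorem transfer_X_pow_mul (i : Fin n) (a : ℕ) (Q : MvPolynomial (Fin n) R) :
    F.transfer (MvPolynomial.X i ^ a * Q) = ((-F.yE i) ^ a) (F.transfer Q) := by
  induction Q using MvPolynomial.induction_on' with
  | add P Q hP hQ => rw [mul_add, transfer_add, transfer_add, hP, hQ, map_add]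
  | monomial k r =>
    rw [MvPolynomial.X_pow_eq_monomial, MvPolynomial.monomial_mul, one_mul, transfer_monomial,
      transfer_monomial, Finsupp.coe_add, listPow_add fun i j =>
        ((F.commute_yE i j).neg_left).neg_right, Finsupp.single_eq_pi_single, listPow_single]
    rfl

theorem transfer_aeval_mul (i : Fin n) (q : Polynomial ℂ) (Q : MvPolynomial (Fin n) R) :
    F.transfer (Polynomial.aeval (MvPolynomial.X i) q * Q) =
      Polynomial.aeval (-F.yE i) q (F.transfer Q) := by
  induction q using Polynomial.induction_on' with
  | add P Q hP hQ => rw [map_add, add_mul, transfer_add, hP, hQ, map_add, LinearMap.add_apply]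
  | monomial k c =>
    have hc : ∀ P : MvPolynomial (Fin n) R, F.transfer (algebraMap ℂ _ c * P) = c • F.transfer P := by
      intro P
      rw [transfer, transfer, smul_finsum' _ (finite_support_apply _ P)]
      refine finsum_congr fun k => ?_
      rw [← Algebra.smul_def, MvPolynomial.coeff_smul, map_smul]
    rw [Polynomial.aeval_monomial, Polynomial.aeval_monomial, mul_assoc, hc, transfer_X_pow_mul,
      Module.End.mul_apply, Module.algebraMap_end_apply]

/-- The series `(∂_θ + v / θ) ^ r exp (⋯)` at `v = v_i` and `θ = x_i y_i`. -/
def serLT (i : Fin n) (r : ℕ) : PowerSeries (MvPolynomial (Fin n) R) :=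
  PowerSeries.mk fun K => MvPolynomial.C ((↑(F.x i)⁻¹ * ↑(F.y i)⁻¹ : R) ^ (K + r)) *
    Polynomial.aeval (MvPolynomial.X i) (ell K * fallFrom K r)

/-- The prefactors `- (y_i / dy_i) (dx_i / x_i)`. -/
def pre (i : Fin n) : R := (F.y i * ↑(F.dy i)⁻¹ : R) * -↑(F.x i)⁻¹

/-- The outer part of the universal formula. -/
def outer (I : PowerSeries (MvPolynomial (Fin n) R)) : PowerSeries (MvPolynomial (Fin n) R) :=
  (∏ i, PowerSeries.C (MvPolynomial.C (F.pre i))) *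
    PowerSeries.mk fun N => ∑ p ∈ Finset.HasAntidiagonal.antidiagonal N, ∑ᶠ r : Fin n →₀ ℕ,
      PowerSeries.coeff p.1 (∏ i, F.serLT i (r i)) *
        MvPolynomial.C (coeffDiv (PowerSeries.coeff p.2 I) r)

theorem pre_mem_loc (i : Fin n) : F.pre i ∈ F.loc i :=
  mul_mem (mul_mem (F.y_mem_loc i) (F.inv_mem_loc (F.dy_mem_loc i)))
    (neg_mem (F.inv_mem_loc (F.x_mem_loc i)))

theorem transfer_listProd (r : Fin n → ℕ) {l : List (Fin n)} (hl : l.Nodup) (K : ℕ) (f : R) :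
    F.transfer (PowerSeries.coeff K (l.map fun i => PowerSeries.C (MvPolynomial.C (F.pre i)) *
      F.serLT i (r i)).prod * MvPolynomial.C f) =
        PowerSeries.coeff K (l.map fun i => F.lamSer i (r i + 1)).prod f := by
  induction l generalizing K f with
  | nil =>
    rw [List.map_nil, List.map_nil, List.prod_nil, List.prod_nil, PowerSeries.coeff_one,
      PowerSeries.coeff_one]
    split_ifs
    · rw [one_mul, MvPolynomial.C_apply, transfer_monomial, Finsupp.coe_zero, listPow_zero]
    · rw [zero_mul, LinearMap.zero_apply]
      exact map_zero F.transferHom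
  | cons i l ih =>
    rw [List.nodup_cons] at hl
    rw [List.map_cons, List.prod_cons, List.map_cons, List.prod_cons, PowerSeries.coeff_mul,
      PowerSeries.coeff_mul, Finset.sum_mul, ← transferHom_apply, map_sum, LinearMap.sum_apply]
    refine Finset.sum_congr rfl fun p _ => ?_
    obtain ⟨a, ha⟩ : ∃ a : R, a = F.pre i * (↑(F.x i)⁻¹ * ↑(F.y i)⁻¹ : R) ^ (p.1 + r i) := ⟨_, rfl⟩
    have haL : a ∈ F.loc i := ha ▸ mul_mem (F.pre_mem_loc i) (pow_mem (mul_mem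
      (F.inv_mem_loc (F.x_mem_loc i)) (F.inv_mem_loc (F.y_mem_loc i))) _)
    have hc : Commute (LinearMap.mulLeft ℂ a)
        (PowerSeries.coeff p.2 (l.map fun i => F.lamSer i (r i + 1)).prod) := by
      have h1 : Commute (PowerSeries.C (LinearMap.mulLeft ℂ a))
          (l.map fun i => F.lamSer i (r i + 1)).prod := by
        refine Commute.list_prod_right _ _ fun A hA => ?_
        obtain ⟨j, hj, rfl⟩ := List.mem_map.1 hA
        have hij : i ≠ j := by
          rintro rfl
          exact hl.1 hj
        exact commute_C_mk fun K => F.commute_mulLeft_lamOp hij haL K _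
      have h2 := congrArg (PowerSeries.coeff p.2) h1.eq
      rwa [PowerSeries.coeff_C_mul, PowerSeries.coeff_mul_C] at h2
    have e1 : PowerSeries.coeff p.1 (PowerSeries.C (MvPolynomial.C (F.pre i)) * F.serLT i (r i)) =
        Polynomial.aeval (MvPolynomial.X i) (ell p.1 * fallFrom p.1 (r i)) * MvPolynomial.C a := by
      rw [PowerSeries.coeff_C_mul, serLT, PowerSeries.coeff_mk, ha, MvPolynomial.C_mul]
      ring
    have e2 : PowerSeries.coeff p.1 (F.lamSer i (r i + 1)) =
        Polynomial.aeval (-F.yE i) (ell p.1 * fallFrom p.1 (r i)) * LinearMap.mulLeft ℂ a := by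
      rw [lamSer, PowerSeries.coeff_mk, lamOp_eq, if_neg (Nat.succ_ne_zero _), Nat.add_sub_cancel]
      exact congrArg (fun z => _ * LinearMap.mulLeft ℂ z) (by rw [ha, pre]; ring)
    rw [transferHom_apply, e1, e2, mul_assoc, mul_assoc, transfer_aeval_mul, mul_left_comm,
      ← MvPolynomial.C_mul, ih hl.2, mul_assoc (Polynomial.aeval _ _), hc.eq]
    rfl

theorem transfer_prod (r : Fin n → ℕ) (K : ℕ) (f : R) :
    F.transfer (MvPolynomial.C (∏ i, F.pre i) * (PowerSeries.coeff K (∏ i, F.serLT i (r i)) *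
      MvPolynomial.C f)) = PowerSeries.coeff K (F.lamProd fun i => r i + 1) f := by
  rw [lamProd, ← F.transfer_listProd r (List.nodup_finRange n), ← Fin.prod_univ_def,
    Finset.prod_mul_distrib, ← map_prod, ← map_prod, PowerSeries.coeff_C_mul, mul_assoc]

theorem lamProd_eq_zero {s : Fin n → ℕ} {i : Fin n} (h : s i = 0) : F.lamProd s = 0 := by
  have : F.lamSer i 0 = 0 := by
    ext1 K
    rw [lamSer, PowerSeries.coeff_mk, lamOp_eq, if_pos rfl, map_zero]
  rw [lamProd]
  refine List.prod_eq_zero (List.mem_map.2 ⟨i, List.mem_finRange i, ?_⟩)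
  rw [h, this]

theorem finite_support_coeffDiv {R : Type*} [CommRing R] (P : MvPolynomial (Fin n) R) :
    (Function.support (coeffDiv P)).Finite := by
  refine ((P.support.finite_toSet).preimage (add_left_injective (oneIdx n)).injOn).subset
    fun k hk => ?_
  rw [Set.mem_preimage, Finset.mem_coe, MvPolynomial.mem_support_iff]
  exact hk

/-- The universal formula acts on the coefficient of `∏_i u_i ^ (r i + 1)` by a product of one
operator for each variable. -/
theorem transfer_outer (hn : 1 ≤ n) (M : ℕ) (I : PowerSeries (MvPolynomial (Fin n) R)) :
    F.transfer (PowerSeries.coeff M (F.outer I)) = F.univ M I := by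
  have h1 : ∀ (A : (Fin n →₀ ℕ) → MvPolynomial (Fin n) R) (P : MvPolynomial (Fin n) R),
      (Function.support fun r => A r * MvPolynomial.C (coeffDiv P r)).Finite := by
    intro A P
    refine (finite_support_coeffDiv P).subset fun r hr => ?_
    intro h
    rw [Function.mem_support, h, map_zero, mul_zero] at hr
    exact hr rfl
  rw [outer, ← map_prod, ← map_prod, PowerSeries.coeff_C_mul, PowerSeries.coeff_mk, Finset.mul_sum,
    ← transferHom_apply, map_sum, ← Finset.Nat.sum_antidiagonal_swap,
    Finset.Nat.sum_antidiagonal_eq_sum_range_succ_mk, univ]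
  refine Finset.sum_congr rfl fun K _ => ?_
  rw [Prod.fst_swap, Prod.snd_swap]
  change (F.transferHom.comp (AddMonoidHom.mulLeft (MvPolynomial.C (∏ i, F.pre i)))) _ = _
  rw [AddMonoidHom.map_finsum _ (h1 _ _), finsum_split hn (finite_support_apply _ _)]
  · have h0 : F.lamProd ⇑(0 : Fin n →₀ ℕ) = 0 := F.lamProd_eq_zero (i := ⟨0, hn⟩) rfl
    rw [h0, map_zero, LinearMap.zero_apply, zero_add]
    refine finsum_congr fun r => ?_
    exact F.transfer_prod r _ _
  · intro m hm
    right
    intro i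
    by_contra h
    refine hm ?_
    rw [F.lamProd_eq_zero (i := i) (by omega), map_zero, LinearMap.zero_apply]

end Frame

end Outer

/-! ### The integrands attached to a graph -/

section Divisibility

variable {A : Type*} [CommRing A]

theorem C_dvd_of_coeff {a : A} {f : PowerSeries A} (h : ∀ N, a ∣ PowerSeries.coeff N f) :
    PowerSeries.C a ∣ f := by
  choose g hg using h
  refine ⟨PowerSeries.mk g, ?_⟩
  ext1 N
  rw [PowerSeries.coeff_C_mul, PowerSeries.coeff_mk, hg]

theorem dvd_coeff_of_C_dvd {a : A} {f : PowerSeries A} (h : PowerSeries.C a ∣ f) (N : ℕ) :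
    a ∣ PowerSeries.coeff N f := by
  obtain ⟨g, rfl⟩ := h
  rw [PowerSeries.coeff_C_mul]
  exact dvd_mul_right _ _

/-- Monomials of a multiple of `X i` contain `X i`. -/
theorem one_le_of_X_dvd {n : ℕ} {R : Type*} [CommRing R] {i : Fin n} {P : MvPolynomial (Fin n) R}
    (h : MvPolynomial.X i ∣ P) {m : Fin n →₀ ℕ} (hm : MvPolynomial.coeff m P ≠ 0) : 1 ≤ m i := by
  obtain ⟨Q, rfl⟩ := h
  rw [MvPolynomial.coeff_X_mul'] at hm
  by_contra h0
  refine hm (if_neg ?_)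
  rw [Finsupp.mem_support_iff]
  omega

end Divisibility

section Factors

variable {B R : Type*} [CommRing B] [Algebra ℂ B] [CommRing R] [Algebra ℂ R] {k n : ℕ}

theorem X_dvd_edgeSer (e : Fin k → Fin n) (pull : B →ₗ[ℂ] R) (E : Fin k → Module.End ℂ B)
    (H : ℕ → B) (j : Fin k) :
    PowerSeries.C (MvPolynomial.X (e j)) ∣ edgeSer e pull E H := by
  refine C_dvd_of_coeff fun N => ?_
  rw [edgeSer, PowerSeries.coeff_mk]
  refine Finset.dvd_sum fun p _ => Finset.dvd_sum fun a _ => Dvd.dvd.mul_right ?_ _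
  refine dvd_trans (dvd_pow_self _ (Nat.succ_ne_zero (a j))) (Finset.dvd_prod_of_mem
    (fun j => (MvPolynomial.X (e j) : MvPolynomial (Fin n) R) ^ (a j + 1)) (Finset.mem_univ j))

/-- The factor of a multiedge with one leg. -/
theorem edgeSer_one (i : Fin n) (pull : B →ₗ[ℂ] R) (E : Fin 1 → Module.End ℂ B)
    (E' : Module.End ℂ R) (hE : ∀ h, pull (E 0 h) = E' (pull h)) (H : ℕ → B) :
    edgeSer (fun _ => i) pull E H = PowerSeries.C (MvPolynomial.X i) * PowerSeries.mk fun N =>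
      ∑ p ∈ Finset.HasAntidiagonal.antidiagonal N, MvPolynomial.monomial (Finsupp.single i p.1)
        (PowerSeries.coeff p.1 calS • (E' ^ p.1) (PowerSeries.coeff p.2 (genusSeries fun g => pull (H g)))) := by
  have h1 : ∀ a h, pull ((E 0 ^ a) h) = (E' ^ a) (pull h) := by
    intro a
    induction a with
    | zero => intro h; rfl
    | succ a ih => intro h; rw [pow_succ, pow_succ, Module.End.mul_apply, Module.End.mul_apply, ih, hE]
  have h2 : ∀ N, PowerSeries.coeff N (genusSeries fun g => pull (H g)) =
      pull (PowerSeries.coeff N (genusSeries H)) := by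
    intro N
    rw [genusSeries, genusSeries, PowerSeries.coeff_mk, PowerSeries.coeff_mk]
    split_ifs <;> simp
  ext1 N
  rw [PowerSeries.coeff_C_mul, edgeSer, PowerSeries.coeff_mk, PowerSeries.coeff_mk, Finset.mul_sum]
  refine Finset.sum_congr rfl fun p _ => ?_
  rw [Finset.sum_eq_single fun _ => p.1]
  · rw [Fin.prod_univ_one, Fin.prod_univ_one, h2, ← h1, pow_succ', mul_assoc]
    congr 1
    rw [MvPolynomial.X_pow_eq_monomial, mul_comm, MvPolynomial.C_mul_monomial, mul_one, listPow,
      List.finRange_succ, List.finRange_zero]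
    simp
  · intro a ha ha'
    refine absurd ?_ ha'
    rw [Finset.mem_piAntidiag] at ha
    funext j
    rw [Subsingleton.elim j 0, ← ha.1]
    simp
  · intro h
    refine absurd ?_ h
    rw [Finset.mem_piAntidiag]
    simp

end Factors

/-- The functions attached to the vertices and to the multiedges of a graph, in algebras of functions
of one variable for each leg, together with their restrictions to the diagonals. -/
structure GraphData {R : Type*} [CommRing R] [Algebra ℂ R] {n : ℕ} (F : Frame R n)
    (Γ : MultiGraph n) where
  B : ∀ k : ℕ, (Fin k → Fin n) → Type
  [ring : ∀ k e, CommRing (B k e)]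
  [alg : ∀ k e, Algebra ℂ (B k e)]
  frame : ∀ k e, Frame (B k e) k
  hom : ∀ k e, FrameHom F (frame k e) e
  one : ∀ i : Fin n, ℕ → B 1 fun _ => i
  one_zero : ∀ i, one i 0 = -(frame 1 fun _ => i).y 0
  edge : ∀ e : Fin Γ.numEdges, ℕ → B (Γ.index e) (Γ.attach e)

attribute [instance] GraphData.ring GraphData.alg

namespace GraphData

variable {R : Type*} [CommRing R] [Algebra ℂ R] {n : ℕ} {F : Frame R n} {Γ : MultiGraph n}
  (d : GraphData F Γ)

/-- The factor of a multiedge in the simple formula. -/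
def edgeS (e : Fin Γ.numEdges) : PowerSeries (MvPolynomial (Fin n) R) :=
  edgeSer (Γ.attach e) (d.hom _ (Γ.attach e)).pull.toLinearMap (d.frame _ (Γ.attach e)).E (d.edge e)

/-- The factor of a multiedge in the universal formula. -/
def edgeU (e : Fin Γ.numEdges) : PowerSeries (MvPolynomial (Fin n) R) :=
  edgeSer (Γ.attach e) (d.hom _ (Γ.attach e)).pull.toLinearMap (d.frame _ (Γ.attach e)).xE
    fun g => (∏ j, -((d.frame _ (Γ.attach e)).x j : d.B _ (Γ.attach e))) * d.edge e g

/-- The integrand of the simple formula. -/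
def innerS : PowerSeries (MvPolynomial (Fin n) R) :=
  PowerSeries.X ^ (2 * Γ.betti) *
    (∏ i, expHbar (vertexS F (d.hom 1 fun _ => i) (d.one i))) * ∏ e, d.edgeS e

/-- The integrand of the universal formula. -/
def innerU : PowerSeries (MvPolynomial (Fin n) R) :=
  PowerSeries.X ^ (2 * Γ.betti) *
    (∏ i, iota i (PowerSeries.map (algebraMap ℂ R) calS⁻¹) *
      expHbar (vertexU F (d.hom 1 fun _ => i) (d.one i))) * ∏ e, d.edgeU e

/-- The integrands of the two formulas correspond to each other under `Psi`, up to the factors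
`vertexCorr`. -/
theorem jet_innerU (M : ℕ) :
    jet M d.innerU = (∏ i, jet M (F.vertexCorr i)) * F.Psi M d.innerS := by
  have h1 : ∀ i, jet M (iota i (PowerSeries.map (algebraMap ℂ R) calS⁻¹) *
      expHbar (vertexU F (d.hom 1 fun _ => i) (d.one i))) = jet M (F.vertexCorr i) *
        F.Psi M (expHbar (vertexS F (d.hom 1 fun _ => i) (d.one i))) :=
    fun i => jet_expHbar_vertexU M _ (d.one_zero i)
  have h2 : ∀ e, F.Psi M (d.edgeS e) = jet M (d.edgeU e) := fun e => Psi_edgeSer _ _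
  have h3 : F.Psi M (PowerSeries.X ^ (2 * Γ.betti)) = jet M (PowerSeries.X ^ (2 * Γ.betti)) := by
    rw [Frame.Psi, jetExt_X_pow, map_pow]
  rw [innerU, innerS, map_mul (jet M), map_mul (jet M), map_mul (F.Psi M), map_mul (F.Psi M),
    map_prod (jet M), map_prod (jet M), map_prod (F.Psi M), map_prod (F.Psi M), h3,
    Finset.prod_congr rfl fun i _ => h1 i, Finset.prod_congr rfl fun e _ => h2 e,
    Finset.prod_mul_distrib]
  ring

/-- A graph with a leg at every vertex contributes the same to both formulas. -/
theorem univ_innerU (hn : 1 ≤ n) (M : ℕ) (hΓ : ∀ i, ∃ j, Γ.vertexOf j = i) :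
    F.univ M d.innerU = (∏ i, (F.y i : R)) * F.simple M d.innerS := by
  refine F.univ_eq_of_pos hn (d.jet_innerU M) fun K _ m hm i => ?_
  obtain ⟨j, rfl⟩ := hΓ i
  refine one_le_of_X_dvd (dvd_coeff_of_C_dvd (Dvd.dvd.mul_left ?_ _) K) hm
  refine dvd_trans ?_ (Finset.dvd_prod_of_mem _ (Finset.mem_univ (Γ.edgeOf j)))
  have h := X_dvd_edgeSer (Γ.attach (Γ.edgeOf j)) (d.hom _ (Γ.attach (Γ.edgeOf j))).pull.toLinearMap
    (d.frame _ (Γ.attach (Γ.edgeOf j))).E (d.edge (Γ.edgeOf j)) (Fintype.equivFin _ ⟨j, rfl⟩)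
  have h1 : Γ.attach (Γ.edgeOf j) (Fintype.equivFin _ ⟨j, rfl⟩) = Γ.vertexOf j := by
    exact congrArg (fun z : {l // Γ.edgeOf l = Γ.edgeOf j} => Γ.vertexOf z.val) (Equiv.symm_apply_apply _ _)
  rwa [h1] at h

theorem coeff_zero_expHbar {i : Fin n} {f : PowerSeries (MvPolynomial (Fin n) R)}
    (h : PowerSeries.C (MvPolynomial.X i) ∣ f) (K : ℕ) :
    MvPolynomial.coeff 0 (PowerSeries.coeff K (expHbar f)) = if K = 0 then 1 else 0 := by
  rw [expHbar, PowerSeries.coeff_mk, MvPolynomial.coeff_sum, Finset.sum_eq_single 0]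
  · rw [pow_zero, PowerSeries.coeff_one, Nat.factorial_zero, Nat.cast_one, inv_one, one_smul]
    split_ifs <;> simp
  · intro j _ hj
    rw [MvPolynomial.coeff_smul]
    have h1 : MvPolynomial.coeff 0 (PowerSeries.coeff K (f ^ j)) = 0 := by
      by_contra h0
      have := one_le_of_X_dvd (dvd_coeff_of_C_dvd (dvd_pow h hj) K) h0
      simp at this
    rw [h1, smul_zero]
  · simp

/-- For the graph without multiedges the contributions differ by the regularization. -/
theorem univ_innerU_add {F : Frame R 1} {Γ : MultiGraph 1} (d : GraphData F Γ) {M : ℕ}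
    (hM : M ≠ 1) (hΓ : Γ.numEdges = 0) :
    F.univ M d.innerU + opT (F.yE 0) ((ell M).divX.map (algebraMap ℂ R))
      ((↑(F.x 0)⁻¹ * ↑(F.y 0)⁻¹ : R) ^ M * -F.yE 0 (F.x 0 * F.y 0)) =
        (∏ i, (F.y i : R)) * F.simple M d.innerS := by
  refine F.univ_eq_of_one hM (d.jet_innerU M) fun K => ?_
  have hE : IsEmpty (Fin Γ.numEdges) := hΓ ▸ inferInstanceAs (IsEmpty (Fin 0))
  have hL : Γ.numLegs = 0 := by
    by_contra h
    exact hE.elim (Γ.edgeOf ⟨0, Nat.pos_of_ne_zero h⟩)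
  have hb : Γ.betti = 0 := by rw [MultiGraph.betti, hL, hΓ]
  rw [innerS, hb, mul_zero, pow_zero, one_mul, Fin.prod_univ_one, Finset.prod_of_isEmpty, mul_one]
  refine coeff_zero_expHbar (i := 0) (dvd_sub (X_dvd_edgeSer (fun _ => 0) _ _ _ 0) ?_) K
  rw [map_mul]
  exact dvd_mul_right _ _

end GraphData

/-! ### Germs of analytic functions -/

section Coordinates

variable {B R : Type*} [CommRing B] [Algebra ℂ B] [CommRing R] [Algebra ℂ R] {k n : ℕ}

/-- Commuting derivations `d i` along coordinates, together with functions `x i`, `y i` of the `i`-th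
coordinate that are invertible and have invertible derivatives `dx i`, `dy i`. -/
structure CoordFrame (R : Type*) [CommRing R] [Algebra ℂ R] (n : ℕ) where
  d : Fin n → Derivation ℂ R R
  comm : ∀ i j f, d i (d j f) = d j (d i f)
  x : Fin n → Rˣ
  y : Fin n → Rˣ
  dx : Fin n → Rˣ
  dy : Fin n → Rˣ
  d_x : ∀ i j, d i (x j) = if i = j then (dx j : R) else 0
  d_y : ∀ i j, d i (y j) = if i = j then (dy j : R) else 0

namespace CoordFrame

variable (F : CoordFrame R n)

theorem d_dx {i j : Fin n} (h : i ≠ j) : F.d i (F.dx j : R) = 0 := by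
  have h1 : (F.dx j : R) = F.d j (F.x j) := by rw [F.d_x, if_pos rfl]
  rw [h1, F.comm, F.d_x, if_neg h, map_zero]

theorem d_dx_inv {i j : Fin n} (h : i ≠ j) : F.d i (↑(F.dx j)⁻¹ : R) = 0 := by
  rw [Derivation.leibniz_of_mul_eq_one (F.d i) (F.dx j).inv_mul, F.d_dx h, smul_zero]

/-- The frame of the derivations `∂_{x i}`. -/
def toFrame : Frame R n where
  D i := (↑(F.dx i)⁻¹ : R) • F.d i
  comm i j f := by
    rcases eq_or_ne i j with rfl | h
    · rfl
    · simp only [Derivation.smul_apply, smul_eq_mul, Derivation.leibniz, F.d_dx_inv h,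
        F.d_dx_inv h.symm, mul_zero, add_zero, F.comm i j]
      ring
  x := F.x
  y := F.y
  dy i := (F.dx i)⁻¹ * F.dy i
  D_x i j := by
    rw [Derivation.smul_apply, F.d_x, smul_eq_mul]
    split_ifs with h
    · rw [h, Units.inv_mul]
    · rw [mul_zero]
  D_y i j := by
    rw [Derivation.smul_apply, F.d_y, smul_eq_mul]
    split_ifs with h
    · rw [h, Units.val_mul]
    · rw [mul_zero]

theorem toFrame_D (i : Fin n) (f : R) : F.toFrame.D i f = ↑(F.dx i)⁻¹ * F.d i f := rfl

/-- The restriction to a diagonal is compatible with frames. -/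
def toFrameHom {F : CoordFrame R n} {G : CoordFrame B k} {e : Fin k → Fin n} (pull : B →ₐ[ℂ] R)
    (pull_x : ∀ j, pull (G.x j : B) = (F.x (e j) : R))
    (pull_y : ∀ j, pull (G.y j : B) = (F.y (e j) : R))
    (d_pull : ∀ i h, F.d i (pull h) = ∑ j, if e j = i then pull (G.d j h) else 0) :
    FrameHom F.toFrame G.toFrame e where
  pull := pull
  pull_x := pull_x
  pull_y := pull_y
  D_pull i h := by
    have hx : ∀ j, pull (G.dx j : B) = (F.dx (e j) : R) := by
      intro j
      have h1 : (F.dx (e j) : R) = F.d (e j) (F.x (e j)) := by rw [F.d_x, if_pos rfl]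
      rw [h1, ← pull_x, d_pull, Finset.sum_eq_single j]
      · rw [if_pos rfl, G.d_x, if_pos rfl]
      · intro l _ hl
        rw [G.d_x, if_neg hl, map_zero, ite_self]
      · simp
    have hxi : ∀ j, pull (↑(G.dx j)⁻¹ : B) = (↑(F.dx (e j))⁻¹ : R) := by
      intro j
      rw [← mul_one (pull _), ← (F.dx (e j)).mul_inv, ← hx, ← mul_assoc, ← map_mul, Units.inv_mul,
        map_one, one_mul]
    rw [toFrame_D, d_pull, Finset.mul_sum]
    refine Finset.sum_congr rfl fun j _ => ?_
    split_ifs with hj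
    · rw [toFrame_D, map_mul, hxi, hj]
    · rw [mul_zero]

end CoordFrame

end Coordinates

section Germs

open Filter

/-- The pointwise structure of an algebra on germs of functions. -/
instance {α : Type*} (l : Filter α) : Algebra ℂ (Germ l ℂ) :=
  Algebra.ofModule
    (fun r x y => Germ.inductionOn₂ x y fun f g => congrArg Germ.ofFun (smul_mul_assoc r f g))
    (fun r x y => Germ.inductionOn₂ x y fun f g => congrArg Germ.ofFun (mul_smul_comm r f g))

/-- The germ of a function, as a homomorphism of algebras. -/
def germHom {α : Type*} (l : Filter α) : (α → ℂ) →ₐ[ℂ] Germ l ℂ :=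
  AlgHom.ofLinearMap ⟨⟨fun f => (f : Germ l ℂ), fun _ _ => rfl⟩, fun _ _ => rfl⟩ rfl fun _ _ => rfl

variable {n k : ℕ}

/-- The algebra of germs of analytic functions at a point of `ℂ ^ n`. -/
def anGerm (t₀ : Fin n → ℂ) : Subalgebra ℂ (Germ (𝓝 t₀) ℂ) where
  carrier := {φ | ∃ f : (Fin n → ℂ) → ℂ, AnalyticAt ℂ f t₀ ∧ (f : Germ (𝓝 t₀) ℂ) = φ}
  mul_mem' := by
    rintro _ _ ⟨f, hf, rfl⟩ ⟨g, hg, rfl⟩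
    exact ⟨f * g, hf.mul hg, rfl⟩
  add_mem' := by
    rintro _ _ ⟨f, hf, rfl⟩ ⟨g, hg, rfl⟩
    exact ⟨f + g, hf.add hg, rfl⟩
  algebraMap_mem' c := ⟨fun _ => c, analyticAt_const, ((germHom (𝓝 t₀)).commutes c)⟩

/-- The germ of an analytic function. -/
def anGerm.mk {t₀ : Fin n → ℂ} (f : (Fin n → ℂ) → ℂ) (hf : AnalyticAt ℂ f t₀) : anGerm t₀ :=
  ⟨(f : Germ (𝓝 t₀) ℂ), f, hf, rfl⟩

theorem anGerm.exists_rep {t₀ : Fin n → ℂ} (φ : anGerm t₀) :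
    ∃ (f : (Fin n → ℂ) → ℂ) (hf : AnalyticAt ℂ f t₀), anGerm.mk f hf = φ := by
  obtain ⟨φ, f, hf, rfl⟩ := φ
  exact ⟨f, hf, rfl⟩

theorem anGerm.mk_eq {t₀ : Fin n → ℂ} {f g : (Fin n → ℂ) → ℂ} {hf : AnalyticAt ℂ f t₀}
    {hg : AnalyticAt ℂ g t₀} : anGerm.mk f hf = anGerm.mk g hg ↔ f =ᶠ[𝓝 t₀] g := by
  rw [← Germ.coe_eq]
  exact Subtype.ext_iff

/-- A germ of an analytic function that does not vanish at the point is invertible. -/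
def anGerm.unit {t₀ : Fin n → ℂ} (f : (Fin n → ℂ) → ℂ) (hf : AnalyticAt ℂ f t₀) (h0 : f t₀ ≠ 0) :
    (anGerm t₀)ˣ where
  val := anGerm.mk f hf
  inv := anGerm.mk f⁻¹ (hf.inv h0)
  val_inv := by
    refine Subtype.ext (Germ.coe_eq.2 ?_)
    filter_upwards [hf.continuousAt.eventually_ne h0] with t ht
    exact mul_inv_cancel₀ ht
  inv_val := by
    refine Subtype.ext (Germ.coe_eq.2 ?_)
    filter_upwards [hf.continuousAt.eventually_ne h0] with t ht
    exact inv_mul_cancel₀ ht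

/-- The partial derivatives of a function on `ℂ ^ n`. -/
def pd (i : Fin n) (f : (Fin n → ℂ) → ℂ) : (Fin n → ℂ) → ℂ :=
  fun t => fderiv ℂ f t (Pi.single i 1)

theorem analyticAt_pd {i : Fin n} {f : (Fin n → ℂ) → ℂ} {t₀ : Fin n → ℂ} (hf : AnalyticAt ℂ f t₀) :
    AnalyticAt ℂ (pd i f) t₀ :=
  ((ContinuousLinearMap.apply ℂ ℂ (Pi.single i 1 : Fin n → ℂ)).analyticAt _).comp hf.fderiv

/-- The partial derivatives of germs. -/
def germPd (t₀ : Fin n → ℂ) (i : Fin n) : Germ (𝓝 t₀) ℂ → Germ (𝓝 t₀) ℂ :=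
  Germ.map' (pd i) fun f g (h : f =ᶠ[𝓝 t₀] g) =>
    h.fderiv.fun_comp fun A : (Fin n → ℂ) →L[ℂ] ℂ => A (Pi.single i 1)

theorem germPd_mem {t₀ : Fin n → ℂ} (i : Fin n) (φ : anGerm t₀) : germPd t₀ i φ ∈ anGerm t₀ := by
  obtain ⟨f, hf, rfl⟩ := anGerm.exists_rep φ
  exact ⟨pd i f, analyticAt_pd hf, rfl⟩

theorem eventually_differentiableAt {t₀ : Fin n → ℂ} {f : (Fin n → ℂ) → ℂ}
    (hf : AnalyticAt ℂ f t₀) : ∀ᶠ t in 𝓝 t₀, DifferentiableAt ℂ f t :=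
  hf.eventually_analyticAt.mono fun _ h => h.differentiableAt

/-- The partial derivatives of germs of analytic functions, as derivations. -/
def anPd (t₀ : Fin n → ℂ) (i : Fin n) : Derivation ℂ (anGerm t₀) (anGerm t₀) :=
  Derivation.mk'
    { toFun := fun φ => ⟨germPd t₀ i φ, germPd_mem i φ⟩
      map_add' := fun φ χ => by
        obtain ⟨f, hf, rfl⟩ := anGerm.exists_rep φ
        obtain ⟨g, hg, rfl⟩ := anGerm.exists_rep χ
        refine Subtype.ext (Germ.coe_eq.2 ?_)
        filter_upwards [eventually_differentiableAt hf, eventually_differentiableAt hg] with t h1 h2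
        change fderiv ℂ (f + g) t _ = fderiv ℂ f t _ + fderiv ℂ g t _
        rw [fderiv_add h1 h2]
        rfl
      map_smul' := fun c φ => by
        obtain ⟨f, hf, rfl⟩ := anGerm.exists_rep φ
        refine Subtype.ext (Germ.coe_eq.2 ?_)
        filter_upwards [eventually_differentiableAt hf] with t h1
        change fderiv ℂ (c • f) t _ = c • fderiv ℂ f t _
        rw [fderiv_const_smul h1]
        rfl }
    fun φ χ => by
      obtain ⟨f, hf, rfl⟩ := anGerm.exists_rep φ
      obtain ⟨g, hg, rfl⟩ := anGerm.exists_rep χ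
      refine Subtype.ext (Germ.coe_eq.2 ?_)
      filter_upwards [eventually_differentiableAt hf, eventually_differentiableAt hg] with t h1 h2
      change fderiv ℂ (f * g) t _ = f t * fderiv ℂ g t _ + g t * fderiv ℂ f t _
      rw [fderiv_mul h1 h2]
      rfl

theorem anPd_mk {t₀ : Fin n → ℂ} (i : Fin n) {f : (Fin n → ℂ) → ℂ} (hf : AnalyticAt ℂ f t₀) :
    anPd t₀ i (anGerm.mk f hf) = anGerm.mk (pd i f) (analyticAt_pd hf) := rfl

/-- The symmetry of the second derivative. -/
theorem anPd_comm {t₀ : Fin n → ℂ} (i j : Fin n) (φ : anGerm t₀) :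
    anPd t₀ i (anPd t₀ j φ) = anPd t₀ j (anPd t₀ i φ) := by
  obtain ⟨f, hf, rfl⟩ := anGerm.exists_rep φ
  rw [anPd_mk, anPd_mk, anPd_mk, anPd_mk, anGerm.mk_eq]
  filter_upwards [hf.eventually_analyticAt] with t ht
  have h1 : ∀ v w : Fin n → ℂ, fderiv ℂ (fun s => fderiv ℂ f s v) t w =
      fderiv ℂ (fderiv ℂ f) t w v := by
    intro v w
    have h2 : DifferentiableAt ℂ (fderiv ℂ f) t := ht.fderiv.differentiableAt
    rw [fderiv_clm_apply h2 (differentiableAt_const v)]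
    simp
  have h3 : IsSymmSndFDerivAt ℂ f t :=
    (ht.contDiffAt (n := ω)).isSymmSndFDerivAt le_top
  change fderiv ℂ (fun s => fderiv ℂ f s (Pi.single j 1)) t (Pi.single i 1) =
    fderiv ℂ (fun s => fderiv ℂ f s (Pi.single i 1)) t (Pi.single j 1)
  rw [h1, h1]
  exact h3 _ _

/-- The diagonal map `t ↦ t ∘ e`. -/
def diagMap (e : Fin k → Fin n) : (Fin n → ℂ) →L[ℂ] (Fin k → ℂ) :=
  ContinuousLinearMap.pi fun j => ContinuousLinearMap.proj (e j)

theorem diagMap_apply (e : Fin k → Fin n) (t : Fin n → ℂ) : diagMap e t = t ∘ e := rfl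

theorem tendsto_diagMap (e : Fin k → Fin n) (t₀ : Fin n → ℂ) :
    Tendsto (diagMap e) (𝓝 t₀) (𝓝 (t₀ ∘ e)) := (diagMap e).continuous.tendsto t₀

/-- The restriction of germs to a diagonal. -/
def germPull (e : Fin k → Fin n) (t₀ : Fin n → ℂ) : Germ (𝓝 (t₀ ∘ e)) ℂ →ₐ[ℂ] Germ (𝓝 t₀) ℂ :=
  AlgHom.ofLinearMap
    ⟨⟨fun φ => φ.compTendsto (diagMap e) (tendsto_diagMap e t₀),
      fun φ χ => Germ.inductionOn₂ φ χ fun _ _ => rfl⟩,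
      fun _ φ => Germ.inductionOn φ fun _ => rfl⟩ rfl
    fun φ χ => Germ.inductionOn₂ φ χ fun _ _ => rfl

theorem analyticAt_comp_diag {e : Fin k → Fin n} {t₀ : Fin n → ℂ} {f : (Fin k → ℂ) → ℂ}
    (hf : AnalyticAt ℂ f (t₀ ∘ e)) : AnalyticAt ℂ (fun t => f (t ∘ e)) t₀ :=
  AnalyticAt.comp (f := diagMap e) hf ((diagMap e).analyticAt t₀)

/-- The restriction of germs of analytic functions to a diagonal. -/
def anPull (e : Fin k → Fin n) (t₀ : Fin n → ℂ) : anGerm (t₀ ∘ e) →ₐ[ℂ] anGerm t₀ :=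
  ((germPull e t₀).comp (anGerm (t₀ ∘ e)).val).codRestrict (anGerm t₀) fun φ => by
    obtain ⟨f, hf, rfl⟩ := anGerm.exists_rep φ
    exact ⟨fun t => f (t ∘ e), analyticAt_comp_diag hf, rfl⟩

/-- The chain rule for the diagonal map. -/
theorem anPd_anPull (e : Fin k → Fin n) {t₀ : Fin n → ℂ} (i : Fin n) (φ : anGerm (t₀ ∘ e)) :
    anPd t₀ i (anPull e t₀ φ) =
      ∑ j, if e j = i then anPull e t₀ (anPd (t₀ ∘ e) j φ) else 0 := by
  obtain ⟨f, hf, rfl⟩ := anGerm.exists_rep φ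
  have h1 : ∀ j, (if e j = i then anPull e t₀ (anPd (t₀ ∘ e) j (anGerm.mk f hf)) else 0 : anGerm t₀) =
      anGerm.mk (fun t => if e j = i then pd j f (t ∘ e) else 0) (by
        split_ifs
        exacts [analyticAt_comp_diag (analyticAt_pd hf), analyticAt_const]) := by
    intro j
    split_ifs <;> rfl
  have h2 : ∀ s : Finset (Fin k), ∑ j ∈ s, (germHom (𝓝 t₀))
      (fun t => if e j = i then pd j f (t ∘ e) else 0) =
      germHom (𝓝 t₀) (∑ j ∈ s, fun t => if e j = i then pd j f (t ∘ e) else 0) :=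
    fun s => (map_sum (germHom (𝓝 t₀)) _ s).symm
  refine Subtype.ext ?_
  rw [Finset.sum_congr rfl fun j _ => h1 j, AddSubmonoidClass.coe_finsetSum]
  refine Eq.trans ?_ (h2 Finset.univ).symm
  refine Germ.coe_eq.2 ?_
  filter_upwards [(tendsto_diagMap e t₀).eventually (eventually_differentiableAt hf)] with t ht
  have h3 : (diagMap e) (Pi.single i 1) = ∑ j, if e j = i then Pi.single j (1 : ℂ) else 0 := by
    funext l
    rw [Finset.sum_apply, Finset.sum_eq_single l]
    · rw [diagMap_apply, Function.comp_apply, Pi.single_apply]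
      split_ifs <;> simp
    · intro j _ hj
      split_ifs
      · rw [Pi.single_eq_of_ne hj.symm]
      · rfl
    · simp
  have h4 : fderiv ℂ (f ∘ diagMap e) t = (fderiv ℂ f (t ∘ e)).comp (diagMap e) := by
    rw [fderiv_comp t ht (diagMap e).differentiableAt, ContinuousLinearMap.fderiv]
    rfl
  change fderiv ℂ (f ∘ diagMap e) t (Pi.single i 1) = _
  rw [h4, ContinuousLinearMap.comp_apply, h3, map_sum, Finset.sum_apply]
  refine Finset.sum_congr rfl fun j _ => ?_
  split_ifs
  · rfl
  · rw [map_zero]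

end Germs

/-! ### Holomorphic functions on powers of a Riemann surface -/

section Charts

open Filter

variable {S : Type*} [TopologicalSpace S] [ChartedSpace ℂ S] {n k : ℕ}

theorem analyticAt_coordChange [IsManifold 𝓘(ℂ) ω S] {p q s : S} (hp : s ∈ (chartAt ℂ p).source)
    (hq : s ∈ (chartAt ℂ q).source) :
    AnalyticAt ℂ (fun t => chartAt ℂ q ((chartAt ℂ p).symm t)) (chartAt ℂ p s) := by
  have h := (contDiffGroupoid ω 𝓘(ℂ)).compatible (chart_mem_atlas ℂ p) (chart_mem_atlas ℂ q)
  rw [contDiffGroupoid, mem_groupoid_of_pregroupoid] at h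
  have h1 : ContDiffOn ℂ ω (fun t => chartAt ℂ q ((chartAt ℂ p).symm t))
      ((chartAt ℂ p).symm.trans (chartAt ℂ q)).source := by
    have h2 := h.1
    simp only [contDiffPregroupoid, contDiffPregroupoid, modelWithCornersSelf_coe,
      modelWithCornersSelf_coe_symm, Set.range_id, Set.inter_univ, Set.preimage_id,
      Function.comp_id, Function.id_comp] at h2
    exact h2
  have h3 : chartAt ℂ p s ∈ ((chartAt ℂ p).symm.trans (chartAt ℂ q)).source := by
    rw [OpenPartialHomeomorph.trans_source, OpenPartialHomeomorph.symm_source]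
    refine ⟨(chartAt ℂ p).map_source hp, ?_⟩
    rw [Set.mem_preimage, (chartAt ℂ p).left_inv hp]
    exact hq
  exact (h1.contDiffAt ((OpenPartialHomeomorph.open_source _).mem_nhds h3)).analyticAt

theorem tendsto_toCoord (c : Fin n → S) : Tendsto (toCoord c) (𝓝 c) (𝓝 (toCoord c c)) := by
  rw [tendsto_pi_nhds]
  intro i
  exact ((chartAt ℂ (c i)).continuousAt (mem_chart_source ℂ (c i))).tendsto.comp
    (continuous_apply i).continuousAt

theorem ofCoord_self (c : Fin n → S) : ofCoord c (toCoord c c) = c :=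
  funext fun i => (chartAt ℂ (c i)).left_inv (mem_chart_source ℂ (c i))

theorem tendsto_ofCoord (c : Fin n → S) : Tendsto (ofCoord c) (𝓝 (toCoord c c)) (𝓝 c) := by
  rw [tendsto_pi_nhds]
  intro i
  have h := ((chartAt ℂ (c i)).continuousAt_symm (mem_chart_target ℂ (c i))).tendsto
  rw [(chartAt ℂ (c i)).left_inv (mem_chart_source ℂ (c i))] at h
  exact h.comp (continuous_apply i).continuousAt

theorem eventually_mem_source (c : Fin n → S) :
    ∀ᶠ z in 𝓝 c, ∀ i, z i ∈ (chartAt ℂ (c i)).source :=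
  eventually_all.2 fun i => (continuous_apply i).continuousAt.eventually
    (chart_source_mem_nhds ℂ (c i))

theorem eventually_mem_target (c : Fin n → S) :
    ∀ᶠ t in 𝓝 (toCoord c c), ∀ i, t i ∈ (chartAt ℂ (c i)).target :=
  eventually_all.2 fun i => (continuous_apply i).continuousAt.eventually
    (chart_target_mem_nhds ℂ (c i))

theorem ofCoord_toCoord {c z : Fin n → S} (h : ∀ i, z i ∈ (chartAt ℂ (c i)).source) :
    ofCoord c (toCoord c z) = z := funext fun i => (chartAt ℂ (c i)).left_inv (h i)

/-- Holomorphy at `z` may be tested in the charts at a nearby point. -/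
theorem holAtPow_of_analyticAt [IsManifold 𝓘(ℂ) ω S] {F : (Fin n → S) → ℂ} {c z : Fin n → S}
    (h : ∀ i, z i ∈ (chartAt ℂ (c i)).source)
    (hF : AnalyticAt ℂ (fun t => F (ofCoord c t)) (toCoord c z)) : HolAtPow F z := by
  have hT : AnalyticAt ℂ (fun t : Fin n → ℂ => toCoord c (ofCoord z t)) (toCoord z z) := by
    rw [analyticAt_pi_iff]
    intro i
    exact AnalyticAt.comp (f := fun t : Fin n → ℂ => t i) (x := toCoord z z)
      (g := fun a => chartAt ℂ (c i) ((chartAt ℂ (z i)).symm a))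
      (analyticAt_coordChange (mem_chart_source ℂ (z i)) (h i))
      ((ContinuousLinearMap.proj (R := ℂ) (φ := fun _ : Fin n => ℂ) i).analyticAt _)
  have h0 : toCoord c (ofCoord z (toCoord z z)) = toCoord c z := by rw [ofCoord_self]
  have h1 : AnalyticAt ℂ (fun t => F (ofCoord c (toCoord c (ofCoord z t)))) (toCoord z z) :=
    AnalyticAt.comp (g := fun t => F (ofCoord c t)) (by rwa [h0]) hT
  refine h1.congr ?_
  have h2 : ∀ᶠ s in 𝓝 z, ∀ i, s i ∈ (chartAt ℂ (c i)).source := by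
    rw [eventually_all]
    intro i
    exact (continuous_apply i).continuousAt.eventually
      ((chartAt ℂ (c i)).open_source.mem_nhds (h i))
  filter_upwards [(tendsto_ofCoord z).eventually h2] with t ht
  rw [ofCoord_toCoord ht]

theorem HolAtPow.eventually [IsManifold 𝓘(ℂ) ω S] {F : (Fin n → S) → ℂ} {c : Fin n → S}
    (h : HolAtPow F c) : ∀ᶠ z in 𝓝 c, HolAtPow F z := by
  filter_upwards [eventually_mem_source c,
    (tendsto_toCoord c).eventually (AnalyticAt.eventually_analyticAt h)] with z h1 h2
  exact holAtPow_of_analyticAt h1 h2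

theorem HolAtPow.continuousAt {F : (Fin n → S) → ℂ} {c : Fin n → S} (h : HolAtPow F c) :
    ContinuousAt F c := by
  have h1 : Tendsto (fun z => F (ofCoord c (toCoord c z))) (𝓝 c) (𝓝 (F (ofCoord c (toCoord c c)))) :=
    (AnalyticAt.continuousAt h).tendsto.comp (tendsto_toCoord c)
  rw [ofCoord_self] at h1
  refine h1.congr' ?_
  filter_upwards [eventually_mem_source c] with z hz
  rw [ofCoord_toCoord hz]

theorem HolAtPow.congr {F G : (Fin n → S) → ℂ} {c : Fin n → S} (h : HolAtPow F c)
    (hFG : F =ᶠ[𝓝 c] G) : HolAtPow G c :=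
  AnalyticAt.congr h ((tendsto_ofCoord c).eventually hFG)

theorem HolAtPow.coord {f : S → ℂ} {c : Fin n → S} {i : Fin n} (h : HolAt f (c i)) :
    HolAtPow (fun z => f (z i)) c :=
  AnalyticAt.comp (g := fun a => f ((chartAt ℂ (c i)).symm a)) (f := fun t : Fin n → ℂ => t i) h
    ((ContinuousLinearMap.proj (R := ℂ) (φ := fun _ : Fin n => ℂ) i).analyticAt _)

theorem HolAt.eventually [IsManifold 𝓘(ℂ) ω S] {f : S → ℂ} {p : S} (h : HolAt f p) :
    ∀ᶠ q in 𝓝 p, HolAt f q := by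
  have h0 : Tendsto (fun q => fun _ : Fin 1 => q) (𝓝 p) (𝓝 fun _ => p) :=
    (continuous_pi fun _ => continuous_id).tendsto p
  filter_upwards [h0.eventually (HolAtPow.coord (c := fun _ : Fin 1 => p) (i := 0) h).eventually]
    with q hq
  exact AnalyticAt.comp (f := fun (t : ℂ) (_ : Fin 1) => t)
    (x := chartAt ℂ q q) hq (analyticAt_pi_iff.2 fun _ => analyticAt_id)

theorem HolAt.eventually_differentiableAt {f : S → ℂ} {p : S} (h : HolAt f p) :
    ∀ᶠ t in 𝓝 (chartAt ℂ p p), DifferentiableAt ℂ (fun t => f ((chartAt ℂ p).symm t)) t :=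
  (AnalyticAt.eventually_analyticAt h).mono fun _ ht => ht.differentiableAt

theorem ofCoord_update (c : Fin n → S) (t : Fin n → ℂ) (i : Fin n) (a : ℂ) :
    ofCoord c (Function.update t i a) =
      Function.update (ofCoord c t) i ((chartAt ℂ (c i)).symm a) := by
  funext j
  by_cases h : j = i
  · subst h
    simp [ofCoord]
  · simp [ofCoord, h]

end Charts

section Derivatives

open Filter

variable {S : Type*} [TopologicalSpace S] [ChartedSpace ℂ S] [IsManifold 𝓘(ℂ) ω S] {n k : ℕ}

theorem dAt_eq_deriv_mul {f : S → ℂ} {p q : S} (hq : q ∈ (chartAt ℂ p).source)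
    (hf : DifferentiableAt ℂ (fun t => f ((chartAt ℂ p).symm t)) (chartAt ℂ p q)) :
    dAt f q = deriv (fun t => f ((chartAt ℂ p).symm t)) (chartAt ℂ p q) * dAt (chartAt ℂ p) q := by
  have : IsManifold 𝓘(ℂ) 1 S := IsManifold.of_le (n := ω) le_top
  have h1 : f =ᶠ[𝓝 q] (fun t => f ((chartAt ℂ p).symm t)) ∘ chartAt ℂ p := by
    filter_upwards [(chartAt ℂ p).open_source.mem_nhds hq] with s hs
    rw [Function.comp_apply, (chartAt ℂ p).left_inv hs]
  have h2 : MDifferentiableAt 𝓘(ℂ) 𝓘(ℂ) (chartAt ℂ p) q :=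
    mdifferentiableAt_atlas (chart_mem_atlas ℂ p) hq
  change mfderiv 𝓘(ℂ) 𝓘(ℂ) f q (1 : ℂ) = _
  rw [h1.mfderiv_eq, mfderiv_comp q hf.mdifferentiableAt h2, mfderiv_eq_fderiv]
  change fderiv ℂ (fun t => f ((chartAt ℂ p).symm t)) (chartAt ℂ p q) (dAt (chartAt ℂ p) q) = _
  rw [fderiv_eq_smul_deriv, smul_eq_mul, mul_comm]

theorem dAt_chart_ne_zero {p q : S} (hq : q ∈ (chartAt ℂ p).source) : dAt (chartAt ℂ p) q ≠ 0 := by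
  have : IsManifold 𝓘(ℂ) 1 S := IsManifold.of_le (n := ω) le_top
  intro h
  have h1 := (mdifferentiable_chart (I := 𝓘(ℂ)) p).mfderiv_injective hq
  have h2 : (1 : ℂ) = 0 := h1 (h.trans (map_zero (mfderiv 𝓘(ℂ) 𝓘(ℂ) (chartAt ℂ p) q)).symm)
  exact one_ne_zero h2

theorem pd_coord {g : ℂ → ℂ} {t : Fin n → ℂ} {j : Fin n} (hg : DifferentiableAt ℂ g (t j))
    (i : Fin n) : pd i (fun t => g (t j)) t = if i = j then deriv g (t j) else 0 := by
  have h1 : HasFDerivAt (fun t : Fin n → ℂ => g (t j)) ((fderiv ℂ g (t j)).comp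
      (ContinuousLinearMap.proj (R := ℂ) (φ := fun _ : Fin n => ℂ) j)) t :=
    HasFDerivAt.comp t hg.hasFDerivAt (f := fun t : Fin n → ℂ => t j) (hasFDerivAt_apply j t)
  rw [pd, h1.fderiv, ContinuousLinearMap.comp_apply, fderiv_eq_smul_deriv,
    ContinuousLinearMap.proj_apply, Pi.single_apply]
  by_cases h : i = j
  · rw [if_pos h, if_pos h.symm, one_smul]
  · rw [if_neg h, if_neg (Ne.symm h), zero_smul]

/-- The derivative `∂_{f_i}` in coordinates. -/
theorem partialD_ofCoord {f : S → ℂ} {F : (Fin n → S) → ℂ} {c : Fin n → S} {i : Fin n}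
    (hf : HolAt f (c i)) (hF : HolAtPow F c) : ∀ᶠ t in 𝓝 (toCoord c c),
      partialD f i F (ofCoord c t) =
        pd i (fun t => F (ofCoord c t)) t / pd i (fun t => f (ofCoord c t i)) t := by
  have hf' : ∀ᶠ t in 𝓝 (toCoord c c),
      DifferentiableAt ℂ (fun a => f ((chartAt ℂ (c i)).symm a)) (t i) :=
    (continuous_apply i).continuousAt.eventually hf.eventually_differentiableAt
  filter_upwards [eventually_mem_target c, hf', eventually_differentiableAt hF] with t ht h1 h2
  have hs : ofCoord c t i ∈ (chartAt ℂ (c i)).source := (chartAt ℂ (c i)).map_target (ht i)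
  have ht' : chartAt ℂ (c i) (ofCoord c t i) = t i := (chartAt ℂ (c i)).right_inv (ht i)
  have h3 : HasDerivAt (fun a => F (ofCoord c (Function.update t i a)))
      (pd i (fun t => F (ofCoord c t)) t) (t i) := by
    have h4 : HasFDerivAt (fun t => F (ofCoord c t)) (fderiv ℂ (fun t => F (ofCoord c t)) t)
        (Function.update t i (t i)) := by
      rw [Function.update_eq_self]
      exact h2.hasFDerivAt
    exact h4.comp_hasDerivAt (t i) (hasDerivAt_update t i (t i))
  have h5 : (fun a => F (Function.update (ofCoord c t) i ((chartAt ℂ (c i)).symm a))) =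
      fun a => F (ofCoord c (Function.update t i a)) := by
    funext a
    rw [ofCoord_update]
  rw [partialD, dAt_eq_deriv_mul (f := fun s => F (Function.update (ofCoord c t) i s)) hs
    (by rw [ht', h5]; exact h3.differentiableAt), dAt_eq_deriv_mul (f := f) hs (by rwa [ht']), ht', h5,
    h3.deriv, mul_div_mul_right _ _ (dAt_chart_ne_zero hs)]
  congr 1
  exact ((pd_coord (g := fun a => f ((chartAt ℂ (c i)).symm a)) h1 i).trans (if_pos rfl)).symm

theorem deriv_ne_zero_of_dAt {f : S → ℂ} {p : S} (h : HolAt f p) (h0 : dAt f p ≠ 0) :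
    deriv (fun t => f ((chartAt ℂ p).symm t)) (chartAt ℂ p p) ≠ 0 := by
  rw [dAt_eq_deriv_mul (mem_chart_source ℂ p) (AnalyticAt.differentiableAt h)] at h0
  exact left_ne_zero_of_mul h0

end Derivatives

section FrameAt

open Filter

variable {S : Type*} [TopologicalSpace S] [ChartedSpace ℂ S] {n k : ℕ}

/-- The functions `x` and `y` are holomorphic at `p`, and they and their differentials do not vanish
there. -/
structure IsGood (x y : S → ℂ) (p : S) : Prop where
  hol_x : HolAt x p
  hol_y : HolAt y p
  dx_ne : dAt x p ≠ 0
  dy_ne : dAt y p ≠ 0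
  x_ne : x p ≠ 0
  y_ne : y p ≠ 0

variable {x y : S → ℂ}

theorem anPd_coord {f : S → ℂ} {c : Fin n → S} {j : Fin n} (h : HolAt f (c j)) (i : Fin n) :
    anPd (toCoord c c) i (anGerm.mk (fun t => f (ofCoord c t j)) (HolAtPow.coord h)) =
      if i = j then anGerm.mk (pd j fun t => f (ofCoord c t j)) (analyticAt_pd (HolAtPow.coord h))
        else 0 := by
  change anGerm.mk (pd i fun t => f (ofCoord c t j)) (analyticAt_pd (HolAtPow.coord h)) = _
  split_ifs with hij
  · subst hij
    rfl
  · refine Subtype.ext (Germ.coe_eq.2 ?_)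
    filter_upwards [(continuous_apply j).continuousAt.eventually h.eventually_differentiableAt]
      with t ht
    exact (pd_coord (g := fun a => f ((chartAt ℂ (c j)).symm a)) ht i).trans (if_neg hij)

variable [IsManifold 𝓘(ℂ) ω S]

theorem pd_coord_ne_zero {f : S → ℂ} {c : Fin n → S} {j : Fin n} (h : HolAt f (c j))
    (h0 : dAt f (c j) ≠ 0) : pd j (fun t => f (ofCoord c t j)) (toCoord c c) ≠ 0 := by
  have h1 := pd_coord (g := fun a => f ((chartAt ℂ (c j)).symm a)) (t := toCoord c c)
    (j := j) (AnalyticAt.differentiableAt h) j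
  rw [if_pos rfl] at h1
  exact h1.trans_ne (deriv_ne_zero_of_dAt h h0)

/-- The coordinates at a good point. -/
def coordFrame {c : Fin n → S} (hc : ∀ i, IsGood x y (c i)) :
    CoordFrame (anGerm (toCoord c c)) n where
  d := anPd (toCoord c c)
  comm := anPd_comm
  x i := anGerm.unit (fun t => x (ofCoord c t i)) (HolAtPow.coord (hc i).hol_x)
    (by rw [ofCoord_self]; exact (hc i).x_ne)
  y i := anGerm.unit (fun t => y (ofCoord c t i)) (HolAtPow.coord (hc i).hol_y)
    (by rw [ofCoord_self]; exact (hc i).y_ne)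
  dx i := anGerm.unit _ (analyticAt_pd (HolAtPow.coord (hc i).hol_x))
    (pd_coord_ne_zero (hc i).hol_x (hc i).dx_ne)
  dy i := anGerm.unit _ (analyticAt_pd (HolAtPow.coord (hc i).hol_y))
    (pd_coord_ne_zero (hc i).hol_y (hc i).dy_ne)
  d_x i j := anPd_coord (hc j).hol_x i
  d_y i j := anPd_coord (hc j).hol_y i

/-- The frame at a good point. -/
def frameAt {c : Fin n → S} (hc : ∀ i, IsGood x y (c i)) : Frame (anGerm (toCoord c c)) n :=
  (coordFrame hc).toFrame

/-- The restriction of germs to a diagonal, as a homomorphism of frames. -/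
def frameHomAt {c : Fin n → S} (hc : ∀ i, IsGood x y (c i)) (e : Fin k → Fin n) :
    FrameHom (frameAt hc) (frameAt (c := c ∘ e) fun j => hc (e j)) e :=
  CoordFrame.toFrameHom (F := coordFrame hc) (G := coordFrame (c := c ∘ e) fun j => hc (e j))
    (anPull e (toCoord c c)) (fun _ => rfl) (fun _ => rfl)
    (anPd_anPull e (t₀ := toCoord c c))

end FrameAt

/-! ### Regular points and points in general position -/

section Regular

open Filter

variable {S : Type*} [TopologicalSpace S] [ChartedSpace ℂ S] {n k : ℕ}

theorem HolAtPow.add {F G : (Fin n → S) → ℂ} {c : Fin n → S} (hF : HolAtPow F c)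
    (hG : HolAtPow G c) : HolAtPow (fun z => F z + G z) c := AnalyticAt.fun_add hF hG

/-- Two holomorphic extensions of the same meromorphic function agree. -/
theorem IsHolExtension.apply_eq {F G G' : (Fin n → S) → ℂ} {c : Fin n → S}
    (h : IsHolExtension F G c) (h' : IsHolExtension F G' c) : G c = G' c := by
  obtain ⟨hG, U, hU, hUd, hFG⟩ := h
  obtain ⟨hG', U', hU', hUd', hFG'⟩ := h'
  refine tendsto_nhds_unique_of_frequently_eq hG.continuousAt.tendsto hG'.continuousAt.tendsto ?_
  have h1 : ∃ᶠ z in 𝓝 c, z ∈ U ∩ U' :=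
    mem_closure_iff_frequently.1 ((hUd.inter_of_isOpen_left hUd' hU) c)
  exact (h1.and_eventually (hFG.and hFG')).mono fun z hz => (hz.2.1 hz.1.1).symm.trans (hz.2.2 hz.1.2)

theorem RegularAt.add_holAtPow {F H : (Fin n → S) → ℂ} {c : Fin n → S} (h : RegularAt F c)
    (hH : HolAtPow H c) : RegularAt (fun z => F z + H z) c := by
  obtain ⟨G, hG, U, hU, hUd, hFG⟩ := h
  exact ⟨fun z => G z + H z, hG.add hH, U, hU, hUd,
    hFG.mono fun z hz hzU => congrArg (· + H z) (hz hzU)⟩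

theorem HolAt.continuousAt {f : S → ℂ} {p : S} (h : HolAt f p) : ContinuousAt f p := by
  have h1 : HolAtPow (fun z : Fin 1 → S => f (z 0)) fun _ => p := HolAtPow.coord h
  exact ContinuousAt.comp (f := fun (q : S) (_ : Fin 1) => q) h1.continuousAt
    (continuous_pi fun _ => continuous_id).continuousAt

theorem frequently_ne_of_dAt_ne_zero {f : S → ℂ} {p : S} (h0 : dAt f p ≠ 0) (a : ℂ) :
    ∃ᶠ q in 𝓝 p, f q ≠ a := by
  intro h
  refine h0 ?_
  have h1 : f =ᶠ[𝓝 p] fun _ => a := h.mono fun q hq => not_not.1 hq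
  change mfderiv 𝓘(ℂ) 𝓘(ℂ) f p (1 : ℂ) = 0
  rw [h1.mfderiv_eq, mfderiv_const]
  rfl

theorem holAtPow_doublePole {x : S → ℂ} {k : ℕ} {c : Fin k → S} (hk : k = 2) (hc : ∀ j, HolAt x (c j))
    (h : ∀ i j, i ≠ j → x (c i) ≠ x (c j)) : HolAtPow (doublePole x k) c := by
  subst hk
  have h1 : ∀ j : Fin 2, HolAtPow (fun z => x (z j)) c := fun j => HolAtPow.coord (hc j)
  have h2 : AnalyticAt ℂ (fun t => x (ofCoord c t 0) - x (ofCoord c t 1)) (toCoord c c) :=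
    AnalyticAt.sub (h1 0) (h1 1)
  refine (h2.pow 2).inv ?_ |>.congr (Eventually.of_forall fun t => ?_)
  · rw [Pi.pow_apply, ofCoord_self]
    exact pow_ne_zero 2 (sub_ne_zero.2 (h 0 1 (by decide)))
  · change _ = doublePole x 2 (ofCoord c t)
    rw [doublePole, dif_pos rfl, one_div]
    rfl

variable [IsManifold 𝓘(ℂ) ω S]

theorem IsHolExtension.eventually {F G : (Fin n → S) → ℂ} {c : Fin n → S}
    (h : IsHolExtension F G c) : ∀ᶠ z in 𝓝 c, IsHolExtension F G z := by
  obtain ⟨hG, U, hU, hUd, hFG⟩ := h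
  filter_upwards [hG.eventually, eventually_eventually_nhds.2 hFG] with z h1 h2
  exact ⟨h1, U, hU, hUd, h2⟩

/-- The function `regExt F` is the holomorphic extension of `F`. -/
theorem IsHolExtension.regExt_eq {F G : (Fin n → S) → ℂ} {c : Fin n → S}
    (h : IsHolExtension F G c) : regExt F =ᶠ[𝓝 c] G := by
  filter_upwards [h.eventually] with z hz
  have h1 : RegularAt F z := ⟨G, hz⟩
  rw [regExt, dif_pos h1]
  exact h1.choose_spec.apply_eq hz

theorem RegularAt.eventually {F : (Fin n → S) → ℂ} {c : Fin n → S} (h : RegularAt F c) :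
    ∀ᶠ z in 𝓝 c, RegularAt F z := by
  obtain ⟨G, hG⟩ := h
  exact hG.eventually.mono fun z hz => ⟨G, hz⟩

theorem RegularAt.holAtPow_regExt {F : (Fin n → S) → ℂ} {c : Fin n → S} (h : RegularAt F c) :
    HolAtPow (regExt F) c := by
  obtain ⟨G, hG⟩ := h
  exact hG.1.congr hG.regExt_eq.symm

end Regular

section Generic

open Filter

variable {S : Type*} [TopologicalSpace S] [ChartedSpace ℂ S] [IsManifold 𝓘(ℂ) ω S] {n k : ℕ}
  {x y : S → ℂ}

theorem HolAt.eventually_dAt_ne_zero {f : S → ℂ} {p : S} (h : HolAt f p) (h0 : dAt f p ≠ 0) :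
    ∀ᶠ q in 𝓝 p, dAt f q ≠ 0 := by
  have h1 : ContinuousAt (deriv fun t => f ((chartAt ℂ p).symm t)) (chartAt ℂ p p) :=
    (AnalyticAt.deriv h).continuousAt
  have h2 := ((chartAt ℂ p).continuousAt (mem_chart_source ℂ p)).tendsto
  filter_upwards [h2.eventually (h1.eventually_ne (deriv_ne_zero_of_dAt h h0)),
    h2.eventually h.eventually_differentiableAt, chart_source_mem_nhds ℂ p] with q a b d
  rw [dAt_eq_deriv_mul d b]
  exact mul_ne_zero a (dAt_chart_ne_zero d)

theorem isOpen_isGood : IsOpen {p | IsGood x y p} := by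
  rw [isOpen_iff_eventually]
  intro p hp
  filter_upwards [hp.hol_x.eventually, hp.hol_y.eventually,
    hp.hol_x.eventually_dAt_ne_zero hp.dx_ne, hp.hol_y.eventually_dAt_ne_zero hp.dy_ne,
    hp.hol_x.continuousAt.eventually_ne hp.x_ne, hp.hol_y.continuousAt.eventually_ne hp.y_ne]
    with q a b c d e f
  exact ⟨a, b, c, d, e, f⟩

/-- The points where a nonconstant meromorphic function is holomorphic and nonzero with nonzero
differential form a dense open set. -/
theorem dense_ne_zero {f : S → ℂ} (hf : IsNonconstMeromorphic f) :
    IsOpen {p | HolAt f p ∧ dAt f p ≠ 0 ∧ f p ≠ 0} ∧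
      Dense {p | HolAt f p ∧ dAt f p ≠ 0 ∧ f p ≠ 0} := by
  constructor
  · rw [isOpen_iff_eventually]
    rintro p ⟨h1, h2, h3⟩
    filter_upwards [h1.eventually, h1.eventually_dAt_ne_zero h2, h1.continuousAt.eventually_ne h3]
      with q a b c
    exact ⟨a, b, c⟩
  · refine dense_iff_inter_open.2 fun O hO hne => ?_
    obtain ⟨p, hpO, h1, h2⟩ := hf.nonconst.inter_open_nonempty O hO hne
    obtain ⟨q, hq⟩ := ((frequently_ne_of_dAt_ne_zero h2 0).and_eventually
      ((hO.eventually_mem hpO).and (h1.eventually.and (h1.eventually_dAt_ne_zero h2)))).exists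
    exact ⟨q, hq.2.1, hq.2.2.1, hq.2.2.2, hq.1⟩

theorem dense_isGood (hx : IsNonconstMeromorphic x) (hy : IsNonconstMeromorphic y) :
    Dense {p | IsGood x y p} :=
  ((dense_ne_zero hx).2.inter_of_isOpen_left (dense_ne_zero hy).2 (dense_ne_zero hx).1).mono
    fun _ h => ⟨h.1.1, h.2.1, h.1.2.1, h.2.2.1, h.1.2.2, h.2.2.2⟩

theorem isOpen_forall_isGood (n : ℕ) : IsOpen {z : Fin n → S | ∀ i, IsGood x y (z i)} := by
  simp only [Set.ofPred_forall]
  exact isOpen_iInter_of_finite fun i => isOpen_isGood.preimage (continuous_apply i)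

theorem dense_forall_isGood (hx : IsNonconstMeromorphic x) (hy : IsNonconstMeromorphic y) (n : ℕ) :
    Dense {z : Fin n → S | ∀ i, IsGood x y (z i)} := by
  have h := dense_pi (Set.univ : Set (Fin n)) (s := fun _ => {p | IsGood x y p})
    fun _ _ => dense_isGood hx hy
  exact h.mono fun z hz i => Set.mem_univ_pi.1 hz i

/-- Points in general position: the coordinates are good, and `x` separates two of them. -/
theorem separated_open_dense (hx : IsNonconstMeromorphic x) (hy : IsNonconstMeromorphic y)
    {i j : Fin n} (hij : i ≠ j) :
    IsOpen {z : Fin n → S | (∀ l, IsGood x y (z l)) ∧ x (z i) ≠ x (z j)} ∧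
      Dense {z : Fin n → S | (∀ l, IsGood x y (z l)) ∧ x (z i) ≠ x (z j)} := by
  have hc : ∀ z : Fin n → S, (∀ l, IsGood x y (z l)) → ∀ l, ContinuousAt (fun z => x (z l)) z :=
    fun z hz l => ContinuousAt.comp (f := fun z : Fin n → S => z l) (hz l).hol_x.continuousAt
      (continuous_apply l).continuousAt
  constructor
  · rw [isOpen_iff_eventually]
    rintro z ⟨h1, h2⟩
    filter_upwards [(isOpen_forall_isGood n).eventually_mem h1,
      ((hc z h1 i).sub (hc z h1 j)).eventually_ne (sub_ne_zero.2 h2)] with w a b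
    exact ⟨a, sub_ne_zero.1 b⟩
  · refine dense_iff_inter_open.2 fun O hO hne => ?_
    obtain ⟨z, hzO, hz⟩ := (dense_forall_isGood hx hy n).inter_open_nonempty O hO hne
    have hu : Tendsto (fun s => Function.update z i s) (𝓝 (z i)) (𝓝 z) := by
      have h := (continuous_const.update i continuous_id : Continuous fun s =>
        Function.update z i s).tendsto (z i)
      rwa [Function.update_eq_self] at h
    obtain ⟨s, hs⟩ := ((frequently_ne_of_dAt_ne_zero (hz i).dx_ne (x (z j))).and_eventually
      ((hu.eventually (hO.eventually_mem hzO)).and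
        (hu.eventually ((isOpen_forall_isGood n).eventually_mem hz)))).exists
    refine ⟨_, hs.2.1, hs.2.2, ?_⟩
    rw [Function.update_self, Function.update_of_ne hij.symm]
    exact hs.1

/-- The function `ω^{(h)}_{k,0} / (dx_1 ⋯ dx_k) - δ_{(h,k),(0,2)} (x_1 - x_2)⁻²`. -/
def minusPole (x : S → ℂ) (om : ℕ → ∀ m : ℕ, MultiDifferential S m) (h k : ℕ) : (Fin k → S) → ℂ :=
  fun t => divDx x (om h k) t - if h = 0 ∧ k = 2 then doublePole x k t else 0

/-- A point of `S ^ n` in general position for the differentials of genus at most `g` in at most `K`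
variables: the coordinates are good, they are separated by `x`, and their repetitions
are regular points of the differentials. -/
structure IsGeneric (x y : S → ℂ) (om : ℕ → ∀ m : ℕ, MultiDifferential S m) (g K : ℕ) {n : ℕ}
    (c : Fin n → S) : Prop where
  good : ∀ i, IsGood x y (c i)
  sep : ∀ i j, i ≠ j → x (c i) ≠ x (c j)
  reg : ∀ h ≤ g, ∀ k, 1 ≤ k → k ≤ K → ∀ e : Fin k → Fin n, RegularAt (minusPole x om h k) (c ∘ e)

theorem isOpen_and_dense_biInter {X ι : Type*} [TopologicalSpace X] {s : Set ι} (hs : s.Finite)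
    {A : ι → Set X} (h : ∀ i ∈ s, IsOpen (A i) ∧ Dense (A i)) :
    IsOpen (⋂ i ∈ s, A i) ∧ Dense (⋂ i ∈ s, A i) := by
  induction s, hs using Set.Finite.induction_on with
  | empty => simp
  | @insert a s _ _ ih =>
    have h1 := ih fun i hi => h i (Set.mem_insert_of_mem _ hi)
    have h2 := h a (Set.mem_insert _ _)
    rw [Set.biInter_insert]
    exact ⟨h2.1.inter h1.1, h2.2.inter_of_isOpen_left h1.2 h2.1⟩

theorem isGeneric_open_dense (hx : IsNonconstMeromorphic x) (hy : IsNonconstMeromorphic y)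
    {om : ℕ → ∀ m : ℕ, MultiDifferential S m} (hom : IsInitialSystem x y om) (g K n : ℕ) :
    IsOpen {c : Fin n → S | IsGeneric x y om g K c} ∧
      Dense {c : Fin n → S | IsGeneric x y om g K c} := by
  have h1 := isOpen_and_dense_biInter (Set.toFinite {p : Fin n × Fin n | p.1 ≠ p.2})
    fun p hp => separated_open_dense hx hy hp
  have h2 := isOpen_and_dense_biInter (X := Fin n → S)
    (Set.toFinite (Set.univ : Set (Σ p : Fin (g + 1) × Fin K, Fin (p.2 + 1) → Fin n)))
    (A := fun q => {c | RegularAt (minusPole x om q.1.1 (q.1.2 + 1)) (c ∘ q.2)}) fun q _ =>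
      ⟨by
        rw [isOpen_iff_eventually]
        intro c hc
        have ht : Continuous fun c : Fin n → S => c ∘ q.2 :=
          continuous_pi fun j => continuous_apply (q.2 j)
        exact (ht.tendsto c).eventually hc.eventually,
      hom.diagonals _ _ _ (Nat.le_add_left 1 _) q.2⟩
  have h3 : {c : Fin n → S | IsGeneric x y om g K c} = {c : Fin n → S | ∀ l, IsGood x y (c l)} ∩
      ((⋂ p ∈ {p : Fin n × Fin n | p.1 ≠ p.2}, {z : Fin n → S | (∀ l, IsGood x y (z l)) ∧
        x (z p.1) ≠ x (z p.2)}) ∩ ⋂ q ∈ (Set.univ : Set (Σ p : Fin (g + 1) × Fin K,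
          Fin (p.2 + 1) → Fin n)), {c | RegularAt (minusPole x om q.1.1 (q.1.2 + 1)) (c ∘ q.2)}) := by
    ext c
    constructor
    · intro h
      refine ⟨h.good, Set.mem_iInter₂.2 fun p hp => ⟨h.good, h.sep _ _ hp⟩,
        Set.mem_iInter₂.2 fun q _ => ?_⟩
      exact h.reg _ (Nat.lt_succ_iff.1 q.1.1.2) _ (Nat.le_add_left 1 _) q.1.2.2 q.2
    · rintro ⟨a, b, d⟩
      refine ⟨a, fun i j hij => (Set.mem_iInter₂.1 b (i, j) hij).2, ?_⟩
      rintro h hh k hk hkK e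
      obtain ⟨k, rfl⟩ := Nat.exists_eq_add_of_le' hk
      exact Set.mem_iInter₂.1 d ⟨(⟨h, Nat.lt_succ_of_le hh⟩, ⟨k, hkK⟩), e⟩ trivial
  rw [h3]
  have h4 := h1.2.inter_of_isOpen_left h2.2 h1.1
  exact ⟨(isOpen_forall_isGood n).inter (h1.1.inter h2.1),
    (dense_forall_isGood hx hy n).inter_of_isOpen_left h4 (isOpen_forall_isGood n)⟩

namespace IsGeneric

variable {om : ℕ → ∀ m : ℕ, MultiDifferential S m} {g K : ℕ} {c : Fin n → S}

/-- If the double pole of `ω^{(0)}_{2,0}` is not subtracted, the two legs end at different vertices,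
and there the double pole is regular. -/
theorem holAtPow_omegaTilde (hc : IsGeneric x y om g K c) {h : ℕ} (hh : h ≤ g) {k : ℕ} (hk : 1 ≤ k)
    (hkK : k ≤ K) (e : Fin k → Fin n) : HolAtPow (omegaTilde x om e h) (c ∘ e) := by
  have h1 := hc.reg h hh k hk hkK e
  by_cases he : h = 0 ∧ k = 2 ∧ ¬ ∀ i j, e i = e j
  · obtain ⟨h0, h2, hij⟩ := he
    have h3 := h1.add_holAtPow (holAtPow_doublePole (x := x) h2 (fun j => (hc.good (e j)).hol_x)
      (fun i j hne => hc.sep _ _ fun hcon => hij ?_))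
    · have h4 : (fun z => minusPole x om h k z + doublePole x k z) = fun t => divDx x (om h k) t -
          if h = 0 ∧ k = 2 ∧ ∀ i j, e i = e j then doublePole x k t else 0 := by
        funext t
        rw [minusPole, if_pos ⟨h0, h2⟩, if_neg fun hcon => hij hcon.2.2]
        ring
      rw [h4] at h3
      exact h3.holAtPow_regExt
    · subst h2
      intro a b
      revert hcon hne
      fin_cases i <;> fin_cases j <;> fin_cases a <;> fin_cases b <;> simp +contextual [eq_comm]
  · have h4 : minusPole x om h k = fun t => divDx x (om h k) t -
        if h = 0 ∧ k = 2 ∧ ∀ i j, e i = e j then doublePole x k t else 0 := by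
      funext t
      rw [minusPole]
      have : (h = 0 ∧ k = 2) ↔ (h = 0 ∧ k = 2 ∧ ∀ i j, e i = e j) := by tauto
      simp only [this]
    rw [h4] at h1
    exact h1.holAtPow_regExt

theorem holAtPow_omegaOne (hc : IsGeneric x y om g K c) (hK : 1 ≤ K) {h : ℕ} (hh : h ≤ g)
    (i : Fin n) : HolAtPow (regExt (divDx x (om h 1))) fun _ => c i := by
  have h1 := hc.reg h hh 1 le_rfl hK fun _ => i
  have h4 : minusPole x om h 1 = divDx x (om h 1) := by
    funext t
    simp [minusPole]
  rw [h4] at h1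
  exact h1.holAtPow_regExt

end IsGeneric

theorem regExt_omega_zero_one (hx : IsNonconstMeromorphic x) (hy : IsNonconstMeromorphic y)
    {om : ℕ → ∀ m : ℕ, MultiDifferential S m} (hom : IsInitialSystem x y om) {p : S}
    (hp : IsGood x y p) :
    regExt (divDx x (om 0 1)) =ᶠ[𝓝 fun _ : Fin 1 => p] fun z => -y (z 0) := by
  refine IsHolExtension.regExt_eq ⟨AnalyticAt.fun_neg (HolAtPow.coord hp.hol_y),
    {z : Fin 1 → S | ∀ i, IsGood x y (z i)}, isOpen_forall_isGood 1,
    dense_forall_isGood hx hy 1, Eventually.of_forall fun z hz => ?_⟩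
  have h1 : z = fun _ => z 0 := funext fun i => congrArg z (Subsingleton.elim i 0)
  have h2 := hom.omega_zero_one (z 0) (hz 0).hol_x (hz 0).hol_y fun _ => (1 : ℂ)
  rw [divDx, Fin.prod_univ_one, div_eq_iff (hz 0).dx_ne]
  rw [h1]
  exact h2

end Generic

/-! ### From functions to germs -/

section Represents

variable {A R T σ : Type*} [CommRing A] [Algebra ℂ A] [CommRing R] [Algebra ℂ R] [CommRing T]
  [Algebra ℂ T] (γ : A →ₐ[ℂ] T) (ι : R →ₐ[ℂ] T)

/-- The polynomials `p` and `q` have the same image over `T`. -/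
def RepP (p : MvPolynomial σ A) (q : MvPolynomial σ R) : Prop :=
  MvPolynomial.mapAlgHom γ p = MvPolynomial.mapAlgHom ι q

variable {γ ι}

theorem RepP.coeff {p : MvPolynomial σ A} {q : MvPolynomial σ R} (h : RepP γ ι p q) (k : σ →₀ ℕ) :
    γ (MvPolynomial.coeff k p) = ι (MvPolynomial.coeff k q) := by
  have h1 := congrArg (MvPolynomial.coeff k) h
  rwa [MvPolynomial.mapAlgHom_apply, MvPolynomial.mapAlgHom_apply, MvPolynomial.coeff_map,
    MvPolynomial.coeff_map] at h1

theorem RepP.sub {p p' : MvPolynomial σ A} {q q' : MvPolynomial σ R} (h : RepP γ ι p q)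
    (h' : RepP γ ι p' q') : RepP γ ι (p - p') (q - q') := by
  rw [RepP, map_sub, map_sub, h, h']

theorem RepP.mul {p p' : MvPolynomial σ A} {q q' : MvPolynomial σ R} (h : RepP γ ι p q)
    (h' : RepP γ ι p' q') : RepP γ ι (p * p') (q * q') := by
  rw [RepP, map_mul, map_mul, h, h']

theorem RepP.sum {κ : Type*} (s : Finset κ) {p : κ → MvPolynomial σ A} {q : κ → MvPolynomial σ R}
    (h : ∀ i ∈ s, RepP γ ι (p i) (q i)) : RepP γ ι (∑ i ∈ s, p i) (∑ i ∈ s, q i) := by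
  rw [RepP, map_sum, map_sum]
  exact Finset.sum_congr rfl h

theorem RepP.prod {κ : Type*} (s : Finset κ) {p : κ → MvPolynomial σ A} {q : κ → MvPolynomial σ R}
    (h : ∀ i ∈ s, RepP γ ι (p i) (q i)) : RepP γ ι (∏ i ∈ s, p i) (∏ i ∈ s, q i) := by
  rw [RepP, map_prod, map_prod]
  exact Finset.prod_congr rfl h

theorem RepP.pow {p : MvPolynomial σ A} {q : MvPolynomial σ R} (h : RepP γ ι p q) (a : ℕ) :
    RepP γ ι (p ^ a) (q ^ a) := by
  rw [RepP, map_pow, map_pow, h]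

theorem RepP.smul {p : MvPolynomial σ A} {q : MvPolynomial σ R} (h : RepP γ ι p q) (a : ℂ) :
    RepP γ ι (a • p) (a • q) := by
  rw [RepP, map_smul, map_smul, h]

theorem RepP.finsum {κ : Type*} {p : κ → MvPolynomial σ A} {q : κ → MvPolynomial σ R}
    (hp : (Function.support p).Finite) (hq : (Function.support q).Finite)
    (h : ∀ i, RepP γ ι (p i) (q i)) : RepP γ ι (∑ᶠ i, p i) (∑ᶠ i, q i) := by
  have h1 := AddMonoidHom.map_finsum (MvPolynomial.mapAlgHom (σ := σ) γ).toAddMonoidHom hp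
  have h2 := AddMonoidHom.map_finsum (MvPolynomial.mapAlgHom (σ := σ) ι).toAddMonoidHom hq
  exact h1.trans ((finsum_congr h).trans h2.symm)

theorem repP_monomial (k : σ →₀ ℕ) {f : A} {r : R} (h : γ f = ι r) :
    RepP γ ι (MvPolynomial.monomial k f) (MvPolynomial.monomial k r) := by
  rw [RepP, MvPolynomial.mapAlgHom_apply, MvPolynomial.mapAlgHom_apply, MvPolynomial.map_monomial,
    MvPolynomial.map_monomial]
  exact congrArg _ h

theorem repP_C {f : A} {r : R} (h : γ f = ι r) :
    RepP (σ := σ) γ ι (MvPolynomial.C f) (MvPolynomial.C r) := repP_monomial 0 h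

theorem repP_X (i : σ) : RepP γ ι (MvPolynomial.X i) (MvPolynomial.X i) :=
  repP_monomial _ ((map_one γ).trans (map_one ι).symm)

theorem repP_one : RepP (σ := σ) γ ι 1 1 := (map_one _).trans (map_one _).symm

theorem repP_zero : RepP (σ := σ) γ ι 0 0 := (map_zero _).trans (map_zero _).symm

variable (γ ι) in
/-- The coefficients of `ħ ^ N`, `N ≤ M`, in the series `f` and `g` have the same image over `T`. -/
def RepS (M : ℕ) (f : PowerSeries (MvPolynomial σ A)) (g : PowerSeries (MvPolynomial σ R)) : Prop :=
  ∀ N ≤ M, RepP γ ι (PowerSeries.coeff N f) (PowerSeries.coeff N g)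

variable {M : ℕ} {f f' : PowerSeries (MvPolynomial σ A)} {g g' : PowerSeries (MvPolynomial σ R)}

theorem RepS.sub (h : RepS γ ι M f g) (h' : RepS γ ι M f' g') : RepS γ ι M (f - f') (g - g') :=
  fun N hN => by
    rw [map_sub, map_sub]
    exact (h N hN).sub (h' N hN)

theorem RepS.mul (h : RepS γ ι M f g) (h' : RepS γ ι M f' g') : RepS γ ι M (f * f') (g * g') :=
  fun N hN => by
    rw [PowerSeries.coeff_mul, PowerSeries.coeff_mul]
    refine RepP.sum _ fun p hp => ?_
    have := Finset.HasAntidiagonal.mem_antidiagonal.1 hp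
    exact (h _ (by omega)).mul (h' _ (by omega))

theorem repS_one : RepS (σ := σ) γ ι M 1 1 := fun N _ => by
  rw [PowerSeries.coeff_one, PowerSeries.coeff_one]
  split_ifs
  exacts [repP_one, repP_zero]

theorem repS_X : RepS (σ := σ) γ ι M PowerSeries.X PowerSeries.X := fun N _ => by
  rw [PowerSeries.coeff_X, PowerSeries.coeff_X]
  split_ifs
  exacts [repP_one, repP_zero]

theorem repS_C {p : MvPolynomial σ A} {q : MvPolynomial σ R} (h : RepP γ ι p q) :
    RepS γ ι M (PowerSeries.C p) (PowerSeries.C q) := fun N _ => by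
  rw [PowerSeries.coeff_C, PowerSeries.coeff_C]
  split_ifs
  exacts [h, repP_zero]

theorem RepS.pow (h : RepS γ ι M f g) (a : ℕ) : RepS γ ι M (f ^ a) (g ^ a) := by
  induction a with
  | zero =>
    rw [pow_zero, pow_zero]
    exact repS_one
  | succ a ih =>
    rw [pow_succ, pow_succ]
    exact ih.mul h

theorem RepS.prod {κ : Type*} (s : Finset κ) {f : κ → PowerSeries (MvPolynomial σ A)}
    {g : κ → PowerSeries (MvPolynomial σ R)} (h : ∀ i, RepS γ ι M (f i) (g i)) :
    RepS γ ι M (∏ i ∈ s, f i) (∏ i ∈ s, g i) := by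
  classical
  induction s using Finset.induction_on with
  | empty => exact repS_one
  | insert a s ha ih =>
    rw [Finset.prod_insert ha, Finset.prod_insert ha]
    exact (h a).mul ih

theorem RepS.expHbar (h : RepS γ ι M f g) : RepS γ ι M (expHbar f) (expHbar g) := fun N hN => by
  rw [XYSwap.expHbar, XYSwap.expHbar, PowerSeries.coeff_mk, PowerSeries.coeff_mk]
  exact RepP.sum _ fun j _ => (h.pow j N hN).smul _

end Represents

section AtPoint

open Filter

variable {S : Type*} [TopologicalSpace S] [ChartedSpace ℂ S] {n k : ℕ}

/-- The germ at `c` of a function on `S ^ n`. -/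
def germAt (c : Fin n → S) : ((Fin n → S) → ℂ) →ₐ[ℂ] Germ (𝓝 (toCoord c c)) ℂ :=
  (germHom _).comp (AlgHom.pi fun t => Pi.evalAlgHom ℂ _ (ofCoord c t))

/-- The function `F` has the germ `r` at `c`. -/
def Rep (c : Fin n → S) (F : (Fin n → S) → ℂ) (r : anGerm (toCoord c c)) : Prop :=
  germAt c F = (anGerm (toCoord c c)).val r

variable {c : Fin n → S} {F G : (Fin n → S) → ℂ} {r s : anGerm (toCoord c c)}

theorem Rep.holAtPow (h : Rep c F r) : HolAtPow F c := by
  obtain ⟨f, hf, rfl⟩ := anGerm.exists_rep r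
  exact hf.congr (Germ.coe_eq.1 h).symm

theorem Rep.eq_mk (h : Rep c F r) : r = anGerm.mk (fun t => F (ofCoord c t)) h.holAtPow :=
  Subtype.ext h.symm

theorem Rep.apply_eq (h : Rep c F r) (h' : Rep c G r) : F c = G c := by
  have h1 : F (ofCoord c (toCoord c c)) = G (ofCoord c (toCoord c c)) :=
    (Germ.coe_eq.1 (h.trans h'.symm)).self_of_nhds
  rwa [ofCoord_self] at h1

theorem Rep.congr (h : Rep c F r) (hFG : F =ᶠ[𝓝 c] G) : Rep c G r := by
  have h1 : ∀ᶠ t in 𝓝 (toCoord c c), F (ofCoord c t) = G (ofCoord c t) :=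
    (tendsto_ofCoord c).eventually hFG
  exact (Germ.coe_eq.2 h1).symm.trans h

theorem Rep.add (h : Rep c F r) (h' : Rep c G s) : Rep c (F + G) (r + s) := by
  rw [Rep, map_add, map_add, h, h']

theorem Rep.mul (h : Rep c F r) (h' : Rep c G s) : Rep c (F * G) (r * s) := by
  rw [Rep, map_mul, map_mul, h, h']

theorem Rep.neg (h : Rep c F r) : Rep c (-F) (-r) := by
  rw [Rep, map_neg, map_neg, h]

theorem Rep.smul (h : Rep c F r) (a : ℂ) : Rep c (a • F) (a • r) := by
  rw [Rep, map_smul, map_smul, h]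

theorem Rep.pow (h : Rep c F r) (a : ℕ) : Rep c (F ^ a) (r ^ a) := by
  rw [Rep, map_pow, map_pow, h]

theorem rep_zero : Rep c 0 0 := (map_zero _).trans (map_zero _).symm

theorem Rep.prod {κ : Type*} (s : Finset κ) {F : κ → (Fin n → S) → ℂ}
    {r : κ → anGerm (toCoord c c)} (h : ∀ i, Rep c (F i) (r i)) :
    Rep c (∏ i ∈ s, F i) (∏ i ∈ s, r i) := by
  rw [Rep, map_prod, map_prod]
  exact Finset.prod_congr rfl fun i _ => h i

theorem Rep.finsum {κ : Type*} {F : κ → (Fin n → S) → ℂ} {r : κ → anGerm (toCoord c c)}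
    (hF : (Function.support F).Finite) (hr : (Function.support r).Finite)
    (h : ∀ i, Rep c (F i) (r i)) : Rep c (∑ᶠ i, F i) (∑ᶠ i, r i) := by
  have h1 := AddMonoidHom.map_finsum (germAt c).toAddMonoidHom hF
  have h2 := AddMonoidHom.map_finsum (anGerm (toCoord c c)).val.toAddMonoidHom hr
  exact h1.trans ((finsum_congr h).trans h2.symm)

theorem Rep.inv {u : (anGerm (toCoord c c))ˣ} (h : Rep c F u) : Rep c (fun z => (F z)⁻¹) ↑(u⁻¹) := by
  have h1 : germAt c (fun z => (F z)⁻¹) = (germAt c F)⁻¹ := rfl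
  obtain ⟨f, hf, hfu⟩ := anGerm.exists_rep (↑u⁻¹ : anGerm (toCoord c c))
  have h2 : (anGerm (toCoord c c)).val u * (anGerm (toCoord c c)).val ↑u⁻¹ = 1 := by
    rw [← map_mul, Units.mul_inv, map_one]
  rw [← hfu] at h2
  rw [Rep, ← hfu]
  refine Germ.coe_eq.2 ?_
  rw [← h] at h2
  have h3 : ∀ᶠ t in 𝓝 (toCoord c c), F (ofCoord c t) * f t = 1 := Germ.coe_eq.1 h2
  filter_upwards [h3] with t ht
  exact inv_eq_of_mul_eq_one_right ht

/-- Restriction to a diagonal. -/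
theorem Rep.diag {e : Fin k → Fin n} {G : (Fin k → S) → ℂ} {φ : anGerm (toCoord (c ∘ e) (c ∘ e))}
    (h : Rep (c ∘ e) G φ) : Rep c (fun z => G (z ∘ e)) (anPull e (toCoord c c) φ) := by
  rw [h.eq_mk]
  rfl

/-- The operator `D` on functions acts on germs as `E`. -/
def RepOp (c : Fin n → S) (D : ((Fin n → S) → ℂ) → ((Fin n → S) → ℂ))
    (E : Module.End ℂ (anGerm (toCoord c c))) : Prop := ∀ F r, Rep c F r → Rep c (D F) (E r)

variable {D : ((Fin n → S) → ℂ) → ((Fin n → S) → ℂ)} {E : Module.End ℂ (anGerm (toCoord c c))}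

theorem RepOp.iterate (h : RepOp c D E) (a : ℕ) : RepOp c D^[a] (E ^ a) := by
  intro F r hF
  induction a with
  | zero => exact hF
  | succ a ih =>
    rw [Function.iterate_succ_apply', pow_succ', Module.End.mul_apply]
    exact h _ _ ih

theorem RepOp.neg (h : RepOp c D E) : RepOp c (fun F => -D F) (-E) := fun F r hF =>
  (h F r hF).neg

theorem RepOp.iterD {D : Fin n → ((Fin n → S) → ℂ) → ((Fin n → S) → ℂ)}
    {E : Fin n → Module.End ℂ (anGerm (toCoord c c))} (h : ∀ i, RepOp c (D i) (E i))
    (a : Fin n → ℕ) : RepOp c (iterD D a) (listPow E a) := by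
  intro F r hF
  rw [XYSwap.iterD, listPow]
  induction List.finRange n with
  | nil => exact hF
  | cons i l ih =>
    rw [List.map_cons, List.prod_cons, List.foldr_cons, Module.End.mul_apply]
    exact (h i).iterate (a i) _ _ ih

end AtPoint

section FrameRep

open Filter

variable {S : Type*} [TopologicalSpace S] [ChartedSpace ℂ S] [IsManifold 𝓘(ℂ) ω S] {n k : ℕ}
  {x y : S → ℂ} {c : Fin n → S} (hc : ∀ i, IsGood x y (c i))

theorem rep_x (i : Fin n) : Rep c (fun z => x (z i)) ((frameAt hc).x i) := rfl

theorem rep_y (i : Fin n) : Rep c (fun z => y (z i)) ((frameAt hc).y i) := rfl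

theorem repOp_partialD_x (i : Fin n) : RepOp c (partialD x i) ((frameAt hc).E i) := by
  intro F r hF
  have h := partialD_ofCoord (hc i).hol_x hF.holAtPow
  rw [hF.eq_mk]
  refine Germ.coe_eq.2 (h.mono fun t ht => ?_)
  exact ht.trans (div_eq_inv_mul _ _)

theorem dY_frameAt (i : Fin n) (r : anGerm (toCoord c c)) :
    (frameAt hc).dY i r = ↑((coordFrame hc).dy i)⁻¹ * anPd (toCoord c c) i r := by
  have h1 : (frameAt hc).dY i r = ↑(((coordFrame hc).dx i)⁻¹ * (coordFrame hc).dy i)⁻¹ *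
    (↑((coordFrame hc).dx i)⁻¹ * anPd (toCoord c c) i r) := rfl
  rw [h1, mul_inv_rev, inv_inv, Units.val_mul, mul_assoc, Units.mul_inv_cancel_left]

theorem repOp_partialD_y (i : Fin n) : RepOp c (partialD y i) ((frameAt hc).dY i) := by
  intro F r hF
  have h := partialD_ofCoord (hc i).hol_y hF.holAtPow
  rw [dY_frameAt, hF.eq_mk]
  refine Germ.coe_eq.2 (h.mono fun t ht => ?_)
  exact ht.trans (div_eq_inv_mul _ _)

theorem repOp_eulerD_x (i : Fin n) : RepOp c (eulerD x i) ((frameAt hc).xE i) := fun F r hF =>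
  (rep_x hc i).mul (repOp_partialD_x hc i F r hF)

theorem repOp_eulerD_y (i : Fin n) : RepOp c (eulerD y i) ((frameAt hc).yE i) := fun F r hF => by
  have h := (rep_y hc i).mul (repOp_partialD_y hc i F r hF)
  have h1 : (frameAt hc).yE i r = ((frameAt hc).y i : anGerm (toCoord c c)) * (frameAt hc).dY i r :=
    mul_assoc _ _ _
  rw [h1]
  exact h

/-- The function `dx_i / dy_i` is `∂_{y_i} x_i`. -/
theorem rep_dAt_div (i : Fin n) :
    Rep c (fun z => dAt x (z i) / dAt y (z i)) ↑((frameAt hc).dy i)⁻¹ := by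
  have h := repOp_partialD_y hc i _ _ (rep_x hc i)
  have h1 : partialD y i (fun z : Fin n → S => x (z i)) = fun z => dAt x (z i) / dAt y (z i) := by
    funext z
    simp only [partialD, Function.update_self]
  have h2 : (frameAt hc).dY i ((frameAt hc).x i) = ↑((frameAt hc).dy i)⁻¹ := by
    change ↑((frameAt hc).dy i)⁻¹ * (frameAt hc).D i ((frameAt hc).x i) = _
    rw [(frameAt hc).D_x, if_pos rfl, mul_one]
  rwa [h1, h2] at h

theorem rep_pre (i : Fin n) : Rep c (fun z => -(y (z i) / dAt y (z i)) * (dAt x (z i) / x (z i)))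
    ((frameAt hc).pre i) := by
  have h := ((rep_y hc i).mul (rep_dAt_div hc i)).mul (Rep.inv (rep_x hc i)).neg
  have h1 : (fun z : Fin n → S => -(y (z i) / dAt y (z i)) * (dAt x (z i) / x (z i))) =
      (fun z : Fin n → S => y (z i)) * (fun z => dAt x (z i) / dAt y (z i)) * -fun z => (x (z i))⁻¹ := by
    funext z
    simp only [Pi.mul_apply, Pi.neg_apply, div_eq_mul_inv]
    ring
  rw [h1]
  exact h

end FrameRep

/-! ### The terms of the formulas as germs -/

section Factors

open Filter

theorem FrameHom.pull_E_one {n : ℕ} {B R : Type*} [CommRing B] [Algebra ℂ B] [CommRing R] [Algebra ℂ R]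
    {F : Frame R n} {G : Frame B 1} {i : Fin n} (f : FrameHom F G fun _ => i) (h : B) :
    f.pull (G.E 0 h) = F.E i (f.pull h) := by
  rw [F.E_apply, f.D_pull, Fin.sum_univ_one, if_pos rfl, G.E_apply]

theorem FrameHom.pull_xE_one {n : ℕ} {B R : Type*} [CommRing B] [Algebra ℂ B] [CommRing R] [Algebra ℂ R]
    {F : Frame R n} {G : Frame B 1} {i : Fin n} (f : FrameHom F G fun _ => i) (h : B) :
    f.pull (G.xE 0 h) = F.xE i (f.pull h) := by
  rw [F.xE_apply, G.xE_apply, map_mul, f.pull_x, ← F.E_apply, ← f.pull_E_one, G.E_apply]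

theorem iterD_zero {S : Type*} {n : ℕ} {D : Fin n → ((Fin n → S) → ℂ) → ((Fin n → S) → ℂ)} (hD : ∀ i, D i 0 = 0)
    (a : Fin n → ℕ) : iterD D a 0 = 0 := by
  rw [iterD]
  induction List.finRange n with
  | nil => rfl
  | cons i l ih =>
    rw [List.foldr_cons, ih]
    exact Function.iterate_fixed (hD i) _

theorem substTheta_mul {S : Type*} {n : ℕ} (i : Fin n) (T : (Fin n → S) → ℂ) (f : ℂ → ℂ) (P : Polynomial ℂ) :
    substTheta i T (Polynomial.C f * P.map (algebraMap ℂ (ℂ → ℂ))) =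
      MvPolynomial.C (fun z => f (T z)) * Polynomial.aeval (MvPolynomial.X i) P := by
  rw [map_mul]
  congr 1
  · exact Polynomial.eval₂_C _ _
  · rw [substTheta, Polynomial.coe_eval₂RingHom, Polynomial.eval₂_map, Polynomial.aeval_def]
    rfl

variable {S : Type*} [TopologicalSpace S] [ChartedSpace ℂ S] {n k g : ℕ} {c : Fin n → S}

theorem rep_genusSeries {H : ℕ → (Fin n → S) → ℂ} {r : ℕ → anGerm (toCoord c c)}
    (h : ∀ l ≤ g, Rep c (H l) (r l)) {N : ℕ} (hN : N ≤ 2 * g) :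
    Rep c (PowerSeries.coeff N (genusSeries H)) (PowerSeries.coeff N (genusSeries r)) := by
  rw [genusSeries, genusSeries, PowerSeries.coeff_mk, PowerSeries.coeff_mk]
  split_ifs
  · exact h _ (by omega)
  · exact rep_zero

theorem repS_edgeFactor (e : Fin k → Fin n) {D : Fin k → ((Fin k → S) → ℂ) → ((Fin k → S) → ℂ)}
    {E : Fin k → Module.End ℂ (anGerm (toCoord (c ∘ e) (c ∘ e)))}
    (hD : ∀ j, RepOp (c ∘ e) (D j) (E j)) {H : ℕ → (Fin k → S) → ℂ}
    {r : ℕ → anGerm (toCoord (c ∘ e) (c ∘ e))} (hH : ∀ h ≤ g, Rep (c ∘ e) (H h) (r h)) :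
    RepS (germAt c) (anGerm (toCoord c c)).val (2 * g) (edgeFactor e D H)
      (edgeSer e (anPull e (toCoord c c)).toLinearMap E r) := by
  intro N hN
  change RepP _ _ (PowerSeries.coeff N (PowerSeries.mk _)) (PowerSeries.coeff N (PowerSeries.mk _))
  rw [PowerSeries.coeff_mk, PowerSeries.coeff_mk]
  refine RepP.sum _ fun p hp => RepP.sum _ fun a _ => ?_
  have hp2 := Finset.HasAntidiagonal.mem_antidiagonal.1 hp
  refine (RepP.prod _ fun j _ => (repP_X (e j)).pow _).mul (repP_C ?_)
  exact Rep.smul (Rep.diag (RepOp.iterD hD a _ _ (rep_genusSeries hH (by omega)))) _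

/-- The exponent at a vertex, up to the subtracted term. -/
theorem repS_applyS (i : Fin n) {D : ((Fin n → S) → ℂ) → ((Fin n → S) → ℂ)}
    {E : Module.End ℂ (anGerm (toCoord c c))} (hD : RepOp c D E) {F : ℕ → S → ℂ}
    {r : ℕ → anGerm (toCoord c c)} (hF : ∀ h ≤ g, Rep c (fun z => F h (z i)) (r h)) :
    RepS (germAt c) (anGerm (toCoord c c)).val (2 * g)
      (var S i * applyS i D (genusSeries fun h z => F h (z i)))
      (PowerSeries.C (MvPolynomial.X i) * PowerSeries.mk fun N =>
        ∑ p ∈ Finset.HasAntidiagonal.antidiagonal N, MvPolynomial.monomial (Finsupp.single i p.1)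
          (PowerSeries.coeff p.1 calS • (E ^ p.1) (PowerSeries.coeff p.2 (genusSeries r)))) := by
  refine (repS_C (repP_X i)).mul fun N hN => ?_
  rw [applyS, PowerSeries.coeff_mk, PowerSeries.coeff_mk]
  refine RepP.sum _ fun p hp => repP_monomial _ ?_
  have hp2 := Finset.HasAntidiagonal.mem_antidiagonal.1 hp
  exact Rep.smul (hD.iterate p.1 _ _ (rep_genusSeries hF (by omega))) _

theorem repS_invS (i : Fin n) (M : ℕ) : RepS (germAt c) (anGerm (toCoord c c)).val M
    (PowerSeries.mk fun N =>
      MvPolynomial.monomial (Finsupp.single i N) (fun _ => PowerSeries.coeff N calS⁻¹))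
    (iota i (PowerSeries.map (algebraMap ℂ (anGerm (toCoord c c))) calS⁻¹)) := by
  intro N _
  rw [coeff_iota, PowerSeries.coeff_mk, MvPolynomial.X_pow_eq_monomial, mul_comm,
    MvPolynomial.C_mul_monomial, mul_one, PowerSeries.coeff_map]
  refine repP_monomial _ ?_
  exact ((germAt c).commutes _).trans ((anGerm (toCoord c c)).val.commutes _).symm

theorem rep_transferSum {D : Fin n → ((Fin n → S) → ℂ) → ((Fin n → S) → ℂ)}
    {E : Fin n → Module.End ℂ (anGerm (toCoord c c))} (hD : ∀ i, RepOp c (D i) (E i))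
    (hD0 : ∀ i, D i 0 = 0) {P : (Fin n →₀ ℕ) → (Fin n → S) → ℂ}
    {p : (Fin n →₀ ℕ) → anGerm (toCoord c c)} (hP : (Function.support P).Finite)
    (hp : (Function.support p).Finite) (h : ∀ k, Rep c (P k) (p k)) :
    Rep c (transferSum D P) (∑ᶠ k : Fin n →₀ ℕ, listPow E k (p k)) := by
  refine Rep.finsum (hP.subset fun k hk hk0 => hk ?_) (hp.subset fun k hk hk0 => hk ?_) fun k =>
    RepOp.iterD hD k _ _ (h k)
  · change iterD D k (P k) = 0
    rw [hk0, iterD_zero hD0]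
  · change listPow E k (p k) = 0
    rw [hk0, map_zero]

theorem dAt_const (a : ℂ) (p : S) : dAt (fun _ : S => a) p = 0 := by
  change mfderiv 𝓘(ℂ) 𝓘(ℂ) (fun _ : S => a) p (1 : ℂ) = 0
  rw [mfderiv_const]
  rfl

theorem partialD_zero (f : S → ℂ) (i : Fin n) : partialD f i 0 = 0 := by
  funext z
  change dAt (fun _ : S => 0) (z i) / dAt f (z i) = 0
  rw [dAt_const, zero_div]

theorem eulerD_zero (f : S → ℂ) (i : Fin n) : eulerD f i 0 = 0 := by
  funext z
  rw [eulerD, partialD_zero]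
  exact mul_zero _

theorem finite_support_coeff {σ A : Type*} [CommSemiring A] (P : MvPolynomial σ A) :
    (Function.support fun k => MvPolynomial.coeff k P).Finite :=
  P.support.finite_toSet.subset fun _ hk => Finset.mem_coe.2 (MvPolynomial.mem_support_iff.2 hk)

theorem repP_aeval (i : Fin n) (P : Polynomial ℂ) : RepP (germAt c) (anGerm (toCoord c c)).val
    (Polynomial.aeval (MvPolynomial.X i) P) (Polynomial.aeval (MvPolynomial.X i) P) := by
  rw [RepP, ← Polynomial.aeval_algHom_apply, ← Polynomial.aeval_algHom_apply]
  exact congrArg (fun a => Polynomial.aeval a P) (repP_X i)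

end Factors

section GraphAt

open Filter

variable {S : Type*} [TopologicalSpace S] [ChartedSpace ℂ S] [IsManifold 𝓘(ℂ) ω S] {n g K : ℕ}
  {x y : S → ℂ} {om : ℕ → ∀ m : ℕ, MultiDifferential S m} {c : Fin n → S}

theorem index_le (Γ : MultiGraph n) (e : Fin Γ.numEdges) : Γ.index e ≤ Γ.numLegs :=
  (Fintype.card_subtype_le _).trans_eq (Fintype.card_fin _)

/-- The coefficients of the formulas at a point in general position. The differentials of genus
greater than `g` do not matter and are replaced by `0`. -/
def graphDataAt (hx : IsNonconstMeromorphic x) (hy : IsNonconstMeromorphic y)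
    (hom : IsInitialSystem x y om) (hc : IsGeneric x y om g K c) (Γ : MultiGraph n)
    (hK : 1 ≤ K) (hΓ : Γ.numLegs ≤ K) : GraphData (frameAt hc.good) Γ where
  B _ e := anGerm (toCoord (c ∘ e) (c ∘ e))
  frame _ e := frameAt (c := c ∘ e) fun j => hc.good (e j)
  hom _ e := frameHomAt hc.good e
  one i h := if hh : h ≤ g then anGerm.mk _ (hc.holAtPow_omegaOne hK hh i) else 0
  one_zero i := by
    rw [dif_pos (Nat.zero_le g)]
    exact (anGerm.mk_eq (g := fun t => -y (ofCoord (fun _ : Fin 1 => c i) t 0))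
      (hg := AnalyticAt.fun_neg (HolAtPow.coord (hc.good i).hol_y))).2
      ((tendsto_ofCoord fun _ : Fin 1 => c i).eventually
        (regExt_omega_zero_one hx hy hom (hc.good i)))
  edge e h := if hh : h ≤ g then anGerm.mk _ (hc.holAtPow_omegaTilde hh
    (one_le_two.trans (Γ.two_le_index e)) ((index_le Γ e).trans hΓ) (Γ.attach e)) else 0

variable (hx : IsNonconstMeromorphic x) (hy : IsNonconstMeromorphic y)
  (hom : IsInitialSystem x y om) (hc : IsGeneric x y om g K c) (Γ : MultiGraph n)
  (hK : 1 ≤ K) (hΓ : Γ.numLegs ≤ K)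

theorem rep_one (i : Fin n) {h : ℕ} (hh : h ≤ g) :
    Rep (c ∘ fun _ : Fin 1 => i) (regExt (divDx x (om h 1)))
      ((graphDataAt hx hy hom hc Γ hK hΓ).one i h) := by
  have h1 : (graphDataAt hx hy hom hc Γ hK hΓ).one i h =
      anGerm.mk _ (hc.holAtPow_omegaOne hK hh i) := dif_pos hh
  rw [h1]
  rfl

theorem rep_edge (e : Fin Γ.numEdges) {h : ℕ} (hh : h ≤ g) :
    Rep (c ∘ Γ.attach e) (omegaTilde x om (Γ.attach e) h)
      ((graphDataAt hx hy hom hc Γ hK hΓ).edge e h) := by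
  have h1 : (graphDataAt hx hy hom hc Γ hK hΓ).edge e h = anGerm.mk _ (hc.holAtPow_omegaTilde hh
    (one_le_two.trans (Γ.two_le_index e)) ((index_le Γ e).trans hΓ) (Γ.attach e)) := dif_pos hh
  rw [h1]
  rfl

theorem rep_omegaOne (i : Fin n) {h : ℕ} (hh : h ≤ g) :
    Rep c (fun z => omegaOne x om h (z i))
      (((graphDataAt hx hy hom hc Γ hK hΓ).hom 1 fun _ => i).pull
        ((graphDataAt hx hy hom hc Γ hK hΓ).one i h)) :=
  Rep.diag (rep_one hx hy hom hc Γ hK hΓ i hh)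

theorem repS_edgeS (e : Fin Γ.numEdges) : RepS (germAt c) (anGerm (toCoord c c)).val (2 * g)
    (edgeFactor (Γ.attach e) (fun j => partialD x j) (omegaTilde x om (Γ.attach e)))
    ((graphDataAt hx hy hom hc Γ hK hΓ).edgeS e) :=
  repS_edgeFactor (Γ.attach e) (fun j => repOp_partialD_x (fun j => hc.good (Γ.attach e j)) j)
    fun _ hh => rep_edge hx hy hom hc Γ hK hΓ e hh

theorem repS_edgeU (e : Fin Γ.numEdges) : RepS (germAt c) (anGerm (toCoord c c)).val (2 * g)
    (edgeFactor (Γ.attach e) (fun j => eulerD x j)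
      fun g t => (∏ j, -x (t j)) * omegaTilde x om (Γ.attach e) g t)
    ((graphDataAt hx hy hom hc Γ hK hΓ).edgeU e) := by
  refine repS_edgeFactor (Γ.attach e)
    (fun j => repOp_eulerD_x (fun j => hc.good (Γ.attach e j)) j) fun h hh => ?_
  have h1 := (Rep.prod Finset.univ fun j => (rep_x (fun j => hc.good (Γ.attach e j)) j).neg).mul
    (rep_edge hx hy hom hc Γ hK hΓ e hh)
  have h2 : (fun t => (∏ j, -x (t j)) * omegaTilde x om (Γ.attach e) h t) =
      (∏ j, -fun t : Fin (Γ.index e) → S => x (t j)) * omegaTilde x om (Γ.attach e) h := by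
    funext t
    rw [Pi.mul_apply, Finset.prod_apply]
    rfl
  rw [h2]
  exact h1

theorem repS_vertexS (i : Fin n) : RepS (germAt c) (anGerm (toCoord c c)).val (2 * g)
    (vertexExp i (partialD x i) (omegaOne x om))
    (expHbar (vertexS (frameAt hc.good) ((graphDataAt hx hy hom hc Γ hK hΓ).hom 1 fun _ => i)
      ((graphDataAt hx hy hom hc Γ hK hΓ).one i))) := by
  refine RepS.expHbar (RepS.sub ?_ ?_)
  · rw [edgeSer_one i _ _ ((frameAt hc.good).E i) fun h =>
      ((graphDataAt hx hy hom hc Γ hK hΓ).hom 1 fun _ => i).pull_E_one h]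
    exact repS_applyS i (repOp_partialD_x hc.good i) fun h hh => rep_omegaOne hx hy hom hc Γ hK hΓ i hh
  · rw [map_mul]
    exact (repS_C (repP_X i)).mul (repS_C (repP_C (rep_omegaOne hx hy hom hc Γ hK hΓ i (Nat.zero_le g))))

/-- On the germs, `θ_i = x_i y_i`. -/
theorem rep_theta (hx : IsNonconstMeromorphic x) (hy : IsNonconstMeromorphic y)
    (hom : IsInitialSystem x y om) (hc : IsGeneric x y om g K c) (i : Fin n) : Rep c (fun z => theta x om (z i))
    ((frameAt hc.good).x i * (frameAt hc.good).y i : anGerm (toCoord c c)) := by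
  refine ((rep_x hc.good i).mul (rep_y hc.good i)).congr ?_
  have h : Tendsto (fun (z : Fin n → S) (_ : Fin 1) => z i) (𝓝 c) (𝓝 fun _ => c i) :=
    (continuous_pi fun _ => continuous_apply i).tendsto c
  filter_upwards [h.eventually (regExt_omega_zero_one hx hy hom (hc.good i))] with z hz
  rw [theta, omegaOne, hz, neg_mul_neg]
  rfl

theorem repS_vertexU (i : Fin n) : RepS (germAt c) (anGerm (toCoord c c)).val (2 * g)
    (vertexExp i (eulerD x i) (fun g p => -x p * omegaOne x om g p))
    (expHbar (vertexU (frameAt hc.good) ((graphDataAt hx hy hom hc Γ hK hΓ).hom 1 fun _ => i)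
      ((graphDataAt hx hy hom hc Γ hK hΓ).one i))) := by
  refine RepS.expHbar (RepS.sub ?_ ?_)
  · rw [edgeSer_one i _ _ ((frameAt hc.good).xE i) fun h =>
      ((graphDataAt hx hy hom hc Γ hK hΓ).hom 1 fun _ => i).pull_xE_one h]
    refine repS_applyS (F := fun h p => -x p * omegaOne x om h p) i
      (repOp_eulerD_x hc.good i) fun h hh => ?_
    have h1 := (rep_x hc.good i).neg.mul (rep_omegaOne hx hy hom hc Γ hK hΓ i hh)
    have h2 := ((graphDataAt hx hy hom hc Γ hK hΓ).hom 1 fun _ => i).pull_x 0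
    change Rep c _ (((graphDataAt hx hy hom hc Γ hK hΓ).hom 1 fun _ => i).pull (-_ * _))
    rw [map_mul, map_neg, h2]
    exact h1
  · rw [map_mul]
    exact (repS_C (repP_X i)).mul (repS_C (repP_C (rep_theta hx hy hom hc i)))

end GraphAt

/-! ### The contributions of a graph as germs -/

section Terms

open Filter

variable {S : Type*} [TopologicalSpace S] [ChartedSpace ℂ S] [IsManifold 𝓘(ℂ) ω S] {n g K : ℕ}
  {x y : S → ℂ} {om : ℕ → ∀ m : ℕ, MultiDifferential S m} {c : Fin n → S}
  (hx : IsNonconstMeromorphic x) (hy : IsNonconstMeromorphic y)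
  (hom : IsInitialSystem x y om) (hc : IsGeneric x y om g K c) (Γ : MultiGraph n)
  (hK : 1 ≤ K) (hΓ : Γ.numLegs ≤ K)

theorem repS_innerU : RepS (germAt c) (anGerm (toCoord c c)).val (2 * g)
    (universalInner x om Γ) (graphDataAt hx hy hom hc Γ hK hΓ).innerU :=
  ((repS_X.pow _).mul (RepS.prod _ fun i =>
    (repS_invS i _).mul (repS_vertexU hx hy hom hc Γ hK hΓ i))).mul
      (RepS.prod _ fun e => repS_edgeU hx hy hom hc Γ hK hΓ e)

theorem repS_innerS : RepS (germAt c) (anGerm (toCoord c c)).val (2 * g)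
    (PowerSeries.X ^ (2 * Γ.betti) *
      (∏ i, cst (fun z => dAt x (z i) / dAt y (z i)) *
        vertexExp i (partialD x i) (omegaOne x om)) *
      ∏ e, edgeFactor (Γ.attach e) (fun j => partialD x j) (omegaTilde x om (Γ.attach e)))
    (PowerSeries.C (MvPolynomial.C (∏ i, (↑((frameAt hc.good).dy i)⁻¹ : anGerm (toCoord c c)))) *
      (graphDataAt hx hy hom hc Γ hK hΓ).innerS) := by
  have h : PowerSeries.C (MvPolynomial.C
      (∏ i, (↑((frameAt hc.good).dy i)⁻¹ : anGerm (toCoord c c)))) *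
      (graphDataAt hx hy hom hc Γ hK hΓ).innerS = PowerSeries.X ^ (2 * Γ.betti) *
      (∏ i, PowerSeries.C (MvPolynomial.C (↑((frameAt hc.good).dy i)⁻¹ : anGerm (toCoord c c))) *
        expHbar (vertexS (frameAt hc.good) ((graphDataAt hx hy hom hc Γ hK hΓ).hom 1 fun _ => i)
          ((graphDataAt hx hy hom hc Γ hK hΓ).one i))) *
      ∏ e, (graphDataAt hx hy hom hc Γ hK hΓ).edgeS e := by
    rw [Finset.prod_mul_distrib, ← map_prod, ← map_prod, GraphData.innerS]
    ring
  rw [h]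
  exact ((repS_X.pow _).mul (RepS.prod _ fun i => (repS_C (repP_C (rep_dAt_div hc.good i))).mul
    (repS_vertexS hx hy hom hc Γ hK hΓ i))).mul
      (RepS.prod _ fun e => repS_edgeS hx hy hom hc Γ hK hΓ e)

/-- The contribution of a graph to the simple formula, as a germ. -/
theorem rep_simpleTerm : Rep c (simpleTerm x y om g Γ)
    ((frameAt hc.good).simple (2 * g) (graphDataAt hx hy hom hc Γ hK hΓ).innerS) := by
  have h := repS_innerS hx hy hom hc Γ hK hΓ (2 * g) le_rfl
  rw [PowerSeries.coeff_C_mul] at h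
  refine rep_transferSum (fun i => repOp_partialD_y hc.good i) (fun i => partialD_zero y i)
    (Frame.finite_support_coeffDiv _) ?_ fun k => ?_
  · refine (Frame.finite_support_coeffDiv (PowerSeries.coeff (2 * g)
      (graphDataAt hx hy hom hc Γ hK hΓ).innerS)).subset fun k hk hk0 => hk ?_
    change _ * coeffDiv _ k = 0
    rw [hk0, mul_zero]
  · have h1 := h.coeff (k + oneIdx n)
    rw [MvPolynomial.coeff_C_mul] at h1
    exact h1

theorem repS_serLAt (hx : IsNonconstMeromorphic x) (hy : IsNonconstMeromorphic y)
    (hom : IsInitialSystem x y om) (hc : IsGeneric x y om g K c) (i : Fin n) (r M : ℕ) :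
    RepS (germAt c) (anGerm (toCoord c c)).val M (serLAt x om i r)
      ((frameAt hc.good).serLT i r) := by
  intro N _
  rw [serLAt, PowerSeries.coeff_map, serL_eq, PowerSeries.coeff_mk, substTheta_mul, Frame.serLT,
    PowerSeries.coeff_mk]
  refine (repP_C ?_).mul (repP_aeval i _)
  have h := rep_theta hx hy hom hc i
  have h1 : Rep c (fun z => (theta x om (z i))⁻¹)
      ↑((frameAt hc.good).x i * (frameAt hc.good).y i)⁻¹ := Rep.inv h
  rw [mul_inv, Units.val_mul] at h1
  exact h1.pow (N + r)

theorem finite_support_mul_C {A : Type*} [CommRing A] {n : ℕ}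
    (a : (Fin n →₀ ℕ) → MvPolynomial (Fin n) A) (P : MvPolynomial (Fin n) A) :
    (Function.support fun r => a r * MvPolynomial.C (coeffDiv P r)).Finite := by
  refine (Frame.finite_support_coeffDiv P).subset fun k hk hk0 => hk ?_
  change a k * MvPolynomial.C (coeffDiv P k) = 0
  rw [hk0, map_zero, mul_zero]

theorem repS_outer : RepS (germAt c) (anGerm (toCoord c c)).val (2 * g)
    (universalOuter x y om Γ)
    ((frameAt hc.good).outer (graphDataAt hx hy hom hc Γ hK hΓ).innerU) := by
  refine (RepS.prod _ fun i => repS_C (repP_C (rep_pre hc.good i))).mul fun N hN => ?_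
  rw [PowerSeries.coeff_mk, PowerSeries.coeff_mk]
  refine RepP.sum _ fun p hp => ?_
  have hp2 := Finset.HasAntidiagonal.mem_antidiagonal.1 hp
  refine RepP.finsum (finite_support_mul_C _ _) (finite_support_mul_C _ _) fun r => ?_
  refine (RepS.prod (M := p.1) _ (fun i => repS_serLAt hx hy hom hc i (r i) p.1) p.1 le_rfl).mul
    (repP_C ?_)
  exact (repS_innerU hx hy hom hc Γ hK hΓ p.2 (by omega)).coeff (r + oneIdx n)

/-- The contribution of a graph to the universal formula, as a germ. -/
theorem rep_universalTerm (hn : 1 ≤ n) : Rep c (universalTerm x y om g Γ)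
    ((frameAt hc.good).univ (2 * g) (graphDataAt hx hy hom hc Γ hK hΓ).innerU) := by
  rw [← (frameAt hc.good).transfer_outer hn]
  exact rep_transferSum (fun i => (repOp_eulerD_y hc.good i).neg)
    (fun i => by rw [eulerD_zero, neg_zero]) (finite_support_coeff _) (finite_support_coeff _)
    fun k => (repS_outer hx hy hom hc Γ hK hΓ (2 * g) le_rfl).coeff k

end Terms

section Regularization

variable {S : Type*} [TopologicalSpace S] [ChartedSpace ℂ S] [IsManifold 𝓘(ℂ) ω S] {n g K : ℕ}
  {x y : S → ℂ} {om : ℕ → ∀ m : ℕ, MultiDifferential S m} {c : Fin n → S}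

theorem coeff_aeval_X (i : Fin n) {A : Type*} [CommRing A] [Algebra ℂ A] (P : Polynomial ℂ) (k : ℕ) :
    MvPolynomial.coeff (Finsupp.single i k)
      (Polynomial.aeval (MvPolynomial.X i : MvPolynomial (Fin n) A) P) =
        algebraMap ℂ A (P.coeff k) := by
  induction P using Polynomial.induction_on' with
  | add P Q hP hQ => rw [map_add, MvPolynomial.coeff_add, hP, hQ, Polynomial.coeff_add, map_add]
  | monomial j a =>
    rw [Polynomial.aeval_monomial, MvPolynomial.algebraMap_apply, MvPolynomial.coeff_C_mul,
      MvPolynomial.coeff_X_pow, Polynomial.coeff_monomial]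
    by_cases h : j = k
    · subst h
      simp
    · rw [if_neg (fun h' => h (Finsupp.single_injective i h')), if_neg h, mul_zero, map_zero]

/-- The regularization, as a germ. -/
theorem rep_regularization (hx : IsNonconstMeromorphic x) (hy : IsNonconstMeromorphic y)
    (hom : IsInitialSystem x y om) (hc : IsGeneric x y om g K c) (i : Fin n) :
    Rep c (regularization x y om g i)
      (opT ((frameAt hc.good).yE i)
        ((ell (2 * g)).divX.map (algebraMap ℂ (anGerm (toCoord c c))))
        ((↑((frameAt hc.good).x i)⁻¹ * ↑((frameAt hc.good).y i)⁻¹ : anGerm (toCoord c c)) ^ (2 * g) *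
          -(frameAt hc.good).yE i ((frameAt hc.good).x i * (frameAt hc.good).y i))) := by
  obtain ⟨a, ha⟩ : ∃ a : anGerm (toCoord c c), a =
      (↑((frameAt hc.good).x i)⁻¹ * ↑((frameAt hc.good).y i)⁻¹ : anGerm (toCoord c c)) := ⟨_, rfl⟩
  obtain ⟨b, hb⟩ : ∃ b : anGerm (toCoord c c), b =
      -(frameAt hc.good).yE i ((frameAt hc.good).x i * (frameAt hc.good).y i) := ⟨_, rfl⟩
  have hb' : Rep c (-eulerD y i fun z => theta x om (z i)) b :=
    hb ▸ (repOp_eulerD_y hc.good i _ _ (rep_theta hx hy hom hc i)).neg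
  rw [← ha, ← hb, opT_map, Polynomial.aeval_eq_sum_range, LinearMap.sum_apply]
  have h1 : ∀ k, MvPolynomial.coeff (Finsupp.single i (k + 1)) (PowerSeries.coeff (2 * g)
      ((frameAt hc.good).serLT i 0)) = (ell (2 * g)).divX.coeff k • a ^ (2 * g) := by
    intro k
    rw [Frame.serLT, PowerSeries.coeff_mk, MvPolynomial.coeff_C_mul, coeff_aeval_X, ← ha, add_zero,
      Polynomial.coeff_divX, Algebra.smul_def, mul_comm]
    congr 3
    simp [fallFrom]
  have h2 : ∑ k ∈ Finset.range ((ell (2 * g)).divX.natDegree + 1),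
      ((ell (2 * g)).divX.coeff k • (-(frameAt hc.good).yE i) ^ k) (a ^ (2 * g) * b) =
      ∑ᶠ k : ℕ, ((-(frameAt hc.good).yE i) ^ k) (((ell (2 * g)).divX.coeff k • a ^ (2 * g)) * b) := by
    rw [finsum_eq_sum_of_support_subset]
    · refine Finset.sum_congr rfl fun k _ => ?_
      rw [smul_mul_assoc, map_smul]
      rfl
    · intro k hk
      rw [Finset.mem_coe, Finset.mem_range, Nat.lt_succ_iff]
      refine Polynomial.le_natDegree_of_ne_zero fun h0 => hk ?_
      change ((-(frameAt hc.good).yE i) ^ k) (((ell (2 * g)).divX.coeff k • a ^ (2 * g)) * b) = 0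
      rw [h0, zero_smul, zero_mul, map_zero]
  rw [h2]
  have hz : ∀ k, (fun F => -eulerD y i F)^[k] 0 = 0 := fun k =>
    Function.iterate_fixed (by rw [eulerD_zero, neg_zero]) k
  refine Rep.finsum ?_ ?_ fun k => ?_
  · refine (((finite_support_coeff (PowerSeries.coeff (2 * g) (serLAt x om i 0))).preimage
      ((Finsupp.single_injective i).comp (add_left_injective 1)).injOn)).subset fun k hk hk0 => hk ?_
    have hk1 : MvPolynomial.coeff (Finsupp.single i (k + 1))
        (PowerSeries.coeff (2 * g) (serLAt x om i 0)) = 0 := hk0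
    change (fun F => -eulerD y i F)^[k] _ = 0
    rw [hk1, zero_mul, hz]
  · refine (Finset.finite_toSet (Finset.range ((ell (2 * g)).divX.natDegree + 1))).subset
      fun k hk => ?_
    rw [Finset.mem_coe, Finset.mem_range, Nat.lt_succ_iff]
    refine Polynomial.le_natDegree_of_ne_zero fun h0 => hk ?_
    change ((-(frameAt hc.good).yE i) ^ k) (((ell (2 * g)).divX.coeff k • a ^ (2 * g)) * b) = 0
    rw [h0, zero_smul, zero_mul, map_zero]
  · rw [← h1]
    refine (repOp_eulerD_y hc.good i).neg.iterate k _ _ (Rep.mul ?_ hb')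
    exact (repS_serLAt hx hy hom hc i 0 _ (2 * g) le_rfl).coeff _

end Regularization

/-! ### Sums over graphs -/

namespace MultiGraph

variable {n : ℕ}

theorem two_mul_numEdges_le (Γ : MultiGraph n) : 2 * Γ.numEdges ≤ Γ.numLegs := by
  have h := Fintype.card_congr (Equiv.sigmaFiberEquiv Γ.edgeOf)
  rw [Fintype.card_sigma, Fintype.card_fin] at h
  rw [← h, mul_comm, ← smul_eq_mul]
  have h1 := Finset.card_nsmul_le_sum (Finset.univ : Finset (Fin Γ.numEdges)) _ 2
    fun e _ => Γ.two_le_index e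
  rwa [Finset.card_fin] at h1

theorem numLegs_le (Γ : MultiGraph n) {g : ℕ} (h : Γ.betti ≤ g) : Γ.numLegs ≤ 2 * (g + n) := by
  have := Γ.two_mul_numEdges_le
  rw [betti] at h
  omega

/-- In a connected graph every vertex has a leg, unless the graph is a single vertex. -/
theorem exists_leg_or (Γ : MultiGraph n) :
    (∀ i, ∃ j, Γ.vertexOf j = i) ∨ (n = 1 ∧ Γ.numEdges = 0) := by
  by_cases hv : ∀ i : Fin n, ∃ v : Fin n ⊕ Fin Γ.numEdges, v ≠ Sum.inl i
  · refine Or.inl fun i => ?_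
    obtain ⟨v, hv⟩ := hv i
    obtain ⟨w⟩ := Γ.connected.preconnected (Sum.inl i) v
    cases w with
    | nil => exact absurd rfl hv
    | cons h _ =>
      rw [SimpleGraph.fromRel_adj] at h
      rcases h.2 with ⟨j, h1, _⟩ | ⟨j, _, h2⟩
      · exact ⟨j, (Sum.inl_injective h1).symm⟩
      · exact absurd h2 Sum.inl_ne_inr
  · push Not at hv
    obtain ⟨i, hi⟩ := hv
    refine Or.inr ⟨?_, ?_⟩
    · have : Subsingleton (Fin n) := ⟨fun a b => Sum.inl_injective
        ((hi (Sum.inl a)).trans (hi (Sum.inl b)).symm)⟩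
      have h1 := Fintype.card_le_one_iff_subsingleton.2 this
      rw [Fintype.card_fin] at h1
      have := i.pos
      omega
    · by_contra h0
      exact Sum.inr_ne_inl (hi (Sum.inr ⟨0, Nat.pos_of_ne_zero h0⟩))

theorem numLegs_eq_zero {Γ : MultiGraph n} (h : Γ.numEdges = 0) : Γ.numLegs = 0 := by
  by_contra h0
  have h1 : Fin Γ.numEdges := Γ.edgeOf ⟨0, Nat.pos_of_ne_zero h0⟩
  rw [h] at h1
  exact h1.elim0

theorem finite_bounded (n K : ℕ) : {Γ : MultiGraph n | Γ.numLegs ≤ K}.Finite := by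
  have hf : Function.Injective fun Γ : MultiGraph n => (⟨Γ.numEdges, Γ.numLegs, Γ.edgeOf, Γ.vertexOf⟩ :
      Σ (E : ℕ) (L : ℕ), (Fin L → Fin E) × (Fin L → Fin n)) := by
    rintro ⟨⟩ ⟨⟩ h
    cases h
    rfl
  refine Set.Finite.of_finite_image ?_ hf.injOn
  refine (Set.finite_range fun s : Σ (E : Fin (K + 1)) (L : Fin (K + 1)),
    (Fin L → Fin E) × (Fin L → Fin n) => (⟨s.1, s.2.1, s.2.2⟩ :
      Σ (E : ℕ) (L : ℕ), (Fin L → Fin E) × (Fin L → Fin n))).subset ?_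
  rintro _ ⟨Γ, hΓ, rfl⟩
  have hΓ' : Γ.numLegs ≤ K := hΓ
  have := Γ.two_mul_numEdges_le
  exact ⟨⟨⟨Γ.numEdges, by omega⟩, ⟨Γ.numLegs, by omega⟩, Γ.edgeOf, Γ.vertexOf⟩, rfl⟩

/-- The classes of graphs with at most `K` legs. -/
def classes (n K : ℕ) : Finset (Quotient (isoSetoid n)) :=
  ((finite_bounded n K).preimage Quotient.out_injective.injOn).toFinset

theorem mem_classes {K : ℕ} {q : Quotient (isoSetoid n)} :
    q ∈ classes n K ↔ q.out.numLegs ≤ K := by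
  rw [classes, Set.Finite.mem_toFinset]
  rfl

/-- The graph with one vertex and no legs. -/
def point : MultiGraph 1 where
  numEdges := 0
  numLegs := 0
  edgeOf := id
  vertexOf := Fin.elim0
  two_le_index e := e.elim0
  connected :=
    have : Subsingleton (Fin 1 ⊕ Fin 0) := ⟨by
      rintro (a | a) (b | b)
      exacts [congrArg _ (Subsingleton.elim a b), b.elim0, a.elim0, a.elim0]⟩
    have : Nonempty (Fin 1 ⊕ Fin 0) := ⟨Sum.inl 0⟩
    ⟨SimpleGraph.Preconnected.of_subsingleton⟩

/-- Two graphs without multiedges are isomorphic, in a unique way. -/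
def isoOfEdgeless {Γ Δ : MultiGraph n} (hΓ : Γ.numEdges = 0) (hΔ : Δ.numEdges = 0) : Iso Γ Δ where
  legs := finCongr ((numLegs_eq_zero hΓ).trans (numLegs_eq_zero hΔ).symm)
  edges := finCongr (hΓ.trans hΔ.symm)
  edge_comp j := (Fin.cast (numLegs_eq_zero hΓ) j).elim0
  vertex_comp j := (Fin.cast (numLegs_eq_zero hΓ) j).elim0

theorem numAut_eq_one {Γ : MultiGraph n} (h : Γ.numEdges = 0) : Γ.numAut = 1 := by
  have h1 : Subsingleton (Iso Γ Γ) := ⟨by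
    rintro ⟨a, b, _, _⟩ ⟨a', b', _, _⟩
    have ha : a = a' := Equiv.ext fun j => (Fin.cast (numLegs_eq_zero h) j).elim0
    have hb : b = b' := Equiv.ext fun j => (Fin.cast h j).elim0
    subst ha hb
    rfl⟩
  rw [numAut, Nat.card_eq_one_iff_unique]
  exact ⟨h1, ⟨isoOfEdgeless h h⟩⟩

theorem numEdges_out_eq_zero_iff {q : Quotient (isoSetoid 1)} :
    q.out.numEdges = 0 ↔ q = Quotient.mk _ point := by
  constructor
  · intro h
    rw [← q.out_eq]
    exact Quotient.sound ⟨isoOfEdgeless h rfl⟩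
  · rintro rfl
    obtain ⟨f⟩ : Nonempty (Iso (Quotient.mk (isoSetoid 1) point).out point) := Quotient.mk_out point
    have h := Fintype.card_congr f.edges
    rwa [Fintype.card_fin, Fintype.card_fin] at h

end MultiGraph

theorem graphSum_apply {X : Type*} {n K : ℕ} {F : MultiGraph n → X → ℂ}
    (h : ∀ Γ, K < Γ.numLegs → F Γ = 0) (z : X) :
    graphSum F z = ∑ q ∈ MultiGraph.classes n K, ((q.out.numAut : ℂ)⁻¹) * F q.out z := by
  rw [graphSum, finsum_eq_sum_of_support_subset (s := MultiGraph.classes n K), Finset.sum_apply]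
  · rfl
  · intro q hq
    rw [Finset.mem_coe, MultiGraph.mem_classes]
    by_contra hK
    refine hq ?_
    change _ • F q.out = 0
    rw [h _ (not_le.1 hK), smul_zero]

section Vanishing

variable {S : Type*} [TopologicalSpace S] [ChartedSpace ℂ S] {n g : ℕ}
  {x y : S → ℂ} {om : ℕ → ∀ m : ℕ, MultiDifferential S m}

theorem transferSum_zero {S : Type*} {n : ℕ} {D : Fin n → ((Fin n → S) → ℂ) → ((Fin n → S) → ℂ)}
    (hD : ∀ i, D i 0 = 0) {P : (Fin n →₀ ℕ) → (Fin n → S) → ℂ} (h : ∀ k, P k = 0) :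
    transferSum D P = 0 := by
  refine (finsum_congr fun k => ?_).trans finsum_zero
  rw [h, iterD_zero hD]

theorem coeffDiv_zero {R : Type*} [CommSemiring R] (k : Fin n →₀ ℕ) :
    coeffDiv (0 : MvPolynomial (Fin n) R) k = 0 := MvPolynomial.coeff_zero _

theorem simpleTerm_eq_zero {Γ : MultiGraph n} (h : g < Γ.betti) : simpleTerm x y om g Γ = 0 := by
  refine transferSum_zero (fun i => partialD_zero y i) fun k => ?_
  rw [mul_assoc, PowerSeries.coeff_X_pow_mul', if_neg (by omega), coeffDiv_zero]

theorem universalTerm_eq_zero {Γ : MultiGraph n} (h : g < Γ.betti) :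
    universalTerm x y om g Γ = 0 := by
  refine transferSum_zero (fun i => by rw [eulerD_zero, neg_zero]) fun k => ?_
  have h1 : ∀ N ≤ 2 * g, PowerSeries.coeff N (universalInner x om Γ) = 0 := by
    intro N hN
    rw [universalInner, mul_assoc, PowerSeries.coeff_X_pow_mul', if_neg (by omega)]
  rw [universalOuter, PowerSeries.coeff_mul, Finset.sum_eq_zero, MvPolynomial.coeff_zero]
  intro p hp
  have hp2 := Finset.HasAntidiagonal.mem_antidiagonal.1 hp
  rw [PowerSeries.coeff_mk, Finset.sum_eq_zero, mul_zero]
  intro q hq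
  have hq2 := Finset.HasAntidiagonal.mem_antidiagonal.1 hq
  refine (finsum_congr fun r => ?_).trans finsum_zero
  rw [h1 _ (by omega), coeffDiv_zero, map_zero, mul_zero]

end Vanishing

section Comparison

variable {S : Type*} [TopologicalSpace S] [ChartedSpace ℂ S] [IsManifold 𝓘(ℂ) ω S] {n g K : ℕ}
  {x y : S → ℂ} {om : ℕ → ∀ m : ℕ, MultiDifferential S m} {c : Fin n → S}

theorem rep_prod_y (hc : ∀ i, IsGood x y (c i)) : Rep c (∏ i, fun z : Fin n → S => y (z i))
    (∏ i, ((frameAt hc).y i : anGerm (toCoord c c))) :=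
  Rep.prod _ fun i => rep_y hc i

theorem universalTerm_apply (hx : IsNonconstMeromorphic x) (hy : IsNonconstMeromorphic y)
    (hom : IsInitialSystem x y om) (hc : IsGeneric x y om g K c) (Γ : MultiGraph n) (hn : 1 ≤ n)
    (hK : 1 ≤ K) (hΓK : Γ.numLegs ≤ K) (hΓ : ∀ i, ∃ j, Γ.vertexOf j = i) :
    universalTerm x y om g Γ c = (∏ i, y (c i)) * simpleTerm x y om g Γ c := by
  have h1 := rep_universalTerm hx hy hom hc Γ hK hΓK hn
  rw [GraphData.univ_innerU _ hn _ hΓ] at h1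
  have h2 := h1.apply_eq ((rep_prod_y hc.good).mul (rep_simpleTerm hx hy hom hc Γ hK hΓK))
  rwa [Pi.mul_apply, Finset.prod_apply] at h2

theorem universalTerm_add_regularization_apply {c : Fin 1 → S} (hx : IsNonconstMeromorphic x)
    (hy : IsNonconstMeromorphic y) (hom : IsInitialSystem x y om) (hc : IsGeneric x y om g K c)
    (Γ : MultiGraph 1) (hK : 1 ≤ K) (hΓK : Γ.numLegs ≤ K) (hΓ : Γ.numEdges = 0) :
    universalTerm x y om g Γ c + regularization x y om g 0 c =
      (∏ i, y (c i)) * simpleTerm x y om g Γ c := by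
  have h1 := (rep_universalTerm hx hy hom hc Γ hK hΓK le_rfl).add
    (rep_regularization hx hy hom hc 0)
  rw [GraphData.univ_innerU_add _ (by omega) hΓ] at h1
  have h2 := h1.apply_eq ((rep_prod_y hc.good).mul (rep_simpleTerm hx hy hom hc Γ hK hΓK))
  rwa [Pi.mul_apply, Finset.prod_apply] at h2

/-- At points in general position, the sums over graphs differ by the factor `∏_i y_i` and by the
regularization, which is the contribution of the single vertex. -/
theorem graphSum_universalTerm (hx : IsNonconstMeromorphic x) (hy : IsNonconstMeromorphic y)
    (hom : IsInitialSystem x y om) (hn : 1 ≤ n) (hc : IsGeneric x y om g (2 * (g + n)) c) :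
    graphSum (universalTerm x y om g) c +
        (if h : n = 1 then regularization x y om g (⟨0, by omega⟩ : Fin n) else 0) c =
      (∏ i, y (c i)) * graphSum (simpleTerm x y om g) c := by
  classical
  have hbetti : ∀ Γ : MultiGraph n, 2 * (g + n) < Γ.numLegs → g < Γ.betti := by
    intro Γ h
    by_contra hb
    exact absurd (Γ.numLegs_le (not_lt.1 hb)) (not_le.2 h)
  rw [graphSum_apply fun Γ h => universalTerm_eq_zero (hbetti Γ h),
    graphSum_apply fun Γ h => simpleTerm_eq_zero (hbetti Γ h), Finset.mul_sum]
  by_cases h1 : n = 1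
  · subst h1
    have h0 : Quotient.mk _ MultiGraph.point ∈ MultiGraph.classes 1 (2 * (g + 1)) := by
      rw [MultiGraph.mem_classes, MultiGraph.numLegs_eq_zero
        (MultiGraph.numEdges_out_eq_zero_iff.2 rfl)]
      exact Nat.zero_le _
    rw [dif_pos rfl, ← Finset.add_sum_erase _ _ h0, ← Finset.add_sum_erase _ _ h0, add_right_comm]
    congr 1
    · have h2 : (Quotient.mk _ MultiGraph.point : Quotient (MultiGraph.isoSetoid 1)).out.numEdges = 0 :=
        MultiGraph.numEdges_out_eq_zero_iff.2 rfl
      rw [MultiGraph.numAut_eq_one h2, Nat.cast_one, inv_one, one_mul, one_mul]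
      exact universalTerm_add_regularization_apply hx hy hom hc _ (by omega)
        (MultiGraph.mem_classes.1 h0) h2
    · refine Finset.sum_congr rfl fun q hq => ?_
      rw [Finset.mem_erase] at hq
      have h2 := q.out.exists_leg_or.resolve_right fun h =>
        hq.1 (MultiGraph.numEdges_out_eq_zero_iff.1 h.2)
      rw [universalTerm_apply hx hy hom hc _ hn (by omega) (MultiGraph.mem_classes.1 hq.2) h2,
        mul_left_comm]
  · rw [dif_neg h1, Pi.zero_apply, add_zero]
    refine Finset.sum_congr rfl fun q hq => ?_
    have h2 := q.out.exists_leg_or.resolve_right fun h => h1 h.1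
    rw [universalTerm_apply hx hy hom hc _ hn (by omega) (MultiGraph.mem_classes.1 hq) h2,
      mul_left_comm]

theorem universalRHS_apply (hx : IsNonconstMeromorphic x) (hy : IsNonconstMeromorphic y)
    (hom : IsInitialSystem x y om) (hn : 1 ≤ n) (hc : IsGeneric x y om g (2 * (g + n)) c) :
    universalRHS x y om g n c = (∏ i, (-y (c i))) * simpleRHS x y om g n c := by
  have h1 : (∏ i, (-y (c i))) * (-1) ^ n = ∏ i, y (c i) := by
    rw [← Fin.prod_const, ← Finset.prod_mul_distrib]
    exact Finset.prod_congr rfl fun i _ => by ring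
  rw [universalRHS, simpleRHS, Pi.add_apply, Pi.add_apply, Pi.add_apply, Pi.mul_apply, Pi.pow_apply,
    Pi.neg_apply, Pi.one_apply, graphSum_universalTerm hx hy hom hn hc, mul_add, ← mul_assoc, h1]
  congr 1
  by_cases h : g = 0 ∧ n = 1
  · rw [dif_pos h, dif_pos h]
    obtain ⟨rfl, rfl⟩ := h
    have h2 := (rep_theta hx hy hom hc 0).apply_eq ((rep_x hc.good 0).mul (rep_y hc.good 0))
    rw [Fin.prod_univ_one]
    refine h2.trans ?_
    change x (c 0) * y (c 0) = -y (c 0) * -x (c 0)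
    ring
  · rw [dif_neg h, dif_neg h, Pi.zero_apply, mul_zero]

end Comparison

end XYSwap

end

theorem mainTheorem2 {S : Type*} [TopologicalSpace S] [T2Space S] [ChartedSpace ℂ S]
    [IsManifold 𝓘(ℂ) ω S] (x y : S → ℂ)
    (hx : XYSwap.IsNonconstMeromorphic x) (hy : XYSwap.IsNonconstMeromorphic y)
    (om : ℕ → ∀ m : ℕ, XYSwap.MultiDifferential S m) (hom : XYSwap.IsInitialSystem x y om)
    (g n : ℕ) (hn : 1 ≤ n) :
    XYSwap.MeroEq (XYSwap.universalRHS x y om g n)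
      (fun z => (∏ i, (- y (z i))) * XYSwap.simpleRHS x y om g n z) ∧
    ∀ η : XYSwap.MultiDifferential S n,
      XYSwap.UniversalFormula x y om g n η ↔ XYSwap.SimpleFormula x y om g n η := by
  obtain ⟨hU, hUd⟩ := XYSwap.isGeneric_open_dense hx hy hom g (2 * (g + n)) n
  have key : ∀ z, XYSwap.IsGeneric x y om g (2 * (g + n)) z → XYSwap.universalRHS x y om g n z =
      (∏ i, (-y (z i))) * XYSwap.simpleRHS x y om g n z :=
    fun z hz => XYSwap.universalRHS_apply hx hy hom hn hz
  refine ⟨⟨_, hU, hUd, key⟩, fun η => ?_⟩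
  have h0 : ∀ z : Fin n → S, XYSwap.coordValue η z * ∏ i, (-(y (z i) / XYSwap.dAt y (z i))) =
      (∏ i, (-y (z i))) * (XYSwap.coordValue η z * ∏ i, (1 / XYSwap.dAt y (z i))) := by
    intro z
    rw [mul_left_comm, ← Finset.prod_mul_distrib]
    congr 1
    exact Finset.prod_congr rfl fun i _ => by ring
  constructor
  · rintro ⟨V, hV, hVd, h⟩
    refine ⟨_, hU.inter hV, hUd.inter_of_isOpen_left hVd hU, fun z hz => ?_⟩
    have h1 : (∏ i, (-y (z i))) ≠ 0 :=
      Finset.prod_ne_zero_iff.2 fun i _ => neg_ne_zero.2 (hz.1.good i).y_ne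
    exact mul_left_cancel₀ h1 ((h0 z).symm.trans ((h z hz.2).trans (key z hz.1)))
  · rintro ⟨V, hV, hVd, h⟩
    refine ⟨_, hU.inter hV, hUd.inter_of_isOpen_left hVd hU, fun z hz => ?_⟩
    exact (h0 z).trans ((congrArg _ (h z hz.2)).trans (key z hz.1).symm)
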